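/- Let $F$ be a finite extension of $\mathbb{Q}_p$, $\breve F$ the completion of the maximal unramified extension of $F$, $\sigma$ the Frobenius automorphism of $\breve F$ over $F$, and $v_{\breve F}$ the normalized additive valuation of $\breve F$. Let $K$ be a henselian discretely valued field whose ring of integers $\mathcal{O}_K$ contains $\breve F$, with absolute value $|\cdot|$ and uniformizer $\pi$. A norm $\alpha$ on a finite dimensional $K$-vector space $\mathcal{V}$ is an ultrametric norm compatible with $|\cdot|$; it is *splittable* if there is a basis $(e_i)$ of $\mathcal{V}$, called orthogonal for $\alpha$, with $\alpha(\sum_i\lambda_i e_i)=\max_i|\lambda_i|\alpha(e_i)$ for all $\lambda_i \in K$. For splittable norms $\alpha,\beta$ on $\mathcal V$, put $\nu(\alpha,\beta)=\sum_i(\mu_i-\lambda_i)$, where $(e_i)$ is a basis orthogonal for both and $\alpha(e_i)=|\pi|^{\lambda_i}$, $\beta(e_i)=|\pi|^{\mu_i}$ (such a basis exists, and the sum does not depend on it). An isocrystal $D$ is a finite dimensional $\breve F$-vector space with a bijective $\sigma$-semilinear map $\phi$; its dimension is $\dim(D)=v_{\breve F}(\det\phi)$. A normed isocrystal $(D,\alpha)$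 is an isocrystal $D$ with a splittable $K$-norm $\alpha$ on $D_K=D\otimes_{\breve F}K$. Its degree is $\deg(D,\alpha)=\nu(\mathbf{o},\alpha)-\dim(D)$, where $\mathbf{o}(v)=\inf\{|\lambda| : \lambda\in K,\ v\in\lambda(D\otimes_{\breve F}\mathcal{O}_K)\}$, and, if $D\neq 0$, its slope is $\deg(D,\alpha)/\dim_{\breve F}D$. It is semistable if $D\ne 0$ and every nonzero subisocrystal $D'\subset D$, with the restricted norm, has slope at most that of $(D,\alpha)$. The Harder–Narasimhan filtration $\mathcal{F}_{\rm HN}(D,\alpha)$ is the unique decreasing, exhaustive, separated, left continuous filtration $(\mathrm{Fil}^sD)_{s\in\mathbb{R}}$ of $D$ by subisocrystals such that, for every $s\in\mathbb R$, the quotient $\mathrm{Fil}^sD/\bigcup_{t>s}\mathrm{Fil}^tD$ with the norm induced by $\alpha$ is either zero or semistable of slope $s$. The tensor product of $(D,\alpha)$ and $(D',\alpha')$ is $(D\otimes_{\breve F}D',\alpha\otimes\alpha')$, where $D\otimes_{\breve F}D'$ carries $\phi\otimes\phi'$ and $(\alpha\otimes\alpha')(v)=\min\{\max_i\alpha(v_i)\alpha'(v_i')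 : v=\sum_i v_i\otimes v_i'\}$ for $v \in D_K\otimes_K D'_K$. The tensor product of filtrations is $(\mathcal{F}\otimes\mathcal{F}')^a=\sum_{s+t=a}\mathcal{F}^s\otimes\mathcal{F}'^t$. **Theorem.** Let $(D,\alpha)$ and $(D',\alpha')$ be normed isocrystals. Then $\alpha\otimes\alpha'$ is a splittable norm, the Harder–Narasimhan filtrations of $(D,\alpha)$, $(D',\alpha')$ and $(D\otimes D',\alpha\otimes\alpha')$ exist and are unique, and $$\mathcal{F}_{\rm HN}(D\otimes D',\alpha\otimes\alpha')=\mathcal{F}_{\rm HN}(D,\alpha)\otimes\mathcal{F}_{\rm HN}(D',\alpha').$$ Moreover, if $(D,\alpha)$ and $(D',\alpha')$ are semistable, then so is $(D\otimes D',\alpha\otimes\alpha')$. -/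

import Mathlib

open scoped NNReal TensorProduct

noncomputable section

/-! ## The base field: `F̆` and its Frobenius -/

section BaseField

variable {p : ℕ} [Fact p.Prime]

/-- The maximal unramified extension of a finite extension `F` of `ℚ_p` inside the fixed algebraic
closure of `ℚ_p`: it is generated over `F` by the roots of unity of order prime to `p`. -/
def maxUnramified (F : IntermediateField ℚ_[p] (PadicAlgCl p)) :
    IntermediateField F (PadicAlgCl p) :=
  IntermediateField.adjoin F {ζ : PadicAlgCl p | ∃ n : ℕ, ¬ p ∣ n ∧ ζ ^ n = 1}

/-- `F̆`: the completion of the maximal unramified extension of `F`, realized as its closure in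
the complete field `ℂ_p`. -/
def breve (F : IntermediateField ℚ_[p] (PadicAlgCl p)) : Subfield ℂ_[p] :=
  ((maxUnramified F).toSubfield.map (algebraMap (PadicAlgCl p) ℂ_[p])).topologicalClosure

/-- The number of elements of the residue field of `F`. -/
def residueCard (F : IntermediateField ℚ_[p] (PadicAlgCl p)) : ℕ :=
  Nat.card (IsLocalRing.ResidueField
    ((NormedField.valuation (K := PadicAlgCl p)).comap
      (algebraMap F (PadicAlgCl p))).valuationSubring)

/-- `σ` is the Frobenius automorphism of `F̆` over `F`: the continuous automorphism which is the
identity on `F` and induces `x ↦ x ^ q` on the residue field, `q` being the cardinality of the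
residue field of `F`. -/
structure IsFrobenius (F : IntermediateField ℚ_[p] (PadicAlgCl p)) (σ : breve F ≃+* breve F) :
    Prop where
  continuous : Continuous σ
  fixes : ∀ (x : F) (z : breve F),
    (z : ℂ_[p]) = algebraMap (PadicAlgCl p) ℂ_[p] (x : PadicAlgCl p) → σ z = z
  residue : ∀ z : breve F, ‖z‖ ≤ 1 → ‖σ z - z ^ residueCard F‖ < 1

/-- The normalized additive valuation on a discretely valued field `L` with absolute value `‖·‖`
(on nonzero elements): if `c` is the largest absolute value `< 1`, that is, the
absolute value of a uniformizer, then `‖x‖ = c ^ normalizedVal x`. -/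
def normalizedVal {L : Type*} [NormedField L] (x : L) : ℝ :=
  Real.logb (sSup {r : ℝ | ∃ y : L, r = ‖y‖ ∧ ‖y‖ < 1}) ‖x‖

end BaseField

/-! ## Isocrystals -/

/-- An isocrystal over a field `L` with automorphism `σ`: a finite dimensional `L`-vector space
with a bijective `σ`-semilinear endomorphism. -/
structure Isocrystal.{u, w} {L : Type w} [Field L] (σ : L ≃+* L) where
  carrier : Type u
  [addCommGroup : AddCommGroup carrier]
  [module : Module L carrier]
  [finite : FiniteDimensional L carrier]
  frob : carrier →ₛₗ[(σ : L →+* L)] carrier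
  bijective : Function.Bijective frob

namespace Isocrystal

section Field

variable {L : Type*} [Field L] {σ : L ≃+* L}

instance : CoeSort (Isocrystal σ) (Type _) := ⟨Isocrystal.carrier⟩

instance (D : Isocrystal σ) : AddCommGroup D := D.addCommGroup
instance (D : Isocrystal σ) : Module L D := D.module
instance (D : Isocrystal σ) : FiniteDimensional L D := D.finite

/-- A subspace `W` of `D` underlies a subisocrystal if the Frobenius maps it onto itself. -/
def IsSub (D : Isocrystal σ) (W : Submodule L D) : Prop := W.map D.frob = W

theorem IsSub.mem {D : Isocrystal σ} {W : Submodule L D} (h : D.IsSub W) {x : D} (hx : x ∈ W) :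
    D.frob x ∈ W := by
  rw [← h]; exact Submodule.mem_map_of_mem hx

theorem IsSub.iSup {D : Isocrystal σ} {ι : Sort*} {W : ι → Submodule L D}
    (h : ∀ i, D.IsSub (W i)) : D.IsSub (⨆ i, W i) := by
  unfold IsSub
  rw [Submodule.map_iSup]
  exact iSup_congr h

/-- The subisocrystal on a Frobenius-stable subspace. -/
def sub (D : Isocrystal σ) (W : Submodule L D) (h : D.IsSub W) : Isocrystal σ where
  carrier := W
  frob := (D.frob.domRestrict W).codRestrict W fun x => h.mem x.2
  bijective := by
    constructor
    · intro x y hxy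
      exact Subtype.ext (D.bijective.1 (congrArg Subtype.val hxy))
    · rintro ⟨y, hy⟩
      have hy' := hy
      rw [← h] at hy'
      obtain ⟨x, hx, rfl⟩ := hy'
      exact ⟨⟨x, hx⟩, rfl⟩

/-- The quotient of an isocrystal by a subisocrystal. -/
def quot (D : Isocrystal σ) (W : Submodule L D) (h : D.IsSub W) : Isocrystal σ where
  carrier := D ⧸ W
  frob := W.mapQ W D.frob fun _ hx => h.mem hx
  bijective := by
    constructor
    · rw [injective_iff_map_eq_zero]
      intro a
      induction a using Submodule.Quotient.induction_on with
      | _ x =>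
        intro hx
        rw [Submodule.mapQ_apply, Submodule.Quotient.mk_eq_zero] at hx
        rw [Submodule.Quotient.mk_eq_zero]
        rw [← h] at hx
        obtain ⟨y, hy, hyx⟩ := hx
        rwa [← D.bijective.1 hyx]
    · intro a
      induction a using Submodule.Quotient.induction_on with
      | _ y =>
        obtain ⟨x, rfl⟩ := D.bijective.2 y
        exact ⟨Submodule.Quotient.mk x, rfl⟩

/-- The tensor product of isocrystals, with Frobenius `φ ⊗ φ'`. -/
def tensor (D D' : Isocrystal σ) : Isocrystal σ where
  carrier := D ⊗[L] D'
  frob := TensorProduct.map D.frob D'.frob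
  bijective := by
    have := RingHomInvPair.of_ringEquiv σ
    have := RingHomInvPair.of_ringEquiv_symm σ
    exact (TensorProduct.congr (LinearEquiv.ofBijective D.frob D.bijective)
      (LinearEquiv.ofBijective D'.frob D'.bijective)).bijective

end Field

end Isocrystal

section More

variable {L : Type*} [NormedField L] {σ : L ≃+* L}

/-- The dimension of an isocrystal, `v(det φ)`, where `φ` is written as a matrix in some basis and
`v` is the normalized valuation. It does not depend on the basis when `σ` preserves `v`. -/
def Isocrystal.dim (D : Isocrystal σ) : ℝ :=
  normalizedVal (Matrix.det (Matrix.of fun i j : Fin (Module.finrank L D) =>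
    (Module.finBasis L D).repr (D.frob (Module.finBasis L D j)) i))

/-! ## Norms -/

section Norms

variable {K : Type*} [Field K] (v : Valuation K ℝ≥0)

/-- The basis `e` is orthogonal for the function `α`. -/
def IsOrthogonalBasis {V ι : Type*} [Fintype ι] [AddCommGroup V] [Module K V]
    (α : V → ℝ≥0) (e : Module.Basis ι K V) : Prop :=
  ∀ x : V, α x = Finset.univ.sup fun i => v (e.repr x i) * α (e i)

/-- A splittable (ultrametric) `K`-norm on a finite dimensional vector space. -/
structure IsSplittableNorm {V : Type*} [AddCommGroup V] [Module K V] (α : V → ℝ≥0) : Prop where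
  eq_zero_iff : ∀ x, α x = 0 ↔ x = 0
  smul : ∀ (c : K) (x : V), α (c • x) = v c * α x
  add_le_max : ∀ x y, α (x + y) ≤ max (α x) (α y)
  splittable : ∃ e : Module.Basis (Fin (Module.finrank K V)) K V, IsOrthogonalBasis v α e

open Classical in
/-- The relative position `ν(α, β) = ∑ (μ_i - λ_i)`, where `e` is a basis orthogonal for both
`α` and `β`, and `α(e_i) = |π| ^ λ_i`, `β(e_i) = |π| ^ μ_i`. Such a basis exists for splittable
norms over a discretely valued field, and the sum does not depend on its choice. -/
def relativeDegree (π : K) {V : Type*} [AddCommGroup V] [Module K V] (α β : V → ℝ≥0) : ℝ :=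
  if h : ∃ e : Module.Basis (Fin (Module.finrank K V)) K V,
      IsOrthogonalBasis v α e ∧ IsOrthogonalBasis v β e then
    ∑ i, (Real.logb (v π) (β (h.choose i)) - Real.logb (v π) (α (h.choose i)))
  else 0

/-- The tensor product of two norms:
`(α ⊗ β)(t) = min {max_i α(x_i) β(y_i) | t = ∑ x_i ⊗ y_i}`. -/
def tensorNorm {V W : Type*} [AddCommGroup V] [Module K V] [AddCommGroup W] [Module K W]
    (α : V → ℝ≥0) (β : W → ℝ≥0) : V ⊗[K] W → ℝ≥0 := fun t =>
  sInf {r | ∃ (n : ℕ) (x : Fin n → V) (y : Fin n → W),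
    t = ∑ i, x i ⊗ₜ[K] y i ∧ r = Finset.univ.sup fun i => α (x i) * β (y i)}

end Norms

/-! ## Normed isocrystals

A normed isocrystal is a pair `(D, α)` with `D` an isocrystal and `α` a splittable norm on
`K ⊗ D`. The constructions below are made for an arbitrary function `α : K ⊗ D → ℝ≥0`. -/

namespace Isocrystal

variable {K : Type*} [Field K] [Algebra L K] (v : Valuation K ℝ≥0) (π : K)

/-- The norm on a subisocrystal `W` of `D` obtained by restricting `α` along `K ⊗ W ⊆ K ⊗ D`. -/
def subNorm (D : Isocrystal σ) (α : K ⊗[L] D → ℝ≥0) (W : Submodule L D) (h : D.IsSub W) :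
    K ⊗[L] (D.sub W h) → ℝ≥0 :=
  fun x => α (LinearMap.baseChange K W.subtype x)

/-- The quotient norm on `K ⊗ (D / W)`: the infimum of `α` over all preimages. -/
def quotNorm (D : Isocrystal σ) (α : K ⊗[L] D → ℝ≥0) (W : Submodule L D) (h : D.IsSub W) :
    K ⊗[L] (D.quot W h) → ℝ≥0 :=
  fun x => sInf {r | ∃ y : K ⊗[L] D, LinearMap.baseChange K W.mkQ y = x ∧ r = α y}

/-- The norm `α ⊗ α'` on `K ⊗ (D ⊗ D') ≃ (K ⊗ D) ⊗ (K ⊗ D')`. -/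
def tensorNorm (D D' : Isocrystal σ) (α : K ⊗[L] D → ℝ≥0) (α' : K ⊗[L] D' → ℝ≥0) :
    K ⊗[L] (D.tensor D') → ℝ≥0 :=
  fun x => _root_.tensorNorm α α'
    (TensorProduct.AlgebraTensorModule.distribBaseChange L K D D' x)

/-- The standard norm `o` on `K ⊗ D`:
`o(x) = inf {|c| : c ∈ K, x ∈ c (O_K ⊗ D)}`, where `O_K ⊗ D ⊆ K ⊗ D` is the set of sums of
elements `a ⊗ d` with `a ∈ O_K`. -/
def standardNorm (D : Isocrystal σ) : K ⊗[L] D → ℝ≥0 := fun x =>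
  sInf {r | ∃ c : K, r = v c ∧
    ∃ y ∈ AddSubgroup.closure {z : K ⊗[L] D | ∃ (a : K) (d : D), v a ≤ 1 ∧ z = a ⊗ₜ[L] d},
      x = c • y}

/-- The degree `ν(o, α) - dim D` of a normed isocrystal. -/
def degree (D : Isocrystal σ) (α : K ⊗[L] D → ℝ≥0) : ℝ :=
  relativeDegree v π (D.standardNorm v) α - D.dim

/-- The slope `deg / rank` of a nonzero normed isocrystal. -/
def slope (D : Isocrystal σ) (α : K ⊗[L] D → ℝ≥0) : ℝ :=
  D.degree v π α / Module.finrank L D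

/-- A normed isocrystal is semistable if it is nonzero and all its nonzero subisocrystals, with
the restricted norm, have at most its slope. -/
def IsSemistable (D : Isocrystal σ) (α : K ⊗[L] D → ℝ≥0) : Prop :=
  Nontrivial D ∧ ∀ (W : Submodule L D) (h : D.IsSub W), W ≠ ⊥ →
    (D.sub W h).slope v π (D.subNorm α W h) ≤ D.slope v π α

/-! ## Filtrations -/

/-- `Fil^{s+} = ⋃_{t > s} Fil^t`. -/
def filPlus {D : Isocrystal σ} (f : ℝ → Submodule L D) (s : ℝ) : Submodule L D :=
  ⨆ t : Set.Ioi s, f t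

/-- A decreasing `ℝ`-filtration by subisocrystals, exhaustive, separated and left continuous. -/
structure IsFiltration (D : Isocrystal σ) (f : ℝ → Submodule L D) : Prop where
  isSub : ∀ s, D.IsSub (f s)
  antitone : Antitone f
  exhaustive : ⨆ s, f s = ⊤
  separated : ⨅ s, f s = ⊥
  leftContinuous : ∀ s, f s = ⨅ t : Set.Iio s, f t

theorem isSub_filPlus {D : Isocrystal σ} {f : ℝ → Submodule L D} (hf : D.IsFiltration f) (s : ℝ) :
    (D.sub (f s) (hf.isSub s)).IsSub ((filPlus f s).comap (f s).subtype) := by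
  have h : D.IsSub (filPlus f s) := IsSub.iSup fun t => hf.isSub t
  have hle : filPlus f s ≤ f s := iSup_le fun t => hf.antitone (le_of_lt t.2)
  apply le_antisymm
  · rintro _ ⟨x, hx, rfl⟩
    exact h.mem hx
  · rintro ⟨y, hys⟩ hy
    have hy' : y ∈ filPlus f s := hy
    rw [← h] at hy'
    obtain ⟨x, hx, rfl⟩ := hy'
    exact ⟨⟨x, hle hx⟩, hx, rfl⟩

/-- The graded piece `gr^s = Fil^s / Fil^{s+}`. -/
def gr {D : Isocrystal σ} {f : ℝ → Submodule L D} (hf : D.IsFiltration f) (s : ℝ) : Isocrystal σ :=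
  (D.sub (f s) (hf.isSub s)).quot _ (isSub_filPlus hf s)

/-- The norm on `gr^s` induced by `α`. -/
def grNorm {D : Isocrystal σ} (α : K ⊗[L] D → ℝ≥0) {f : ℝ → Submodule L D}
    (hf : D.IsFiltration f) (s : ℝ) : K ⊗[L] (gr hf s) → ℝ≥0 :=
  (D.sub (f s) (hf.isSub s)).quotNorm (D.subNorm α (f s) (hf.isSub s)) _ (isSub_filPlus hf s)

/-- `f` is a Harder–Narasimhan filtration of `(D, α)`: for every `s`, the graded piece `gr^s` is
zero or semistable of slope `s`. -/
structure IsHNFiltration (D : Isocrystal σ) (α : K ⊗[L] D → ℝ≥0) (f : ℝ → Submodule L D) :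
    Prop where
  isFiltration : D.IsFiltration f
  graded : ∀ s, Subsingleton (gr isFiltration s) ∨
    ((gr isFiltration s).IsSemistable v π (grNorm α isFiltration s) ∧
      (gr isFiltration s).slope v π (grNorm α isFiltration s) = s)

/-- The Harder–Narasimhan filtration of `(D, α)`: the unique filtration with the above property. -/
def hnFiltration (D : Isocrystal σ) (α : K ⊗[L] D → ℝ≥0) : ℝ → Submodule L D :=
  Classical.epsilon (D.IsHNFiltration v π α)

/-- The tensor product of filtrations, `Fil^a = ∑_{s + t = a} Fil^s ⊗ Fil^t`. -/
def tensorFiltration (D D' : Isocrystal σ) (f : ℝ → Submodule L D) (f' : ℝ → Submodule L D') :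
    ℝ → Submodule L (D.tensor D') := fun a =>
  ⨆ s : ℝ, Submodule.map₂ (TensorProduct.mk L D D') (f s) (f' (a - s))

end Isocrystal

end More

end

/-!
The proof works with volumes. Two splittable norms over a discretely valued field have a common
orthogonal basis (`HasDiscreteValues.exists_common_basis`). The volume `lvol` of a norm is the
logarithm of the norm which it induces on the determinant line; by Hadamard's inequality
(`IsOrthogonalBasis.hadamard`) it is an infimum over all bases, attained at the orthogonal ones. For
a space with an `L`-structure the volume `lv` does not depend on a basis, and the degree of a normed
isocrystal is `lv α / log (v π) - dim D`. Volumes are additive in exact sequences and monotone in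
the norm, so the degree is supermodular on subisocrystals (`Setting.subDeg_supermodular`).

*Harder–Narasimhan filtrations.* A filtration `f` is the Harder–Narasimhan filtration exactly if
each `f s` is the largest maximizer of `deg X - s * rank X` (`Setting.isHNFiltration_iff`), which
makes it unique. Maximizers exist because the degrees of subisocrystals are bounded above and lie in
finitely many classes modulo `ℤ`. The tensor product of two filtrations can be refined to a chain
whose subquotients are the tensor products of their graded pieces, with the tensor product norms
(`isNormedQuotient_tensor`). So `Setting.isHNFiltration_tensorFiltration` reduces the theorem to
`Setting.hasSlope_tensor`: semistable objects of slopes `s` and `t` have a semistable tensor product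
of slope `s + t`.

*Optimal filtrations.* For this, a lower bound is needed for the volume of each subisocrystal `W` of
`D ⊗ D'`. Filtrations of a vector space are norms for the trivial valuation. On pairs of filtrations
of `D` and `D'`, the functional `kempf` is the volume which their tensor product induces on `W`, minus
the normalized volumes of the two filtrations, plus half the sum of the squares of their labels. It is
strictly convex along common orthogonal bases and has a unique minimizer (`exists_isKempf`,
`IsKempf.unique`), as in Kempf's theory of instability. Since the minimizer is unique, the one over
an algebraically closed field `Ω` containing `L` descends to `L` (`exists_isKempf_extMap`), and the
minimizer over `L` is stable under the Frobenius (`IsKempf.invariant`). Its steps are therefore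
subisocrystals (`isSub_coordSub`).

*The lower bound.* Take `Ω` to be an algebraic closure of the residue field of `K`. Tilt the norms
on `D_K` and `D'_K` by `τ` times the optimal filtrations, using bases adapted to the norm, the
filtration and the standard lattice (`HasDiscreteValues.exists_adapted_basis`). Reduction to `Ω`
gives filtrations to which minimality applies, and `τ → ∞` yields a lower bound for the volume of
`W`: the normalized volumes of the two norms, corrected by a sum over the labels of the optimal
filtrations, weighted by the volumes of the norms on their steps (`exists_core`).

*Conclusion.* That bound contains no dimensions of isocrystals. They enter through the norms of
`Setting.exists_slopeNorm`, which are defined by the slope filtrations and whose volumes on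
subisocrystals are the dimensions (on subisocrystals of the tensor product, at most the dimensions).
This rests on the growth of the iterates of the Frobenius of an isoclinic isocrystal
(`CompleteSetting.hasGrowth`), a condition which passes to tensor products
(`CompleteSetting.hasGrowth_tensor`). Add the lower bound for the given norms to the one for these
norms. By semistability and Abel summation the weighted sums are then nonpositive
(`Setting.sum_log_mul_nonpos`), and what remains is the inequality between the slopes.

Of the field `breve F` only this is used: it has characteristic zero and is complete, and if its value
group is discrete, the Frobenius is an isometry, because it fixes `p` and preserves the absolute
value of units (`norm_frobenius`). That the value group is discrete is not needed: otherwise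
`normalizedVal` and all dimensions would vanish, and the argument applies as well.
-/

set_option linter.unusedSectionVars false

noncomputable section

open Module
open Function (Injective Surjective Bijective Exact iterate_succ_apply' iterate_succ_apply)
open Finset (univ mem_univ mem_filter filter_congr sum_add_distrib sum_sub_distrib sum_congr
  sum_const sum_div sum_le_sum sum_mul mul_sum sum_nonneg card_univ le_sup sup_congr
  exists_mem_eq_sup prod_pos mem_range card_filter sum_eq_single sum_subset prod_mul_distrib
  prod_le_prod' single_le_sum)
open Set (Ioi Iio mem_iUnion finite_iUnion exists_max_image)
open LinearMap (ker range mem_ker mem_range_self baseChange baseChange_tmul exact_subtype_ker_map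
  exact_subtype_mkQ range_eq_top range_comp)
open Submodule (span subset_span span_le topEquiv finrank_le mkQ_surjective equivMapOfInjective
  mem_comap mem_bot mem_iInf comap_mono exists_mem_ne_zero_of_ne_bot finrank_lt_finrank_of_lt
  injective_subtype ker_mkQ mem_iSup_of_directed eq_of_le_of_finrank_le range_subtype)
open TensorProduct (tmul_zero tmul_add map_tmul smul_tmul' range_map)
open TensorProduct.AlgebraTensorModule (distribBaseChange distribBaseChange_tmul)
open Real (log logb exp exp_pos exp_add log_exp log_mul log_one log_pow log_rpow log_neg log_le_log
  toNNReal coe_toNNReal toNNReal_pos toNNReal_mul rpow_pos_of_pos)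
open NNReal (coe_ne_zero coe_mul coe_one rpow_pos mul_finset_sup sqrt sqrt_pos)
open Fintype (card card_fin card_subtype equivOfCardEq sum_sum_type)
open NormedField (valuation)
open Valuation (mem_valuationSubring_iff)
open Finsupp (single_apply finsetSum_apply)
open Nat (le_succ)

/-! ### Ultrametric norms over a valued field and orthogonal bases -/

section NormBasics

variable {K : Type*} [Field K] (v : Valuation K ℝ≥0)

/-- An ultrametric norm compatible with the valuation `v`, not assumed to be splittable. -/
structure IsUNorm {V : Type*} [AddCommGroup V] [Module K V] (α : V → ℝ≥0) : Prop where
  eq_zero_iff : ∀ x, α x = 0 ↔ x = 0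
  smul : ∀ (c : K) (x : V), α (c • x) = v c * α x
  add_le_max : ∀ x y, α (x + y) ≤ max (α x) (α y)

/-- The function `∑ zᵢ bᵢ ↦ max |zᵢ| cᵢ` attached to a basis `b` and weights `c`. -/
def ofBasis {V ι : Type*} [Fintype ι] [AddCommGroup V] [Module K V] (b : Basis ι K V)
    (c : ι → ℝ≥0) : V → ℝ≥0 := fun x => univ.sup fun i => v (b.repr x i) * c i

variable {v}
variable {V : Type*} [AddCommGroup V] [Module K V] {α β : V → ℝ≥0}
  {ι κ : Type*} [Fintype ι] [Fintype κ] {e : Basis ι K V} {v₁ v₂ : Valuation K ℝ≥0}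

namespace IsUNorm

theorem map_zero (h : IsUNorm v α) : α 0 = 0 := (h.eq_zero_iff 0).2 rfl

theorem pos (h : IsUNorm v α) {x : V} (hx : x ≠ 0) : 0 < α x :=
  pos_iff_ne_zero.2 fun h0 => hx ((h.eq_zero_iff x).1 h0)

theorem map_neg (h : IsUNorm v α) (x : V) : α (-x) = α x := by
  rw [← neg_one_smul K, h.smul, Valuation.map_neg, v.map_one, one_mul]

theorem sub_le_max (h : IsUNorm v α) (x y : V) : α (x - y) ≤ max (α x) (α y) := by
  rw [sub_eq_add_neg, ← h.map_neg y]; exact h.add_le_max _ _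

theorem sum_le (h : IsUNorm v α) {ι : Type*} (s : Finset ι) (f : ι → V) {C : ℝ≥0}
    (hC : ∀ i ∈ s, α (f i) ≤ C) : α (∑ i ∈ s, f i) ≤ C := by
  classical
  induction s using Finset.induction_on with
  | empty => simp [h.map_zero]
  | insert a s ha ih =>
    rw [Finset.sum_insert ha]
    exact (h.add_le_max _ _).trans (max_le (hC a (Finset.mem_insert_self a s))
      (ih fun i hi => hC i (Finset.mem_insert_of_mem hi)))

theorem comp (h : IsUNorm v α) {W : Type*} [AddCommGroup W] [Module K W] (f : W →ₗ[K] V)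
    (hf : Injective f) : IsUNorm v fun x => α (f x) where
  eq_zero_iff x := by rw [h.eq_zero_iff, map_eq_zero_iff f hf]
  smul c x := by rw [_root_.map_smul, h.smul]
  add_le_max x y := by rw [map_add]; exact h.add_le_max _ _

theorem isOrthogonalBasis (h : IsUNorm v α) (e : Basis ι K V)
    (he : ∀ (a : ι → K) (i : ι), v (a i) * α (e i) ≤ α (∑ j, a j • e j)) :
    IsOrthogonalBasis v α e := by
  intro x
  apply le_antisymm
  · conv_lhs => rw [← e.sum_repr x]
    refine h.sum_le _ _ fun i _ => ?_
    rw [h.smul]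
    exact le_sup (f := fun i => v (e.repr x i) * α (e i)) (mem_univ i)
  · refine Finset.sup_le fun i _ => ?_
    have := he (fun i => e.repr x i) i
    rwa [e.sum_repr x] at this

end IsUNorm

theorem IsSplittableNorm.isUNorm (h : IsSplittableNorm v α) : IsUNorm v α :=
  ⟨h.eq_zero_iff, h.smul, h.add_le_max⟩

theorem IsOrthogonalBasis.le (he : IsOrthogonalBasis v α e) (x : V)
    (i : ι) : v (e.repr x i) * α (e i) ≤ α x := by
  rw [he x]
  exact le_sup (f := fun i => v (e.repr x i) * α (e i)) (mem_univ i)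

theorem IsOrthogonalBasis.le_iff (he : IsOrthogonalBasis v α e) {x : V}
    {C : ℝ≥0} : α x ≤ C ↔ ∀ i, v (e.repr x i) * α (e i) ≤ C := by rw [he x]; simp

theorem IsOrthogonalBasis.eq_ofBasis (he : IsOrthogonalBasis v α e) :
    α = ofBasis v e fun i => α (e i) := funext he

theorem IsOrthogonalBasis.reindex (he : IsOrthogonalBasis v α e)
    (f : ι ≃ κ) : IsOrthogonalBasis v α (e.reindex f) := by
  intro x
  rw [he x]
  exact eq_of_forall_ge_iff fun c => by
    simpa using (f.symm.forall_congr_right (q := fun i => v (e.repr x i) * α (e i) ≤ c)).symm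

theorem IsOrthogonalBasis.exists_eq (hα : IsUNorm v α)
    (he : IsOrthogonalBasis v α e) {x : V} (hx : x ≠ 0) :
    ∃ i, e.repr x i ≠ 0 ∧ α x = v (e.repr x i) * α (e i) := by
  have hpos := (hα.pos hx).ne'
  have : Nonempty ι := not_isEmpty_iff.1 fun _ => hpos (by simp [he x])
  obtain ⟨i, -, hi⟩ := exists_mem_eq_sup _ Finset.univ_nonempty fun i => v (e.repr x i) * α (e i)
  rw [← he x] at hi
  exact ⟨i, fun h0 => hpos (by rw [hi, h0, v.map_zero, zero_mul]), hi⟩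

theorem IsUNorm.isSplittableNorm (h : IsUNorm v α)
    (he : IsOrthogonalBasis v α e) : IsSplittableNorm v α where
  eq_zero_iff := h.eq_zero_iff
  smul := h.smul
  add_le_max := h.add_le_max
  splittable := by
    have hc : card ι = card (Fin (finrank K V)) := by rw [card_fin, finrank_eq_card_basis e]
    exact ⟨_, he.reindex (equivOfCardEq hc)⟩

theorem IsSplittableNorm.exists_basis (h : IsSplittableNorm v α) (b : Basis ι K V) :
    ∃ e : Basis ι K V, IsOrthogonalBasis v α e := by
  obtain ⟨e, he⟩ := h.splittable
  have hc : card (Fin (finrank K V)) = card ι := by rw [card_fin, finrank_eq_card_basis b]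
  exact ⟨_, he.reindex (equivOfCardEq hc)⟩

theorem ofBasis_apply_basis (b : Basis ι K V) (c : ι → ℝ≥0) (i : ι) :
    ofBasis v b c (b i) = c i := by
  classical
  refine le_antisymm (Finset.sup_le fun j _ => ?_) ?_
  · rw [b.repr_self, single_apply]
    split_ifs with hij <;> simp [hij]
  · simpa [ofBasis] using le_sup (f := fun j => v (b.repr (b i) j) * c j) (mem_univ i)

theorem isUNorm_ofBasis (b : Basis ι K V) {c : ι → ℝ≥0} (hc : ∀ i, 0 < c i) :
    IsUNorm v (ofBasis v b c) where
  eq_zero_iff x := by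
    unfold ofBasis
    rw [← bot_eq_zero, Finset.sup_eq_bot_iff]
    refine ⟨fun h => b.repr.map_eq_zero_iff.1 (Finsupp.ext fun i => ?_), ?_⟩
    · have := h i (mem_univ i)
      rw [bot_eq_zero, mul_eq_zero, Valuation.zero_iff] at this
      exact this.resolve_right (hc i).ne'
    · rintro rfl; simp
  smul a x := by simp [ofBasis, mul_finset_sup, mul_assoc]
  add_le_max x y := by
    refine Finset.sup_le fun i _ => ?_
    have h1 := le_sup (f := fun i => v (b.repr x i) * c i) (mem_univ i)
    have h2 := le_sup (f := fun i => v (b.repr y i) * c i) (mem_univ i)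
    rw [map_add, Finsupp.add_apply]
    calc _ ≤ max (v (b.repr x i)) (v (b.repr y i)) * c i := by gcongr; exact v.map_add _ _
      _ = max (v (b.repr x i) * c i) (v (b.repr y i) * c i) := max_mul_of_nonneg _ _ (zero_le)
      _ ≤ _ := max_le_max h1 h2

theorem isOrthogonalBasis_ofBasis (b : Basis ι K V) (c : ι → ℝ≥0) :
    IsOrthogonalBasis v (ofBasis v b c) b := fun x => by simp only [ofBasis_apply_basis]; rfl

theorem isSplittableNorm_ofBasis (b : Basis ι K V) {c : ι → ℝ≥0} (hc : ∀ i, 0 < c i) :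
    IsSplittableNorm v (ofBasis v b c) :=
  (isUNorm_ofBasis b hc).isSplittableNorm (isOrthogonalBasis_ofBasis b c)

theorem IsOrthogonalBasis.isUNorm (he : IsOrthogonalBasis v α e)
    (hpos : ∀ i, 0 < α (e i)) : IsUNorm v α := by rw [he.eq_ofBasis]; exact isUNorm_ofBasis e hpos

theorem IsOrthogonalBasis.isSplittableNorm
    (he : IsOrthogonalBasis v α e) (hpos : ∀ i, 0 < α (e i)) : IsSplittableNorm v α :=
  (he.isUNorm hpos).isSplittableNorm he

/-- A one-dimensional form of the Hahn–Banach theorem: a vector of a splittable normed space has an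
orthogonal complement. -/
theorem IsSplittableNorm.exists_functional (h : IsSplittableNorm v α) {x : V} (hx : x ≠ 0) :
    ∃ l : V →ₗ[K] K, l x = 1 ∧ ∀ y, v (l y) * α x ≤ α y := by
  obtain ⟨e, he⟩ := h.splittable
  obtain ⟨i, hxi, hi⟩ := he.exists_eq h.isUNorm hx
  refine ⟨(e.repr x i)⁻¹ • e.coord i, by simp [hxi], fun y => ?_⟩
  have hv : v (e.repr x i) ≠ 0 := v.ne_zero_iff.2 hxi
  calc _ = v (e.repr y i) * α (e i) := by
        simp only [LinearMap.smul_apply, Basis.coord_apply, smul_eq_mul, map_mul, map_inv₀, hi]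
        field_simp
    _ ≤ _ := he.le y i

/-- The inductive construction of common orthogonal bases: it is enough to be able to split off, in
each nonzero subspace of a class stable under the process, a vector which has a common orthogonal
complement for both norms. The two norms may refer to different valuations of `K`. -/
theorem exists_common_basis [FiniteDimensional K V]
    (hα : IsUNorm v₁ α) (hβ : IsUNorm v₂ β) (P : Submodule K V → Prop) (Q : V → Prop)
    (step : ∀ U, P U → U ≠ ⊥ → ∃ x ∈ U, Q x ∧ ∃ l : V →ₗ[K] K, l x = 1 ∧ P (U ⊓ ker l) ∧
      ∀ y ∈ U, v₁ (l y) * α x ≤ α y ∧ v₂ (l y) * β x ≤ β y) (U : Submodule K V) (hU : P U) :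
    ∃ (n : ℕ) (e : Basis (Fin n) K U), (∀ i, Q (e i)) ∧
      IsOrthogonalBasis v₁ (fun y : U => α y) e ∧ IsOrthogonalBasis v₂ (fun y : U => β y) e := by
  induction hn : finrank K U using Nat.strong_induction_on generalizing U with
  | _ n ih =>
  by_cases hbot : U = ⊥
  · subst hbot
    refine ⟨0, Basis.empty _, fun i => i.elim0, fun x => ?_, fun x => ?_⟩
    · rw [Subsingleton.elim x 0]; simp [hα.map_zero]
    · rw [Subsingleton.elim x 0]; simp [hβ.map_zero]
  obtain ⟨x, hxU, hQx, l, hlx, hP, hl⟩ := step U hU hbot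
  set U' := U ⊓ ker l with hU'
  have hlt : U' < U := lt_of_le_of_ne inf_le_left fun heq =>
    one_ne_zero (hlx.symm.trans (heq ▸ hxU : x ∈ U').2)
  obtain ⟨m, b, hQb, hb1, hb2⟩ := ih _ (hn ▸ finrank_lt_finrank_of_lt hlt) U' hP rfl
  have hli : ∀ (c : K), ∀ w ∈ U', c • x + w = 0 → c = 0 := fun c w hw hcw => by
    simpa [hlx, show l w = 0 from hw.2] using congrArg l hcw
  have hsp : ∀ z ∈ U, ∃ c : K, z + c • x ∈ U' := fun z hz =>
    ⟨-l z, U.add_mem hz (U.smul_mem _ hxU), by simp [hlx]⟩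
  let e := Basis.mkFinConsOfLE x hxU b inf_le_left hli hsp
  have he : (e : Fin (m + 1) → U) = Fin.cons ⟨x, hxU⟩ (Submodule.inclusion inf_le_left ∘ b) :=
    Basis.coe_mkFinConsOfLE _ _ _ _ _ _
  have key : ∀ (v : Valuation K ℝ≥0) (γ : V → ℝ≥0), IsUNorm v γ →
      (∀ y ∈ U, v (l y) * γ x ≤ γ y) → IsOrthogonalBasis v (fun y : U' => γ y) b →
      IsOrthogonalBasis v (fun y : U => γ y) e := by
    intro v γ hγ hlγ hbγ
    have hγU : IsUNorm v fun y : U => γ y := hγ.comp U.subtype U.injective_subtype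
    refine hγU.isOrthogonalBasis e fun a i => ?_
    have hsum : ((∑ j, a j • e j : U) : V) = a 0 • x + ((∑ j, a j.succ • b j : U') : V) := by
      simp [Fin.sum_univ_succ, he]
    set w : U' := ∑ j, a j.succ • b j with hw
    have h0 : v (a 0) * γ x ≤ γ (a 0 • x + w) := by
      simpa [hlx, show l w = 0 from w.2.2] using
        hlγ (a 0 • x + w) (U.add_mem (U.smul_mem _ hxU) w.2.1)
    have hw' : γ w ≤ γ (a 0 • x + w) := by
      have := hγ.sub_le_max (a 0 • x + w) (a 0 • x)
      rw [add_sub_cancel_left, hγ.smul] at this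
      exact this.trans (max_le le_rfl h0)
    change v (a i) * γ (e i : V) ≤ γ ((∑ j, a j • e j : U) : V)
    rw [hsum, he]
    refine Fin.cases ?_ (fun i => ?_) i
    · simpa using h0
    · refine le_trans ?_ hw'
      have := hbγ.le w i
      rwa [hw, b.repr_sum_self] at this
  refine ⟨m + 1, e, ?_, key v₁ α hα (fun y hy => (hl y hy).1) hb1,
    key v₂ β hβ (fun y hy => (hl y hy).2) hb2⟩
  rw [he]
  exact Fin.cases (by simpa using hQx) fun i => by simpa using hQb i

theorem IsOrthogonalBasis.map_equiv {W : Type*} [AddCommGroup W] [Module K W]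
    (he : IsOrthogonalBasis v α e) (f : V ≃ₗ[K] W) :
    IsOrthogonalBasis v (fun x => α (f.symm x)) (e.map f) := by
  intro x
  simp only [Basis.map_apply, LinearEquiv.symm_apply_apply, Basis.map_repr]
  exact he _

theorem exists_common_basis_top [FiniteDimensional K V] (hα : IsUNorm v₁ α) (hβ : IsUNorm v₂ β)
    (step : ∀ U : Submodule K V, U ≠ ⊥ → ∃ x ∈ U, ∃ l : V →ₗ[K] K, l x = 1 ∧
      ∀ y ∈ U, v₁ (l y) * α x ≤ α y ∧ v₂ (l y) * β x ≤ β y) (b : Basis ι K V) :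
    ∃ e : Basis ι K V, IsOrthogonalBasis v₁ α e ∧ IsOrthogonalBasis v₂ β e := by
  obtain ⟨n, e, -, h1, h2⟩ := exists_common_basis hα hβ (fun _ => True) (fun _ => True)
    (fun U _ hU => let ⟨x, hx, l, hl, h⟩ := step U hU; ⟨x, hx, trivial, l, hl, trivial, h⟩) ⊤ trivial
  have hc : card (Fin n) = card ι := by
    rw [← finrank_eq_card_basis b, ← finrank_eq_card_basis (e.map topEquiv)]
  exact ⟨_, (h1.map_equiv topEquiv).reindex (equivOfCardEq hc), (h2.map_equiv topEquiv).reindex _⟩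

/-- Subspaces of splittable normed spaces are splittable. -/
theorem IsSplittableNorm.comp [FiniteDimensional K V] (h : IsSplittableNorm v α) {W : Type*}
    [AddCommGroup W] [Module K W] (f : W →ₗ[K] V) (hf : Injective f) :
    IsSplittableNorm v fun x => α (f x) := by
  have : FiniteDimensional K W := FiniteDimensional.of_injective f hf
  have hn := h.isUNorm.comp f hf
  obtain ⟨e, he, -⟩ := exists_common_basis_top hn hn (fun U hU => by
    obtain ⟨x, hxU, hx⟩ := exists_mem_ne_zero_of_ne_bot hU
    obtain ⟨l, hl, hl'⟩ := h.exists_functional ((map_ne_zero_iff f hf).2 hx)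
    exact ⟨x, hxU, l ∘ₗ f, hl, fun y _ => ⟨hl' (f y), hl' (f y)⟩⟩) (finBasis K W)
  exact hn.isSplittableNorm he

/-! ### Trivially valued fields -/

variable (K) in
/-- The trivial absolute value. A norm with respect to it is an `ℝ`-filtration: `α x = exp (-s)`
means that `x` lies in `Fil^s` but in no smaller step. -/
def trivVal : Valuation K ℝ≥0 := by
  classical
  exact (Valuation.one K ℝ≥0).one

theorem trivVal_apply {x : K} (hx : x ≠ 0) : trivVal K x = 1 := by
  classical
  exact if_neg hx

/-- A splittable norm and a filtration have a common orthogonal basis. -/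
theorem exists_common_basis_trivVal [FiniteDimensional K V] (hα : IsSplittableNorm v α)
    (hβ : IsUNorm (trivVal K) β) (hfin : (Set.range β).Finite) (b : Basis ι K V) :
    ∃ e : Basis ι K V, IsOrthogonalBasis v α e ∧ IsOrthogonalBasis (trivVal K) β e := by
  refine exists_common_basis_top hα.isUNorm hβ (fun U hU => ?_) b
  have hne : (β '' {x | x ∈ U ∧ x ≠ 0}).Nonempty := by
    obtain ⟨x, hxU, hx⟩ := exists_mem_ne_zero_of_ne_bot hU
    exact ⟨_, x, ⟨hxU, hx⟩, rfl⟩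
  obtain ⟨_, ⟨x, ⟨hxU, hx⟩, rfl⟩, hmin⟩ := Set.exists_min_image _ id
    (hfin.subset (Set.image_subset_range _ _)) hne
  obtain ⟨l, hl, hl'⟩ := hα.exists_functional hx
  refine ⟨x, hxU, l, hl, fun y hy => ⟨hl' y, ?_⟩⟩
  by_cases hly : l y = 0
  · simp [hly]
  · rw [trivVal_apply hly, one_mul]
    exact hmin _ ⟨y, ⟨hy, fun h0 => hly (by rw [h0, LinearMap.map_zero])⟩, rfl⟩

theorem IsUNorm.isSplittableNorm_of_trivVal [FiniteDimensional K V]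
    (hβ : IsUNorm (trivVal K) β) (hfin : (Set.range β).Finite) :
    IsSplittableNorm (trivVal K) β := by
  obtain ⟨e, -, he⟩ := exists_common_basis_trivVal
    (isSplittableNorm_ofBasis (v := trivVal K) (finBasis K V) (c := fun _ => 1)
      fun _ => one_pos) hβ hfin (finBasis K V)
  exact hβ.isSplittableNorm he

theorem IsSplittableNorm.finite_range (h : IsSplittableNorm (trivVal K) α) :
    (Set.range α).Finite := by
  obtain ⟨e, he⟩ := h.splittable
  refine ((Set.finite_range fun i => α (e i)).union (Set.finite_singleton 0)).subset ?_
  rintro _ ⟨x, rfl⟩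
  by_cases hx : x = 0
  · right; simp [hx, h.isUNorm.map_zero]
  obtain ⟨i, h0, hi⟩ := he.exists_eq h.isUNorm hx
  exact Or.inl ⟨i, by rw [hi, trivVal_apply h0, one_mul]⟩

/-- An orthogonal basis adapted to a subspace. -/
theorem IsSplittableNorm.exists_basis_subspace [FiniteDimensional K V]
    (hα : IsSplittableNorm v α) (W : Submodule K V) (b : Basis ι K V) :
    ∃ (e : Basis ι K V) (S : Set ι), IsOrthogonalBasis v α e ∧
      ∀ x, x ∈ W ↔ ∀ i ∉ S, e.repr x i = 0 := by
  classical
  let β : V → ℝ≥0 := fun x => if x = 0 then 0 else if x ∈ W then 1 else 2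
  have hβ : IsUNorm (trivVal K) β := by
    refine ⟨fun x => ?_, fun c x => ?_, fun x y => ?_⟩
    · simp only [β]; split_ifs with h1 h2 <;> simp [h1]
    · by_cases hc : c = 0
      · simp [β, hc]
      · rw [trivVal_apply hc, one_mul]
        simp only [β, smul_eq_zero, hc, false_or, W.smul_mem_iff hc]
    · by_cases hx : x = 0
      · simp [hx]
      by_cases hy : y = 0
      · simp [hy]
      by_cases hxW : x ∈ W
      · by_cases hyW : y ∈ W
        · have : x + y ∈ W := W.add_mem hxW hyW
          simp only [β, hx, hy, hxW, hyW, this, if_true, if_false]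
          split_ifs <;> simp
        · simp only [β, hx, hy, hxW, hyW, if_true, if_false]
          split_ifs <;> norm_num
      · simp only [β, hx, hy, hxW, if_false]
        split_ifs <;> norm_num
  have hfin : (Set.range β).Finite := by
    refine (Set.toFinite ({0, 1, 2} : Set ℝ≥0)).subset ?_
    rintro _ ⟨x, rfl⟩
    simp only [β]
    split_ifs <;> simp
  obtain ⟨e, he, heβ⟩ := exists_common_basis_trivVal hα hβ hfin b
  refine ⟨e, {i | e i ∈ W}, he, fun x => ⟨fun hx i hi => ?_, fun hx => ?_⟩⟩
  · by_contra hne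
    have h1 := heβ.le x i
    rw [trivVal_apply hne, one_mul] at h1
    have hi' : e i ∉ W := hi
    have h2 : β (e i) = 2 := by simp [β, e.ne_zero i, hi']
    have h3 : β x ≤ 1 := by simp only [β]; split_ifs <;> simp
    rw [h2] at h1
    exact absurd (h1.trans h3) (by norm_num)
  · rw [← e.sum_repr x]
    refine W.sum_mem fun i _ => ?_
    by_cases hi : e i ∈ W
    · exact W.smul_mem _ hi
    · rw [hx i hi, zero_smul]; exact W.zero_mem

/-! ### Discretely valued fields -/

/-- The nonzero absolute values are discrete in `(0, ∞)`. This holds for trivial and for discrete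
valuations. -/
def HasDiscreteValues (v : Valuation K ℝ≥0) : Prop :=
  ∀ a b : ℝ≥0, 0 < a → (Set.range v ∩ Set.Icc a b).Finite

theorem IsSplittableNorm.exists_le_mul (hα : IsUNorm v α) (hβ : IsSplittableNorm v β) :
    ∃ C : ℝ≥0, 0 < C ∧ ∀ x, α x ≤ C * β x := by
  obtain ⟨e, he⟩ := hβ.splittable
  set C : ℝ≥0 := (univ.sup fun i => α (e i) / β (e i)) + 1 with hC
  refine ⟨C, by positivity, fun x => ?_⟩
  conv_lhs => rw [← e.sum_repr x]
  refine hα.sum_le _ _ fun i _ => ?_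
  have hpos := hβ.isUNorm.pos (e.ne_zero i)
  have h1 : α (e i) / β (e i) ≤ C := by
    refine le_trans ?_ le_self_add
    exact le_sup (f := fun i => α (e i) / β (e i)) (mem_univ i)
  rw [div_le_iff₀ hpos] at h1
  calc α (e.repr x i • e i) = v (e.repr x i) * α (e i) := hα.smul _ _
    _ ≤ v (e.repr x i) * (C * β (e i)) := by gcongr
    _ = C * (v (e.repr x i) * β (e i)) := by ring
    _ ≤ C * β x := by gcongr; exact he.le x i

/-- In a subspace, the ratio of two splittable norms has a maximum. -/
theorem HasDiscreteValues.exists_max_ratio (hd : HasDiscreteValues v) (hα : IsSplittableNorm v α)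
    (hβ : IsSplittableNorm v β) {U : Set V} (hU : ∃ x ∈ U, x ≠ 0) :
    ∃ x ∈ U, x ≠ 0 ∧ ∀ y ∈ U, β y * α x ≤ β x * α y := by
  obtain ⟨C, hC, hle⟩ := IsSplittableNorm.exists_le_mul hβ.isUNorm hα
  obtain ⟨x₀, hx₀U, hx₀⟩ := hU
  obtain ⟨e, he⟩ := hα.splittable
  obtain ⟨u, hu⟩ := hβ.splittable
  set r : V → ℝ≥0 := fun x => β x / α x with hr
  have hr₀ : 0 < r x₀ := div_pos (hβ.isUNorm.pos hx₀) (hα.isUNorm.pos hx₀)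
  set T : Set ℝ≥0 := r '' {x | x ∈ U ∧ x ≠ 0 ∧ r x₀ ≤ r x} with hT
  have hfin : T.Finite := by
    have : T ⊆ ⋃ i, ⋃ j, (fun c => c * (β (u i) / α (e j))) ''
        (Set.range v ∩ Set.Icc (r x₀ / (β (u i) / α (e j))) (C / (β (u i) / α (e j)))) := by
      rintro _ ⟨x, ⟨hxU, hx, hxr⟩, rfl⟩
      obtain ⟨i, hi0, hi⟩ := hu.exists_eq hβ.isUNorm hx
      obtain ⟨j, hj0, hj⟩ := he.exists_eq hα.isUNorm hx
      have hpi := hβ.isUNorm.pos (u.ne_zero i)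
      have hpj := hα.isUNorm.pos (e.ne_zero j)
      have hq : 0 < β (u i) / α (e j) := div_pos hpi hpj
      have hrx : r x = v (u.repr x i / e.repr x j) * (β (u i) / α (e j)) := by
        simp only [hr]
        rw [hi, hj, map_div₀]
        field_simp
      refine mem_iUnion.2 ⟨i, mem_iUnion.2 ⟨j, v (u.repr x i / e.repr x j),
        ⟨⟨_, rfl⟩, ?_, ?_⟩, hrx.symm⟩⟩
      · rw [div_le_iff₀ hq, ← hrx]; exact hxr
      · rw [le_div_iff₀ hq, ← hrx]
        simp only [hr]
        rw [div_le_iff₀ (hα.isUNorm.pos hx)]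
        exact hle x
    refine Set.Finite.subset (finite_iUnion fun i => finite_iUnion fun j => ?_) this
    refine (hd _ _ ?_).image _
    have hpi := hβ.isUNorm.pos (u.ne_zero i)
    have hpj := hα.isUNorm.pos (e.ne_zero j)
    positivity
  obtain ⟨_, ⟨x, ⟨hxU, hx, hxr⟩, rfl⟩, hmax⟩ := exists_max_image T id hfin
    ⟨_, x₀, ⟨hx₀U, hx₀, le_rfl⟩, rfl⟩
  refine ⟨x, hxU, hx, fun y hy => ?_⟩
  by_cases hy0 : y = 0
  · simp [hy0, hβ.isUNorm.map_zero]
  have hyr : r y ≤ r x := by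
    rcases le_total (r x₀) (r y) with h | h
    · exact hmax _ ⟨y, ⟨hy, hy0, h⟩, rfl⟩
    · exact h.trans hxr
  simp only [hr] at hyr
  rwa [div_le_div_iff₀ (hα.isUNorm.pos hy0) (hα.isUNorm.pos hx)] at hyr

/-- Two splittable norms have a common orthogonal basis (Goldman–Iwahori). -/
theorem HasDiscreteValues.exists_common_basis [FiniteDimensional K V] (hd : HasDiscreteValues v)
    (hα : IsSplittableNorm v α) (hβ : IsSplittableNorm v β) (b : Basis ι K V) :
    ∃ e : Basis ι K V, IsOrthogonalBasis v α e ∧ IsOrthogonalBasis v β e := by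
  refine exists_common_basis_top hα.isUNorm hβ.isUNorm (fun U hU => ?_) b
  obtain ⟨x, hxU, hx, hmax⟩ := hd.exists_max_ratio hα hβ (U := U) (exists_mem_ne_zero_of_ne_bot hU)
  obtain ⟨l, hl, hl'⟩ := hβ.exists_functional hx
  refine ⟨x, hxU, l, hl, fun y hy => ⟨?_, hl' y⟩⟩
  refine le_of_mul_le_mul_left ?_ (hβ.isUNorm.pos hx)
  calc β x * (v (l y) * α x) = v (l y) * β x * α x := by ring
    _ ≤ β y * α x := by gcongr; exact hl' y
    _ ≤ _ := hmax y hy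

end NormBasics

/-! ### Volumes of norms -/

section Volume

variable {K : Type*} [Field K] {v : Valuation K ℝ≥0}
variable {V : Type*} [AddCommGroup V] [Module K V] {α β : V → ℝ≥0}
  {ι κ : Type*} [Fintype ι] [Fintype κ] [DecidableEq ι] [DecidableEq κ]
variable {e : Basis ι K V} {x : ι → V}

/-- Hadamard's inequality. -/
theorem IsOrthogonalBasis.hadamard (hα : IsUNorm v α)
    (he : IsOrthogonalBasis v α e) (x : ι → V) : v (e.det x) * ∏ i, α (e i) ≤ ∏ i, α (x i) := by
  have hpos : 0 < ∏ i, α (e i) := prod_pos fun i _ => hα.pos (e.ne_zero i)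
  rw [← le_div_iff₀ hpos, Basis.det_apply, Matrix.det_apply]
  refine v.map_sum_le fun τ _ => ?_
  have hsign : v (Equiv.Perm.sign τ • ∏ i, e.toMatrix x (τ i) i) =
      ∏ i, v (e.toMatrix x (τ i) i) := by
    rcases Int.units_eq_one_or (Equiv.Perm.sign τ) with h | h <;> simp [h, map_prod]
  rw [hsign, le_div_iff₀ hpos, ← Equiv.prod_comp τ fun i => α (e i), ← prod_mul_distrib]
  exact prod_le_prod' fun i _ => he.le (x i) (τ i)

variable (v) in
/-- The logarithm of the volume of a norm, relative to a reference basis `b`. It is the minimum of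
`∑ log α(xᵢ) - log |det_b x|` over all bases `x`; the minimum is reached at the bases which are
orthogonal for `α`. -/
def lvol (b : Basis ι K V) (α : V → ℝ≥0) : ℝ := sInf {r | ∃ x : ι → V, b.det x ≠ 0 ∧
    r = ∑ i, log (α (x i)) - log (v (b.det x))}

theorem ne_zero_of_det_ne_zero {b : Basis ι K V} (hx : b.det x ≠ 0) (i : ι) :
    x i ≠ 0 := fun h => hx (b.det.map_coord_zero i h)

theorem det_basis_ne_zero (b e : Basis ι K V) : b.det e ≠ 0 := (b.isUnit_det e).ne_zero

theorem val_det_ne_zero (b e : Basis ι K V) : (v (b.det e) : ℝ) ≠ 0 :=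
  coe_ne_zero.2 (v.ne_zero_iff.2 (det_basis_ne_zero b e))

theorem det_eq_det_mul_det (b c : Basis ι K V) (x : ι → V) : b.det x = b.det c * c.det x := by
  rw [Basis.det_apply, Basis.det_apply, Basis.det_apply, ← Matrix.det_mul,
    Basis.toMatrix_mul_toMatrix]

theorem IsOrthogonalBasis.log_volume_le (hα : IsUNorm v α)
    (he : IsOrthogonalBasis v α e) (b : Basis ι K V) (hx : b.det x ≠ 0) :
    ∑ i, log (α (e i)) - log (v (b.det e)) ≤ ∑ i, log (α (x i)) - log (v (b.det x)) := by
  have hmul := det_eq_det_mul_det b e x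
  have hex : e.det x ≠ 0 := fun h => hx (by rw [hmul, h, mul_zero])
  have hv1 : (v (e.det x) : ℝ) ≠ 0 := coe_ne_zero.2 (v.ne_zero_iff.2 hex)
  have hp1 : ∀ i, (α (e i) : ℝ) ≠ 0 := fun i => coe_ne_zero.2 (hα.pos (e.ne_zero i)).ne'
  have hp2 : ∀ i, (α (x i) : ℝ) ≠ 0 := fun i =>
    coe_ne_zero.2 (hα.pos (ne_zero_of_det_ne_zero hx i)).ne'
  have hprod := mul_ne_zero hv1 (Finset.prod_ne_zero_iff.2 fun i (_ : i ∈ univ) => hp1 i)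
  have h := he.hadamard hα x
  have h' : (v (e.det x) : ℝ) * ∏ i, (α (e i) : ℝ) ≤ ∏ i, (α (x i) : ℝ) := by exact_mod_cast h
  have hlog := log_le_log (lt_of_le_of_ne (by positivity) hprod.symm) h'
  rw [log_mul hv1 (right_ne_zero_of_mul hprod), Real.log_prod (fun i _ => hp1 i),
    Real.log_prod (fun i _ => hp2 i)] at hlog
  rw [hmul, map_mul, coe_mul, log_mul (val_det_ne_zero b e) hv1]
  linarith

theorem IsOrthogonalBasis.lvol_eq (hα : IsUNorm v α)
    (he : IsOrthogonalBasis v α e) (b : Basis ι K V) :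
    lvol v b α = ∑ i, log (α (e i)) - log (v (b.det e)) := by
  refine IsLeast.csInf_eq ⟨⟨e, det_basis_ne_zero b e, rfl⟩, ?_⟩
  rintro _ ⟨x, hx, rfl⟩
  exact he.log_volume_le hα b hx

theorem IsSplittableNorm.lvol_le (hα : IsSplittableNorm v α) (b : Basis ι K V)
    (hx : b.det x ≠ 0) : lvol v b α ≤ ∑ i, log (α (x i)) - log (v (b.det x)) := by
  obtain ⟨e, he⟩ := hα.exists_basis b
  rw [he.lvol_eq hα.isUNorm b]
  exact he.log_volume_le hα.isUNorm b hx

theorem lvol_le_of_le_mul (hα : IsSplittableNorm v α) (hβ : IsSplittableNorm v β)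
    (b : Basis ι K V) {C : ℝ≥0} (hC : 0 < C) (h : ∀ x, α x ≤ C * β x) :
    lvol v b α ≤ card ι * log C + lvol v b β := by
  obtain ⟨e, he⟩ := hβ.exists_basis b
  rw [he.lvol_eq hβ.isUNorm b]
  refine (hα.lvol_le b (det_basis_ne_zero b e)).trans ?_
  have : ∑ i, log (α (e i)) ≤ ∑ i, (log C + log (β (e i))) := by
    refine sum_le_sum fun i _ => ?_
    have hp := hβ.isUNorm.pos (e.ne_zero i)
    rw [← log_mul (by exact_mod_cast hC.ne') (by exact_mod_cast hp.ne')]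
    refine log_le_log (by exact_mod_cast hα.isUNorm.pos (e.ne_zero i)) ?_
    exact_mod_cast h (e i)
  rw [sum_add_distrib, sum_const, card_univ, nsmul_eq_mul] at this
  linarith

theorem lvol_eq_of_det (b b' : Basis ι K V) (h : v (b.det b') = 1) (α : V → ℝ≥0) :
    lvol v b α = lvol v b' α := by
  refine congrArg sInf (Set.ext fun r => exists_congr fun x => ?_)
  rw [det_eq_det_mul_det b b', map_mul, h, one_mul]
  simp [det_basis_ne_zero b b']

theorem lvol_reindex (b : Basis ι K V) (f : ι ≃ κ) (α : V → ℝ≥0) :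
    lvol v (b.reindex f) α = lvol v b α := by
  refine congrArg sInf (Set.ext fun r => ?_)
  refine (f.symm.arrowCongr (Equiv.refl V)).exists_congr fun x => ?_
  rw [Basis.det_reindex, ← Equiv.sum_comp f]
  rfl

theorem lvol_map {W : Type*} [AddCommGroup W] [Module K W] (b : Basis ι K V)
    (f : V ≃ₗ[K] W) (α : W → ℝ≥0) : lvol v (b.map f) α = lvol v b fun x => α (f x) := by
  refine congrArg sInf (Set.ext fun r => ?_)
  refine ((Equiv.refl ι).arrowCongr f.symm.toEquiv).exists_congr fun x => ?_
  simp [Basis.det_map, Function.comp_def]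
  rfl

theorem lvol_const_mul (hα : IsSplittableNorm v α) (b : Basis ι K V) {C : ℝ≥0}
    (hC : 0 < C) : IsSplittableNorm v (fun x => C * α x) ∧
      lvol v b (fun x => C * α x) = card ι * log C + lvol v b α := by
  obtain ⟨e, he⟩ := hα.exists_basis b
  have he' : IsOrthogonalBasis v (fun x => C * α x) e := fun x => by
    simp only [he x, mul_finset_sup, mul_left_comm]
  have hs : IsSplittableNorm v fun x => C * α x :=
    he'.isSplittableNorm fun i => mul_pos hC (hα.isUNorm.pos (e.ne_zero i))
  refine ⟨hs, ?_⟩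
  rw [he'.lvol_eq hs.isUNorm, he.lvol_eq hα.isUNorm]
  have : ∑ i, log ((C * α (e i) : ℝ≥0) : ℝ) = ∑ i, (log C + log (α (e i))) := by
    refine sum_congr rfl fun i _ => ?_
    rw [coe_mul, log_mul (by exact_mod_cast hC.ne')
      (by exact_mod_cast (hα.isUNorm.pos (e.ne_zero i)).ne')]
  rw [this, sum_add_distrib, sum_const, card_univ, nsmul_eq_mul]
  ring

/-- For the trivial absolute value the reference basis does not matter. -/
theorem IsOrthogonalBasis.lvol_trivVal {e : Basis κ K V} (hα : IsUNorm (trivVal K) α)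
    (he : IsOrthogonalBasis (trivVal K) α e) (b : Basis ι K V) :
    lvol (trivVal K) b α = ∑ i, log (α (e i)) := by
  have hc : card κ = card ι := by rw [← finrank_eq_card_basis b, ← finrank_eq_card_basis e]
  let f := equivOfCardEq hc
  rw [(he.reindex f).lvol_eq hα b, trivVal_apply (det_basis_ne_zero _ _)]
  simp only [Basis.reindex_apply, coe_one, log_one, sub_zero]
  exact Equiv.sum_comp f.symm fun i => log (α (e i))

end Volume

/-! ### Exact sequences -/

section Exact

variable {K : Type*} [Field K] {v : Valuation K ℝ≥0}
variable {U₁ U U₂ : Type*} [AddCommGroup U₁] [Module K U₁] [AddCommGroup U] [Module K U]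
  [AddCommGroup U₂] [Module K U₂]
  {ι₁ ι₂ : Type*} [Fintype ι₁] [Fintype ι₂] [DecidableEq ι₁] [DecidableEq ι₂]

/-- A basis of the middle term of an exact sequence `U₁ → U → U₂`, made of the images of a basis
of `U₁` and of lifts of a basis of `U₂`. -/
structure IsExactBasis (i : U₁ →ₗ[K] U) (p : U →ₗ[K] U₂) (b₁ : Basis ι₁ K U₁)
    (b : Basis (ι₁ ⊕ ι₂) K U) (b₂ : Basis ι₂ K U₂) : Prop where
  inl : ∀ k, b (Sum.inl k) = i (b₁ k)
  inr : ∀ k, p (b (Sum.inr k)) = b₂ k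
  comp : ∀ x, p (i x) = 0

variable {i : U₁ →ₗ[K] U} {p : U →ₗ[K] U₂} {b₁ : Basis ι₁ K U₁}
  {b : Basis (ι₁ ⊕ ι₂) K U} {b₂ : Basis ι₂ K U₂}

namespace IsExactBasis

theorem repr_inr (h : IsExactBasis i p b₁ b b₂) (y : U) (k : ι₂) :
    b₂.repr (p y) k = b.repr y (Sum.inr k) := by
  have : b₂.coord k ∘ₗ p = b.coord (Sum.inr k) := by
    refine b.ext fun j => ?_
    rcases j with j | j
    · have h0 : p (b (Sum.inl j)) = 0 := by rw [h.inl, h.comp]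
      simp [h0]
    · simp [h.inr, single_apply]
  exact LinearMap.congr_fun this y

theorem repr_inl (h : IsExactBasis i p b₁ b b₂) (y : U₁) (k : ι₁) :
    b.repr (i y) (Sum.inl k) = b₁.repr y k := by
  have : b.coord (Sum.inl k) ∘ₗ i = b₁.coord k := b₁.ext fun j => by simp [← h.inl, single_apply]
  exact LinearMap.congr_fun this y

theorem exists_of_ker (h : IsExactBasis i p b₁ b b₂) {y : U} (hy : p y = 0) : ∃ x, i x = y := by
  refine ⟨∑ k, b.repr y (Sum.inl k) • b₁ k, ?_⟩
  conv_rhs => rw [← b.sum_repr y, sum_sum_type]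
  have : ∀ k, b.repr y (Sum.inr k) = 0 := fun k => by rw [← h.repr_inr, hy]; simp
  simp [this, h.inl]

theorem det_eq (h : IsExactBasis i p b₁ b b₂) (e : ι₁ ⊕ ι₂ → U) (e₁ : ι₁ → U₁)
    (he : ∀ k, i (e₁ k) = e (Sum.inl k)) :
    b.det e = b₁.det e₁ * b₂.det fun k => p (e (Sum.inr k)) := by
  have : b.toMatrix e = Matrix.fromBlocks (b₁.toMatrix e₁)
      (Matrix.of fun j k => b.repr (e (Sum.inr k)) (Sum.inl j)) 0
      (b₂.toMatrix fun k => p (e (Sum.inr k))) := by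
    ext j k
    rcases j with j | j <;> rcases k with k | k
    · simp [Basis.toMatrix_apply, ← he, h.repr_inl]
    · simp [Basis.toMatrix_apply]
    · simp [Basis.toMatrix_apply, ← he, ← h.repr_inr, h.comp]
    · simp [Basis.toMatrix_apply, h.repr_inr]
  rw [Basis.det_apply, this, Matrix.det_fromBlocks_zero₂₁, Basis.det_apply, Basis.det_apply]

theorem exists_adapted (h : IsExactBasis i p b₁ b b₂) {α : U → ℝ≥0} (hα : IsSplittableNorm v α) :
    ∃ e : Basis (ι₁ ⊕ ι₂) K U, IsOrthogonalBasis v α e ∧ ∃ (e₁ : Basis ι₁ K U₁)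
      (e₂ : Basis ι₂ K U₂), IsExactBasis i p e₁ e e₂ := by
  classical
  have := Finite.of_basis b
  obtain ⟨e, S, he, hS⟩ := hα.exists_basis_subspace (ker p) b
  have hspan : ∀ (u : Basis (ι₁ ⊕ ι₂) K U) (T : Set (ι₁ ⊕ ι₂)) [Fintype T],
      (∀ x, x ∈ ker p ↔ ∀ j ∉ T, u.repr x j = 0) → finrank K (ker p) = card T := fun u T _ hT => by
    have : ker p = span K (Set.range fun k : T => u k) := by
      ext x
      rw [hT, ← Set.image_eq_range, Basis.mem_span_image]
      simp [Set.subset_def, not_imp_comm]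
    rw [this]
    exact finrank_span_eq_card (u.linearIndependent.comp _ Subtype.val_injective)
  have hcard : card S = card ι₁ := by
    rw [← hspan e S hS, hspan b (Set.range Sum.inl) fun x => ⟨fun hx j hj => ?_, fun hx => ?_⟩,
      Set.card_range_of_injective Sum.inl_injective]
    · rcases j with j | j
      · exact absurd ⟨j, rfl⟩ hj
      · rw [← h.repr_inr, mem_ker.1 hx]; simp
    · exact mem_ker.2 (b₂.repr.map_eq_zero_iff.1
        (Finsupp.ext fun k => (h.repr_inr x k).trans (hx _ (by simp))))
  have hcard2 : card (Sᶜ : Set (ι₁ ⊕ ι₂)) = card ι₂ := by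
    have h1 := Fintype.card_congr (Equiv.Set.sumCompl S)
    rw [Fintype.card_sum, Fintype.card_sum] at h1
    omega
  let f : ι₁ ⊕ ι₂ ≃ ι₁ ⊕ ι₂ := (Equiv.sumCongr (equivOfCardEq hcard.symm)
    (equivOfCardEq hcard2.symm)).trans (Equiv.Set.sumCompl S)
  have hf1 : ∀ k, f (Sum.inl k) ∈ S := fun k => by simp [f]
  set e' := e.reindex f.symm with he'
  have hker : ∀ k, p (e' (Sum.inl k)) = 0 := fun k => by
    have : e (f (Sum.inl k)) ∈ ker p := (hS _).2 fun j hj => by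
      rw [e.repr_self, single_apply, if_neg]
      rintro rfl
      exact hj (hf1 k)
    simpa [he'] using this
  choose x hx using fun k => h.exists_of_ker (hker k)
  have hdet := h.det_eq e' x hx
  have hne := det_basis_ne_zero b e'
  rw [hdet] at hne
  obtain ⟨l1, s1⟩ := (Basis.is_basis_iff_det b₁).2 (left_ne_zero_of_mul hne).isUnit
  obtain ⟨l2, s2⟩ := (Basis.is_basis_iff_det b₂).2 (right_ne_zero_of_mul hne).isUnit
  exact ⟨e', he.reindex _, Basis.mk l1 s1.ge, Basis.mk l2 s2.ge, fun k => by
    rw [Basis.mk_apply, hx], fun k => by rw [Basis.mk_apply], h.comp⟩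

theorem comp_injective (h : IsExactBasis i p b₁ b b₂) : Injective i := by
  refine (injective_iff_map_eq_zero i).2 fun x hx => b₁.repr.map_eq_zero_iff.1 (Finsupp.ext fun k => ?_)
  rw [← h.repr_inl, hx]; simp

theorem orthogonal_inl (h : IsExactBasis i p b₁ b b₂) {α : U → ℝ≥0}
    (hb : IsOrthogonalBasis v α b) : IsOrthogonalBasis v (fun x => α (i x)) b₁ := by
  intro x
  simp only
  apply le_antisymm
  · rw [hb.le_iff]
    rintro (j | j)
    · rw [h.repr_inl, h.inl]
      exact le_sup (f := fun k => v (b₁.repr x k) * α (i (b₁ k))) (mem_univ j)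
    · rw [← h.repr_inr, h.comp]; simp
  · refine Finset.sup_le fun j _ => ?_
    rw [← h.repr_inl, ← h.inl]
    exact hb.le _ _

/-- The quotient norm has the images of the lifts as an orthogonal basis. -/
theorem quotient_eq (h : IsExactBasis i p b₁ b b₂) {α : U → ℝ≥0}
    (hb : IsOrthogonalBasis v α b) {α₂ : U₂ → ℝ≥0} (hle : ∀ x, α₂ (p x) ≤ α x)
    (hex : ∀ z, ∃ x, p x = z ∧ α x = α₂ z) : α₂ = ofBasis v b₂ fun k => α (b (Sum.inr k)) := by
  ext z
  apply congrArg
  apply le_antisymm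
  · have hpz : p (∑ k, b₂.repr z k • b (Sum.inr k)) = z := by simp [h.inr, b₂.sum_repr]
    rw [← hpz]
    refine (hle _).trans ?_
    rw [hpz, hb.le_iff]
    rintro (j | j)
    · simp
    · rw [← h.repr_inr, hpz]
      exact le_sup (f := fun k => v (b₂.repr z k) * α (b (Sum.inr k))) (mem_univ j)
  · obtain ⟨x, rfl, hx⟩ := hex z
    rw [← hx]
    refine Finset.sup_le fun j _ => ?_
    rw [h.repr_inr]
    exact hb.le _ _

theorem quotient_attained (h : IsExactBasis i p b₁ b b₂) {α : U → ℝ≥0}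
    (hα : IsSplittableNorm v α) (z : U₂) : ∃ x, p x = z ∧ ∀ y, p y = z → α x ≤ α y := by
  obtain ⟨e, he, e₁, e₂, h'⟩ := h.exists_adapted hα
  have hpz : p (∑ k, e₂.repr z k • e (Sum.inr k)) = z := by simp [h'.inr, e₂.sum_repr]
  refine ⟨_, hpz, fun y hy => ?_⟩
  rw [he.le_iff]
  rintro (j | j)
  · simp
  · rw [← h'.repr_inr, hpz, ← hy, h'.repr_inr]
    exact he.le _ _

theorem lvol_le (h : IsExactBasis i p b₁ b b₂) {α : U → ℝ≥0} (hα : IsSplittableNorm v α)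
    {α₂ : U₂ → ℝ≥0} (hα₂ : IsSplittableNorm v α₂) (hle : ∀ x, α₂ (p x) ≤ α x) :
    lvol v b₁ (fun x => α (i x)) + lvol v b₂ α₂ ≤ lvol v b α := by
  have := Finite.of_basis b
  obtain ⟨e, he, e₁, e₂, h'⟩ := h.exists_adapted hα
  have hdet := h.det_eq e e₁ fun k => (h'.inl k).symm
  simp only [h'.inr] at hdet
  have hα₁ := hα.comp i h.comp_injective
  have l1 := hα₁.lvol_le b₁ (det_basis_ne_zero b₁ e₁)
  have l2 := hα₂.lvol_le b₂ (det_basis_ne_zero b₂ e₂)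
  rw [he.lvol_eq hα.isUNorm b, hdet, map_mul, coe_mul,
    log_mul (val_det_ne_zero _ _) (val_det_ne_zero _ _), sum_sum_type]
  simp only [h'.inl]
  have : ∑ k, log (α₂ (e₂ k)) ≤ ∑ k, log (α (e (Sum.inr k))) := by
    refine sum_le_sum fun k _ => ?_
    refine log_le_log (by exact_mod_cast hα₂.isUNorm.pos (e₂.ne_zero k)) ?_
    rw [← h'.inr]
    exact_mod_cast hle _
  linarith

/-- Additivity of the volume: the quotient norm of a splittable norm is splittable, and volumes
add up. -/
theorem lvol_eq (h : IsExactBasis i p b₁ b b₂) {α : U → ℝ≥0} (hα : IsSplittableNorm v α)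
    {α₂ : U₂ → ℝ≥0} (hle : ∀ x, α₂ (p x) ≤ α x) (hex : ∀ z, ∃ x, p x = z ∧ α x = α₂ z) :
    IsSplittableNorm v α₂ ∧ lvol v b₁ (fun x => α (i x)) + lvol v b₂ α₂ = lvol v b α := by
  have := Finite.of_basis b
  obtain ⟨e, he, e₁, e₂, h'⟩ := h.exists_adapted hα
  have hdet := h.det_eq e e₁ fun k => (h'.inl k).symm
  simp only [h'.inr] at hdet
  have hα₁ := hα.comp i h.comp_injective
  have hq := h'.quotient_eq he hle hex
  have hpos : ∀ k, 0 < α (e (Sum.inr k)) := fun k => hα.isUNorm.pos (e.ne_zero _)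
  have hα₂ : IsSplittableNorm v α₂ := by rw [hq]; exact isSplittableNorm_ofBasis _ hpos
  have he₂ : IsOrthogonalBasis v α₂ e₂ := by rw [hq]; exact isOrthogonalBasis_ofBasis _ _
  refine ⟨hα₂, ?_⟩
  have hval : ∀ k, α₂ (e₂ k) = α (e (Sum.inr k)) := fun k => by rw [hq, ofBasis_apply_basis]
  rw [(h'.orthogonal_inl he).lvol_eq hα₁.isUNorm, he₂.lvol_eq hα₂.isUNorm,
    he.lvol_eq hα.isUNorm b, hdet, map_mul, coe_mul,
    log_mul (val_det_ne_zero _ _) (val_det_ne_zero _ _), sum_sum_type]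
  simp only [h'.inl, hval]
  ring

end IsExactBasis

end Exact

/-! ### Tensor products of norms -/

section Tensor

variable {K : Type*} [Field K] {v : Valuation K ℝ≥0}
variable {V W : Type*} [AddCommGroup V] [Module K V] [AddCommGroup W] [Module K W]
  {α : V → ℝ≥0} {β : W → ℝ≥0} {ι κ : Type*} [Fintype ι] [Fintype κ]
variable {e : Basis ι K V} {u : Basis κ K W}

theorem repr_tensorProduct_tmul (e : Basis ι K V) (u : Basis κ K W) (x : V) (y : W) (k : ι × κ) :
    (e.tensorProduct u).repr (x ⊗ₜ[K] y) k = e.repr x k.1 * u.repr y k.2 := by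
  rw [show k = (k.1, k.2) from rfl, Basis.tensorProduct_repr_tmul_apply]
  simp [mul_comm]

/-- Tensor products of orthogonal bases are orthogonal for the tensor product of the norms. -/
theorem tensorNorm_eq_ofBasis (hα : IsUNorm v α) (hβ : IsUNorm v β)
    (he : IsOrthogonalBasis v α e) (hu : IsOrthogonalBasis v β u) :
    tensorNorm α β = ofBasis v (e.tensorProduct u) fun k => α (e k.1) * β (u k.2) := by
  ext t
  apply congrArg
  unfold tensorNorm ofBasis
  have key : ∀ r ∈ {r | ∃ (n : ℕ) (x : Fin n → V) (y : Fin n → W),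
      t = ∑ i, x i ⊗ₜ[K] y i ∧ r = univ.sup fun i => α (x i) * β (y i)}, (univ.sup fun k : ι × κ =>
        v ((e.tensorProduct u).repr t k) * (α (e k.1) * β (u k.2))) ≤ r := by
    rintro _ ⟨n, x, y, rfl, rfl⟩
    refine Finset.sup_le fun k _ => ?_
    have hpos : 0 < α (e k.1) * β (u k.2) := mul_pos (hα.pos (e.ne_zero _)) (hβ.pos (u.ne_zero _))
    rw [← le_div_iff₀ hpos, map_sum, finsetSum_apply]
    refine v.map_sum_le fun j _ => ?_
    rw [repr_tensorProduct_tmul, le_div_iff₀ hpos, map_mul]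
    calc _ = (v (e.repr (x j) k.1) * α (e k.1)) * (v (u.repr (y j) k.2) * β (u k.2)) := by ring
      _ ≤ α (x j) * β (y j) := mul_le_mul' (he.le _ _) (hu.le _ _)
      _ ≤ _ := le_sup (f := fun j => α (x j) * β (y j)) (mem_univ j)
  have hmem : (univ.sup fun k : ι × κ =>
        v ((e.tensorProduct u).repr t k) * (α (e k.1) * β (u k.2))) ∈
      {r | ∃ (n : ℕ) (x : Fin n → V) (y : Fin n → W),
      t = ∑ i, x i ⊗ₜ[K] y i ∧ r = univ.sup fun i => α (x i) * β (y i)} := by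
    let f := Fintype.equivFin (ι × κ)
    refine ⟨_, fun j => (e.tensorProduct u).repr t (f.symm j) • e (f.symm j).1,
      fun j => u (f.symm j).2, ?_, ?_⟩
    · rw [Equiv.sum_comp f.symm fun k => ((e.tensorProduct u).repr t k • e k.1) ⊗ₜ[K] u k.2]
      conv_lhs => rw [← (e.tensorProduct u).sum_repr t]
      refine sum_congr rfl fun k _ => ?_
      rw [Basis.tensorProduct_apply', smul_tmul']
    · simp only [hα.smul]
      exact eq_of_forall_ge_iff fun c => by
        simpa [mul_assoc] using (f.symm.forall_congr_right (q := fun k =>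
          v ((e.tensorProduct u).repr t k) * (α (e k.1) * β (u k.2)) ≤ c)).symm
  exact IsLeast.csInf_eq ⟨hmem, key⟩

theorem isOrthogonalBasis_tensorNorm (hα : IsUNorm v α) (hβ : IsUNorm v β)
    (he : IsOrthogonalBasis v α e)
    (hu : IsOrthogonalBasis v β u) : IsOrthogonalBasis v (tensorNorm α β) (e.tensorProduct u) := by
  rw [tensorNorm_eq_ofBasis hα hβ he hu]; exact isOrthogonalBasis_ofBasis _ _

theorem tensorNorm_basis (hα : IsUNorm v α) (hβ : IsUNorm v β) (he : IsOrthogonalBasis v α e)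
    (hu : IsOrthogonalBasis v β u) (k : ι × κ) :
    tensorNorm (K := K) α β (e.tensorProduct u k) = α (e k.1) * β (u k.2) := by
  rw [tensorNorm_eq_ofBasis hα hβ he hu, ofBasis_apply_basis]

theorem IsSplittableNorm.tensorNorm (hα : IsSplittableNorm v α) (hβ : IsSplittableNorm v β) :
    IsSplittableNorm v (tensorNorm (K := K) α β) := by
  obtain ⟨e, he⟩ := hα.splittable
  obtain ⟨u, hu⟩ := hβ.splittable
  rw [tensorNorm_eq_ofBasis hα.isUNorm hβ.isUNorm he hu]
  exact isSplittableNorm_ofBasis _ fun k =>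
    mul_pos (hα.isUNorm.pos (e.ne_zero _)) (hβ.isUNorm.pos (u.ne_zero _))

variable [DecidableEq ι] [DecidableEq κ]

theorem det_tensorProduct (b : Basis ι K V) (b' : Basis κ K W) (e : ι → V) (u : κ → W) :
    (b.tensorProduct b').det (fun k => e k.1 ⊗ₜ[K] u k.2) =
      b.det e ^ card κ * b'.det u ^ card ι := by
  have : (b.tensorProduct b').toMatrix (fun k => e k.1 ⊗ₜ[K] u k.2) =
      Matrix.kroneckerMap (· * ·) (b.toMatrix e) (b'.toMatrix u) := by
    ext j k
    rw [Basis.toMatrix_apply, repr_tensorProduct_tmul]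
    rfl
  rw [Basis.det_apply, this, Matrix.det_kronecker, Basis.det_apply, Basis.det_apply]

theorem lvol_tensorNorm (hα : IsSplittableNorm v α) (hβ : IsSplittableNorm v β)
    (b : Basis ι K V) (b' : Basis κ K W) : lvol v (b.tensorProduct b') (tensorNorm α β) =
      card κ * lvol v b α + card ι * lvol v b' β := by
  obtain ⟨e, he⟩ := hα.exists_basis b
  obtain ⟨u, hu⟩ := hβ.exists_basis b'
  rw [he.lvol_eq hα.isUNorm, hu.lvol_eq hβ.isUNorm,
    (isOrthogonalBasis_tensorNorm hα.isUNorm hβ.isUNorm he hu).lvol_eq (hα.tensorNorm hβ).isUNorm,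
    show ⇑(e.tensorProduct u) = fun k => e k.1 ⊗ₜ[K] u k.2 from
      funext fun k => e.tensorProduct_apply' u k, det_tensorProduct]
  rw [map_mul, map_pow, map_pow, coe_mul, NNReal.coe_pow, NNReal.coe_pow,
    log_mul (pow_ne_zero _ (val_det_ne_zero b e)) (pow_ne_zero _ (val_det_ne_zero b' u)), log_pow,
    log_pow]
  have : ∑ k : ι × κ, log (tensorNorm α β (e k.1 ⊗ₜ[K] u k.2)) =
      ∑ k : ι × κ, (log (α (e k.1)) + log (β (u k.2))) := by
    refine sum_congr rfl fun k _ => ?_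
    rw [← Basis.tensorProduct_apply', tensorNorm_basis hα.isUNorm hβ.isUNorm he hu,
      coe_mul, log_mul]
    · exact_mod_cast (hα.isUNorm.pos (e.ne_zero _)).ne'
    · exact_mod_cast (hβ.isUNorm.pos (u.ne_zero _)).ne'
  rw [this, Fintype.sum_prod_type]
  simp only [sum_add_distrib, sum_const, card_univ, nsmul_eq_mul]
  rw [← mul_sum]
  ring

end Tensor

/-! ### Norms on the scalar extension of a vector space -/

section ScalarExtension

theorem exists_isExactBasis {L : Type*} [Field L] {V₁ V V₂ : Type*} [AddCommGroup V₁] [Module L V₁]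
    [AddCommGroup V] [Module L V] [AddCommGroup V₂] [Module L V₂]
    {ι₁ ι₂ : Type*} [Fintype ι₁] [Fintype ι₂] {i : V₁ →ₗ[L] V} {p : V →ₗ[L] V₂}
    (hi : Injective i) (hp : Surjective p) (hex : Exact i p)
    (b₁ : Basis ι₁ L V₁) (b₂ : Basis ι₂ L V₂) :
    ∃ b : Basis (ι₁ ⊕ ι₂) L V, IsExactBasis i p b₁ b b₂ := by
  choose s hs using fun k => hp (b₂ k)
  have hpi : ∀ x, p (i x) = 0 := fun x => (hex _).2 ⟨x, rfl⟩
  have hli : LinearIndependent L (Sum.elim (fun k => i (b₁ k)) s) := by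
    rw [Fintype.linearIndependent_iff]
    intro g hg
    rw [sum_sum_type] at hg
    simp only [Sum.elim_inl, Sum.elim_inr] at hg
    have h2 : ∀ k, g (Sum.inr k) = 0 := by
      refine Fintype.linearIndependent_iff.1 b₂.linearIndependent (fun k => g (Sum.inr k)) ?_
      simpa [hpi, hs] using congrArg p hg
    have h1 : ∀ k, g (Sum.inl k) = 0 := by
      refine Fintype.linearIndependent_iff.1 b₁.linearIndependent _ (hi ?_)
      simpa [h2] using hg
    exact Sum.rec h1 h2
  have hsp : ⊤ ≤ span L (Set.range (Sum.elim (fun k => i (b₁ k)) s)) := by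
    intro x _
    have h0 : p (x - ∑ k, b₂.repr (p x) k • s k) = 0 := by simp [hs, b₂.sum_repr]
    obtain ⟨y, hy⟩ := (hex _).1 h0
    have hx : x = ∑ k, b₁.repr y k • i (b₁ k) + ∑ k, b₂.repr (p x) k • s k := by
      rw [← sub_eq_iff_eq_add, ← hy]
      conv_lhs => rw [← b₁.sum_repr y]
      simp only [map_sum, _root_.map_smul]
    rw [hx]
    exact Submodule.add_mem _
      (Submodule.sum_mem _ fun k _ => Submodule.smul_mem _ _ (subset_span ⟨Sum.inl k, rfl⟩))
      (Submodule.sum_mem _ fun k _ => Submodule.smul_mem _ _ (subset_span ⟨Sum.inr k, rfl⟩))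
  exact ⟨Basis.mk hli hsp, fun k => by simp, fun k => by simp [hs], hpi⟩

variable {L : Type*} [Field L] {K : Type*} [Field K] [Algebra L K] (v : Valuation K ℝ≥0)

/-- The valuation `v` is trivial on the subfield `L`. -/
def TrivialOn (L : Type*) [Field L] {K : Type*} [Field K] [Algebra L K] (v : Valuation K ℝ≥0) :
    Prop := ∀ x : L, x ≠ 0 → v (algebraMap L K x) = 1

theorem trivialOn_trivVal : TrivialOn L (trivVal K) := fun _ hx =>
  trivVal_apply ((map_ne_zero (algebraMap L K)).2 hx)

variable {v}

theorem TrivialOn.le_one (hv : TrivialOn L v) (x : L) : v (algebraMap L K x) ≤ 1 := by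
  by_cases hx : x = 0
  · simp [hx]
  · rw [hv x hx]

theorem IsExactBasis.baseChange {V₁ V V₂ : Type*} [AddCommGroup V₁] [Module L V₁]
    [AddCommGroup V] [Module L V] [AddCommGroup V₂] [Module L V₂]
    {ι₁ ι₂ : Type*} [Fintype ι₁] [Fintype ι₂] {i : V₁ →ₗ[L] V} {p : V →ₗ[L] V₂}
    {b₁ : Basis ι₁ L V₁} {b : Basis (ι₁ ⊕ ι₂) L V} {b₂ : Basis ι₂ L V₂}
    (h : IsExactBasis i p b₁ b b₂) :
    IsExactBasis (i.baseChange K) (p.baseChange K) (b₁.baseChange K) (b.baseChange K)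
      (b₂.baseChange K) where
  inl k := by simp [h.inl]
  inr k := by simp [h.inr]
  comp x := by
    induction x using TensorProduct.induction_on with
    | zero => simp
    | tmul a x => simp [h.comp]
    | add x y hx hy => simp [hx, hy]

theorem det_baseChange {V ι : Type*} [AddCommGroup V] [Module L V] [Fintype ι] [DecidableEq ι]
    (b b' : Basis ι L V) : (b.baseChange K).det (b'.baseChange K) = algebraMap L K (b.det b') := by
  rw [Basis.det_apply, Basis.det_apply, RingHom.map_det]
  congr 1
  ext j k
  simp [Basis.toMatrix_apply, Algebra.algebraMap_eq_smul_one]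

theorem baseChange_tensorProduct_map {V V' ι ι' : Type*} [AddCommGroup V] [Module L V]
    [AddCommGroup V'] [Module L V'] [Finite ι] [Finite ι'] (b : Basis ι L V) (b' : Basis ι' L V') :
    ((b.tensorProduct b').baseChange K).map (distribBaseChange L K V V') =
      (b.baseChange K).tensorProduct (b'.baseChange K) := by
  ext k
  rw [Basis.map_apply, Basis.baseChange_apply, Basis.tensorProduct_apply',
    distribBaseChange_tmul, Basis.tensorProduct_apply',
    Basis.baseChange_apply, Basis.baseChange_apply]

variable (v) in
/-- The logarithmic volume of a norm on `K ⊗ V`, relative to the `L`-structure `V`. -/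
def lv {V : Type*} [AddCommGroup V] [Module L V] [FiniteDimensional L V] (α : K ⊗[L] V → ℝ≥0) :
    ℝ := lvol v ((finBasis L V).baseChange K) α

section

variable {V : Type*} [AddCommGroup V] [Module L V] [FiniteDimensional L V] {α : K ⊗[L] V → ℝ≥0}

theorem TrivialOn.lv_eq (hv : TrivialOn L v) {ι : Type*} [Fintype ι] [DecidableEq ι]
    (b : Basis ι L V) (α : K ⊗[L] V → ℝ≥0) : lvol v (b.baseChange K) α = lv v α := by
  have hc : card (Fin (finrank L V)) = card ι := by rw [card_fin, finrank_eq_card_basis b]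
  let f := equivOfCardEq hc
  have h1 : ((finBasis L V).reindex f).baseChange K = ((finBasis L V).baseChange K).reindex f := by
    ext i; simp
  rw [lv, ← lvol_reindex _ f, ← h1]
  exact lvol_eq_of_det _ _ (by rw [det_baseChange, hv _ (det_basis_ne_zero _ _)]) _

end

section

variable {V₁ V V₂ : Type*} [AddCommGroup V₁] [Module L V₁] [FiniteDimensional L V₁]
    [AddCommGroup V] [Module L V] [FiniteDimensional L V]
    [AddCommGroup V₂] [Module L V₂] [FiniteDimensional L V₂]
    {i : V₁ →ₗ[L] V} {p : V →ₗ[L] V₂} {α : K ⊗[L] V → ℝ≥0} {α₂ : K ⊗[L] V₂ → ℝ≥0}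

theorem TrivialOn.lv_add_le (hv : TrivialOn L v)
    (hi : Injective i) (hp : Surjective p) (hex : Exact i p)
    (hα : IsSplittableNorm v α) (hα₂ : IsSplittableNorm v α₂)
    (hle : ∀ x, α₂ (p.baseChange K x) ≤ α x) :
    lv v (fun x => α (i.baseChange K x)) + lv v α₂ ≤ lv v α := by
  obtain ⟨b, hb⟩ := exists_isExactBasis hi hp hex (finBasis L V₁) (finBasis L V₂)
  rw [← hv.lv_eq b]
  exact hb.baseChange.lvol_le hα hα₂ hle

theorem TrivialOn.lv_add_eq (hv : TrivialOn L v)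
    (hi : Injective i) (hp : Surjective p) (hex : Exact i p) (hα : IsSplittableNorm v α)
    (hle : ∀ x, α₂ (p.baseChange K x) ≤ α x) (hat : ∀ z, ∃ x, p.baseChange K x = z ∧ α x = α₂ z) :
    IsSplittableNorm v α₂ ∧ lv v (fun x => α (i.baseChange K x)) + lv v α₂ = lv v α := by
  obtain ⟨b, hb⟩ := exists_isExactBasis hi hp hex (finBasis L V₁) (finBasis L V₂)
  rw [← hv.lv_eq b]
  exact hb.baseChange.lvol_eq hα hle hat

theorem baseChange_injective (hi : Injective i) : Injective (i.baseChange K) :=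
  Flat.lTensor_preserves_injective_linearMap i hi

/-- The quotient norm is attained. -/
theorem quotient_norm_attained (hi : Injective i) (hp : Surjective p) (hex : Exact i p)
    (hα : IsSplittableNorm v α) (hα₂ : ∀ z, α₂ z = sInf {r | ∃ y, p.baseChange K y = z ∧ r = α y}) :
    (∀ x, α₂ (p.baseChange K x) ≤ α x) ∧ ∀ z, ∃ x, p.baseChange K x = z ∧ α x = α₂ z := by
  obtain ⟨b, hb⟩ := exists_isExactBasis hi hp hex (finBasis L V₁) (finBasis L V₂)
  refine ⟨fun x => ?_, fun z => ?_⟩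
  · exact (hα₂ _).trans_le (csInf_le' (Set.mem_ofPred.2 ⟨x, rfl, rfl⟩))
  · obtain ⟨x, hx, hmin⟩ := hb.baseChange.quotient_attained hα z
    refine ⟨x, hx, ((hα₂ z).trans (IsLeast.csInf_eq ⟨⟨x, hx, rfl⟩, ?_⟩)).symm⟩
    rintro _ ⟨y, hy, rfl⟩
    exact hmin y hy

end

end ScalarExtension

/-! ### The standard norm and the degree -/

namespace Isocrystal

section Degree

variable {L : Type*} [NormedField L] {σ : L ≃+* L} {K : Type*} [Field K] [Algebra L K]
  {v : Valuation K ℝ≥0} {π : K}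

theorem standardNorm_eq (hv : TrivialOn L v) (D : Isocrystal σ) {ι : Type*} [Fintype ι]
    (b : Basis ι L D) : D.standardNorm (K := K) v = ofBasis v (b.baseChange K) fun _ => 1 := by
  funext x
  unfold standardNorm
  set B := b.baseChange K
  have ho := isOrthogonalBasis_ofBasis (v := v) B fun _ => (1 : ℝ≥0)
  have hcl : ∀ y ∈ AddSubgroup.closure {z : K ⊗[L] D | ∃ (a : K) (d : D), v a ≤ 1 ∧ z = a ⊗ₜ[L] d},
      ∀ i, v (B.repr y i) ≤ 1 := by
    intro y hy i
    induction hy using AddSubgroup.closure_induction with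
    | mem z hz =>
      obtain ⟨a, d, ha, rfl⟩ := hz
      rw [Basis.baseChange_repr_tmul, Algebra.smul_def, map_mul]
      exact mul_le_one' (hv.le_one _) ha
    | zero => simp
    | add y z _ _ hy hz =>
      rw [map_add, Finsupp.add_apply]
      exact (v.map_add _ _).trans (max_le hy hz)
    | neg y _ hy => rw [map_neg, Finsupp.neg_apply, Valuation.map_neg]; exact hy
  refine IsLeast.csInf_eq ⟨?_, ?_⟩
  · by_cases hx : x = 0
    · exact ⟨0, by simp [hx, ofBasis], 0, AddSubgroup.zero_mem _, by simp [hx]⟩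
    obtain ⟨i, hi0, hi⟩ := ho.exists_eq (isUNorm_ofBasis _ fun _ => one_pos) hx
    rw [ofBasis_apply_basis, mul_one] at hi
    refine ⟨B.repr x i, hi, (B.repr x i)⁻¹ • x, ?_, ?_⟩
    · rw [← B.sum_repr ((B.repr x i)⁻¹ • x)]
      refine AddSubgroup.sum_mem _ fun j _ => AddSubgroup.subset_closure
        ⟨B.repr ((B.repr x i)⁻¹ • x) j, b j, ?_, ?_⟩
      · have := ho.le x j
        rw [ofBasis_apply_basis, mul_one, hi] at this
        rw [_root_.map_smul, Finsupp.smul_apply, smul_eq_mul, map_mul, map_inv₀]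
        exact inv_mul_le_one_of_le₀ this zero_le
      · rw [Basis.baseChange_apply, smul_tmul', smul_eq_mul, mul_one]
    · rw [smul_smul, mul_inv_cancel₀ hi0, one_smul]
  · rintro _ ⟨c, rfl, y, hy, rfl⟩
    refine Finset.sup_le fun i _ => ?_
    rw [mul_one, _root_.map_smul, Finsupp.smul_apply, smul_eq_mul, map_mul]
    exact mul_le_of_le_one_right zero_le (hcl y hy i)

theorem isSplittableNorm_standardNorm (hv : TrivialOn L v) (D : Isocrystal σ) :
    IsSplittableNorm v (D.standardNorm (K := K) v) := by
  rw [standardNorm_eq hv D (finBasis L D)]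
  exact isSplittableNorm_ofBasis _ fun _ => one_pos

theorem isOrthogonalBasis_standardNorm (hv : TrivialOn L v) (D : Isocrystal σ) {ι : Type*}
    [Fintype ι] (b : Basis ι L D) :
    IsOrthogonalBasis v (D.standardNorm (K := K) v) (b.baseChange K) := by
  rw [standardNorm_eq hv D b]; exact isOrthogonalBasis_ofBasis _ _

theorem lv_standardNorm (hv : TrivialOn L v) (D : Isocrystal σ) :
    lv v (D.standardNorm (K := K) v) = 0 := by
  rw [lv, (isOrthogonalBasis_standardNorm hv D _).lvol_eq
    (isSplittableNorm_standardNorm hv D).isUNorm, standardNorm_eq hv D (finBasis L D),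
    Basis.det_self]
  simp [-Basis.baseChange_apply, ofBasis_apply_basis]

theorem degree_eq (hv : TrivialOn L v) (hd : HasDiscreteValues v) (D : Isocrystal σ)
    {α : K ⊗[L] D → ℝ≥0} (hα : IsSplittableNorm v α) :
    D.degree v π α = lv v α / log (v π) - D.dim := by
  unfold degree
  congr 1
  have ho := isSplittableNorm_standardNorm (K := K) hv D
  have hex := hd.exists_common_basis ho hα (finBasis K (K ⊗[L] D))
  unfold relativeDegree
  rw [dif_pos hex]
  obtain ⟨h1, h2⟩ := hex.choose_spec
  set e := hex.choose
  have hc : card (Fin (finrank L D)) = card (Fin (finrank K (K ⊗[L] D))) := by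
    rw [card_fin, card_fin, finrank_baseChange]
  let f := equivOfCardEq hc
  have h0 := lv_standardNorm (K := K) hv D
  rw [lv, ← lvol_reindex _ f, h1.lvol_eq ho.isUNorm] at h0
  rw [show lv v α = _ from (lvol_reindex _ f _).symm, h2.lvol_eq hα.isUNorm]
  simp only [logb]
  rw [sum_sub_distrib, ← sum_div, ← sum_div, ← sub_div]
  congr 1
  linarith

end Degree

/-! ### The dimension of an isocrystal -/

section Dim

variable {L : Type*} [NormedField L] {σ : L ≃+* L}

theorem normalizedVal_mul {x y : L} (hx : x ≠ 0) (hy : y ≠ 0) :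
    normalizedVal (x * y) = normalizedVal x + normalizedVal y := by
  unfold normalizedVal
  rw [norm_mul, Real.logb_mul (norm_ne_zero_iff.2 hx) (norm_ne_zero_iff.2 hy)]

/-- What the theory of the dimension needs: `σ` preserves the normalized valuation, which takes
integral values. -/
structure PreservesVal (σ : L ≃+* L) : Prop where
  map : ∀ x, normalizedVal (σ x) = normalizedVal x
  int : ∀ x : L, x ≠ 0 → ∃ k : ℤ, normalizedVal x = k

variable {D : Isocrystal σ} {ι : Type*} [Fintype ι] [DecidableEq ι]

theorem frob_smul (D : Isocrystal σ) (c : L) (x : D) : D.frob (c • x) = σ c • D.frob x :=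
  map_smulₛₗ D.frob c x

theorem det_frob_comp (b : Basis ι L D) (x : ι → D) :
    b.det (fun k => D.frob (x k)) = b.det (fun k => D.frob (b k)) * σ (b.det x) := by
  have : b.toMatrix (fun k => D.frob (x k)) =
      b.toMatrix (fun k => D.frob (b k)) * (b.toMatrix x).map (σ : L →+* L) := by
    ext j k
    rw [Basis.toMatrix_apply, Matrix.mul_apply]
    conv_lhs => rw [← b.sum_repr (x k)]
    rw [map_sum]
    simp only [frob_smul, map_sum, finsetSum_apply, _root_.map_smul, Finsupp.smul_apply,
      smul_eq_mul]
    refine sum_congr rfl fun l _ => ?_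
    rw [mul_comm]
    rfl
  rw [Basis.det_apply, this, Matrix.det_mul, Basis.det_apply,
    ← RingHom.mapMatrix_apply, ← RingHom.map_det, Basis.det_apply]
  rfl

theorem det_frob_ne_zero (b : Basis ι L D) : b.det (fun k => D.frob (b k)) ≠ 0 := by
  choose x hx using fun k => D.bijective.2 (b k)
  have h := det_frob_comp b x
  simp only [hx] at h
  rw [Basis.det_self] at h
  exact left_ne_zero_of_mul (h ▸ one_ne_zero)

theorem PreservesVal.dim_eq (hσ : PreservesVal σ) (b : Basis ι L D) :
    D.dim = normalizedVal (b.det fun k => D.frob (b k)) := by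
  have hc : card (Fin (finrank L D)) = card ι := by rw [card_fin, finrank_eq_card_basis b]
  let f := equivOfCardEq hc
  set c := (finBasis L D).reindex f with hcdef
  have h1 : D.dim = normalizedVal (c.det fun k => D.frob (c k)) := by
    change normalizedVal ((finBasis L D).det fun k => D.frob (finBasis L D k)) = _
    rw [hcdef, Basis.det_reindex]; congr 2; ext k; simp
  rw [h1]
  have hmul := det_eq_det_mul_det b c fun k => D.frob (c k)
  rw [det_frob_comp] at hmul
  have := congrArg normalizedVal hmul
  rw [normalizedVal_mul (det_frob_ne_zero b) ((map_ne_zero σ).2 (det_basis_ne_zero b c)),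
    normalizedVal_mul (det_basis_ne_zero b c) (det_frob_ne_zero c), hσ.map] at this
  linarith

theorem PreservesVal.dim_int (hσ : PreservesVal σ) (D : Isocrystal σ) : ∃ k : ℤ, D.dim = k :=
  hσ.int _ (det_frob_ne_zero (finBasis L D))

theorem PreservesVal.dim_add (hσ : PreservesVal σ) {D₁ D D₂ : Isocrystal σ} {i : D₁ →ₗ[L] D}
    {p : D →ₗ[L] D₂} (hi : Injective i) (hp : Surjective p)
    (hex : Exact i p) (hiφ : ∀ x, i (D₁.frob x) = D.frob (i x))
    (hpφ : ∀ x, p (D.frob x) = D₂.frob (p x)) : D.dim = D₁.dim + D₂.dim := by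
  obtain ⟨b, hb⟩ := exists_isExactBasis hi hp hex (finBasis L D₁) (finBasis L D₂)
  rw [hσ.dim_eq b, hσ.dim_eq (finBasis L D₁), hσ.dim_eq (finBasis L D₂),
    ← normalizedVal_mul (det_frob_ne_zero _) (det_frob_ne_zero _),
    hb.det_eq _ (fun k => D₁.frob (finBasis L D₁ k)) fun k => by rw [hiφ, hb.inl]]
  simp only [hpφ, hb.inr]

theorem normalizedVal_pow {x : L} (n : ℕ) : normalizedVal (x ^ n) = n * normalizedVal x := by
  unfold normalizedVal
  rw [norm_pow, Real.logb_pow]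

theorem PreservesVal.dim_tensor (hσ : PreservesVal σ) (D D' : Isocrystal σ) :
    (D.tensor D').dim = finrank L D' * D.dim + finrank L D * D'.dim := by
  let b := finBasis L D
  let b' := finBasis L D'
  have h := det_tensorProduct b b' (fun k => D.frob (b k)) (fun k => D'.frob (b' k))
  let c : Basis (Fin (finrank L D) × Fin (finrank L D')) L (D.tensor D') := b.tensorProduct b'
  have h2 : (fun k => (D.tensor D').frob (c k)) = fun k => D.frob (b k.1) ⊗ₜ[L] D'.frob (b' k.2) :=
    funext fun k => congrArg (D.tensor D').frob (b.tensorProduct_apply' b' k)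
  rw [hσ.dim_eq c, h2, hσ.dim_eq b, hσ.dim_eq b']
  change normalizedVal ((b.tensorProduct b').det _) = _
  rw [h, normalizedVal_mul (pow_ne_zero _ (det_frob_ne_zero b))
    (pow_ne_zero _ (det_frob_ne_zero b')), normalizedVal_pow, normalizedVal_pow]
  simp

end Dim

/-! ### Degrees in exact sequences and tensor products -/

section DegreeExact

variable {L : Type*} [NormedField L] {σ : L ≃+* L} {K : Type*} [Field K] [Algebra L K]
  {v : Valuation K ℝ≥0} {π : K}
variable {D D' : Isocrystal σ} {α' : K ⊗[L] D' → ℝ≥0} {α : K ⊗[L] D → ℝ≥0}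

variable {D₁ D D₂ : Isocrystal σ} {i : D₁ →ₗ[L] D} {p : D →ₗ[L] D₂} {α : K ⊗[L] D → ℝ≥0}
  {α₂ : K ⊗[L] D₂ → ℝ≥0}

/-- An exact sequence of isocrystals. -/
structure IsExact (i : D₁ →ₗ[L] D) (p : D →ₗ[L] D₂) : Prop where
  injective : Injective i
  surjective : Surjective p
  exact : Exact i p
  left : ∀ x, i (D₁.frob x) = D.frob (i x)
  right : ∀ x, p (D.frob x) = D₂.frob (p x)

theorem IsExact.finrank (h : IsExact i p) : finrank L D = finrank L D₁ + finrank L D₂ := by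
  have := LinearMap.finrank_range_add_finrank_ker p
  rw [range_eq_top.2 h.surjective, finrank_top,
    LinearMap.exact_iff.1 h.exact, LinearMap.finrank_range_of_inj h.injective] at this
  omega

theorem IsExact.degree_le (h : IsExact i p) (hσ : PreservesVal σ) (hv : TrivialOn L v)
    (hd : HasDiscreteValues v) (hπ : log (v π) < 0) (hα : IsSplittableNorm v α)
    (hα₂ : IsSplittableNorm v α₂) (hle : ∀ x, α₂ (p.baseChange K x) ≤ α x) :
    D.degree v π α ≤ D₁.degree v π (fun x => α (i.baseChange K x)) + D₂.degree v π α₂ := by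
  have hα₁ := hα.comp _ (baseChange_injective (K := K) h.injective)
  rw [degree_eq hv hd D hα, degree_eq hv hd D₁ hα₁, degree_eq hv hd D₂ hα₂,
    hσ.dim_add h.injective h.surjective h.exact h.left h.right]
  have := hv.lv_add_le h.injective h.surjective h.exact hα hα₂ hle
  have h2 := div_le_div_of_nonpos_of_le hπ.le this
  rw [add_div] at h2
  linarith

theorem IsExact.degree_eq (h : IsExact i p) (hσ : PreservesVal σ) (hv : TrivialOn L v)
    (hd : HasDiscreteValues v) (hα : IsSplittableNorm v α)
    (hle : ∀ x, α₂ (p.baseChange K x) ≤ α x) (hat : ∀ z, ∃ x, p.baseChange K x = z ∧ α x = α₂ z) :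
    IsSplittableNorm v α₂ ∧
    D.degree v π α = D₁.degree v π (fun x => α (i.baseChange K x)) + D₂.degree v π α₂ := by
  have hα₁ := hα.comp _ (baseChange_injective (K := K) h.injective)
  obtain ⟨hα₂, hadd⟩ := hv.lv_add_eq h.injective h.surjective h.exact hα hle hat
  refine ⟨hα₂, ?_⟩
  rw [Isocrystal.degree_eq hv hd _ hα, Isocrystal.degree_eq hv hd _ hα₁,
    Isocrystal.degree_eq hv hd _ hα₂, hσ.dim_add h.injective h.surjective h.exact h.left h.right,
    ← hadd, add_div]
  ring

theorem isSplittableNorm_tensorNorm (hα : IsSplittableNorm v α) (hα' : IsSplittableNorm v α') :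
    IsSplittableNorm v (D.tensorNorm D' α α') := (hα.tensorNorm hα').comp
    (distribBaseChange L K D D').toLinearMap (distribBaseChange L K D D').injective

theorem lv_tensorNorm (hv : TrivialOn L v)
    (hα : IsSplittableNorm v α) (hα' : IsSplittableNorm v α') :
    lv v (D.tensorNorm D' α α') = finrank L D' * lv v α + finrank L D * lv v α' := by
  have h := lvol_tensorNorm hα hα' ((finBasis L D).baseChange K) ((finBasis L D').baseChange K)
  rw [← baseChange_tensorProduct_map, lvol_map, card_fin, card_fin] at h
  let c : Basis (Fin (finrank L D) × Fin (finrank L D')) L (D.tensor D') :=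
    (finBasis L D).tensorProduct (finBasis L D')
  exact (hv.lv_eq c (D.tensorNorm D' α α')).symm.trans h

theorem degree_tensorNorm (hσ : PreservesVal σ) (hv : TrivialOn L v) (hd : HasDiscreteValues v)
    (hα : IsSplittableNorm v α) (hα' : IsSplittableNorm v α') :
    (D.tensor D').degree v π (D.tensorNorm D' α α') =
      finrank L D' * D.degree v π α + finrank L D * D'.degree v π α' := by
  rw [degree_eq hv hd _ (isSplittableNorm_tensorNorm hα hα'), degree_eq hv hd _ hα,
    degree_eq hv hd _ hα', lv_tensorNorm hv hα hα', hσ.dim_tensor]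
  ring

end DegreeExact

end Isocrystal

/-! ### Degrees of subisocrystals and of subquotients -/

section BaseChange

variable {L : Type*} [Field L] {K : Type*} [Field K] [Algebra L K] {U V V' W : Type*}
  [AddCommGroup U] [Module L U] [AddCommGroup V] [Module L V] [AddCommGroup V'] [Module L V']
  [AddCommGroup W] [Module L W]

theorem baseChange_tri {f : U →ₗ[L] V} {g : V →ₗ[L] W} {k : U →ₗ[L] W}
    (h : ∀ x, g (f x) = k x) (z : K ⊗[L] U) :
    g.baseChange K (f.baseChange K z) = k.baseChange K z := by
  have : k = g ∘ₗ f := LinearMap.ext fun x => (h x).symm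
  rw [this, LinearMap.baseChange_comp, LinearMap.comp_apply]

theorem baseChange_square {f : U →ₗ[L] V} {g : V →ₗ[L] W} {f' : U →ₗ[L] V'} {g' : V' →ₗ[L] W}
    (h : ∀ x, g (f x) = g' (f' x)) (z : K ⊗[L] U) :
    g.baseChange K (f.baseChange K z) = g'.baseChange K (f'.baseChange K z) :=
  (baseChange_tri (k := g' ∘ₗ f') h z).trans (baseChange_tri (fun _ => rfl) z).symm

end BaseChange

namespace Isocrystal

section SubDegree

variable {L : Type*} [NormedField L] {σ : L ≃+* L} {K : Type*} [Field K] [Algebra L K]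
variable {D : Isocrystal σ} {α : K ⊗[L] D → ℝ≥0}

theorem isSub_bot (D : Isocrystal σ) : D.IsSub ⊥ := Submodule.map_bot _

theorem isSub_top (D : Isocrystal σ) : D.IsSub ⊤ := by
  have : RingHomSurjective (σ : L →+* L) := ⟨σ.surjective⟩
  rw [IsSub, Submodule.map_top, range_eq_top]
  exact D.bijective.2

theorem IsSub.sup {X Y : Submodule L D} (hX : D.IsSub X) (hY : D.IsSub Y) :
    D.IsSub (X ⊔ Y) := by rw [IsSub, Submodule.map_sup, hX, hY]

theorem IsSub.inf {X Y : Submodule L D} (hX : D.IsSub X) (hY : D.IsSub Y) :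
    D.IsSub (X ⊓ Y) := by rw [IsSub, Submodule.map_inf _ D.bijective.1, hX, hY]

theorem IsSub.map {D E : Isocrystal σ} {p : D →ₗ[L] E} (hp : ∀ x, p (D.frob x) = E.frob (p x))
    {X : Submodule L D} (hX : D.IsSub X) : E.IsSub (X.map p) := by
  apply le_antisymm
  · rintro _ ⟨_, ⟨x, hx, rfl⟩, rfl⟩
    exact ⟨D.frob x, hX.mem hx, hp x⟩
  · rintro _ ⟨x, hx, rfl⟩
    have hx' := hx
    rw [← hX] at hx'
    obtain ⟨y, hy, rfl⟩ := hx'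
    exact ⟨p y, ⟨y, hy, rfl⟩, (hp y).symm⟩

theorem IsSub.comap {D E : Isocrystal σ} {p : D →ₗ[L] E}
    (hp : ∀ x, p (D.frob x) = E.frob (p x)) {X : Submodule L E} (hX : E.IsSub X) :
    D.IsSub (X.comap p) := by
  apply le_antisymm
  · rintro _ ⟨x, hx, rfl⟩
    rw [mem_comap, hp]
    exact hX.mem hx
  · intro x hx
    obtain ⟨y, rfl⟩ := D.bijective.2 x
    refine ⟨y, ?_, rfl⟩
    have hx' : E.frob (p y) ∈ X := by rw [← hp]; exact hx
    rw [← hX] at hx'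
    obtain ⟨z, hz, hzy⟩ := hx'
    rw [SetLike.mem_coe, mem_comap, ← E.bijective.1 hzy]
    exact hz

/-- The standing hypotheses on the base field and on the valued field `K`. -/
structure Setting (σ : L ≃+* L) (v : Valuation K ℝ≥0) (π : K) : Prop where
  preservesVal : PreservesVal σ
  trivialOn : TrivialOn L v
  discrete : HasDiscreteValues v
  log_neg : log (v π) < 0
  generator : ∀ x : K, x ≠ 0 → ∃ k : ℤ, log (v x) = k * log (v π)

variable {v : Valuation K ℝ≥0} {π : K}

theorem Setting.degree_of_subsingleton (S : Setting σ v π) (E : Isocrystal σ) [Subsingleton E]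
    {α : K ⊗[L] E → ℝ≥0} (hα : IsSplittableNorm v α) : E.degree v π α = 0 := by
  have h0 : finrank L E = 0 := finrank_zero_of_subsingleton
  have : IsEmpty (Fin (finrank L E)) := by rw [h0]; exact Fin.isEmpty'
  rw [degree_eq S.trivialOn S.discrete E hα, lv]
  obtain ⟨e, he⟩ := hα.exists_basis ((finBasis L E).baseChange K)
  rw [he.lvol_eq hα.isUNorm, S.preservesVal.dim_eq (finBasis L E)]
  simp [normalizedVal]

theorem Setting.degree_of_iso (S : Setting σ v π) {E E' : Isocrystal σ} (f : E →ₗ[L] E')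
    (hf : Bijective f) (hφ : ∀ x, f (E.frob x) = E'.frob (f x)) {α : K ⊗[L] E' → ℝ≥0}
    (hα : IsSplittableNorm v α) :
    E.degree v π (fun x => α (f.baseChange K x)) = E'.degree v π α := by
  let Q := E'.quot ⊤ E'.isSub_top
  let p : E' →ₗ[L] Q := Submodule.mkQ ⊤
  have hQ : Subsingleton Q := Submodule.Quotient.subsingleton_iff.2 rfl
  have hex : IsExact f p := by
    refine ⟨hf.1, mkQ_surjective _, fun y => ⟨fun _ => hf.2 y, fun _ => ?_⟩, hφ, fun x => rfl⟩
    exact Subsingleton.elim _ _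
  have hQK : Subsingleton (K ⊗[L] Q) := by
    refine ⟨fun x y => ?_⟩
    have h0 : ∀ z : K ⊗[L] Q, z = 0 := fun z => by
      induction z using TensorProduct.induction_on with
      | zero => rfl
      | tmul a x => rw [Subsingleton.elim x 0, tmul_zero]
      | add x y hx hy => rw [hx, hy, add_zero]
    rw [h0 x, h0 y]
  obtain ⟨h2, heq⟩ := hex.degree_eq (π := π) S.preservesVal S.trivialOn S.discrete hα
    (α₂ := fun _ => 0) (fun _ => zero_le) (fun z => ⟨0, Subsingleton.elim _ _, hα.isUNorm.map_zero⟩)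
  rw [heq, S.degree_of_subsingleton Q h2, add_zero]

variable (v π) in
open Classical in
/-- The degree of the subisocrystal on `W`, with the restricted norm. -/
def subDeg (D : Isocrystal σ) (α : K ⊗[L] D → ℝ≥0) (W : Submodule L D) : ℝ :=
  if h : D.IsSub W then (D.sub W h).degree v π (D.subNorm α W h) else 0

theorem IsSub.subDeg_eq {W : Submodule L D}
    (h : D.IsSub W) : D.subDeg v π α W = (D.sub W h).degree v π (D.subNorm α W h) := dif_pos h

/-- The inclusion of a subisocrystal. -/
def subIncl (D : Isocrystal σ) (Z : Submodule L D) (hZ : D.IsSub Z) : D.sub Z hZ →ₗ[L] D :=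
  Z.subtype

theorem subIncl_injective (D : Isocrystal σ) (Z : Submodule L D) (hZ : D.IsSub Z) :
    Injective (D.subIncl Z hZ) := Z.injective_subtype

theorem subNorm_apply (D : Isocrystal σ) (α : K ⊗[L] D → ℝ≥0) (Z : Submodule L D)
    (hZ : D.IsSub Z) (x : K ⊗[L] D.sub Z hZ) :
    D.subNorm α Z hZ x = α ((D.subIncl Z hZ).baseChange K x) := rfl

theorem isSplittableNorm_subNorm (hα : IsSplittableNorm v α) {W : Submodule L D} (h : D.IsSub W) :
    IsSplittableNorm v (D.subNorm α W h) :=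
  hα.comp (baseChange K W.subtype) (baseChange_injective W.injective_subtype)

theorem Setting.subDeg_bot (S : Setting σ v π) (D : Isocrystal σ) {α : K ⊗[L] D → ℝ≥0}
    (hα : IsSplittableNorm v α) : D.subDeg v π α ⊥ = 0 := by
  rw [D.isSub_bot.subDeg_eq]
  have : Subsingleton (D.sub ⊥ D.isSub_bot) := inferInstanceAs (Subsingleton (⊥ : Submodule L D))
  exact S.degree_of_subsingleton _ (isSplittableNorm_subNorm hα _)

theorem Setting.subDeg_top (S : Setting σ v π) (D : Isocrystal σ) {α : K ⊗[L] D → ℝ≥0}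
    (hα : IsSplittableNorm v α) : D.subDeg v π α ⊤ = D.degree v π α := by
  rw [D.isSub_top.subDeg_eq]
  let f : D.sub ⊤ D.isSub_top →ₗ[L] D := Submodule.subtype ⊤
  exact S.degree_of_iso f ⟨injective_subtype _, fun x => ⟨⟨x, trivial⟩, rfl⟩⟩ (fun x => rfl) hα

/-- The degree of a subobject of a subobject. -/
theorem Setting.subDeg_sub (S : Setting σ v π)
    (hα : IsSplittableNorm v α) {Z : Submodule L D} (hZ : D.IsSub Z)
    {X : Submodule L (D.sub Z hZ)} (hX : (D.sub Z hZ).IsSub X) :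
    (D.sub Z hZ).subDeg v π (D.subNorm α Z hZ) X = D.subDeg v π α (X.map (D.subIncl Z hZ)) := by
  have hqX : D.IsSub (X.map (D.subIncl Z hZ)) := hX.map fun _ => rfl
  rw [hX.subDeg_eq, hqX.subDeg_eq]
  let f : (D.sub Z hZ).sub X hX →ₗ[L] D.sub (X.map (D.subIncl Z hZ)) hqX :=
    (D.subIncl Z hZ).restrict fun x hx => Submodule.mem_map_of_mem hx
  have hf : Bijective f := by
    constructor
    · intro x y hxy
      exact Subtype.ext (D.subIncl_injective Z hZ
        (congrArg (fun z : X.map (D.subIncl Z hZ) => (z : D)) hxy))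
    · rintro ⟨_, x, hx, rfl⟩
      exact ⟨⟨x, hx⟩, rfl⟩
  rw [← S.degree_of_iso f hf (fun _ => rfl) (isSplittableNorm_subNorm hα hqX)]
  congr 1
  funext x
  rw [subNorm_apply, subNorm_apply, subNorm_apply]
  exact congrArg α (baseChange_square (fun _ => by rfl) x)

section Quotient

variable {D E : Isocrystal σ} {p : D →ₗ[L] E} {α : K ⊗[L] D → ℝ≥0} {γ : K ⊗[L] E → ℝ≥0}
variable {X : Submodule L D}

theorem IsSub.ker (hp : ∀ x, p (D.frob x) = E.frob (p x)) : D.IsSub (ker p) :=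
  IsSub.comap hp E.isSub_bot

/-- The inclusion between two subisocrystals. -/
def inclSub {X Y : Submodule L D} (hX : D.IsSub X) (hY : D.IsSub Y) (h : X ≤ Y) :
    D.sub X hX →ₗ[L] D.sub Y hY := Submodule.inclusion h

/-- The map induced by `p` from a subisocrystal onto its image. -/
def mapSub (p : D →ₗ[L] E) {X : Submodule L D} (hX : D.IsSub X) (hXp : E.IsSub (X.map p)) :
    D.sub X hX →ₗ[L] E.sub (X.map p) hXp :=
  p.restrict (p := X) (q := X.map p) fun _ hx => Submodule.mem_map_of_mem hx

theorem isExact_restrict (hp : ∀ x, p (D.frob x) = E.frob (p x)) (hX : D.IsSub X) :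
    IsExact (inclSub (hX.inf (IsSub.ker hp)) hX inf_le_left) (mapSub p hX (hX.map hp)) := by
  refine ⟨Submodule.inclusion_injective _, ?_, ?_, fun _ => rfl, fun x => Subtype.ext (hp _)⟩
  · rintro ⟨_, x, hx, rfl⟩
    exact ⟨⟨x, hx⟩, rfl⟩
  · rintro ⟨x, hx⟩
    constructor
    · intro h
      exact ⟨⟨x, hx, congrArg (fun z : X.map p => (z : E)) h⟩, rfl⟩
    · rintro ⟨⟨y, hy1, hy2⟩, hyx⟩
      apply Subtype.ext
      have : y = x := congrArg (fun z : X => (z : D)) hyx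
      subst this
      exact hy2

theorem Setting.subDeg_le_add (S : Setting σ v π) (hp : ∀ x, p (D.frob x) = E.frob (p x))
    (hα : IsSplittableNorm v α) (hγ : IsSplittableNorm v γ)
    (hle : ∀ x, γ (p.baseChange K x) ≤ α x) (hX : D.IsSub X) :
    D.subDeg v π α X ≤ D.subDeg v π α (X ⊓ ker p) + E.subDeg v π γ (X.map p) := by
  have hXp := hX.map hp
  have hXk := hX.inf (IsSub.ker hp)
  rw [hX.subDeg_eq, hXp.subDeg_eq, hXk.subDeg_eq]
  refine ((isExact_restrict hp hX).degree_le (v := v) (π := π) S.preservesVal S.trivialOn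
    S.discrete S.log_neg (isSplittableNorm_subNorm hα hX) (isSplittableNorm_subNorm hγ hXp)
    fun x => ?_).trans (le_of_eq ?_)
  · rw [subNorm_apply, subNorm_apply,
      baseChange_square (g' := p) (f' := D.subIncl X hX) (fun _ => by rfl) x]
    exact hle _
  · congr 2
    funext x
    exact congrArg α (baseChange_tri (fun _ => rfl) x)

theorem Setting.subDeg_eq_add (S : Setting σ v π) (hp : ∀ x, p (D.frob x) = E.frob (p x))
    (hsurj : Surjective p) (hα : IsSplittableNorm v α)
    (hle : ∀ x, γ (p.baseChange K x) ≤ α x) (hat : ∀ z, ∃ x, p.baseChange K x = z ∧ α x = γ z)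
    (hX : D.IsSub X) (hker : ker p ≤ X) :
    D.subDeg v π α X = D.subDeg v π α (ker p) + E.subDeg v π γ (X.map p) := by
  have hXp := hX.map hp
  have hXk := hX.inf (IsSub.ker hp)
  have hk : D.IsSub (ker p) := IsSub.ker hp
  rw [hX.subDeg_eq, hXp.subDeg_eq]
  have hker' : X ⊓ ker p = ker p := inf_eq_right.2 hker
  rw [← hker', hXk.subDeg_eq]
  let r := mapSub p hX hXp
  let j := D.subIncl X hX
  let k := inclSub hk hX hker
  have hcomp : ∀ x, (E.subIncl _ hXp).baseChange K (r.baseChange K x) =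
      p.baseChange K (j.baseChange K x) := fun x => baseChange_square (fun _ => by rfl) x
  have hexK : Exact (baseChange K (D.subIncl _ hk)) (baseChange K p) :=
    lTensor_exact K (exact_subtype_ker_map p) hsurj
  refine ((isExact_restrict hp hX).degree_eq (v := v) (π := π) S.preservesVal S.trivialOn
    S.discrete (α₂ := E.subNorm γ _ hXp) (isSplittableNorm_subNorm hα hX) (fun x => ?_)
    (fun z => ?_)).2.trans ?_
  · rw [subNorm_apply, subNorm_apply, hcomp]
    exact hle _
  · obtain ⟨y, hy, hyz⟩ := hat ((E.subIncl _ hXp).baseChange K z)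
    have hrs : Surjective (baseChange K r) :=
      LinearMap.lTensor_surjective K (isExact_restrict hp hX).surjective
    obtain ⟨x', hx'⟩ := hrs z
    have h0 : baseChange K p (y - baseChange K j x') = 0 := by
      rw [map_sub, hy, ← hcomp, hx', sub_self]
    obtain ⟨w, hw⟩ := (hexK _).1 h0
    have hyx : y = baseChange K j (x' + baseChange K k w) := by
      rw [map_add, ← sub_eq_iff_eq_add', ← hw]
      exact (baseChange_tri (fun _ => rfl) w).symm
    refine ⟨x' + baseChange K k w, ?_, ?_⟩
    · apply baseChange_injective (K := K) (E.subIncl_injective _ hXp)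
      refine (hcomp _).trans ?_
      rw [← hyx, hy]
    · rw [subNorm_apply, subNorm_apply, ← hyz, hyx]
  · congr 2
    funext x
    exact congrArg α (baseChange_tri (fun _ => rfl) x)

theorem quotNorm_attained {Y : Submodule L D} (hY : D.IsSub Y) (hα : IsSplittableNorm v α) :
    IsSplittableNorm v (D.quotNorm α Y hY) ∧
    (∀ x, D.quotNorm α Y hY (baseChange K (Y.mkQ : D →ₗ[L] D.quot Y hY) x) ≤ α x) ∧
    ∀ z, ∃ x, baseChange K (Y.mkQ : D →ₗ[L] D.quot Y hY) x = z ∧ α x = D.quotNorm α Y hY z := by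
  have hex : Exact Y.subtype Y.mkQ := exact_subtype_mkQ Y
  obtain ⟨h1, h2⟩ := quotient_norm_attained (v := v) Y.injective_subtype (mkQ_surjective Y)
    hex hα (α₂ := D.quotNorm α Y hY) fun z => rfl
  obtain ⟨b, hb⟩ := exists_isExactBasis Y.injective_subtype (mkQ_surjective Y) hex
    (finBasis L Y) (finBasis L (D ⧸ Y))
  exact ⟨(hb.baseChange.lvol_eq hα h1 h2).1, h1, h2⟩

/-- The degree is supermodular. -/
theorem Setting.subDeg_supermodular (S : Setting σ v π) (hα : IsSplittableNorm v α)
    {X Y : Submodule L D} (hX : D.IsSub X) (hY : D.IsSub Y) :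
    D.subDeg v π α X + D.subDeg v π α Y ≤ D.subDeg v π α (X ⊔ Y) + D.subDeg v π α (X ⊓ Y) := by
  obtain ⟨h1, h2, h3⟩ := quotNorm_attained hY hα
  let p : D →ₗ[L] D.quot Y hY := Y.mkQ
  have hk : ker p = Y := ker_mkQ Y
  have hm : (X ⊔ Y).map p = X.map p := by
    have hY0 : Y.map p = ⊥ := LinearMap.le_ker_iff_map.1 hk.ge
    rw [Submodule.map_sup, hY0, sup_bot_eq]
  have e1 := S.subDeg_le_add (p := p) (fun _ => rfl) hα h1 h2 hX
  have e2 := S.subDeg_eq_add (p := p) (fun _ => rfl) (mkQ_surjective Y) hα h2 h3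
    (hX.sup hY) (by rw [hk]; exact le_sup_right)
  rw [hm] at e2
  rw [hk] at e1 e2
  linarith

end Quotient

end SubDegree

end Isocrystal

/-! ### Real filtrations of a vector space and their labels -/

section Filtrations

variable {L V : Type*} [Field L] [AddCommGroup V] [Module L V]
variable {f : ℝ → Submodule L V} {ι : Type*} {y : Basis ι L V} {s : ι → ℝ} {b : Basis ι L V}

/-- A decreasing, exhaustive, separated and left continuous filtration by subspaces. -/
structure IsRealFiltration (f : ℝ → Submodule L V) : Prop where
  antitone : Antitone f
  exhaustive : ⨆ s, f s = ⊤
  separated : ⨅ s, f s = ⊥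
  leftContinuous : ∀ s, f s = ⨅ t : Iio s, f t

/-- The basis `y`, where `y i` carries the label `s i`, splits the filtration `f`: every `f t` is
spanned by the vectors `y i` with `t ≤ s i`. -/
def IsLabelling {ι : Type*} (f : ℝ → Submodule L V) (y : Basis ι L V) (s : ι → ℝ) : Prop :=
  ∀ t x, x ∈ f t ↔ ∀ i, y.repr x i ≠ 0 → t ≤ s i

/-- The subspace spanned by the basis vectors `b i`, `i ∈ S`. -/
def coordSub {ι : Type*} (b : Basis ι L V) (S : Set ι) : Submodule L V where
  carrier := {x | ∀ i, b.repr x i ≠ 0 → i ∈ S}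
  add_mem' {x y} hx hy i hi := by
    by_cases h : b.repr x i = 0
    · refine hy i fun h' => hi ?_
      rw [map_add, Finsupp.add_apply, h, h', add_zero]
    · exact hx i h
  zero_mem' i hi := by simp at hi
  smul_mem' c x hx i hi := hx i fun h => hi (by rw [map_smul, Finsupp.smul_apply, h, smul_zero])

theorem mem_coordSub {S : Set ι} {x : V} : x ∈ coordSub b S ↔ ∀ i, b.repr x i ≠ 0 → i ∈ S := Iff.rfl

theorem basis_mem_coordSub {S : Set ι} {i : ι} : b i ∈ coordSub b S ↔ i ∈ S := by
  classical
  refine ⟨fun h => h i (by simp), fun h j hj => ?_⟩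
  rw [b.repr_self, single_apply] at hj
  exact (ite_ne_right_iff.1 hj).1 ▸ h

theorem coordSub_mono (b : Basis ι L V) {S T : Set ι} (h : S ⊆ T) :
    coordSub b S ≤ coordSub b T := fun _ hx i hi => h (hx i hi)

theorem coordSub_univ (b : Basis ι L V) : coordSub b Set.univ = ⊤ :=
  eq_top_iff.2 fun _ _ _ _ => trivial

theorem coordSub_empty (b : Basis ι L V) : coordSub b ∅ = ⊥ := by
  refine eq_bot_iff.2 fun x hx => ?_
  rw [mem_bot, ← b.repr.map_eq_zero_iff]
  ext i
  exact by_contra (hx i)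

theorem coordSub_le [Finite ι] {S : Set ι}
    {W : Submodule L V} (h : ∀ i ∈ S, b i ∈ W) : coordSub b S ≤ W := by
  cases nonempty_fintype ι
  intro x hx
  rw [← b.sum_repr x]
  refine W.sum_mem fun i _ => ?_
  by_cases h0 : b.repr x i = 0
  · simp [h0]
  · exact W.smul_mem _ (h i (hx i h0))

theorem IsLabelling.eq_coordSub (h : IsLabelling f y s) (t : ℝ) : f t = coordSub y {i | t ≤ s i} :=
  Submodule.ext fun x => h t x

theorem IsLabelling.mem_basis (h : IsLabelling f y s) {t : ℝ} {i : ι} : y i ∈ f t ↔ t ≤ s i := by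
  rw [h.eq_coordSub t, basis_mem_coordSub]
  rfl

theorem IsLabelling.isRealFiltration [Finite ι] (h : IsLabelling f y s) : IsRealFiltration f := by
  cases nonempty_fintype ι
  have hanti : Antitone f := fun t u htu x hx => (h t x).2 fun i hi => htu.trans ((h u x).1 hx i hi)
  refine ⟨hanti, ?_, ?_, fun t => ?_⟩
  · rw [eq_top_iff, ← coordSub_univ y]
    exact coordSub_le fun i _ => le_iSup f (s i) (h.mem_basis.2 le_rfl)
  · rw [eq_bot_iff]
    intro x hx
    rw [mem_bot, ← y.repr.map_eq_zero_iff]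
    ext i
    by_contra hi
    have := (h _ x).1 ((mem_iInf _).1 hx (s i + 1)) i hi
    linarith
  · refine le_antisymm (le_iInf fun u => hanti (le_of_lt u.2)) fun x hx => (h t x).2 fun i hi => ?_
    refine le_of_forall_lt fun u hu => ?_
    obtain ⟨w, hw1, hw2⟩ := exists_between hu
    exact hw1.trans_le ((h _ x).1 ((mem_iInf _).1 hx ⟨w, hw2⟩) i hi)

theorem IsLabelling.mem_iSup_Ioi [Finite ι] (h : IsLabelling f y s) (t : ℝ) :
    ⨆ u : Ioi t, f u = coordSub y {i | t < s i} := by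
  apply le_antisymm
  · exact iSup_le fun u x hx i hi => lt_of_lt_of_le u.2 ((h u x).1 hx i hi)
  · exact coordSub_le fun i hi => le_iSup (fun u : Ioi t => f u) ⟨s i, hi⟩ (h.mem_basis.2 le_rfl)

/-- Every real filtration of a finite dimensional space is split by a basis: the labels are the
values of an ultrametric norm for the trivial absolute value. -/
theorem IsRealFiltration.exists_labelling [FiniteDimensional L V]
    (hf : IsRealFiltration f) : ∃ (y : Basis (Fin (finrank L V)) L V) (s : Fin (finrank L V) → ℝ),
      IsLabelling f y s := by
  classical
  have hex : ∀ x, x ≠ 0 → ∃ T, ∀ t, x ∈ f t ↔ t ≤ T := by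
    intro x hx
    have hne : ({t | x ∈ f t} : Set ℝ).Nonempty := by
      have hx' : x ∈ ⨆ s, f s := by rw [hf.exhaustive]; trivial
      exact (mem_iSup_of_directed f hf.antitone.directed_le).1 hx'
    have hbdd : BddAbove {t | x ∈ f t} := by
      by_contra hb
      apply hx
      rw [← mem_bot L, ← hf.separated, mem_iInf]
      intro t
      rw [not_bddAbove_iff] at hb
      obtain ⟨u, hu, htu⟩ := hb t
      exact hf.antitone htu.le hu
    refine ⟨sSup {t | x ∈ f t}, fun t => ⟨fun ht => le_csSup hbdd ht, fun ht => ?_⟩⟩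
    refine hf.antitone ht ?_
    rw [hf.leftContinuous, mem_iInf]
    rintro ⟨u, hu⟩
    obtain ⟨w, hw, huw⟩ := exists_lt_of_lt_csSup hne hu
    exact hf.antitone huw.le hw
  choose! T hT using hex
  let N : V → ℝ≥0 := fun x => if x = 0 then 0 else toNNReal (exp (-T x))
  have hmem : ∀ t x, x ∈ f t ↔ N x ≤ toNNReal (exp (-t)) := by
    intro t x
    by_cases hx : x = 0
    · simp [N, hx]
    · simp only [N, hx, if_false]
      rw [hT x hx, Real.toNNReal_le_toNNReal_iff (exp_pos _).le, Real.exp_le_exp, neg_le_neg_iff]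
  have hNmem : ∀ {x y : V}, y ≠ 0 → (x ∈ f (T y) ↔ N x ≤ N y) := fun {x y} hy => by
    rw [hmem]
    simp only [N, hy, if_false]
  have hN : IsUNorm (trivVal L) N := by
    refine ⟨fun x => ?_, fun c x => ?_, fun x y => ?_⟩
    · by_cases hx : x = 0
      · simp [N, hx]
      · simp [N, hx, exp_pos]
    · by_cases hc : c = 0
      · simp [hc, N]
      by_cases hx : x = 0
      · simp [hx, N]
      have hcx : c • x ≠ 0 := smul_ne_zero hc hx
      have : T (c • x) = T x := by
        refine eq_of_forall_le_iff fun t => ?_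
        rw [← hT _ hcx, ← hT _ hx]
        exact Submodule.smul_mem_iff _ hc
      simp [N, hcx, hx, this, trivVal_apply, hc]
    · have key : ∀ {x y}, N x ≤ N y → N (x + y) ≤ N y := fun {x y} h => by
        by_cases hy : y = 0
        · have hx : x = 0 := by
            by_contra hx
            simp [N, hy, hx, (exp_pos _).not_ge] at h
          simp [hx, hy]
        · exact (hNmem hy).1 (add_mem ((hNmem hy).2 h) ((hNmem hy).2 le_rfl))
      rcases le_total (N x) (N y) with h | h
      · exact (key h).trans (le_max_right _ _)
      · rw [add_comm]
        exact (key h).trans (le_max_left _ _)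
  -- The dimension of the ball of radius `r` determines `r` among the values of `N`.
  have hfin : (Set.range N).Finite := by
    have hanti : StrictAntiOn (fun r : ℝ => finrank L (f r)) (T '' {x | x ≠ 0}) := by
      rintro _ ⟨x, hx, rfl⟩ _ ⟨y, -, rfl⟩ hxy
      refine finrank_lt_finrank_of_lt (lt_of_le_of_ne (hf.antitone hxy.le) fun h => ?_)
      exact hxy.not_ge ((hT x hx _).1 (h ▸ (hT x hx _).2 le_rfl))
    have hfT : (T '' {x | x ≠ 0}).Finite :=
      .of_injOn (t := Set.Iic (finrank L V)) (fun _ _ => finrank_le _) hanti.injOn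
        (Set.finite_Iic _)
    refine ((hfT.image fun r => toNNReal (exp (-r))).union (Set.finite_singleton 0)).subset ?_
    rintro _ ⟨x, rfl⟩
    by_cases hx : x = 0
    · right; simp [N, hx]
    · left; exact ⟨T x, ⟨x, hx, rfl⟩, by simp only [N, hx, if_false]⟩
  obtain ⟨y, hy⟩ := (hN.isSplittableNorm_of_trivVal hfin).splittable
  refine ⟨y, fun i => T (y i), fun t x => ?_⟩
  rw [hmem, hy x, Finset.sup_le_iff]
  have hi : ∀ i, y.repr x i ≠ 0 → (trivVal L (y.repr x i) * N (y i) ≤ toNNReal (exp (-t)) ↔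
      t ≤ T (y i)) := fun i hi => by
    rw [trivVal_apply hi, one_mul, ← hmem, hT _ (y.ne_zero i)]
  refine ⟨fun h i h0 => (hi i h0).1 (h i (mem_univ _)), fun h i _ => ?_⟩
  by_cases h0 : y.repr x i = 0
  · simp [h0]
  · exact (hi i h0).2 (h i h0)

theorem exists_antitone_enum {κ : Type*} [Finite κ] (a : κ → ℝ) :
    ∃ (M : ℕ) (e : Fin M ≃ κ), Antitone (a ∘ e) := by
  cases nonempty_fintype κ
  let e0 := (Fintype.equivFin κ).symm
  refine ⟨_, (Tuple.sort fun i => -a (e0 i)).trans e0, fun i j hij => ?_⟩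
  have := Tuple.monotone_sort (fun i => -a (e0 i)) hij
  simp only [Function.comp_apply] at this
  simpa using this

theorem exists_cut {M : ℕ} {a : Fin M → ℝ} (ha : Antitone a) (s : ℝ) :
    ∃ m ≤ M, ∀ k : Fin M, (k : ℕ) < m ↔ s ≤ a k := by
  classical
  have hM : ∃ m : ℕ, ∀ k : Fin M, s ≤ a k → (k : ℕ) < m := ⟨M, fun k _ => k.2⟩
  refine ⟨_, Nat.find_min' hM fun k _ => k.2, fun k => ⟨fun hk => ?_, Nat.find_spec hM k⟩⟩
  obtain ⟨j, hj⟩ := not_forall.1 (Nat.find_min hM hk)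
  rw [Classical.not_imp, not_lt] at hj
  exact hj.1.trans (ha hj.2)

end Filtrations

/-! ### Abstract Harder–Narasimhan theory -/

section Abstract

variable {L V : Type*} [Field L] [AddCommGroup V] [Module L V] [FiniteDimensional L V]
variable {f : ℝ → Submodule L V}

/-- A degree function `d` on a lattice of subspaces (those satisfying `P`) which is supermodular
and vanishes on the zero subspace. -/
structure IsDegree (P : Submodule L V → Prop) (d : Submodule L V → ℝ) : Prop where
  bot : P ⊥
  top : P ⊤
  sup : ∀ {X Y}, P X → P Y → P (X ⊔ Y)
  inf : ∀ {X Y}, P X → P Y → P (X ⊓ Y)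
  map_bot : d ⊥ = 0
  supermodular : ∀ {X Y}, P X → P Y → d X + d Y ≤ d (X ⊔ Y) + d (X ⊓ Y)

/-- The degree twisted by the slope `s`. -/
def twist (d : Submodule L V → ℝ) (s : ℝ) (X : Submodule L V) : ℝ := d X - s * finrank L X

/-- `Z` is the largest maximizer of the degree twisted by `s`. -/
def IsMaximizer (P : Submodule L V → Prop) (d : Submodule L V → ℝ) (s : ℝ)
    (Z : Submodule L V) : Prop :=
  P Z ∧ ∀ X, P X → twist d s X ≤ twist d s Z ∧ (twist d s X = twist d s Z → X ≤ Z)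

variable {P : Submodule L V → Prop} {d : Submodule L V → ℝ}

theorem IsMaximizer.unique {s : ℝ} {Z Z' : Submodule L V} (h : IsMaximizer P d s Z)
    (h' : IsMaximizer P d s Z') : Z = Z' :=
  le_antisymm ((h'.2 Z h.1).2 (le_antisymm (h'.2 Z h.1).1 (h.2 Z' h'.1).1))
    ((h.2 Z' h'.1).2 (le_antisymm (h.2 Z' h'.1).1 (h'.2 Z h.1).1))

theorem rank_modular (X Y : Submodule L V) : (finrank L X : ℝ) + finrank L Y =
      finrank L (X ⊔ Y : Submodule L V) + finrank L (X ⊓ Y : Submodule L V) := by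
  exact_mod_cast (Submodule.finrank_sup_add_finrank_inf_eq X Y).symm

theorem rank_mono {X Y : Submodule L V} (h : X ≤ Y) : (finrank L X : ℝ) ≤ finrank L Y := by
  exact_mod_cast Submodule.finrank_mono h

theorem IsDegree.twist_supermodular (h : IsDegree P d) (s : ℝ) {X Y : Submodule L V} (hX : P X)
    (hY : P Y) : twist d s X + twist d s Y ≤ twist d s (X ⊔ Y) + twist d s (X ⊓ Y) := by
  have h1 := h.supermodular hX hY
  have h2 := rank_modular X Y
  unfold twist
  linear_combination h1 - s * h2

theorem IsDegree.exists_isMaximizer (h : IsDegree P d) (s : ℝ)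
    (hmax : ∃ Z, P Z ∧ ∀ X, P X → twist d s X ≤ twist d s Z) : ∃ Z, IsMaximizer P d s Z := by
  obtain ⟨Z₀, hZ₀, hmax⟩ := hmax
  let A : Set ℕ := {k | ∃ Z, P Z ∧ twist d s Z = twist d s Z₀ ∧ finrank L Z = k}
  have hA : A.Finite := (Set.finite_Iic (finrank L V)).subset (by
    rintro _ ⟨Z, -, -, rfl⟩
    exact finrank_le _)
  obtain ⟨k, ⟨Z, hZ, hZ0, rfl⟩, hk⟩ := exists_max_image A id hA ⟨_, Z₀, hZ₀, rfl, rfl⟩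
  refine ⟨Z, hZ, fun X hX => ⟨by rw [hZ0]; exact hmax X hX, fun hXZ => ?_⟩⟩
  have h1 := h.twist_supermodular s hX hZ
  have h2 := hmax _ (h.inf hX hZ)
  have h3 := hmax _ (h.sup hX hZ)
  have h4 := hk _ ⟨X ⊔ Z, h.sup hX hZ, by linarith, rfl⟩
  have h5 := eq_of_le_of_finrank_le (le_sup_right : Z ≤ X ⊔ Z) h4
  exact le_of_le_of_eq le_sup_left h5.symm

section OfMaximizer

variable {f : ℝ → Submodule L V}

theorem IsDegree.antitone_of_isMaximizer (h : IsDegree P d) (hf : ∀ s, IsMaximizer P d s (f s)) :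
    Antitone f := by
  intro s t hst
  have hF := (hf s).1
  have hG := (hf t).1
  have h1 := h.twist_supermodular s hF hG
  have h2 := ((hf t).2 _ (h.inf hF hG)).1
  have h3 : (finrank L (f s ⊓ f t : Submodule L V) : ℝ) ≤ finrank L (f t) := rank_mono inf_le_right
  have h5 := ((hf s).2 _ (h.sup hF hG)).1
  have h4 : twist d s (f s ⊔ f t) = twist d s (f s) := by
    unfold twist at *
    nlinarith
  exact le_sup_right.trans (((hf s).2 _ (h.sup hF hG)).2 h4)

/-- An antitone family of subspaces is constant just to the left of each point. -/
theorem eventually_eq_iInf_left (hf : Antitone f) (s : ℝ) :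
    ∀ᶠ t in nhdsWithin s (Iio s), f t = ⨅ u : Iio s, f u := by
  obtain ⟨t₀, -, ht⟩ := exists_minimalFor_of_wellFoundedLT (fun _ : Iio s => True)
    (fun u => f u) ⟨⟨s - 1, by simp⟩, trivial⟩
  filter_upwards [Ioo_mem_nhdsLT t₀.2] with t h
  exact le_antisymm (le_iInf fun u => (hf h.1.le).trans ((le_total (t₀ : ℝ) u).elim
    (fun h => ht trivial (hf h)) fun h => hf h)) (iInf_le (fun u : Iio s => f u) ⟨t, h.2⟩)

/-- An antitone family of subspaces is constant just to the right of each point. -/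
theorem eventually_eq_iSup_right (hf : Antitone f) (s : ℝ) :
    ∀ᶠ t in nhdsWithin s (Ioi s), f t = ⨆ u : Ioi s, f u := by
  obtain ⟨t₀, -, ht⟩ := exists_maximalFor_of_wellFoundedGT (fun _ : Ioi s => True)
    (fun u => f u) ⟨⟨s + 1, by simp⟩, trivial⟩
  filter_upwards [Ioo_mem_nhdsGT t₀.2] with t h
  exact le_antisymm (le_iSup (fun u : Ioi s => f u) ⟨t, h.1⟩) (iSup_le fun u =>
    ((le_total (u : ℝ) t₀).elim (fun h => ht trivial (hf h)) fun h => hf h).trans (hf h.2.le))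

theorem twist_le_of_eventually {l : Filter ℝ} [l.NeBot] {s : ℝ} (hl : l ≤ nhds s)
    {X Y : Submodule L V} (h : ∀ᶠ t in l, twist d t X ≤ twist d t Y) : twist d s X ≤ twist d s Y :=
  have hc : ∀ X, Filter.Tendsto (fun t => twist d t X) l (nhds (twist d s X)) := fun X =>
    (Continuous.tendsto (by unfold twist; fun_prop) s).mono_left hl
  le_of_tendsto_of_tendsto (hc X) (hc Y) h

theorem IsDegree.isRealFiltration (h : IsDegree P d) (hf : ∀ s, IsMaximizer P d s (f s)) :
    IsRealFiltration f := by
  have hanti := h.antitone_of_isMaximizer hf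
  have hbd : ∀ X, P X → d X ≤ d (f 0) := fun X hX => by
    have := ((hf 0).2 X hX).1
    simpa [twist] using this
  refine ⟨hanti, ?_, ?_, fun s => ?_⟩
  · let s : ℝ := min (-1) (d ⊤ - d (f 0) - 1)
    have hs1 : s ≤ -1 := min_le_left _ _
    have hs2 : s ≤ d ⊤ - d (f 0) - 1 := min_le_right _ _
    have : f s = ⊤ := by
      by_contra hne
      have h1 := ((hf s).2 ⊤ h.top).1
      have h2 := hbd _ (hf s).1
      have h3 : (finrank L (f s) : ℝ) + 1 ≤ finrank L (⊤ : Submodule L V) := by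
        exact_mod_cast finrank_lt_finrank_of_lt (lt_top_iff_ne_top.2 hne)
      unfold twist at h1
      nlinarith
    exact eq_top_iff.2 (this ▸ le_iSup f s)
  · let s : ℝ := max 1 (d (f 0) + 1)
    have hs1 : 1 ≤ s := le_max_left _ _
    have hs2 : d (f 0) + 1 ≤ s := le_max_right _ _
    have : f s = ⊥ := by
      by_contra hne
      have h1 := ((hf s).2 ⊥ h.bot).1
      have h2 := hbd _ (hf s).1
      have h3 : (1 : ℝ) ≤ finrank L (f s) := by
        exact_mod_cast Nat.one_le_iff_ne_zero.2 fun h0 => hne (Submodule.finrank_eq_zero.1 h0)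
      unfold twist at h1
      rw [h.map_bot, finrank_bot] at h1
      push_cast at h1
      nlinarith
    exact eq_bot_iff.2 (this ▸ iInf_le f s)
  · refine le_antisymm (le_iInf fun t => hanti (le_of_lt t.2)) ?_
    have hc := eventually_eq_iInf_left hanti s
    obtain ⟨t₀, hc₀⟩ := hc.exists
    rw [← hc₀]
    refine ((hf s).2 _ (hf t₀).1).2 (le_antisymm ((hf s).2 _ (hf t₀).1).1 ?_)
    refine twist_le_of_eventually nhdsWithin_le_nhds (hc.mono fun t ht => ?_)
    rw [hc₀, ← ht]
    exact ((hf t).2 _ (hf s).1).1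

/-- The subquotients `f s / f s⁺` of the filtration by maximizers are semistable of slope `s`. -/
theorem IsDegree.twist_right (h : IsDegree P d) (hf : ∀ s, IsMaximizer P d s (f s)) (s : ℝ) :
    P (⨆ u : Ioi s, f u) ∧ twist d s (f s) = twist d s (⨆ u : Ioi s, f u) := by
  have hc := eventually_eq_iSup_right (h.antitone_of_isMaximizer hf) s
  obtain ⟨t₀, hc₀⟩ := hc.exists
  rw [← hc₀]
  refine ⟨(hf t₀).1, le_antisymm ?_ ((hf s).2 _ (hf t₀).1).1⟩
  refine twist_le_of_eventually nhdsWithin_le_nhds (hc.mono fun t ht => ?_)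
  rw [hc₀, ← ht]
  exact ((hf t).2 _ (hf s).1).1

end OfMaximizer

section Chain

variable {M : ℕ} {Z : ℕ → Submodule L V} {a : Fin M → ℝ}

theorem sum_fin_sub (g : ℕ → ℝ) (M : ℕ) : ∑ k : Fin M, (g (k + 1) - g k) = g M - g 0 := by
  rw [Fin.sum_univ_eq_sum_range (fun k => g (k + 1) - g k), Finset.sum_range_sub]

theorem IsDegree.le_step (h : IsDegree P d) {X A B : Submodule L V} (hX : P X) (hA : P A) (hB : P B)
    (hAB : A ≤ B) {c : ℝ} (hs : ∀ Y, P Y → A ≤ Y → Y ≤ B →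
      d Y - d A ≤ c * (finrank L Y - finrank L A)) : d (X ⊓ B) - d (X ⊓ A) ≤
      c * (finrank L (X ⊓ B : Submodule L V) - finrank L (X ⊓ A : Submodule L V)) := by
  have hX1 := h.inf hX hB
  have hinf : X ⊓ B ⊓ A = X ⊓ A := by rw [inf_assoc, inf_eq_right.2 hAB]
  have h1 := h.supermodular hX1 hA
  have h2 := hs _ (h.sup hX1 hA) le_sup_right (sup_le inf_le_right hAB)
  have h3 := rank_modular (X ⊓ B) A
  rw [hinf] at h1 h3
  linear_combination h1 + h2 - c * h3

/-- The degree of `X` is bounded through the steps of a chain with bounded slopes. -/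
theorem IsDegree.le_chain (h : IsDegree P d) (hZ0 : Z 0 = ⊥) (hZM : Z M = ⊤) (hmono : Monotone Z)
    (hP : ∀ k, P (Z k)) (hslope : ∀ k : Fin M, ∀ X, P X → Z k ≤ X → X ≤ Z (k + 1) →
      d X - d (Z k) ≤ a k * (finrank L X - finrank L (Z k))) {X : Submodule L V} (hX : P X) :
    d X ≤ ∑ k : Fin M, a k * (finrank L (X ⊓ Z (k + 1) : Submodule L V) -
      finrank L (X ⊓ Z k : Submodule L V)) := by
  have := sum_le_sum fun (k : Fin M) (_ : k ∈ univ) =>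
    h.le_step hX (hP k) (hP (k + 1)) (hmono (le_succ k)) (hslope k)
  rw [sum_fin_sub (fun k => d (X ⊓ Z k)), hZ0, hZM, inf_top_eq, inf_bot_eq, h.map_bot,
    sub_zero] at this
  exact this

/-- The steps of a chain whose subquotients are semistable with decreasing slopes are the
maximizers. -/
theorem IsDegree.isMaximizer_chain (h : IsDegree P d) (hZ0 : Z 0 = ⊥) (hZM : Z M = ⊤)
    (hmono : Monotone Z) (hP : ∀ k, P (Z k))
    (hslope : ∀ k : Fin M, ∀ X, P X → Z k ≤ X → X ≤ Z (k + 1) →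
      d X - d (Z k) ≤ a k * (finrank L X - finrank L (Z k)))
    (heq : ∀ k : Fin M, d (Z (k + 1)) - d (Z k) = a k * (finrank L (Z (k + 1)) - finrank L (Z k)))
    {s : ℝ} {m : ℕ} (hmM : m ≤ M) (h1 : ∀ k : Fin M, (k : ℕ) < m → s ≤ a k)
    (h2 : ∀ k : Fin M, m ≤ k → a k < s) : IsMaximizer P d s (Z m) := by
  have up : ∀ X, P X → ∀ k ≤ m, twist d s X ≤ twist d s (X ⊔ Z k) := by
    intro X hX k
    induction k with
    | zero => exact fun _ => (by rw [hZ0, sup_bot_eq])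
    | succ k ih =>
      intro hk
      refine (ih (by omega)).trans ?_
      let i : Fin M := ⟨k, by omega⟩
      have hXk := h.sup hX (hP k)
      have e := h.supermodular hXk (hP (k + 1))
      have e1 := rank_modular (X ⊔ Z k) (Z (k + 1))
      have e2 := hslope i _ (h.inf hXk (hP (k + 1))) (le_inf le_sup_right (hmono (le_succ k)))
        inf_le_right
      have e3 := heq i
      have e4 : (0 : ℝ) ≤ _ := mul_nonneg (sub_nonneg.2 (h1 i hk)) (sub_nonneg.2
        (rank_mono (le_sup_left : X ⊔ Z k ≤ X ⊔ Z k ⊔ Z (k + 1))))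
      rw [sup_assoc, sup_eq_right.2 (hmono (le_succ k))] at e e1 e4
      unfold twist
      linear_combination e + e2 - e3 + e4 - a i * e1
  have down : ∀ Y, P Y → Z m ≤ Y → ∀ j, m ≤ j → j ≤ M → twist d s (Y ⊓ Z j) ≤ twist d s (Z m) ∧
      (twist d s (Y ⊓ Z j) = twist d s (Z m) → Y ⊓ Z j = Z m) := by
    intro Y hY hm j hj
    induction j, hj using Nat.le_induction with
    | base => simp [inf_eq_right.2 hm]
    | succ j hj ih =>
      intro hjM
      obtain ⟨i1, i2⟩ := ih (by omega)
      let i : Fin M := ⟨j, hjM⟩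
      have e := h.le_step hY (hP j) (hP (j + 1)) (hmono (le_succ j)) (hslope i)
      have hle : Y ⊓ Z j ≤ Y ⊓ Z (j + 1) := inf_le_inf_left _ (hmono (le_succ j))
      have e1 := rank_mono hle
      have e2 := h2 i hj
      unfold twist at i1 i2 ⊢
      refine ⟨by nlinarith, fun h' => ?_⟩
      rw [← i2 (by nlinarith)]
      refine (Submodule.eq_of_le_of_finrank_le hle ?_).symm
      have : (finrank L (Y ⊓ Z (j + 1) : Submodule L V) : ℝ) ≤
        finrank L (Y ⊓ Z j : Submodule L V) := by nlinarith
      exact_mod_cast this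
  refine ⟨hP m, fun X hX => ?_⟩
  have h3 := up X hX m le_rfl
  obtain ⟨h4, h5⟩ := down _ (h.sup hX (hP m)) le_sup_right M hmM le_rfl
  rw [hZM, inf_top_eq] at h4 h5
  exact ⟨h3.trans h4, fun h6 => sup_eq_right.1 (h5 (le_antisymm h4 (h6 ▸ h3)))⟩

end Chain

/-- The finite chain of the distinct steps of a labelled filtration. -/
theorem IsLabelling.exists_chain {ι : Type*} [Finite ι]
    {y : Basis ι L V} {l : ι → ℝ} (hl : IsLabelling f y l) :
    ∃ (M : ℕ) (a : Fin M → ℝ) (Z : ℕ → Submodule L V), StrictAnti a ∧ Z 0 = ⊥ ∧ Z M = ⊤ ∧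
      Monotone Z ∧ (∀ k : Fin M, Z k = ⨆ u : Ioi (a k), f u) ∧ (∀ k : Fin M, Z (k + 1) = f (a k)) ∧
      ∀ s, ∃ m ≤ M, f s = Z m ∧ ∀ k : Fin M, (k : ℕ) < m ↔ s ≤ a k := by
  classical
  cases nonempty_fintype ι
  obtain ⟨M, e, he⟩ := exists_antitone_enum (fun r : Set.range l => (r : ℝ))
  let pos : ι → ℕ := fun i => (e.symm ⟨l i, i, rfl⟩ : Fin M)
  let Z : ℕ → Submodule L V := fun k => coordSub y {i | pos i < k}
  have hstrict : StrictAnti (fun k : Fin M => ((e k : Set.range l) : ℝ)) :=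
    he.strictAnti_of_injective (Subtype.val_injective.comp e.injective)
  have hpos : ∀ i (k : Fin M), pos i < k ↔ ((e k : Set.range l) : ℝ) < l i := by
    intro i k
    have := hstrict.lt_iff_gt (a := k) (b := e.symm ⟨l i, i, rfl⟩)
    simp only [Equiv.apply_symm_apply] at this
    exact this.symm
  have hpos' : ∀ i (k : Fin M), pos i < k + 1 ↔ ((e k : Set.range l) : ℝ) ≤ l i := by
    intro i k
    have := hstrict.le_iff_ge (a := k) (b := e.symm ⟨l i, i, rfl⟩)
    simp only [Equiv.apply_symm_apply] at this
    rw [this, Nat.lt_succ_iff]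
    rfl
  have hZM : Z M = ⊤ := by
    rw [← coordSub_univ y]
    exact congrArg (coordSub y) (Set.eq_univ_of_forall fun i => (e.symm ⟨l i, i, rfl⟩).2)
  refine ⟨M, fun k => (e k : Set.range l), Z, hstrict, ?_, hZM,
    fun k k' hk => coordSub_mono y fun i hi => lt_of_lt_of_le hi hk, fun k => ?_, fun k => ?_,
    fun s => ?_⟩
  · simp only [Z, not_lt_zero, Set.ofPred_false, coordSub_empty]
  · rw [hl.mem_iSup_Ioi]
    exact congrArg (coordSub y) (Set.ext fun i => hpos i k)
  · rw [hl.eq_coordSub]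
    exact congrArg (coordSub y) (Set.ext fun i => hpos' i k)
  · obtain ⟨m, hmM, hm⟩ := exists_cut he s
    refine ⟨m, hmM, ?_, hm⟩
    rw [hl.eq_coordSub]
    refine congrArg (coordSub y) (Set.ext fun i => ?_)
    have := hm (e.symm ⟨l i, i, rfl⟩)
    simp only [Function.comp_apply, Equiv.apply_symm_apply] at this
    exact this.symm

theorem IsDegree.prop_chain (h : IsDegree P d) (hP : ∀ s, P (f s)) {M : ℕ}
    {a : Fin M → ℝ} {Z : ℕ → Submodule L V} (hZ0 : Z 0 = ⊥) (hZM : Z M = ⊤) (hmono : Monotone Z)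
    (hZk' : ∀ k : Fin M, Z (k + 1) = f (a k)) : ∀ k, P (Z k)
  | 0 => hZ0 ▸ h.bot
  | k + 1 => by
    rcases lt_or_ge k M with hk | hk
    · exact hZk' ⟨k, hk⟩ ▸ hP _
    · exact eq_top_iff.2 (hZM ▸ hmono (hk.trans (le_succ k))) ▸ h.top

/-- A filtration whose subquotients are semistable of the right slopes consists of the
maximizers. -/
theorem IsDegree.isMaximizer_of_graded (h : IsDegree P d)
    (hf : IsRealFiltration f) (hP : ∀ s, P (f s))
    (hslope : ∀ s X, P X → ⨆ u : Ioi s, f u ≤ X → X ≤ f s → twist d s X ≤ twist d s (f s))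
    (heq : ∀ s, twist d s (f s) = twist d s (⨆ u : Ioi s, f u)) (s : ℝ) :
    IsMaximizer P d s (f s) := by
  obtain ⟨y, l, hl⟩ := hf.exists_labelling
  obtain ⟨M, a, Z, -, hZ0, hZM, hmono, hZk, hZk', hcut⟩ := hl.exists_chain
  obtain ⟨m, hmM, hfs, hm⟩ := hcut s
  rw [hfs]
  refine h.isMaximizer_chain (a := a) hZ0 hZM hmono (h.prop_chain hP hZ0 hZM hmono hZk') (fun k X hX h1 h2 => ?_) (fun k => ?_) hmM (fun k hk => (hm k).1 hk)
    (fun k hk => not_le.1 fun h' => absurd ((hm k).2 h') (not_lt.2 hk))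
  · rw [hZk] at h1
    rw [hZk'] at h2
    have h3 := hslope _ X hX h1 h2
    have h4 := heq (a k)
    rw [hZk]
    unfold twist at h3 h4
    linarith
  · rw [hZk, hZk']
    have h4 := heq (a k)
    unfold twist at h4
    linarith

theorem finrank_coordSub {ι : Type*} [Fintype ι] (b : Basis ι L V) (S : Set ι)
    [DecidablePred (· ∈ S)] : finrank L (coordSub b S) = (univ.filter fun i => i ∈ S).card := by
  have h1 : coordSub b S = span L (Set.range fun i : S => b i) := by
    apply le_antisymm
    · exact coordSub_le fun i hi => subset_span ⟨⟨i, hi⟩, rfl⟩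
    · rw [span_le]
      rintro _ ⟨i, rfl⟩
      exact basis_mem_coordSub.2 i.2
  have h2 : LinearIndependent L fun i : S => b i := b.linearIndependent.comp _ Subtype.val_injective
  rw [h1, finrank_span_eq_card h2, card_subtype]

/-- The degree of `X` is at most `ε` times the sum of the labels of the filtration induced on `X`,
if the graded pieces satisfy the corresponding bound. -/
theorem IsDegree.le_sum_labels (h : IsDegree P d) {ι : Type*} [Finite ι]
    {y : Basis ι L V} {l : ι → ℝ} (hl : IsLabelling f y l) (hP : ∀ s, P (f s)) {ε : ℝ}
    (hslope : ∀ s X, P X → ⨆ u : Ioi s, f u ≤ X → X ≤ f s → d X - d (⨆ u : Ioi s, f u) ≤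
        ε * s * (finrank L X - finrank L (⨆ u : Ioi s, f u : Submodule L V)))
    {X : Submodule L V} (hX : P X) {κ : Type*} [Fintype κ] {w : Basis κ L X} {μ : κ → ℝ}
    (hw : IsLabelling (fun s => (f s).comap X.subtype) w μ) : d X ≤ ε * ∑ i, μ i := by
  classical
  obtain ⟨M, a, Z, ha, hZ0, hZM, hmono, hZk, hZk', hcut⟩ := hl.exists_chain
  have h1 := h.le_chain (a := fun k => ε * a k) hZ0 hZM hmono
    (h.prop_chain hP hZ0 hZM hmono hZk') (fun k Y hY h1 h2 => by
    rw [hZk] at h1 ⊢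
    rw [hZk'] at h2
    exact hslope _ Y hY h1 h2) hX
  have hrk : ∀ Y : Submodule L V, finrank L (X ⊓ Y : Submodule L V) =
      finrank L (Y.comap X.subtype) := fun Y => by
    rw [← Submodule.map_comap_subtype]
    exact (LinearEquiv.finrank_eq (equivMapOfInjective _ X.injective_subtype _)).symm
  have hd1 : ∀ k : Fin M, (Z (k + 1)).comap X.subtype = coordSub w {i | a k ≤ μ i} := fun k => by
    rw [hZk']
    exact hw.eq_coordSub _
  have hd2 : ∀ k : Fin M, (Z k).comap X.subtype = coordSub w {i | a k < μ i} := fun k => by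
    obtain ⟨t, h1, h2⟩ := ((eventually_eq_iSup_right hl.isRealFiltration.antitone (a k)).and
      (eventually_eq_iSup_right hw.isRealFiltration.antitone (a k))).exists
    rw [hZk, ← hw.mem_iSup_Ioi, ← h1, ← h2]
  have hΔ : ∀ k : Fin M, (finrank L (X ⊓ Z (k + 1) : Submodule L V) : ℝ) -
      finrank L (X ⊓ Z k : Submodule L V) = ∑ i, if μ i = a k then (1 : ℝ) else 0 := by
    intro k
    rw [hrk, hrk, hd1, hd2, finrank_coordSub, finrank_coordSub, card_filter, card_filter]
    push_cast
    rw [← sum_sub_distrib]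
    refine sum_congr rfl fun i _ => ?_
    simp only [Set.mem_ofPred]
    rcases lt_trichotomy (a k) (μ i) with hh | hh | hh
    · simp [hh, hh.le, hh.ne']
    · simp [hh]
    · simp [hh.not_ge, hh.not_gt, hh.ne]
  have hex : ∀ i, ∃ k : Fin M, μ i = a k := by
    intro i
    obtain ⟨m, hmM, hm, hk⟩ := hcut (μ i)
    have hi : w i ∈ (Z m).comap X.subtype := hm ▸ hw.mem_basis.2 le_rfl
    obtain _ | k := m
    · rw [hZ0] at hi
      exact absurd (Subtype.ext ((mem_bot L).1 hi)) (w.ne_zero i)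
    · refine ⟨⟨k, hmM⟩, le_antisymm ((hk _).1 k.lt_succ_self) ?_⟩
      rw [hd1 ⟨k, hmM⟩] at hi
      have h4 := basis_mem_coordSub.1 hi
      exact h4
  refine h1.trans (le_of_eq ?_)
  simp only [hΔ]
  rw [mul_sum]
  simp only [mul_sum]
  rw [Finset.sum_comm]
  refine sum_congr rfl fun i _ => ?_
  obtain ⟨k, hk⟩ := hex i
  rw [sum_eq_single k]
  · rw [if_pos hk, mul_one, hk]
  · intro j _ hjk
    rw [if_neg fun h' => hjk (ha.injective (h'.symm.trans hk)), mul_zero]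
  · exact fun h' => absurd (mem_univ k) h'

end Abstract

/-! ### Harder–Narasimhan filtrations of normed isocrystals -/

namespace Isocrystal

section HN

variable {L : Type*} [NormedField L] {σ : L ≃+* L} {K : Type*} [Field K] [Algebra L K]
  {v : Valuation K ℝ≥0} {π : K}
variable {D : Isocrystal σ} {f : ℝ → Submodule L D} {α : K ⊗[L] D → ℝ≥0}

theorem Setting.isDegree (S : Setting σ v π) (D : Isocrystal σ) {α : K ⊗[L] D → ℝ≥0}
    (hα : IsSplittableNorm v α) : IsDegree D.IsSub (D.subDeg v π α) where
  bot := D.isSub_bot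
  top := D.isSub_top
  sup := IsSub.sup
  inf := IsSub.inf
  map_bot := S.subDeg_bot D hα
  supermodular := S.subDeg_supermodular hα

variable (v π) in
/-- All subisocrystals of `(D, α)` have slope at most `s`, and `(D, α)` is zero or has
slope `s`. -/
def HasSlope (D : Isocrystal σ) (α : K ⊗[L] D → ℝ≥0) (s : ℝ) : Prop :=
  D.degree v π α = s * finrank L D ∧ ∀ X, D.IsSub X → D.subDeg v π α X ≤ s * finrank L X

theorem isSemistable_iff : D.IsSemistable v π α ↔ Nontrivial D ∧ ∀ X, D.IsSub X → X ≠ ⊥ →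
      D.subDeg v π α X ≤ D.slope v π α * finrank L X := by
  unfold IsSemistable
  refine and_congr_right fun hD => forall_congr' fun X => forall_congr' fun hX =>
    forall_congr' fun hne => ?_
  have hpos : (0 : ℝ) < finrank L X := by
    exact_mod_cast Nat.pos_of_ne_zero fun h => hne (Submodule.finrank_eq_zero.1 h)
  rw [← div_le_iff₀ hpos, hX.subDeg_eq]
  rfl

theorem Setting.hasSlope_iff (S : Setting σ v π) (hα : IsSplittableNorm v α) (s : ℝ) :
    D.HasSlope v π α s ↔ Subsingleton D ∨ (D.IsSemistable v π α ∧ D.slope v π α = s) := by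
  rcases subsingleton_or_nontrivial D with hD | hD
  · refine iff_of_true ⟨?_, fun X hX => ?_⟩ (Or.inl hD)
    · rw [S.degree_of_subsingleton D hα, finrank_zero_of_subsingleton]
      simp
    · rw [Subsingleton.elim X ⊥, S.subDeg_bot D hα, finrank_bot]
      simp
  · have hpos : (0 : ℝ) < finrank L D := by exact_mod_cast finrank_pos
    have hs : D.slope v π α = s ↔ D.degree v π α = s * finrank L D := div_eq_iff hpos.ne'
    constructor
    · rintro ⟨h1, h2⟩
      have h1' := hs.2 h1
      exact Or.inr ⟨isSemistable_iff.2 ⟨hD, fun X hX _ => h1' ▸ h2 X hX⟩, h1'⟩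
    · rintro (h | ⟨h1, h2⟩)
      · exact absurd h (not_subsingleton_iff_nontrivial.2 hD)
      · refine ⟨hs.1 h2, fun X hX => ?_⟩
        by_cases hX0 : X = ⊥
        · rw [hX0, S.subDeg_bot D hα, finrank_bot]
          simp
        · exact h2 ▸ (isSemistable_iff.1 h1).2 X hX hX0

/-- The subobjects of a subquotient `Z' / Z` of `D`, presented as a quotient `p : Z' → E`. -/
theorem Setting.hasSlope_subquotient_iff (S : Setting σ v π) {D E : Isocrystal σ}
    {α : K ⊗[L] D → ℝ≥0} {γ : K ⊗[L] E → ℝ≥0} (hα : IsSplittableNorm v α)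
    {Z Z' : Submodule L D} (hZ : D.IsSub Z) (hZ' : D.IsSub Z') (hle : Z ≤ Z')
    {p : D.sub Z' hZ' →ₗ[L] E} (hp : ∀ x, p ((D.sub Z' hZ').frob x) = E.frob (p x))
    (hsurj : Surjective p) (hker : ker p = Z.comap (D.subIncl Z' hZ'))
    (hγ : ∀ x, γ (p.baseChange K x) ≤ D.subNorm α Z' hZ' x)
    (hat : ∀ z, ∃ x, p.baseChange K x = z ∧ D.subNorm α Z' hZ' x = γ z) (s : ℝ) :
    E.HasSlope v π γ s ↔ (∀ X, D.IsSub X → Z ≤ X → X ≤ Z' → D.subDeg v π α X - D.subDeg v π α Z ≤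
        s * (finrank L X - finrank L Z)) ∧ D.subDeg v π α Z' - D.subDeg v π α Z =
        s * (finrank L Z' - finrank L Z) := by
  set i := D.subIncl Z' hZ' with hi
  have hir : range i = Z' := Z'.range_subtype
  have hinj := D.subIncl_injective Z' hZ'
  have hcm : ∀ X, X ≤ Z' → (X.comap i).map i = X := fun X hX => by
    rw [Submodule.map_comap_eq, hir, inf_eq_right.2 hX]
  have hsub : ∀ X, D.IsSub X → (D.sub Z' hZ').IsSub (X.comap i) := fun X hX => hX.comap fun _ => rfl
  have hα' := isSplittableNorm_subNorm hα hZ'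
  have hrank : ∀ X, X ≤ Z' → finrank L (X.comap i) = finrank L X := fun X hX => by
    conv_rhs => rw [← hcm X hX]
    exact (LinearEquiv.finrank_eq (equivMapOfInjective i hinj _))
  -- subobjects of `E` and of `D` between `Z` and `Z'` correspond, with degrees and ranks
  have key : ∀ X, D.IsSub X → Z ≤ X → X ≤ Z' →
      E.subDeg v π γ ((X.comap i).map p) = D.subDeg v π α X - D.subDeg v π α Z ∧
      (finrank L ((X.comap i).map p) : ℝ) = finrank L X - finrank L Z := by
    intro X hX h1 h2
    have hk : ker p ≤ X.comap i := hker ▸ comap_mono h1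
    have e1 := S.subDeg_eq_add hp hsurj hα' hγ hat (hsub X hX) hk
    rw [hker, S.subDeg_sub hα hZ' (hsub X hX), S.subDeg_sub hα hZ' (hsub Z hZ), ← hi, hcm X h2,
      hcm Z hle] at e1
    have e2 : finrank L (X.comap i) = finrank L (X.comap i ⊓ ker p :
        Submodule L (D.sub Z' hZ')) + finrank L ((X.comap i).map p) :=
      (isExact_restrict hp (hsub X hX)).finrank
    rw [inf_eq_right.2 hk, hker, hrank X h2, hrank Z hle] at e2
    refine ⟨by linarith, ?_⟩
    rw [e2]; push_cast; ring
  have htop : (Z'.comap i).map p = ⊤ := by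
    rw [show Z'.comap i = ⊤ from eq_top_iff.2 fun x _ => hir.le (mem_range_self i x), Submodule.map_top,
      range_eq_top.2 hsurj]
  have hT := key Z' hZ' hle le_rfl
  rw [htop, S.subDeg_top E (S.trivialOn.lv_add_eq (ker p).injective_subtype hsurj
    (exact_subtype_ker_map p) hα' hγ hat).1, finrank_top] at hT
  unfold HasSlope
  rw [hT.1, hT.2]
  constructor
  · rintro ⟨h1, h2⟩
    refine ⟨fun X hX hZX hXZ => ?_, h1⟩
    have := h2 _ ((hsub X hX).map hp)
    rwa [(key X hX hZX hXZ).1, (key X hX hZX hXZ).2] at this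
  · rintro ⟨h1, h2⟩
    refine ⟨h2, fun Y hY => ?_⟩
    let X : Submodule L D := (Y.comap p).map i
    have hX : D.IsSub X := (hY.comap hp).map fun _ => rfl
    have hZX : Z ≤ X := by
      rw [← hcm Z hle, ← hker]
      exact Submodule.map_mono (LinearMap.ker_le_comap p)
    have hXZ : X ≤ Z' := by
      rintro _ ⟨x, -, rfl⟩
      exact hir.le (mem_range_self i x)
    have hXY : (X.comap i).map p = Y := by
      rw [Submodule.comap_map_eq_of_injective hinj, Submodule.map_comap_eq_of_surjective hsurj]
    have := h1 X hX hZX hXZ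
    rwa [← (key X hX hZX hXZ).1, ← (key X hX hZX hXZ).2, hXY] at this

theorem isFiltration_iff : D.IsFiltration f ↔ IsRealFiltration f ∧ ∀ s, D.IsSub (f s) :=
  ⟨fun h => ⟨⟨h.2, h.3, h.4, h.5⟩, h.1⟩, fun h => ⟨h.2, h.1.1, h.1.2, h.1.3, h.1.4⟩⟩

theorem IsFiltration.isSub_filPlus'
    (hf : D.IsFiltration f) (s : ℝ) : D.IsSub (filPlus f s) := IsSub.iSup fun t => hf.isSub t

theorem IsFiltration.filPlus_le (hf : D.IsFiltration f) (s : ℝ) : filPlus f s ≤ f s :=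
  iSup_le fun t => hf.antitone (le_of_lt t.2)

/-- The projection of `f s` onto `gr^s`. -/
def grMk {D : Isocrystal σ} {f : ℝ → Submodule L D} (hf : D.IsFiltration f) (s : ℝ) :
    D.sub (f s) (hf.isSub s) →ₗ[L] gr hf s := Submodule.mkQ ((filPlus f s).comap (f s).subtype)

theorem grMk_frob (hf : D.IsFiltration f) (s : ℝ) (x : D.sub (f s) (hf.isSub s)) :
    grMk hf s ((D.sub (f s) (hf.isSub s)).frob x) = (gr hf s).frob (grMk hf s x) := rfl

theorem grMk_surjective (hf : D.IsFiltration f)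
    (s : ℝ) : Surjective (grMk hf s) := mkQ_surjective ((filPlus f s).comap (f s).subtype)

theorem ker_grMk (hf : D.IsFiltration f) (s : ℝ) :
    ker (grMk hf s) = (filPlus f s).comap (D.subIncl (f s) (hf.isSub s)) := ker_mkQ _

theorem grNorm_attained (hα : IsSplittableNorm v α)
    (hf : D.IsFiltration f) (s : ℝ) : IsSplittableNorm v (grNorm α hf s) ∧
    (∀ x, grNorm α hf s ((grMk hf s).baseChange K x) ≤ D.subNorm α (f s) (hf.isSub s) x) ∧
    ∀ z, ∃ x, (grMk hf s).baseChange K x = z ∧ D.subNorm α (f s) (hf.isSub s) x = grNorm α hf s z :=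
  quotNorm_attained (isSub_filPlus hf s) (isSplittableNorm_subNorm hα (hf.isSub s))

theorem Setting.hasSlope_gr_iff (S : Setting σ v π) (hα : IsSplittableNorm v α)
    (hf : D.IsFiltration f) (s : ℝ) : (gr hf s).HasSlope v π (grNorm α hf s) s ↔
      (∀ X, D.IsSub X → filPlus f s ≤ X → X ≤ f s → D.subDeg v π α X -
        D.subDeg v π α (filPlus f s) ≤ s * (finrank L X - finrank L (filPlus f s))) ∧
      D.subDeg v π α (f s) - D.subDeg v π α (filPlus f s) =
        s * (finrank L (f s) - finrank L (filPlus f s)) :=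
  S.hasSlope_subquotient_iff hα (hf.isSub_filPlus' s) (hf.isSub s) (hf.filPlus_le s)
    (grMk_frob hf s) (grMk_surjective hf s) (ker_grMk hf s) (grNorm_attained hα hf s).2.1
    (grNorm_attained hα hf s).2.2 s

theorem Setting.isHNFiltration_iff (S : Setting σ v π)
    (hα : IsSplittableNorm v α) (f : ℝ → Submodule L D) :
    D.IsHNFiltration v π α f ↔ ∀ s, IsMaximizer D.IsSub (D.subDeg v π α) s (f s) := by
  have hdeg := S.isDegree D hα
  constructor
  · rintro ⟨hf, hgr⟩
    have hgr' := fun s => (S.hasSlope_gr_iff hα hf s).1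
      ((S.hasSlope_iff (grNorm_attained hα hf s).1 s).2 (hgr s))
    refine hdeg.isMaximizer_of_graded (isFiltration_iff.1 hf).1 hf.isSub (fun s X hX h1 h2 => ?_)
      fun s => ?_
    · have e1 := (hgr' s).1 X hX h1 h2
      have e2 := (hgr' s).2
      unfold twist
      linarith
    · have e2 := (hgr' s).2
      change twist _ s (f s) = twist _ s (filPlus f s)
      unfold twist
      linarith
  · intro h
    have hf : D.IsFiltration f := isFiltration_iff.2 ⟨hdeg.isRealFiltration h, fun s => (h s).1⟩
    refine ⟨hf, fun s => ?_⟩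
    rw [← S.hasSlope_iff (grNorm_attained hα hf s).1, S.hasSlope_gr_iff hα hf]
    have h2 : twist (D.subDeg v π α) s (f s) = twist (D.subDeg v π α) s (filPlus f s) :=
      (hdeg.twist_right h s).2
    refine ⟨fun X hX _ _ => ?_, ?_⟩
    · have h3 := ((h s).2 X hX).1
      unfold twist at h2 h3
      linarith
    · unfold twist at h2
      linarith

end HN

section Standard

variable {L : Type*} [NormedField L] {σ : L ≃+* L} {K : Type*} [Field K] [Algebra L K]
  {v : Valuation K ℝ≥0} {π : K}

theorem subNorm_standardNorm (hv : TrivialOn L v) (D : Isocrystal σ) {W : Submodule L D}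
    (h : D.IsSub W) : D.subNorm (D.standardNorm (K := K) v) W h = (D.sub W h).standardNorm v := by
  obtain ⟨b, hb⟩ := exists_isExactBasis W.injective_subtype (mkQ_surjective W)
    (exact_subtype_mkQ W) (finBasis L W) (finBasis L (D ⧸ W))
  have h1 := (hb.baseChange (K := K)).orthogonal_inl (isOrthogonalBasis_standardNorm hv D b)
  rw [standardNorm_eq hv (D.sub W h) (ι := Fin (finrank L W)) (finBasis L W)]
  refine h1.eq_ofBasis.trans ?_
  congr 1
  funext k
  rw [← (hb.baseChange (K := K)).inl, standardNorm_eq hv D b, ofBasis_apply_basis]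

theorem quotNorm_standardNorm (hv : TrivialOn L v) (D : Isocrystal σ) {W : Submodule L D}
    (h : D.IsSub W) : D.quotNorm (D.standardNorm (K := K) v) W h = (D.quot W h).standardNorm v := by
  obtain ⟨b, hb⟩ := exists_isExactBasis W.injective_subtype (mkQ_surjective W)
    (exact_subtype_mkQ W) (finBasis L W) (finBasis L (D ⧸ W))
  obtain ⟨-, h2, h3⟩ := quotNorm_attained h (isSplittableNorm_standardNorm (K := K) hv D)
  rw [standardNorm_eq hv (D.quot W h) (ι := Fin (finrank L (D ⧸ W))) (finBasis L (D ⧸ W))]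
  refine ((hb.baseChange (K := K)).quotient_eq (isOrthogonalBasis_standardNorm hv D b)
    h2 h3).trans ?_
  congr 1
  funext k
  rw [standardNorm_eq hv D b, ofBasis_apply_basis]

theorem tensorNorm_standardNorm (hv : TrivialOn L v) (D D' : Isocrystal σ) :
    D.tensorNorm D' (D.standardNorm (K := K) v) (D'.standardNorm v) =
      (D.tensor D').standardNorm v := by
  let b := finBasis L D
  let b' := finBasis L D'
  have ho := isOrthogonalBasis_standardNorm (K := K) hv D b
  have ho' := isOrthogonalBasis_standardNorm (K := K) hv D' b'
  rw [standardNorm_eq hv (D.tensor D') (b.tensorProduct b')]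
  funext x
  unfold tensorNorm
  rw [tensorNorm_eq_ofBasis (isSplittableNorm_standardNorm hv D).isUNorm
    (isSplittableNorm_standardNorm hv D').isUNorm ho ho', ← baseChange_tensorProduct_map]
  unfold ofBasis
  congr 1
  funext k
  rw [Basis.map_repr, LinearEquiv.trans_apply]
  erw [LinearEquiv.symm_apply_apply]
  have h1 : D.standardNorm (K := K) v (b.baseChange K k.1) = 1 := by
    rw [standardNorm_eq hv D b, ofBasis_apply_basis]
  have h2 : D'.standardNorm (K := K) v (b'.baseChange K k.2) = 1 := by
    rw [standardNorm_eq hv D' b', ofBasis_apply_basis]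
  simp only [h1, h2, one_mul]
  rfl

theorem Setting.degree_standardNorm (S : Setting σ v π) (D : Isocrystal σ) :
    D.degree v π (D.standardNorm v) = -D.dim := by
  rw [degree_eq S.trivialOn S.discrete D (isSplittableNorm_standardNorm S.trivialOn D),
    lv_standardNorm S.trivialOn, zero_div, zero_sub]

theorem Setting.subDeg_standardNorm (S : Setting σ v π) (D : Isocrystal σ) {W : Submodule L D}
    (h : D.IsSub W) : D.subDeg v π (D.standardNorm v) W = -(D.sub W h).dim := by
  rw [h.subDeg_eq, subNorm_standardNorm S.trivialOn, S.degree_standardNorm]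

end Standard

section Existence

variable {L : Type*} [NormedField L] {σ : L ≃+* L} {K : Type*} [Field K] [Algebra L K]
  {v : Valuation K ℝ≥0} {π : K}

/-- A set of real numbers which is bounded above and lies in finitely many classes
modulo `ℤ` has a largest element. -/
theorem exists_max_of_finite_add_int {τ : Type*} [Finite τ] (g : τ → ℝ) {T : Set ℝ}
    (hne : T.Nonempty) {C : ℝ} (hC : ∀ t ∈ T, t ≤ C) (hT : ∀ t ∈ T, ∃ (i : τ) (k : ℤ), t = g i + k) :
    ∃ t ∈ T, ∀ u ∈ T, u ≤ t := by
  cases nonempty_fintype τ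
  obtain ⟨t₀, ht₀⟩ := hne
  let A : Set ℝ := {t | t ∈ T ∧ t₀ ≤ t}
  have hA : A.Finite := by
    let B : Set (τ × ℤ) := ⋃ i : τ, (Prod.mk i) '' Set.Icc ⌈t₀ - g i⌉ ⌊C - g i⌋
    have hB : B.Finite := finite_iUnion fun i => (Set.finite_Icc _ _).image _
    refine (hB.image fun q => g q.1 + (q.2 : ℝ)).subset ?_
    rintro t ⟨ht, htt⟩
    obtain ⟨i, k, rfl⟩ := hT t ht
    refine ⟨(i, k), mem_iUnion.2 ⟨i, k, ⟨?_, ?_⟩, rfl⟩, rfl⟩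
    · rw [Int.ceil_le]; linarith
    · rw [Int.le_floor]; linarith [hC _ ht]
  obtain ⟨t, ⟨ht, htt⟩, hmax⟩ := exists_max_image A id hA ⟨t₀, ht₀, le_rfl⟩
  refine ⟨t, ht, fun u hu => ?_⟩
  rcases le_total t₀ u with h | h
  · exact hmax u ⟨hu, h⟩
  · exact h.trans htt

/-- The degrees of the subisocrystals lie in finitely many classes modulo `ℤ`. -/
theorem Setting.exists_finite_subDeg (S : Setting σ v π) (D : Isocrystal σ)
    {α : K ⊗[L] D → ℝ≥0} (hα : IsSplittableNorm v α) (s : ℝ) :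
    ∃ (N n : ℕ) (g : (Σ r : Fin n, Fin r → Fin N) → ℝ), ∀ X, D.IsSub X →
      ∃ i, ∃ k : ℤ, twist (D.subDeg v π α) s X = g i + k := by
  have hq := S.log_neg.ne
  obtain ⟨e, he⟩ := hα.exists_basis ((finBasis L D).baseChange K)
  refine ⟨finrank L D, finrank L D + 1,
    fun i => ∑ j, log (α (e (i.2 j))) / log (v π) - s * (i.1 : ℕ), fun X hX => ?_⟩
  have hα' := isSplittableNorm_subNorm hα hX
  let E := D.sub X hX
  obtain ⟨u, hu⟩ := hα'.exists_basis ((finBasis L E).baseChange K)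
  have hlog : ∀ j, ∃ (i : Fin (finrank L D)) (k : ℤ),
      log (D.subNorm α X hX (u j)) = log (α (e i)) + k * log (v π) := by
    intro j
    have hne : (D.subIncl X hX).baseChange K (u j) ≠ 0 := fun h0 => u.ne_zero j
      (baseChange_injective (D.subIncl_injective X hX) (h0.trans (map_zero _).symm))
    obtain ⟨i, hi, hi'⟩ := he.exists_eq hα.isUNorm hne
    obtain ⟨k, hk⟩ := S.generator _ hi
    refine ⟨i, k, ?_⟩
    rw [subNorm_apply, hi', coe_mul, log_mul, hk, add_comm]
    · exact_mod_cast (v.ne_zero_iff).2 hi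
    · exact_mod_cast (hα.isUNorm.pos (e.ne_zero i)).ne'
  choose i k hik using hlog
  obtain ⟨m, hm⟩ := S.generator _ (det_basis_ne_zero ((finBasis L E).baseChange K) u)
  obtain ⟨l, hl⟩ := S.preservesVal.dim_int E
  have hr : finrank L E < finrank L D + 1 := Nat.lt_succ_of_le (finrank_le X)
  refine ⟨⟨⟨finrank L E, hr⟩, i⟩, ∑ j, k j - m - l, ?_⟩
  unfold twist
  rw [hX.subDeg_eq, degree_eq S.trivialOn S.discrete _ hα', lv, hu.lvol_eq hα'.isUNorm, hm, hl,
    sum_congr rfl fun j _ => hik j, sum_add_distrib, ← sum_mul]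
  simp only [← sum_div]
  have : finrank L X = finrank L E := rfl
  rw [this]
  push_cast
  field_simp
  ring

/-- Degrees of subisocrystals are bounded above if their dimensions are bounded below. -/
theorem Setting.exists_subDeg_le (S : Setting σ v π) (D : Isocrystal σ)
    {α : K ⊗[L] D → ℝ≥0} (hα : IsSplittableNorm v α)
    (hB : ∃ B, ∀ X (h : D.IsSub X), B ≤ (D.sub X h).dim) :
    ∃ C, ∀ X, D.IsSub X → D.subDeg v π α X ≤ C := by
  obtain ⟨B, hB⟩ := hB
  have ho := isSplittableNorm_standardNorm (K := K) S.trivialOn D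
  obtain ⟨C₀, hC₀, hle₀⟩ := IsSplittableNorm.exists_le_mul ho.isUNorm hα
  let C : ℝ≥0 := max 1 C₀
  have hC1 : (1 : ℝ) ≤ C := by exact_mod_cast le_max_left 1 C₀
  have hle : ∀ x, D.standardNorm v x ≤ C * α x := fun x =>
    (hle₀ x).trans (mul_le_mul_left (le_max_right 1 C₀) _)
  refine ⟨(finrank L D * log C) / -log (v π) - B, fun X hX => ?_⟩
  have hα' := isSplittableNorm_subNorm hα hX
  have ho' := isSplittableNorm_subNorm ho hX
  have h1 := lvol_le_of_le_mul ho' hα'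
    ((finBasis L (D.sub X hX)).baseChange K) (lt_of_lt_of_le one_pos (le_max_left 1 C₀))
    (fun x => hle ((D.subIncl X hX).baseChange K x))
  have h2 := lv_standardNorm (K := K) S.trivialOn (D.sub X hX)
  rw [← subNorm_standardNorm S.trivialOn, lv] at h2
  rw [h2, card_fin] at h1
  have h3 : (finrank L (D.sub X hX) : ℝ) ≤ finrank L D := by exact_mod_cast finrank_le X
  have h4 : (0 : ℝ) ≤ log C := Real.log_nonneg hC1
  have h5 : -lv v (D.subNorm α X hX) ≤ finrank L D * log C := by
    have := mul_le_mul_of_nonneg_right h3 h4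
    unfold lv
    simp only [C] at *
    linarith
  have h6 := div_le_div_of_nonneg_right h5 (neg_nonneg.2 S.log_neg.le)
  rw [neg_div_neg_eq] at h6
  rw [hX.subDeg_eq, degree_eq S.trivialOn S.discrete _ hα']
  linarith [hB X hX]

theorem Setting.existsUnique_isHNFiltration (S : Setting σ v π) (D : Isocrystal σ)
    {α : K ⊗[L] D → ℝ≥0} (hα : IsSplittableNorm v α)
    (hB : ∃ B, ∀ X (h : D.IsSub X), B ≤ (D.sub X h).dim) : ∃! f, D.IsHNFiltration v π α f := by
  have hdeg := S.isDegree D hα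
  obtain ⟨C, hC⟩ := S.exists_subDeg_le D hα hB
  have hex : ∀ s, ∃ Z, IsMaximizer D.IsSub (D.subDeg v π α) s Z := by
    intro s
    apply hdeg.exists_isMaximizer
    obtain ⟨N, n, g, hg⟩ := S.exists_finite_subDeg D hα s
    obtain ⟨_, ⟨Z, hZ, rfl⟩, hmax⟩ := exists_max_of_finite_add_int g
      (T := {t | ∃ X, D.IsSub X ∧ twist (D.subDeg v π α) s X = t}) ⟨_, ⊥, D.isSub_bot, rfl⟩
      (C := C + |s| * finrank L D) (by
        rintro _ ⟨X, hX, rfl⟩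
        have h1 := hC X hX
        have h2 : (finrank L X : ℝ) ≤ finrank L D := by exact_mod_cast finrank_le X
        have h3 : -(s * finrank L X) ≤ |s| * finrank L D := by
          rw [← neg_mul]
          exact mul_le_mul (neg_le_abs s) h2 (by positivity) (abs_nonneg s)
        unfold twist
        linarith) (by
        rintro _ ⟨X, hX, rfl⟩
        exact hg X hX)
    exact ⟨Z, hZ, fun X hX => hmax _ ⟨X, hX, rfl⟩⟩
  choose f hf using hex
  refine ⟨f, (S.isHNFiltration_iff hα f).2 hf, fun f' hf' => funext fun s => ?_⟩
  exact ((S.isHNFiltration_iff hα f').1 hf' s).unique (hf s)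

end Existence

end Isocrystal

/-! ### Isoclinic isocrystals: growth of the iterates of Frobenius -/

section Bounded

variable {L : Type*} [Field L] {v : Valuation L ℝ≥0} {V V' : Type*} [AddCommGroup V] [Module L V]
  [AddCommGroup V'] [Module L V'] {β : V → ℝ≥0} {β' : V' → ℝ≥0}

/-- An additive map which is compatible with scalars up to an isometry is bounded. -/
theorem IsSplittableNorm.exists_bound (hβ : IsSplittableNorm v β) (hβ' : IsUNorm v β')
    (f : V →+ V') (hf : ∀ (a : L) (x : V), β' (f (a • x)) = v a * β' (f x)) :
    ∃ C : ℝ≥0, 0 < C ∧ ∀ x, β' (f x) ≤ C * β x := by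
  obtain ⟨e, he⟩ := hβ.splittable
  set C : ℝ≥0 := (univ.sup fun i => β' (f (e i)) / β (e i)) + 1 with hC
  refine ⟨C, by positivity, fun x => ?_⟩
  conv_lhs => rw [← e.sum_repr x, map_sum]
  refine hβ'.sum_le _ _ fun i _ => ?_
  rw [hf]
  have hpos := hβ.isUNorm.pos (e.ne_zero i)
  have h1 : β' (f (e i)) ≤ C * β (e i) := by
    rw [← div_le_iff₀ hpos]
    exact (le_sup (f := fun i => β' (f (e i)) / β (e i)) (mem_univ i)).trans
      le_self_add
  calc v (e.repr x i) * β' (f (e i)) ≤ v (e.repr x i) * (C * β (e i)) :=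
        mul_le_mul_right h1 _
    _ = C * (v (e.repr x i) * β (e i)) := by ring
    _ ≤ C * β x := mul_le_mul_right (he.le x i) _

theorem tensorNorm_tmul_le (x : V) (y : V') : tensorNorm (K := L) β β' (x ⊗ₜ[L] y) ≤ β x * β' y :=
  csInf_le' ⟨1, fun _ => x, fun _ => y, by simp, by simp⟩

end Bounded

theorem le_of_pow_le_mul_pow {a b C : ℝ} (hb : 0 < b) (h : ∀ k : ℕ, a ^ k ≤ C * b ^ k) : a ≤ b := by
  by_contra hlt
  obtain ⟨k, hk⟩ := pow_unbounded_of_one_lt C ((one_lt_div hb).2 (not_le.1 hlt))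
  rw [div_pow, lt_div_iff₀ (pow_pos hb k)] at hk
  exact hk.not_ge (h k)

section Complete

variable {L : Type*} [NormedField L]

/-- A norm on a finite dimensional space over a complete field dominates the coordinates. -/
theorem exists_repr_le {V ι : Type*} [AddCommGroup V] [Module L V] [Fintype ι]
    [IsUltrametricDist L] [CompleteSpace L] (hL : ∃ x : L, x ≠ 0 ∧ ‖x‖ < 1)
    {γ : V → ℝ≥0} (hγ : IsUNorm (valuation (K := L)) γ) (b : Basis ι L V) :
    ∃ C : ℝ≥0, 0 < C ∧ ∀ x i, valuation (b.repr x i) ≤ C * γ x := by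
  obtain ⟨a, ha, ha1⟩ := hL
  let _ : NontriviallyNormedField L :=
    { ‹NormedField L› with
      non_trivial := ⟨a⁻¹, by rw [norm_inv]; exact (one_lt_inv₀ (norm_pos_iff.2 ha)).2 ha1⟩ }
  let N : AddGroupNorm V :=
    { toFun := fun x => γ x
      map_zero' := by rw [hγ.map_zero]; rfl
      add_le' := fun x y => by
        have h1 : γ (x + y) ≤ γ x + γ y := (hγ.add_le_max x y).trans
          (max_le le_self_add le_add_self)
        exact_mod_cast h1
      neg' := fun x => by rw [hγ.map_neg]
      eq_zero_of_map_eq_zero' := fun x hx => (hγ.eq_zero_iff x).1 (by exact_mod_cast hx) }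
  let _ : NormedAddCommGroup V := N.toNormedAddCommGroup
  let _ : NormedSpace L V := ⟨fun c x => congrArg NNReal.toReal (hγ.smul c x) |>.le⟩
  have : FiniteDimensional L V := Finite.of_basis b
  let C : ℝ≥0 := (∑ i, ‖(b.coord i).toContinuousLinearMap‖₊) + 1
  refine ⟨C, by positivity, fun x i => ?_⟩
  have h1 := (b.coord i).toContinuousLinearMap.le_opNNNorm x
  have h2 : ‖(b.coord i).toContinuousLinearMap‖₊ ≤ C :=
    (single_le_sum (f := fun i => ‖(b.coord i).toContinuousLinearMap‖₊)
      (fun _ _ => zero_le) (mem_univ i)).trans le_self_add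
  exact h1.trans (mul_le_mul_left h2 _)

/-- Hadamard's inequality applied to families of vectors of bounded growth. -/
theorem IsOrthogonalBasis.le_pow_card {V ι : Type*} [AddCommGroup V] [Module L V] [Fintype ι]
    [DecidableEq ι] [IsUltrametricDist L] {β : V → ℝ≥0} {e : Basis ι L V} (he : IsOrthogonalBasis valuation β e)
    (hβ : IsUNorm (valuation (K := L)) β) {x : ℕ → ι → V} {a : ℝ} {q C : ℝ≥0} (hq : 0 < q)
    (hx : ∀ k i, β (x k i) ≤ C * q ^ k * β (e i)) (ha : ∀ k, ‖e.det (x k)‖ = a ^ k) :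
    a ≤ (q : ℝ) ^ card ι := by
  refine le_of_pow_le_mul_pow (C := (C : ℝ) ^ card ι) (by positivity) fun k => ?_
  have h1 := (he.hadamard hβ (x k)).trans (prod_le_prod' fun i _ => hx k i)
  rw [prod_mul_distrib, Finset.prod_const, card_univ] at h1
  have h2 := le_of_mul_le_mul_right h1 (prod_pos fun i _ => hβ.pos (e.ne_zero i))
  rw [← ha, ← pow_mul, mul_comm (card ι), pow_mul, ← mul_pow]
  exact_mod_cast h2

end Complete

namespace Isocrystal

variable {L : Type*} [NormedField L] {σ : L ≃+* L}

/-- The hypotheses on a complete, discretely valued base field; `c` is the absolute value of a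
uniformizer. -/
structure CompleteSetting (σ : L ≃+* L) (c : ℝ≥0) : Prop where
  c_pos : 0 < c
  c_lt_one : c < 1
  norm_eq : ∀ x : L, x ≠ 0 → ‖x‖ = (c : ℝ) ^ normalizedVal x
  isometry : ∀ x, ‖σ x‖ = ‖x‖
  exists_norm_lt_one : ∃ x : L, x ≠ 0 ∧ ‖x‖ < 1
  preservesVal : PreservesVal σ

/-- The Frobenius as an additive equivalence. -/
def frobEquiv (D : Isocrystal σ) : D ≃+ D :=
  AddEquiv.ofBijective D.frob.toAddMonoidHom D.bijective

theorem frobEquiv_apply (D : Isocrystal σ) (x : D) : D.frobEquiv x = D.frob x := rfl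

theorem frobEquiv_symm_smul (D : Isocrystal σ) (a : L) (x : D) :
    D.frobEquiv.symm (a • x) = σ.symm a • D.frobEquiv.symm x := by
  rw [AddEquiv.symm_apply_eq, frobEquiv_apply, frob_smul, σ.apply_symm_apply]
  congr 1
  exact (D.frobEquiv.apply_symm_apply x).symm

variable [IsUltrametricDist L]

variable {D E : Isocrystal σ} {c : ℝ≥0}

/-- The iterates of Frobenius grow at most like `w ^ m`. -/
def HasGrowth (D : Isocrystal σ) (w : ℝ≥0) : Prop :=
  ∃ β : D → ℝ≥0, IsSplittableNorm (valuation (K := L)) β ∧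
    ∃ C : ℝ≥0, ∀ (m : ℕ) (x : D), β (D.frob^[m] x) ≤ C * w ^ m * β x

theorem HasGrowth.of_norm {w : ℝ≥0} (h : D.HasGrowth w) {β : D → ℝ≥0}
    (hβ : IsSplittableNorm (valuation (K := L)) β) :
    ∃ C : ℝ≥0, 0 < C ∧ ∀ (m : ℕ) (x : D), β (D.frob^[m] x) ≤ C * w ^ m * β x := by
  obtain ⟨β₀, h₀, C₀, hC₀⟩ := h
  obtain ⟨A, hA, hA'⟩ := IsSplittableNorm.exists_le_mul hβ.isUNorm h₀
  obtain ⟨B, hB, hB'⟩ := IsSplittableNorm.exists_le_mul h₀.isUNorm hβ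
  refine ⟨A * C₀ * B + 1, by positivity, fun m x => ?_⟩
  calc β (D.frob^[m] x) ≤ A * (C₀ * w ^ m * (B * β x)) :=
        (hA' _).trans (mul_le_mul_right ((hC₀ m x).trans (mul_le_mul_right (hB' x) _)) _)
    _ = (A * C₀ * B) * w ^ m * β x := by ring
    _ ≤ (A * C₀ * B + 1) * w ^ m * β x := by gcongr; exact le_self_add

theorem exists_splittableNorm (D : Isocrystal σ) :
    ∃ β : D → ℝ≥0, IsSplittableNorm (valuation (K := L)) β :=
  ⟨_, isSplittableNorm_ofBasis (finBasis L D) (c := fun _ => 1) fun _ => one_pos⟩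

theorem valuation_apply_eq (S : CompleteSetting σ c) (a : L) : valuation (σ a) = valuation a :=
  NNReal.eq (S.isometry a)

theorem valuation_symm_eq (S : CompleteSetting σ c) (a : L) :
    valuation (σ.symm a) = valuation a := by
  conv_rhs => rw [← σ.apply_symm_apply a, valuation_apply_eq S]

theorem frob_iterate_smul (m : ℕ) (a : L) (x : D) :
    D.frob^[m] (a • x) = (σ^[m] a) • D.frob^[m] x := by
  induction m with
  | zero => rfl
  | succ m ih => rw [iterate_succ_apply', ih, frob_smul, iterate_succ_apply',
      iterate_succ_apply']

theorem frob_iterate_add (m : ℕ) (x y : D) : D.frob^[m] (x + y) = D.frob^[m] x + D.frob^[m] y :=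
  iterate_map_add D.frob m x y

theorem valuation_iterate (S : CompleteSetting σ c) (m : ℕ) (a : L) :
    valuation (σ^[m] a) = valuation a := by
  induction m with
  | zero => rfl
  | succ m ih => rw [iterate_succ_apply', valuation_apply_eq S, ih]

theorem CompleteSetting.norm_det (S : CompleteSetting σ c) {ι : Type*} [Fintype ι]
    [DecidableEq ι] (b : Basis ι L D) (x : ι → D) (m : ℕ) :
    ‖b.det fun k => D.frob^[m] (x k)‖ = ((c : ℝ) ^ D.dim) ^ m * ‖b.det x‖ := by
  induction m with
  | zero => simp
  | succ m ih =>
    have := det_frob_comp b fun k => D.frob^[m] (x k)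
    simp only [iterate_succ_apply']
    rw [this, norm_mul, S.isometry, ih, S.norm_eq _ (det_frob_ne_zero b), ← S.preservesVal.dim_eq b]
    ring

theorem CompleteSetting.exists_frob_le (S : CompleteSetting σ c) {β : D → ℝ≥0}
    (hβ : IsSplittableNorm (valuation (K := L)) β) :
    ∃ R : ℝ≥0, 0 < R ∧ ∀ x, β (D.frob x) ≤ R * β x :=
  hβ.exists_bound hβ.isUNorm D.frobEquiv.toAddMonoidHom fun a x => by
    change β (D.frob (a • x)) = _ * β (D.frob x)
    rw [frob_smul, hβ.smul, valuation_apply_eq S]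

/-- Growth of Frobenius bounds the dimension from below, by Hadamard's inequality applied to all
the iterates. -/
theorem CompleteSetting.le_dim_of_hasGrowth (S : CompleteSetting σ c) {s : ℝ}
    (h : D.HasGrowth (c ^ s)) : s * finrank L D ≤ D.dim := by
  classical
  obtain ⟨β, hβ⟩ := D.exists_splittableNorm
  obtain ⟨C, hC, hle⟩ := h.of_norm hβ
  obtain ⟨e, he⟩ := hβ.splittable
  have h1 := he.le_pow_card hβ.isUNorm (rpow_pos S.c_pos)
    (fun k i => hle k (e i)) (a := (c : ℝ) ^ D.dim) fun k => by
      rw [S.norm_det, Basis.det_self, norm_one, mul_one]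
  rwa [card_fin, NNReal.coe_rpow, ← Real.rpow_natCast, ← Real.rpow_mul c.coe_nonneg,
    Real.rpow_le_rpow_left_iff_of_base_lt_one (x := (c : ℝ)) S.c_pos S.c_lt_one] at h1

theorem HasGrowth.of_injective {w : ℝ≥0} (h : D.HasGrowth w) (i : E →ₗ[L] D)
    (hi : Injective i) (hφ : ∀ x, i (E.frob x) = D.frob (i x)) : E.HasGrowth w := by
  obtain ⟨β, hβ, C, hC⟩ := h
  refine ⟨fun x => β (i x), hβ.comp i hi, C, fun m x => ?_⟩
  have : i (E.frob^[m] x) = D.frob^[m] (i x) := (Function.Semiconj.iterate_right hφ m) x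
  simp only [this]
  exact hC m _

theorem exists_quotient_norm {V V₂ : Type*} [AddCommGroup V] [Module L V] [FiniteDimensional L V]
    [AddCommGroup V₂] [Module L V₂] [FiniteDimensional L V₂] {β : V → ℝ≥0}
    {v : Valuation L ℝ≥0} (hβ : IsSplittableNorm v β) (p : V →ₗ[L] V₂) (hp : Surjective p) :
    ∃ β₂ : V₂ → ℝ≥0, IsSplittableNorm v β₂ ∧ (∀ x, β₂ (p x) ≤ β x) ∧
      ∀ z, ∃ x, p x = z ∧ β x = β₂ z := by
  obtain ⟨b, hb⟩ := exists_isExactBasis (ker p).injective_subtype hp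
    (exact_subtype_ker_map p) (finBasis L (ker p))
    (finBasis L V₂)
  choose x hx hmin using hb.quotient_attained hβ
  refine ⟨fun z => β (x z), ?_, fun y => hmin _ y rfl, fun z => ⟨x z, hx z, rfl⟩⟩
  exact (hb.lvol_eq hβ (fun y => hmin _ y rfl) (fun z => ⟨x z, hx z, rfl⟩)).1

theorem HasGrowth.of_surjective {w : ℝ≥0} (h : D.HasGrowth w) (p : D →ₗ[L] E)
    (hp : Surjective p) (hφ : ∀ x, p (D.frob x) = E.frob (p x)) : E.HasGrowth w := by
  obtain ⟨β, hβ, C, hC⟩ := h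
  obtain ⟨β₂, hβ₂, hle, hat⟩ := exists_quotient_norm hβ p hp
  refine ⟨β₂, hβ₂, C, fun m z => ?_⟩
  obtain ⟨x, rfl, hx⟩ := hat z
  have : p (D.frob^[m] x) = E.frob^[m] (p x) := (Function.Semiconj.iterate_right hφ m) x
  rw [← this, ← hx]
  exact (hle _).trans (hC m x)

/-- A pure tensor, as an element of the tensor product of two isocrystals. -/
def tmul (D E : Isocrystal σ) (x : D) (y : E) : D.tensor E := x ⊗ₜ[L] y

theorem tensor_frob_tmul (D E : Isocrystal σ) (x : D) (y : E) :
    (D.tensor E).frob (D.tmul E x y) = D.tmul E (D.frob x) (E.frob y) := rfl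

theorem tensor_frob_iterate_tmul (D E : Isocrystal σ) (m : ℕ) (x : D) (y : E) :
    (D.tensor E).frob^[m] (D.tmul E x y) = D.tmul E (D.frob^[m] x) (E.frob^[m] y) := by
  induction m with
  | zero => rfl
  | succ m ih => rw [iterate_succ_apply', ih, tensor_frob_tmul,
      iterate_succ_apply', iterate_succ_apply']

theorem CompleteSetting.hasGrowth_tensor (S : CompleteSetting σ c) {w w' : ℝ≥0}
    (h : D.HasGrowth w) (h' : E.HasGrowth w') : (D.tensor E).HasGrowth (w * w') := by
  obtain ⟨β, hβ, C, hC⟩ := h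
  obtain ⟨β', hβ', C', hC'⟩ := h'
  obtain ⟨e, he⟩ := hβ.splittable
  obtain ⟨u, hu⟩ := hβ'.splittable
  have ht := hβ.tensorNorm hβ'
  have htb := isOrthogonalBasis_tensorNorm hβ.isUNorm hβ'.isUNorm he hu
  refine ⟨_root_.tensorNorm (K := L) β β', ht, C * C', fun m x => ?_⟩
  let F : D.tensor E →+ D.tensor E := AddMonoidHom.mk' ((D.tensor E).frob^[m]) (frob_iterate_add m)
  let b : Basis _ L (D.tensor E) := e.tensorProduct u
  change _root_.tensorNorm (K := L) β β' (F x) ≤ _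
  conv_lhs => rw [← b.sum_repr x, map_sum]
  refine ht.isUNorm.sum_le _ _ fun k _ => ?_
  have h1 : F (b.repr x k • b k) =
      (σ^[m] (b.repr x k)) • (D.frob^[m] (e k.1) ⊗ₜ[L] E.frob^[m] (u k.2)) := by
    change (D.tensor E).frob^[m] (b.repr x k • b k) = _
    rw [frob_iterate_smul]
    congr 1
    have : b k = D.tmul E (e k.1) (u k.2) := Basis.tensorProduct_apply' e u k
    rw [this]
    exact tensor_frob_iterate_tmul D E m _ _
  rw [h1]
  refine (ht.smul _ _).le.trans ?_
  rw [valuation_iterate S]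
  have h2 := htb.le x k
  rw [tensorNorm_basis hβ.isUNorm hβ'.isUNorm he hu] at h2
  calc valuation (b.repr x k) * _root_.tensorNorm (K := L) β β'
        (D.frob^[m] (e k.1) ⊗ₜ[L] E.frob^[m] (u k.2))
      ≤ valuation (b.repr x k) * ((C * w ^ m * β (e k.1)) * (C' * w' ^ m * β' (u k.2))) :=
        mul_le_mul_right ((tensorNorm_tmul_le _ _).trans (mul_le_mul' (hC m _) (hC' m _))) _
    _ = C * C' * (w * w') ^ m * (valuation (b.repr x k) * (β (e k.1) * β' (u k.2))) := by
        rw [mul_pow]; ring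
    _ ≤ _ := mul_le_mul_right h2 _

/-- An extension of isocrystals whose Frobenius grows at most like `w ^ m` has the same growth;
there is no polynomial factor since the absolute value is ultrametric. -/
theorem CompleteSetting.hasGrowth_extension (S : CompleteSetting σ c) {w : ℝ≥0} (hw : 0 < w)
    {D₁ D D₂ : Isocrystal σ} {i : D₁ →ₗ[L] D} {p : D →ₗ[L] D₂} (hex : IsExact i p)
    (h₁ : D₁.HasGrowth w) (h₂ : D₂.HasGrowth w) : D.HasGrowth w := by
  obtain ⟨β, hβ⟩ := D.exists_splittableNorm
  have hβ₁ := hβ.comp i hex.injective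
  obtain ⟨C₁, hC₁, hle₁⟩ := h₁.of_norm hβ₁
  obtain ⟨β₂, hβ₂, hqle, -⟩ := exists_quotient_norm hβ p hex.surjective
  obtain ⟨C₂, hC₂, hle₂⟩ := h₂.of_norm hβ₂
  obtain ⟨j, hj⟩ := LinearMap.exists_rightInverse_of_surjective p
    (range_eq_top.2 hex.surjective)
  have hj' : ∀ y, p (j y) = y := fun y => LinearMap.congr_fun hj y
  obtain ⟨A, hA, hjA⟩ := hβ₂.exists_bound hβ.isUNorm j.toAddMonoidHom fun a x => by
    change β (j (a • x)) = _ * β (j x)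
    rw [_root_.map_smul, hβ.smul]
  -- the defect of Frobenius-equivariance of the section `j`
  let δ : D₂ →+ D :=
    (D.frobEquiv.toAddMonoidHom.comp j.toAddMonoidHom) -
      (j.toAddMonoidHom.comp D₂.frobEquiv.toAddMonoidHom)
  have hδ : ∀ y, δ y = D.frob (j y) - j (D₂.frob y) := fun y => rfl
  obtain ⟨B, hB, hδB⟩ := hβ₂.exists_bound hβ.isUNorm δ fun a x => by
    rw [hδ, _root_.map_smul, frob_smul, frob_smul, _root_.map_smul, ← smul_sub, hβ.smul,
      valuation_apply_eq S, ← hδ]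
  have hδ1 : ∀ y, ∃ z, i z = δ y := fun y => (hex.exact _).1 (by
    rw [hδ, map_sub, hj', hex.right, hj', sub_self])
  let G : ℝ≥0 := C₁ * B * C₂ / w
  have hG : C₁ * B * C₂ = G * w := (div_mul_cancel₀ _ hw.ne').symm
  have key : ∀ (m : ℕ) (y : D₂), ∃ z : D₁, D.frob^[m] (j y) = j (D₂.frob^[m] y) + i z ∧
      ∀ l, β (i (D₁.frob^[l] z)) ≤ G * w ^ (l + m) * β₂ y := by
    intro m y
    induction m with
    | zero =>
      refine ⟨0, by simp, fun l => ?_⟩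
      rw [Function.iterate_fixed (map_zero _) l, map_zero, hβ.isUNorm.map_zero]
      exact zero_le
    | succ m ih =>
      obtain ⟨z, hz, hzl⟩ := ih
      obtain ⟨z', hz'⟩ := hδ1 (D₂.frob^[m] y)
      refine ⟨z' + D₁.frob z, ?_, fun l => ?_⟩
      · rw [iterate_succ_apply', hz, map_add, map_add, hz', hδ, ← hex.left,
          iterate_succ_apply']
        abel
      · rw [frob_iterate_add, map_add, ← iterate_succ_apply]
        refine (hβ.add_le_max _ _).trans (max_le ?_ ?_)
        · calc β (i (D₁.frob^[l] z')) ≤ C₁ * w ^ l * β (i z') := hle₁ l z'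
            _ ≤ C₁ * w ^ l * (B * (C₂ * w ^ m * β₂ y)) := by
                rw [hz']
                exact mul_le_mul_right ((hδB _).trans (mul_le_mul_right (hle₂ m y) _)) _
            _ = (C₁ * B * C₂) * w ^ (l + m) * β₂ y := by rw [pow_add]; ring
            _ = G * w ^ (l + (m + 1)) * β₂ y := by rw [hG]; ring
        · refine (hzl (l + 1)).trans (le_of_eq ?_)
          rw [show l + 1 + m = l + (m + 1) by omega]
  refine ⟨β, hβ, max (A * C₂ + G) (C₁ * (1 + A)), fun m x => ?_⟩
  have hx0 : p (x - j (p x)) = 0 := by rw [map_sub, hj', sub_self]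
  obtain ⟨z, hz⟩ := (hex.exact _).1 hx0
  obtain ⟨u, hu, hul⟩ := key m (p x)
  have hxz : x = i z + j (p x) := by rw [hz]; abel
  have hzβ : β (i z) ≤ (1 + A) * β x := by
    rw [hz]
    refine (hβ.isUNorm.sub_le_max _ _).trans (max_le ?_ ?_)
    · rw [add_mul, one_mul]; exact le_self_add
    · refine (hjA _).trans ((mul_le_mul_right (hqle x) _).trans ?_)
      rw [add_mul]; exact le_add_self
  have hi : i (D₁.frob^[m] z) = D.frob^[m] (i z) := (Function.Semiconj.iterate_right hex.left m) z
  have e1 : D.frob^[m] x = i (D₁.frob^[m] z) + (j (D₂.frob^[m] (p x)) + i u) := by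
    conv_lhs => rw [hxz]
    rw [frob_iterate_add, hu, hi]
  rw [e1]
  refine (hβ.add_le_max _ _).trans (max_le ?_ ((hβ.add_le_max _ _).trans (max_le ?_ ?_)))
  · calc β (i (D₁.frob^[m] z)) ≤ C₁ * w ^ m * β (i z) := hle₁ m z
      _ ≤ C₁ * w ^ m * ((1 + A) * β x) := mul_le_mul_right hzβ _
      _ = (C₁ * (1 + A)) * w ^ m * β x := by ring
      _ ≤ _ := by gcongr; exact le_max_right _ _
  · calc β (j (D₂.frob^[m] (p x))) ≤ A * (C₂ * w ^ m * β x) :=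
          (hjA _).trans (mul_le_mul_right ((hle₂ m _).trans (mul_le_mul_right (hqle x) _)) _)
      _ = (A * C₂) * w ^ m * β x := by ring
      _ ≤ _ := by gcongr; exact le_self_add.trans (le_max_left _ _)
  · have := hul 0
    rw [zero_add] at this
    calc β (i u) ≤ G * w ^ m * β x := this.trans (mul_le_mul_right (hqle x) _)
      _ ≤ _ := by gcongr; exact le_add_self.trans (le_max_left _ _)

end Isocrystal

namespace Isocrystal

variable {L : Type*} [NormedField L] {σ : L ≃+* L}

theorem dim_sub_congr {D : Isocrystal σ} {X Y : Submodule L D} (h : X = Y) (hX : D.IsSub X)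
    (hY : D.IsSub Y) : (D.sub X hX).dim = (D.sub Y hY).dim := by subst h; rfl

theorem PreservesVal.dim_iso (hσ : PreservesVal σ) {D E : Isocrystal σ} (f : D ≃ₗ[L] E)
    (hf : ∀ x, f (D.frob x) = E.frob (f x)) : E.dim = D.dim := by
  rw [hσ.dim_eq (finBasis L D), hσ.dim_eq ((finBasis L D).map f),
    Basis.det_map]
  congr 2
  funext k
  rw [Function.comp_apply, Basis.map_apply, ← hf, LinearEquiv.symm_apply_apply]

theorem PreservesVal.dim_sub_sub (hσ : PreservesVal σ) {D : Isocrystal σ} {Z : Submodule L D}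
    (hZ : D.IsSub Z) {Y : Submodule L (D.sub Z hZ)} (hY : (D.sub Z hZ).IsSub Y)
    (hY' : D.IsSub (Y.map (D.subIncl Z hZ))) :
    (D.sub (Y.map (D.subIncl Z hZ)) hY').dim = ((D.sub Z hZ).sub Y hY).dim :=
  hσ.dim_iso (D := (D.sub Z hZ).sub Y hY) (E := D.sub (Y.map (D.subIncl Z hZ)) hY')
    (equivMapOfInjective (D.subIncl Z hZ) (D.subIncl_injective Z hZ) Y)
    fun _ => rfl

/-- By dimension, a subspace mapped into itself by Frobenius is mapped onto itself. -/
theorem isSub_of_le {D : Isocrystal σ} {W : Submodule L D} (h : ∀ x ∈ W, D.frob x ∈ W) :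
    D.IsSub W := by
  refine eq_of_le_of_finrank_le (Submodule.map_le_iff_le_comap.2 h) ?_
  let e := finBasis L W
  have hu : LinearIndependent L fun i =>
      (⟨D.frob (e i), Submodule.mem_map_of_mem (e i).2⟩ : W.map D.frob) :=
    .of_comp (W.map D.frob).subtype (e.linearIndependent.map_of_injective_injective σ.symm
      (D.frob.toAddMonoidHom.comp W.subtype.toAddMonoidHom) (by simp)
      (fun x hx => Subtype.ext (D.bijective.1 (hx.trans (map_zero D.frob).symm)))
      fun a x => (D.frob_smul _ _).trans (by rw [σ.apply_symm_apply]; rfl))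
  simpa using hu.fintype_card_le_finrank

/-- The projection of `D` onto a quotient. -/
def quotMk (D : Isocrystal σ) (W : Submodule L D) (h : D.IsSub W) : D →ₗ[L] D.quot W h := W.mkQ

theorem isExact_quot (D : Isocrystal σ) (W : Submodule L D) (h : D.IsSub W) :
    IsExact (D.subIncl W h) (D.quotMk W h) :=
  ⟨W.injective_subtype, W.mkQ_surjective, exact_subtype_mkQ W, fun _ => rfl,
    fun _ => rfl⟩

variable [IsUltrametricDist L]

variable {D E : Isocrystal σ} {c : ℝ≥0}

theorem hasGrowth_of_isUNorm [CompleteSpace L] (S : CompleteSetting σ c) {w : ℝ≥0}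
    {γ : D → ℝ≥0} (hγ : IsUNorm (valuation (K := L)) γ)
    (h : ∀ x, γ (D.frob x) ≤ w * γ x) : D.HasGrowth w := by
  let b := finBasis L D
  have hβ : IsSplittableNorm (valuation (K := L))
      (ofBasis valuation b fun _ => 1) := isSplittableNorm_ofBasis b fun _ => one_pos
  obtain ⟨A, hA, hA'⟩ := IsSplittableNorm.exists_le_mul hγ hβ
  obtain ⟨C, hC, hC'⟩ := exists_repr_le S.exists_norm_lt_one hγ b
  have hiter : ∀ (m : ℕ) (x : D), γ (D.frob^[m] x) ≤ w ^ m * γ x := by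
    intro m x
    induction m with
    | zero => simp
    | succ m ih =>
      rw [iterate_succ_apply']
      refine (h _).trans ((mul_le_mul_right ih _).trans (le_of_eq ?_))
      ring
  refine ⟨_, hβ, C * A, fun m x => ?_⟩
  refine Finset.sup_le fun i _ => ?_
  rw [mul_one]
  calc valuation (b.repr (D.frob^[m] x) i) ≤ C * (w ^ m * (A * _)) :=
        (hC' _ i).trans (mul_le_mul_right ((hiter m x).trans (mul_le_mul_right (hA' x) _)) _)
    _ = _ := by ring

section Span

variable {r : ℝ≥0} {x : D}

/-- The balls of the largest seminorm below `β` for which Frobenius shrinks vectors by `w`. -/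
inductive FrobBound (D : Isocrystal σ) (β : D → ℝ≥0) (w : ℝ≥0) : ℝ≥0 → D → Prop
  | self (x : D) : FrobBound D β w (β x) x
  | mono {r r' : ℝ≥0} {x : D} : r ≤ r' → FrobBound D β w r x → FrobBound D β w r' x
  | add {r : ℝ≥0} {x y : D} :
    FrobBound D β w r x → FrobBound D β w r y → FrobBound D β w r (x + y)
  | smul {r : ℝ≥0} {x : D} (a : L) :
    FrobBound D β w r x → FrobBound D β w (valuation a * r) (a • x)
  | frob {r : ℝ≥0} {x : D} : FrobBound D β w r x → FrobBound D β w (w * r) (D.frob x)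

variable {β : D → ℝ≥0} {w : ℝ≥0}

/-- The largest seminorm below `β` for which Frobenius shrinks vectors by the factor `w`. -/
def frobNorm (D : Isocrystal σ) (β : D → ℝ≥0) (w : ℝ≥0) (x : D) : ℝ≥0 :=
  sInf {r | D.FrobBound β w r x}

theorem frobNorm_le (h : D.FrobBound β w r x) : D.frobNorm β w x ≤ r := csInf_le' h

theorem frobBound_of_frobNorm_lt (h : D.frobNorm β w x < r) : D.FrobBound β w r x := by
  obtain ⟨r', h1, h2⟩ := exists_lt_of_csInf_lt ⟨β x, FrobBound.self x⟩ h
  exact h1.mono h2.le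

theorem frobNorm_add (x y : D) :
    D.frobNorm β w (x + y) ≤ max (D.frobNorm β w x) (D.frobNorm β w y) :=
  le_of_forall_gt_imp_ge_of_dense fun _ hr => frobNorm_le
    ((frobBound_of_frobNorm_lt ((le_max_left _ _).trans_lt hr)).add
      (frobBound_of_frobNorm_lt ((le_max_right _ _).trans_lt hr)))

theorem frobNorm_le_mul {a : ℝ≥0} (ha : 0 < a) {y : D}
    (h : ∀ r, D.FrobBound β w r x → D.FrobBound β w (a * r) y) :
    D.frobNorm β w y ≤ a * D.frobNorm β w x := by
  refine le_of_forall_gt_imp_ge_of_dense fun r hr => ?_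
  rw [← lt_div_iff₀' ha] at hr
  have := frobNorm_le (h _ (frobBound_of_frobNorm_lt hr))
  rwa [mul_div_cancel₀ _ ha.ne'] at this

theorem frobNorm_smul_le (hβ : IsUNorm (valuation (K := L)) β) (a : L) (x : D) :
    D.frobNorm β w (a • x) ≤ valuation a * D.frobNorm β w x := by
  by_cases ha : a = 0
  · rw [ha, zero_smul]
    exact (frobNorm_le (.self 0)).trans (hβ.map_zero.le.trans zero_le)
  · exact frobNorm_le_mul (pos_iff_ne_zero.2 ((Valuation.ne_zero_iff _).2 ha)) fun r h => h.smul a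

theorem frobNorm_smul (hβ : IsUNorm (valuation (K := L)) β) (a : L) (x : D) :
    D.frobNorm β w (a • x) = valuation a * D.frobNorm β w x := by
  refine le_antisymm (frobNorm_smul_le hβ a x) ?_
  by_cases ha : a = 0
  · rw [ha, map_zero, zero_mul]; exact zero_le
  have := frobNorm_smul_le (w := w) hβ a⁻¹ (a • x)
  rwa [inv_smul_smul₀ ha, map_inv₀,
    le_inv_mul_iff₀ (pos_iff_ne_zero.2 ((Valuation.ne_zero_iff _).2 ha))] at this

theorem frobNorm_frob (hw : 0 < w) (x : D) : D.frobNorm β w (D.frob x) ≤ w * D.frobNorm β w x :=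
  frobNorm_le_mul hw fun _ h => h.frob

/-- If the largest seminorm below `β` for which Frobenius shrinks vectors by `w` vanishes, then the
inverse of Frobenius grows strictly slower than `w⁻ᵐ`. -/
theorem exists_inverse_growth (S : CompleteSetting σ c) [Nontrivial D]
    (hβ : IsSplittableNorm (valuation (K := L)) β) (hw : 0 < w)
    (h : ∀ x, D.frobNorm β w x = 0) :
    ∃ κ : ℝ≥0, 1 < κ ∧ ∃ C : ℝ≥0, ∀ (k : ℕ) (x : D),
      β (D.frobEquiv.symm^[k] x) ≤ C * ((κ * w)⁻¹) ^ k * β x := by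
  obtain ⟨e, he⟩ := hβ.splittable
  have hepos : ∀ j, 0 < β (e j) := fun j => hβ.isUNorm.pos (e.ne_zero j)
  let N : ℕ → ℝ≥0 := fun k => univ.sup fun j => β (D.frobEquiv.symm^[k] (e j)) / β (e j)
  have hN : ∀ k j, β (D.frobEquiv.symm^[k] (e j)) ≤ N k * β (e j) := fun k j => by
    rw [← div_le_iff₀ (hepos j)]
    exact le_sup (f := fun j => β (D.frobEquiv.symm^[k] (e j)) / β (e j))
      (mem_univ j)
  have hsmul : ∀ (k : ℕ) (a : L) (x : D), β (D.frobEquiv.symm^[k] (a • x)) =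
      valuation a * β (D.frobEquiv.symm^[k] x) := by
    intro k
    induction k with
    | zero => intro a x; exact hβ.smul a x
    | succ k ih =>
      intro a x
      rw [iterate_succ_apply, frobEquiv_symm_smul, ih, valuation_symm_eq S,
        ← iterate_succ_apply]
  have hadd : ∀ (k : ℕ) (x y : D), D.frobEquiv.symm^[k] (x + y) =
      D.frobEquiv.symm^[k] x + D.frobEquiv.symm^[k] y :=
    iterate_map_add D.frobEquiv.symm
  let Φ : ℕ → D →+ D := fun k => AddMonoidHom.mk' (D.frobEquiv.symm^[k]) (hadd k)
  have hNx : ∀ k x, β (D.frobEquiv.symm^[k] x) ≤ N k * β x := by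
    intro k x
    change β (Φ k x) ≤ _
    conv_lhs => rw [← e.sum_repr x, map_sum]
    refine hβ.isUNorm.sum_le _ _ fun j _ => ?_
    change β (D.frobEquiv.symm^[k] _) ≤ _
    rw [hsmul]
    calc valuation (e.repr x j) * β (D.frobEquiv.symm^[k] (e j))
        ≤ valuation (e.repr x j) * (N k * β (e j)) := mul_le_mul_right (hN k j) _
      _ = N k * (valuation (e.repr x j) * β (e j)) := by ring
      _ ≤ _ := mul_le_mul_right (he.le x j) _
  have hbound : ∀ r x, D.FrobBound β w r x → ∃ M, ∀ k, M ≤ k →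
      ∃ i < M, β (D.frobEquiv.symm^[k] x) ≤ N (k - i) * (w ^ i)⁻¹ * r := by
    intro r x hx
    induction hx with
    | self x => exact ⟨1, fun k _ => ⟨0, one_pos, by simpa using hNx k x⟩⟩
    | mono h _ ih =>
      exact ih.imp fun M hM k hk => (hM k hk).imp fun i hi => ⟨hi.1, hi.2.trans (by gcongr)⟩
    | add _ _ ih ih' =>
      obtain ⟨M, hM⟩ := ih
      obtain ⟨M', hM'⟩ := ih'
      refine ⟨max M M', fun k hk => ?_⟩
      obtain ⟨i, hi, h⟩ := hM k ((le_max_left _ _).trans hk)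
      obtain ⟨i', hi', h'⟩ := hM' k ((le_max_right _ _).trans hk)
      rw [hadd]
      rcases le_max_iff.1 (hβ.isUNorm.add_le_max (D.frobEquiv.symm^[k] _) _) with h1 | h1
      · exact ⟨i, hi.trans_le (le_max_left _ _), h1.trans h⟩
      · exact ⟨i', hi'.trans_le (le_max_right _ _), h1.trans h'⟩
    | smul a _ ih =>
      refine ih.imp fun M hM k hk => (hM k hk).imp fun i hi => ⟨hi.1, ?_⟩
      rw [hsmul, mul_left_comm]
      exact mul_le_mul_right hi.2 _
    | frob _ ih =>
      obtain ⟨M, hM⟩ := ih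
      refine ⟨M + 1, fun k hk => ?_⟩
      obtain ⟨l, rfl⟩ := Nat.exists_eq_add_of_le' (le_of_add_le_right hk)
      obtain ⟨i, hi, h⟩ := hM l (by omega)
      refine ⟨i + 1, by omega, ?_⟩
      rw [iterate_succ_apply, ← frobEquiv_apply, AddEquiv.symm_apply_apply, Nat.add_sub_add_right]
      refine h.trans (le_of_eq ?_)
      field_simp
      ring
  choose m hm using fun j => hbound _ _
    (frobBound_of_frobNorm_lt ((h (e j)).trans_lt (half_pos (hepos j))))
  let M := univ.sup m + 1
  let κ : ℝ≥0 := 2 ^ ((M : ℝ)⁻¹)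
  have hM0 : (0 : ℝ) < M := by positivity
  have hκ : 1 < κ := NNReal.one_lt_rpow one_lt_two (inv_pos.2 hM0)
  have hκM : κ ^ M = 2 := by
    rw [← NNReal.rpow_natCast, ← NNReal.rpow_mul, inv_mul_cancel₀ hM0.ne', NNReal.rpow_one]
  let q : ℝ≥0 := (κ * w)⁻¹
  have hκ0 : 0 < κ := one_pos.trans hκ
  have hq : 0 < q := by positivity
  have hrec : ∀ k, M ≤ k → ∃ i < M, N k ≤ N (k - i) * (w ^ i)⁻¹ / 2 := by
    intro k hk
    obtain ⟨j, -, hj⟩ := exists_mem_eq_sup univ ⟨⟨0, finrank_pos⟩, mem_univ _⟩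
      fun j => β (D.frobEquiv.symm^[k] (e j)) / β (e j)
    have hmM : m j < M := Nat.lt_succ_of_le (le_sup (mem_univ j))
    obtain ⟨i, hi, h⟩ := hm j k (hmM.le.trans hk)
    refine ⟨i, hi.trans hmM, hj.le.trans ?_⟩
    rw [div_le_iff₀ (hepos j)]
    exact h.trans_eq (by ring)
  let C : ℝ≥0 := ∑ k ∈ Finset.range M, N k / q ^ k
  have hNC : ∀ k, N k ≤ C * q ^ k := by
    intro k
    induction k using Nat.strong_induction_on with
    | _ k ih =>
      rcases lt_or_ge k M with hk | hk
      · rw [← div_le_iff₀ (pow_pos hq k)]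
        exact single_le_sum (f := fun k => N k / q ^ k) (fun _ _ => zero_le)
          (mem_range.2 hk)
      · obtain ⟨i, hi, hle⟩ := hrec k hk
        rcases Nat.eq_zero_or_pos i with rfl | hi0
        · rw [Nat.sub_zero, pow_zero, inv_one, mul_one] at hle
          rw [show N k = 0 from by_contra fun h0 =>
            (NNReal.half_lt_self h0).not_ge hle]
          exact zero_le
        · have h1 := ih (k - i) (by omega)
          have hκi : κ ^ i ≤ 2 := hκM ▸ pow_le_pow_right₀ hκ.le hi.le
          have hqi : q ^ (k - i) * (w ^ i)⁻¹ = q ^ k * κ ^ i := by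
            have hk' : q ^ k = q ^ (k - i) * q ^ i := by
              rw [← pow_add, Nat.sub_add_cancel (hi.le.trans hk)]
            rw [hk', mul_assoc]
            congr 1
            simp only [q]
            rw [inv_pow, mul_pow]
            field_simp
          calc N k ≤ N (k - i) * (w ^ i)⁻¹ / 2 := hle
            _ ≤ C * q ^ (k - i) * (w ^ i)⁻¹ / 2 := by gcongr
            _ = C * q ^ k * (κ ^ i / 2) := by rw [mul_assoc C, hqi]; ring
            _ ≤ C * q ^ k * 1 := by
                gcongr
                rw [div_le_one two_pos]
                exact hκi
            _ = _ := mul_one _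
  exact ⟨κ, hκ, C, fun k x => (hNx k x).trans (mul_le_mul_left (hNC k) _)⟩

end Span

theorem CompleteSetting.dim_lt_of_frobNorm_eq_zero (S : CompleteSetting σ c) [Nontrivial D]
    {β : D → ℝ≥0} (hβ : IsSplittableNorm (valuation (K := L)) β) {s : ℝ}
    (h : ∀ x, D.frobNorm β (c ^ s) x = 0) : D.dim < s * finrank L D := by
  have hc0 : (0 : ℝ) < c := S.c_pos
  obtain ⟨κ, hκ, C, hC⟩ := exists_inverse_growth S hβ (rpow_pos S.c_pos) h
  obtain ⟨e, he⟩ := hβ.splittable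
  have hcs : 0 < (c : ℝ) ^ s := rpow_pos_of_pos hc0 _
  have h1 := he.le_pow_card hβ.isUNorm (q := (κ * c ^ s)⁻¹)
    (inv_pos.2 (mul_pos (one_pos.trans hκ) (rpow_pos S.c_pos))) (fun k i => hC k (e i))
    (a := (c : ℝ) ^ (-D.dim)) fun k => by
      have h6 := S.norm_det e (fun i => D.frobEquiv.symm^[k] (e i)) k
      have h7 : (fun i => D.frob^[k] (D.frobEquiv.symm^[k] (e i))) = e := funext fun i =>
        (Function.LeftInverse.iterate (fun x => D.frobEquiv.apply_symm_apply x) k) (e i)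
      rw [h7, Basis.det_self, norm_one] at h6
      rw [Real.rpow_neg hc0.le, inv_pow]
      exact eq_inv_of_mul_eq_one_right h6.symm
  rw [card_fin] at h1
  have h2 : (((κ * c ^ s)⁻¹ : ℝ≥0) : ℝ) ^ finrank L D < (c : ℝ) ^ (-(s * finrank L D)) := by
    rw [← neg_mul, Real.rpow_mul hc0.le, Real.rpow_natCast, Real.rpow_neg hc0.le]
    refine pow_lt_pow_left₀ ?_ (by positivity) finrank_pos.ne'
    push_cast
    exact inv_strictAnti₀ hcs (lt_mul_of_one_lt_left hcs (by exact_mod_cast hκ))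
  have h3 := (Real.rpow_lt_rpow_left_iff_of_base_lt_one hc0 S.c_lt_one).1 (h1.trans_lt h2)
  linarith

/-- An isocrystal of slope `s` none of whose subisocrystals has dimension less than `s` times its
rank is isoclinic: its Frobenius grows like `c ^ (s m)`. -/
theorem CompleteSetting.hasGrowth [CompleteSpace L] (S : CompleteSetting σ c) {s : ℝ}
    (hdim : D.dim = s * finrank L D)
    (hsub : ∀ X (h : D.IsSub X), s * finrank L X ≤ (D.sub X h).dim) : D.HasGrowth (c ^ s) := by
  induction hn : finrank L D using Nat.strong_induction_on generalizing D with
  | _ n ih =>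
    have hw : 0 < c ^ s := rpow_pos S.c_pos
    obtain ⟨β, hβ⟩ := D.exists_splittableNorm
    have h0 : ∀ x, D.frobNorm β (c ^ s) x ≤ 0 ↔ D.frobNorm β (c ^ s) x = 0 := fun x => nonpos_iff_eq_zero
    let W : Submodule L D :=
      { carrier := {x | D.frobNorm β (c ^ s) x = 0}
        add_mem' := fun hx hy => (h0 _).1 ((frobNorm_add _ _).trans (max_le hx.le hy.le))
        zero_mem' := (h0 _).1 ((frobNorm_le (.self 0)).trans hβ.isUNorm.map_zero.le)
        smul_mem' := fun a x hx =>
          (frobNorm_smul hβ.isUNorm a x).trans (by rw [Set.mem_ofPred.1 hx, mul_zero]) }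
    have hmemW : ∀ x, x ∈ W ↔ D.frobNorm β (c ^ s) x = 0 := fun x => Iff.rfl
    have hWφ : ∀ x ∈ W, D.frob x ∈ W := fun x hx => by
      exact (h0 _).1 ((frobNorm_frob hw x).trans (by rw [(hmemW x).1 hx, mul_zero]))
    have hW : D.IsSub W := isSub_of_le hWφ
    have hex := D.isExact_quot W hW
    -- `γ` induces a norm on the quotient by its kernel
    have hquot : (D.quot W hW).HasGrowth (c ^ s) := by
      let γ : D.quot W hW → ℝ≥0 := fun z =>
        D.frobNorm β (c ^ s) (Function.surjInv hex.surjective z)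
      have hγ : ∀ x, γ (D.quotMk W hW x) = D.frobNorm β (c ^ s) x := by
        have aux : ∀ x y, x - y ∈ W → D.frobNorm β (c ^ s) x ≤ D.frobNorm β (c ^ s) y := by
          intro x y hxy
          have := frobNorm_add (β := β) (w := c ^ s) (x - y) y
          rw [sub_add_cancel, (hmemW _).1 hxy] at this
          exact this.trans (max_le zero_le le_rfl)
        intro x
        have h1 := Function.surjInv_eq hex.surjective (D.quotMk W hW x)
        have h2 := (Submodule.Quotient.eq W).1 h1
        exact le_antisymm (aux _ _ h2) (aux _ _ (by rw [← neg_sub]; exact W.neg_mem h2))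
      refine hasGrowth_of_isUNorm S (γ := γ) ⟨fun z => ?_, fun a z => ?_, fun z z' => ?_⟩
        fun z => ?_
      · obtain ⟨x, rfl⟩ := hex.surjective z
        rw [hγ, ← hmemW]
        exact (Submodule.Quotient.mk_eq_zero W).symm
      · obtain ⟨x, rfl⟩ := hex.surjective z
        rw [← _root_.map_smul, hγ, hγ, frobNorm_smul hβ.isUNorm]
      · obtain ⟨x, rfl⟩ := hex.surjective z
        obtain ⟨x', rfl⟩ := hex.surjective z'
        rw [← map_add, hγ, hγ, hγ]
        exact frobNorm_add x x'
      · obtain ⟨x, rfl⟩ := hex.surjective z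
        rw [← hex.right, hγ, hγ]
        exact frobNorm_frob hw x
    by_cases hW0 : W = ⊥
    · refine hquot.of_injective (D.quotMk W hW) ?_ fun _ => rfl
      rw [← LinearMap.ker_eq_bot, ← hW0]
      exact W.ker_mkQ
    by_cases hW1 : W = ⊤
    · exfalso
      have hnt : Nontrivial D :=
        not_subsingleton_iff_nontrivial.1 fun _ => hW0 (Subsingleton.elim _ _)
      have := S.dim_lt_of_frobNorm_eq_zero hβ (s := s)
        fun x => (hmemW x).1 (by rw [hW1]; trivial)
      linarith
    have hdimadd := S.preservesVal.dim_add hex.injective hex.surjective hex.exact hex.left hex.right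
    have hWdim := hsub W hW
    have hQdim := S.le_dim_of_hasGrowth hquot
    have hrk' : (finrank L D : ℝ) = finrank L W + finrank L (D.quot W hW) := by
      exact_mod_cast hex.finrank
    have hWeq : (D.sub W hW).dim = s * finrank L W := by
      rw [hrk'] at hdim
      linarith
    have hsubW : (D.sub W hW).HasGrowth (c ^ s) := by
      refine ih _ ?_ hWeq (fun Y hY => ?_) rfl
      · exact hn ▸ Submodule.finrank_lt hW1
      · have hY' : D.IsSub (Y.map (D.subIncl W hW)) := hY.map fun _ => rfl
        rw [← S.preservesVal.dim_sub_sub hW hY hY']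
        have h1 := hsub _ hY'
        rwa [← LinearEquiv.finrank_eq (equivMapOfInjective (D.subIncl W hW)
          (D.subIncl_injective W hW) Y)] at h1
    exact S.hasGrowth_extension hw hex hsubW hquot

/-- All subisocrystals of an isoclinic isocrystal have its slope. -/
theorem CompleteSetting.dim_sub_eq [CompleteSpace L] (S : CompleteSetting σ c) {s : ℝ}
    (hdim : D.dim = s * finrank L D) (hsub : ∀ X (h : D.IsSub X), s * finrank L X ≤ (D.sub X h).dim)
    {X : Submodule L D} (h : D.IsSub X) : (D.sub X h).dim = s * finrank L X := by
  have hex := D.isExact_quot X h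
  have h1 := S.le_dim_of_hasGrowth
    ((S.hasGrowth hdim hsub).of_surjective (D.quotMk X h) hex.surjective hex.right)
  have h2 := S.preservesVal.dim_add hex.injective hex.surjective hex.exact hex.left hex.right
  have h3 : (finrank L D : ℝ) = finrank L X + finrank L (D.quot X h) := by
    exact_mod_cast hex.finrank
  rw [h2, h3] at hdim
  exact le_antisymm (by linarith) (hsub X h)

/-- The subisocrystals of a tensor product of isoclinic isocrystals. -/
theorem CompleteSetting.le_dim_sub_tensor [CompleteSpace L] (S : CompleteSetting σ c) {s t : ℝ}
    (hdim : D.dim = s * finrank L D) (hsub : ∀ X (h : D.IsSub X), s * finrank L X ≤ (D.sub X h).dim)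
    (hdim' : E.dim = t * finrank L E)
    (hsub' : ∀ X (h : E.IsSub X), t * finrank L X ≤ (E.sub X h).dim)
    {X : Submodule L (D.tensor E)} (h : (D.tensor E).IsSub X) :
    (s + t) * finrank L X ≤ ((D.tensor E).sub X h).dim := by
  have h1 := S.hasGrowth_tensor (S.hasGrowth hdim hsub) (S.hasGrowth hdim' hsub')
  rw [← NNReal.rpow_add S.c_pos.ne'] at h1
  exact S.le_dim_of_hasGrowth (h1.of_injective ((D.tensor E).subIncl X h)
    ((D.tensor E).subIncl_injective X h) fun _ => rfl)

end Isocrystal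

/-! ### Extension of filtrations to larger fields -/

section ExtNorm

variable {L : Type*} [Field L] {K : Type*} [Field K] [Algebra L K] {v : Valuation K ℝ≥0}
  {V V' : Type*} [AddCommGroup V] [Module L V] [AddCommGroup V'] [Module L V']
  {ι κ : Type*} [Fintype ι] [Fintype κ]
variable {N : V → ℝ≥0} {y : Basis ι L V}

variable (v) in
/-- The norm on `K ⊗ V` deduced from a norm `N` on `V` for the trivial absolute value; `y` is
an orthogonal basis for `N`. -/
def extNorm (y : Basis ι L V) (N : V → ℝ≥0) : K ⊗[L] V → ℝ≥0 :=
  ofBasis v (y.baseChange K) fun i => N (y i)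

theorem extNorm_basis (y : Basis ι L V) (N : V → ℝ≥0) (i : ι) :
    extNorm v y N (y.baseChange K i) = N (y i) := ofBasis_apply_basis _ _ _

theorem isSplittableNorm_extNorm (hN : IsUNorm (trivVal L) N)
    (y : Basis ι L V) : IsSplittableNorm v (extNorm v y N) :=
  isSplittableNorm_ofBasis _ fun i => hN.pos (y.ne_zero i)

theorem extNorm_le (hv : TrivialOn L v) (hN : IsUNorm (trivVal L) N)
    (hy : IsOrthogonalBasis (trivVal L) N y) (e : Basis κ L V)
    (x : K ⊗[L] V) : extNorm v y N x ≤ extNorm v e N x := by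
  have hs := isSplittableNorm_extNorm (v := v) hN y
  conv_lhs => rw [← (e.baseChange K).sum_repr x]
  refine hs.isUNorm.sum_le _ _ fun j _ => ?_
  rw [hs.smul]
  refine le_trans (mul_le_mul_right ?_ _) (le_sup
    (f := fun j => v ((e.baseChange K).repr x j) * N (e j)) (mem_univ j))
  refine Finset.sup_le fun i _ => ?_
  rw [Basis.baseChange_apply, Basis.baseChange_repr_tmul, Algebra.smul_def, mul_one]
  by_cases h0 : y.repr (e j) i = 0
  · rw [h0, map_zero, map_zero, zero_mul]; exact zero_le
  · have := hy.le (e j) i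
    rw [trivVal_apply h0, one_mul] at this
    rw [hv _ h0, one_mul]
    exact this

theorem extNorm_eq (hv : TrivialOn L v) (hN : IsUNorm (trivVal L) N)
    (hy : IsOrthogonalBasis (trivVal L) N y) {e : Basis κ L V}
    (he : IsOrthogonalBasis (trivVal L) N e) : extNorm v y N = extNorm v e N :=
  funext fun x => le_antisymm (extNorm_le hv hN hy e x) (extNorm_le hv hN he y x)

theorem extNorm_one_tmul (hv : TrivialOn L v) (hy : IsOrthogonalBasis (trivVal L) N y) (x : V) :
    extNorm v y N ((1 : K) ⊗ₜ[L] x) = N x := by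
  rw [hy x]
  unfold extNorm ofBasis
  refine sup_congr rfl fun i _ => ?_
  rw [Basis.baseChange_repr_tmul, Algebra.smul_def, mul_one]
  by_cases h0 : y.repr x i = 0
  · rw [h0, map_zero, map_zero, map_zero]
  · rw [trivVal_apply h0, hv _ h0]

theorem isOrthogonalBasis_extNorm (hv : TrivialOn L v) (hN : IsUNorm (trivVal L) N)
    (hy : IsOrthogonalBasis (trivVal L) N y) {e : Basis κ L V}
    (he : IsOrthogonalBasis (trivVal L) N e) :
    IsOrthogonalBasis v (extNorm v y N) (e.baseChange K) := by
  rw [extNorm_eq hv hN hy he]; exact isOrthogonalBasis_ofBasis _ _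

/-- The volume of the extended norm on a subspace which is defined over `L`. -/
theorem lv_extNorm_comp [FiniteDimensional L V] [FiniteDimensional L V'] (hv : TrivialOn L v)
    (hN : IsUNorm (trivVal L) N) (hy : IsOrthogonalBasis (trivVal L) N y) {i : V' →ₗ[L] V}
    (hi : Injective i) {μ : Type*} [Fintype μ] [DecidableEq μ] (b : Basis μ L V') :
    lv v (fun x => extNorm v y N (i.baseChange K x)) = lvol (trivVal L) b fun x => N (i x) := by
  classical
  let p := (range i).mkQ
  have hex : Exact i p := LinearMap.exact_map_mkQ_range i
  obtain ⟨b', hb'⟩ := exists_isExactBasis hi (mkQ_surjective _) hex b (finBasis L (V ⧸ range i))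
  obtain ⟨e, he, e₁, e₂, h⟩ := hb'.exists_adapted (hN.isSplittableNorm hy)
  have h1 := (h.baseChange (K := K)).orthogonal_inl (isOrthogonalBasis_extNorm (v := v) hv hN hy he)
  have h2 := h.orthogonal_inl he
  have hs := (isSplittableNorm_extNorm (v := v) hN y).comp (i.baseChange K)
    (baseChange_injective (K := K) hi)
  rw [← hv.lv_eq e₁, h1.lvol_eq hs.isUNorm, h2.lvol_trivVal (hN.comp i hi), Basis.det_self]
  simp only [map_one, coe_one, log_one, sub_zero]
  refine sum_congr rfl fun k _ => ?_
  rw [Basis.baseChange_apply, baseChange_tmul, extNorm_one_tmul hv hy]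

/-- Extension of scalars commutes with tensor products of filtrations. -/
theorem tensorNorm_extNorm {N' : V' → ℝ≥0}
    (hN : IsUNorm (trivVal L) N) (hN' : IsUNorm (trivVal L) N')
    (hy : IsOrthogonalBasis (trivVal L) N y)
    {y' : Basis κ L V'} (hy' : IsOrthogonalBasis (trivVal L) N' y') (x : K ⊗[L] (V ⊗[L] V')) :
    tensorNorm (extNorm v y N) (extNorm v y' N') (distribBaseChange L K V V' x) =
      extNorm v (y.tensorProduct y') (tensorNorm (K := L) N N') x := by
  rw [tensorNorm_eq_ofBasis (isSplittableNorm_extNorm hN y).isUNorm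
    (isSplittableNorm_extNorm hN' y').isUNorm (isOrthogonalBasis_ofBasis _ _)
    (isOrthogonalBasis_ofBasis _ _), ← baseChange_tensorProduct_map]
  refine sup_congr rfl fun k _ => ?_
  rw [Basis.map_repr, LinearEquiv.trans_apply, LinearEquiv.symm_apply_apply]
  refine congrArg₂ (· * ·) rfl ?_
  exact (congrArg₂ (· * ·) (extNorm_basis y N k.1) (extNorm_basis y' N' k.2)).trans
    (tensorNorm_basis hN hN' hy hy' k).symm

end ExtNorm

section FilNorm

variable {L : Type*} [Field L] {V : Type*} [AddCommGroup V] [Module L V] {ι : Type*} [Fintype ι]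
variable {f : ℝ → Submodule L V} {y : Basis ι L V} {s : ι → ℝ} {q : ℝ}

/-- The weight `exp (-q s)` attached to the label `s`. -/
def weight (q s : ℝ) : ℝ≥0 := toNNReal (exp (-(q * s)))

theorem weight_pos (q s : ℝ) : 0 < weight q s := toNNReal_pos.2 (exp_pos _)

theorem log_weight (q s : ℝ) : log (weight q s) = -(q * s) := by
  rw [weight, coe_toNNReal _ (exp_pos _).le, log_exp]

theorem weight_le_weight (hq : 0 < q) {s t : ℝ} : weight q s ≤ weight q t ↔ t ≤ s := by
  rw [weight, weight, Real.toNNReal_le_toNNReal_iff (exp_pos _).le, Real.exp_le_exp,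
    neg_le_neg_iff, mul_le_mul_iff_right₀ hq]

/-- The norm for the trivial absolute value attached to a labelled filtration: its balls are the
steps of the filtration. -/
def filNorm (q : ℝ) (y : Basis ι L V) (s : ι → ℝ) : V → ℝ≥0 :=
  ofBasis (trivVal L) y fun i => weight q (s i)

theorem isUNorm_filNorm (q : ℝ) (y : Basis ι L V) (s : ι → ℝ) :
    IsUNorm (trivVal L) (filNorm q y s) := isUNorm_ofBasis y fun _ => weight_pos _ _

theorem isOrthogonalBasis_filNorm (q : ℝ) (y : Basis ι L V) (s : ι → ℝ) :
    IsOrthogonalBasis (trivVal L) (filNorm q y s) y := isOrthogonalBasis_ofBasis _ _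

theorem isSplittableNorm_filNorm (q : ℝ) (y : Basis ι L V) (s : ι → ℝ) :
    IsSplittableNorm (trivVal L) (filNorm q y s) :=
  (isUNorm_filNorm q y s).isSplittableNorm (isOrthogonalBasis_filNorm q y s)

theorem IsLabelling.filNorm_le_iff (h : IsLabelling f y s) (hq : 0 < q) (t : ℝ) (x : V) :
    filNorm q y s x ≤ weight q t ↔ x ∈ f t := by
  rw [h t x, (isOrthogonalBasis_filNorm q y s).le_iff]
  refine forall_congr' fun i => ?_
  rw [filNorm, ofBasis_apply_basis]
  by_cases h0 : y.repr x i = 0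
  · simp [h0]
  · rw [trivVal_apply h0, one_mul, weight_le_weight hq]
    simp [h0]

/-- An orthogonal basis of the restriction of the norm to a subspace labels the induced
filtration. -/
theorem IsLabelling.comap
    (h : IsLabelling f y s) (hq : 0 < q) (X : Submodule L V) {κ : Type*} [Fintype κ]
    {w : Basis κ L X} (hw : IsOrthogonalBasis (trivVal L) (fun x : X => filNorm q y s x) w) :
    IsLabelling (fun t => (f t).comap X.subtype) w fun k => -log (filNorm q y s (w k)) / q := by
  intro t x
  rw [mem_comap, ← h.filNorm_le_iff hq]
  refine (hw.le_iff (x := x)).trans (forall_congr' fun i => ?_)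
  by_cases h0 : w.repr x i = 0
  · simp [h0]
  · have hpos : 0 < filNorm q y s (w i) :=
      (isUNorm_filNorm q y s).pos fun h' => w.ne_zero i (Subtype.ext h')
    have hpos' : (0 : ℝ) < filNorm q y s (w i) := hpos
    have hpos'' : (0 : ℝ) < (weight q t : ℝ≥0) := weight_pos q t
    have hlog := Real.log_le_log_iff hpos' hpos''
    rw [log_weight, NNReal.coe_le_coe, le_neg, mul_comm] at hlog
    rw [trivVal_apply h0, one_mul, le_div_iff₀ hq]
    exact ⟨fun h1 _ => hlog.2 h1, fun h1 => hlog.1 (h1 h0)⟩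

theorem IsDegree.le_lvol [FiniteDimensional L V] {P : Submodule L V → Prop}
    {d : Submodule L V → ℝ} (h : IsDegree P d)
    (hl : IsLabelling f y s) (hP : ∀ s, P (f s)) (hq : 0 < q) {ε : ℝ}
    (hslope : ∀ s X, P X → ⨆ u : Ioi s, f u ≤ X → X ≤ f s → d X - d (⨆ u : Ioi s, f u) ≤
        ε * s * (finrank L X - finrank L (⨆ u : Ioi s, f u : Submodule L V)))
    {X : Submodule L V} (hX : P X) {κ : Type*} [Fintype κ] [DecidableEq κ] (b : Basis κ L X) :
    q * d X ≤ -ε * lvol (trivVal L) b fun x : X => filNorm q y s x := by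
  have hs := (isSplittableNorm_filNorm q y s).comp X.subtype X.injective_subtype
  obtain ⟨w, hw⟩ := hs.exists_basis b
  have h1 := h.le_sum_labels hl hP hslope hX (hl.comap hq X hw)
  rw [← sum_div, Finset.sum_neg_distrib] at h1
  have h2 : lvol (trivVal L) b (fun x : X => filNorm q y s x) =
      ∑ k, log (filNorm q y s (w k)) := hw.lvol_trivVal hs.isUNorm b
  rw [h2]
  have h3 := mul_le_mul_of_nonneg_left h1 hq.le
  refine h3.trans (le_of_eq ?_)
  field_simp

end FilNorm

/-! ### The tensor product of two filtrations -/

section TensorSub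

variable {L : Type*} [Field L] {V V' : Type*} [AddCommGroup V] [Module L V] [AddCommGroup V']
  [Module L V'] {E E' : Type*} [AddCommGroup E] [Module L E] [AddCommGroup E'] [Module L E']

theorem map₂_inf_ker_map_le {P : V →ₗ[L] E} {P' : V' →ₗ[L] E'} {A : Submodule L V}
    {A' : Submodule L V'} (hP : A.map P = ⊤) (hP' : A'.map P' = ⊤) :
    Submodule.map₂ (TensorProduct.mk L V V') A A' ⊓ ker (TensorProduct.map P P') ≤
      Submodule.map₂ (TensorProduct.mk L V V') A (A' ⊓ ker P') ⊔
      Submodule.map₂ (TensorProduct.mk L V V') (A ⊓ ker P) A' := by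
  rintro w ⟨hw, hwk⟩
  rw [← A.range_subtype, ← A'.range_subtype, ← range_map] at hw
  obtain ⟨z, rfl⟩ := hw
  have hs : Surjective (P ∘ₗ A.subtype) := by rw [← range_eq_top, range_comp, range_subtype, hP]
  have hs' : Surjective (P' ∘ₗ A'.subtype) := by rw [← range_eq_top, range_comp, range_subtype, hP']
  have hz : z ∈ ker (TensorProduct.map (P ∘ₗ A.subtype) (P' ∘ₗ A'.subtype)) := by
    rw [mem_ker, TensorProduct.map_comp, LinearMap.comp_apply]; exact hwk
  rw [TensorProduct.map_ker (exact_subtype_ker_map _) hs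
    (exact_subtype_ker_map _) hs'] at hz
  have hr : ∀ {B : Submodule L V} {Q : V →ₗ[L] E}, range (B.subtype ∘ₗ
      (ker (Q ∘ₗ B.subtype)).subtype) ≤ B ⊓ ker Q := by
    rintro B Q _ ⟨x, rfl⟩
    exact ⟨x.1.2, x.2⟩
  have hr' : ∀ {B : Submodule L V'} {Q : V' →ₗ[L] E'}, range (B.subtype ∘ₗ
      (ker (Q ∘ₗ B.subtype)).subtype) ≤ B ⊓ ker Q := by
    rintro B Q _ ⟨x, rfl⟩
    exact ⟨x.1.2, x.2⟩
  obtain ⟨z1, ⟨u1, rfl⟩, z2, ⟨u2, rfl⟩, rfl⟩ := Submodule.mem_sup.1 hz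
  rw [map_add]
  refine Submodule.add_mem_sup ?_ ?_
  · rw [LinearMap.lTensor, ← LinearMap.comp_apply, ← TensorProduct.map_comp, LinearMap.comp_id]
    have h1 := mem_range_self (TensorProduct.map A.subtype
      (A'.subtype ∘ₗ (ker (P' ∘ₗ A'.subtype)).subtype)) u1
    rw [range_map, range_subtype] at h1
    exact Submodule.map₂_le_map₂_right hr' h1
  · rw [LinearMap.rTensor, ← LinearMap.comp_apply, ← TensorProduct.map_comp, LinearMap.comp_id]
    have h1 := mem_range_self (TensorProduct.map
      (A.subtype ∘ₗ (ker (P ∘ₗ A.subtype)).subtype) A'.subtype) u2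
    rw [range_map, range_subtype] at h1
    exact Submodule.map₂_le_map₂_left hr h1

/-- The subspace `∑ f c ⊗ f' c'` of the tensor product, the sum being over the pairs `(c, c')`
in `S`. -/
def tensorSub (f : ℝ → Submodule L V) (f' : ℝ → Submodule L V') (S : Set (ℝ × ℝ)) :
    Submodule L (V ⊗[L] V') :=
  ⨆ c : S, Submodule.map₂ (TensorProduct.mk L V V') (f c.1.1) (f' c.1.2)

theorem tensorSub_mono (f : ℝ → Submodule L V) (f' : ℝ → Submodule L V') {S T : Set (ℝ × ℝ)}
    (h : S ⊆ T) : tensorSub f f' S ≤ tensorSub f f' T :=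
  iSup_le fun c => le_iSup (fun c : T => Submodule.map₂ (TensorProduct.mk L V V') (f c.1.1)
    (f' c.1.2)) ⟨c, h c.2⟩

variable {ι ι' : Type*} [Fintype ι] [Fintype ι'] {f : ℝ → Submodule L V} {f' : ℝ → Submodule L V'}
  {y : Basis ι L V} {y' : Basis ι' L V'} {s : ι → ℝ} {s' : ι' → ℝ}

theorem tmul_mem_tensorSub (hl : IsLabelling f y s) (hl' : IsLabelling f' y' s') {S : Set (ℝ × ℝ)}
    {i : ι} {j : ι'} (h : (s i, s' j) ∈ S) : y i ⊗ₜ[L] y' j ∈ tensorSub f f' S :=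
  le_iSup (fun c : S => Submodule.map₂ (TensorProduct.mk L V V') (f c.1.1) (f' c.1.2))
    ⟨_, h⟩ (Submodule.apply_mem_map₂ _ (hl.mem_basis.2 le_rfl) (hl'.mem_basis.2 le_rfl))

theorem map₂_coordSub_le {S : Set ι} {S' : Set ι'} {W : Submodule L (V ⊗[L] V')}
    (h : ∀ i ∈ S, ∀ j ∈ S', y i ⊗ₜ[L] y' j ∈ W) :
    Submodule.map₂ (TensorProduct.mk L V V') (coordSub y S) (coordSub y' S') ≤ W := by
  refine Submodule.map₂_le.2 fun m hm n hn => ?_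
  rw [← y.sum_repr m, ← y'.sum_repr n, TensorProduct.mk_apply, TensorProduct.sum_tmul]
  refine W.sum_mem fun i _ => ?_
  rw [TensorProduct.tmul_sum]
  refine W.sum_mem fun j _ => ?_
  rw [TensorProduct.smul_tmul_smul]
  by_cases h0 : y.repr m i = 0
  · simp [h0]
  by_cases h1 : y'.repr n j = 0
  · simp [h1]
  exact W.smul_mem _ (h i (hm i h0) j (hn j h1))

/-- The tensor product of two labelled filtrations is labelled by the sums of the labels. -/
theorem IsLabelling.tensor (hl : IsLabelling f y s) (hl' : IsLabelling f' y' s') :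
    IsLabelling (fun a => ⨆ c : ℝ, Submodule.map₂ (TensorProduct.mk L V V') (f c) (f' (a - c)))
      (y.tensorProduct y') fun k => s k.1 + s' k.2 := by
  intro a x
  change _ ↔ x ∈ coordSub (y.tensorProduct y') {k | a ≤ s k.1 + s' k.2}
  refine Submodule.ext_iff.1 (le_antisymm ?_ ?_) x
  · refine iSup_le fun c => ?_
    rw [hl.eq_coordSub, hl'.eq_coordSub]
    refine map₂_coordSub_le fun i hi j hj => ?_
    rw [← Basis.tensorProduct_apply, basis_mem_coordSub]
    have h1 : c ≤ s i := hi
    have h2 : a - c ≤ s' j := hj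
    change a ≤ s i + s' j
    linarith
  · refine coordSub_le fun k hk => ?_
    have hk' : a ≤ s k.1 + s' k.2 := hk
    rw [Basis.tensorProduct_apply']
    refine le_iSup (fun c : ℝ => Submodule.map₂ (TensorProduct.mk L V V') (f c) (f' (a - c)))
      (s k.1) (Submodule.apply_mem_map₂ _ (hl.mem_basis.2 le_rfl) (hl'.mem_basis.2 ?_))
    linarith

end TensorSub

section AdaptedBasis

variable {L : Type*} [Field L] {K : Type*} [Field K] [Algebra L K] {v : Valuation K ℝ≥0}
  {V : Type*} [AddCommGroup V] [Module L V] [FiniteDimensional L V] {ι : Type*} [Fintype ι]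

theorem IsLabelling.one_tmul_mem {f : ℝ → Submodule L V} {y : Basis ι L V} {s : ι → ℝ}
    (h : IsLabelling f y s) {c : ℝ} {x : V} (hx : x ∈ f c) :
    (1 : K) ⊗ₜ[L] x ∈ coordSub (y.baseChange K) {i | c ≤ s i} := by
  intro i hi
  rw [Basis.baseChange_repr_tmul] at hi
  exact (h c x).1 hx i fun h0 => hi (by rw [h0, zero_smul])

theorem IsLabelling.mem_range_baseChange {f : ℝ → Submodule L V} {y : Basis ι L V}
    {s : ι → ℝ} (h : IsLabelling f y s) {c : ℝ} {x : K ⊗[L] V}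
    (hx : x ∈ coordSub (y.baseChange K) {i | c ≤ s i}) :
    x ∈ range ((f c).subtype.baseChange K) := by
  refine coordSub_le (fun i hi => ?_) hx
  refine ⟨1 ⊗ₜ ⟨y i, h.mem_basis.2 hi⟩, ?_⟩
  rw [baseChange_tmul, Basis.baseChange_apply]
  rfl

/-- Over `K`, a norm and a filtration defined over `L` have a common adapted basis, with the
same labels. -/
theorem exists_orthogonal_labelled (y : Basis ι L V)
    (s : ι → ℝ) {α : K ⊗[L] V → ℝ≥0} (hα : IsSplittableNorm v α) :
    ∃ (e : Basis ι K (K ⊗[L] V)) (r : ι → ℝ), IsOrthogonalBasis v α e ∧ (∀ i, r i ∈ Set.range s) ∧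
      ∀ c, coordSub (y.baseChange K) {i | c ≤ s i} = coordSub e {i | c ≤ r i} := by
  have hN := isSplittableNorm_filNorm (L := K) 1 (y.baseChange K) s
  have hN' := isUNorm_filNorm (L := K) 1 (y.baseChange K) s
  have hO := isOrthogonalBasis_filNorm (L := K) 1 (y.baseChange K) s
  have hval : ∀ x, x ≠ 0 → ∃ i, filNorm 1 (y.baseChange K) s x = weight 1 (s i) := by
    intro x hx
    obtain ⟨i, hi, h⟩ := hO.exists_eq hN' hx
    exact ⟨i, by rw [h, trivVal_apply hi, one_mul, filNorm, ofBasis_apply_basis]⟩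
  obtain ⟨e, he, he'⟩ := exists_common_basis_trivVal hα hN' (Set.Finite.subset
    (Set.finite_range (fun o : Option ι => o.elim 0 fun i => weight 1 (s i))) (by
      rintro _ ⟨x, rfl⟩
      by_cases hx : x = 0
      · exact ⟨none, by rw [hx, hN'.map_zero]; rfl⟩
      · obtain ⟨i, hi⟩ := hval x hx
        exact ⟨some i, hi.symm⟩)) (y.baseChange K)
  choose k hk using fun i => hval (e i) (e.ne_zero i)
  have hlab : IsLabelling (fun c => coordSub (y.baseChange K) {i | c ≤ s i}) (y.baseChange K) s :=
    fun c x => Iff.rfl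
  refine ⟨e, fun i => s (k i), he, fun i => ⟨_, rfl⟩, fun c => Submodule.ext fun x => ?_⟩
  rw [← hlab.filNorm_le_iff one_pos c x, he'.le_iff, mem_coordSub]
  refine forall_congr' fun i => ?_
  by_cases h0 : e.repr x i = 0
  · simp [h0]
  · rw [trivVal_apply h0, one_mul, hk, weight_le_weight one_pos]
    simp [h0]

end AdaptedBasis

section TensorQuotient

variable {L : Type*} [Field L] {K : Type*} [Field K] [Algebra L K] {v : Valuation K ℝ≥0}
  {V V' : Type*} [AddCommGroup V] [Module L V] [AddCommGroup V'] [Module L V']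
  {E E' : Type*} [AddCommGroup E] [Module L E] [AddCommGroup E'] [Module L E']

theorem distribBaseChange_map (P : V →ₗ[L] E) (P' : V' →ₗ[L] E') (x : K ⊗[L] (V ⊗[L] V')) :
    distribBaseChange L K E E' ((TensorProduct.map P P').baseChange K x) =
    TensorProduct.map (P.baseChange K) (P'.baseChange K) (distribBaseChange L K V V' x) := by
  induction x using TensorProduct.induction_on with
  | zero => simp
  | add x y hx hy => rw [map_add, map_add, hx, hy, map_add, map_add]
  | tmul a z =>
    induction z using TensorProduct.induction_on with
    | zero => simp
    | add x y hx hy =>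
    rw [tmul_add, map_add, map_add, hx, hy, map_add, map_add]
    | tmul m n =>
      rw [baseChange_tmul, map_tmul, distribBaseChange_tmul, distribBaseChange_tmul, map_tmul,
        baseChange_tmul, baseChange_tmul]

variable [FiniteDimensional L V] [FiniteDimensional L V'] [FiniteDimensional L E]
  [FiniteDimensional L E']
  {ι ι' : Type*} [Fintype ι] [Fintype ι'] {f : ℝ → Submodule L V} {f' : ℝ → Submodule L V'}
  {y : Basis ι L V} {y' : Basis ι' L V'} {s : ι → ℝ} {s' : ι' → ℝ}
  {α : K ⊗[L] V → ℝ≥0} {α' : K ⊗[L] V' → ℝ≥0} {γ : K ⊗[L] E → ℝ≥0} {γ' : K ⊗[L] E' → ℝ≥0}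

/-- Extension of scalars of a subspace generated by tensor products of steps of the filtrations
lies in the span of the corresponding products of adapted basis vectors. -/
theorem distribBaseChange_mem_coordSub {e : Basis ι K (K ⊗[L] V)}
    {e' : Basis ι' K (K ⊗[L] V')} {r : ι → ℝ} {r' : ι' → ℝ}
    (hl : IsLabelling f y s) (hl' : IsLabelling f' y' s')
    (he : ∀ c, coordSub (y.baseChange K) {i | c ≤ s i} = coordSub e {i | c ≤ r i})
    (he' : ∀ c, coordSub (y'.baseChange K) {i | c ≤ s' i} = coordSub e' {i | c ≤ r' i})
    {T : Set (ℝ × ℝ)} {S : Set (ι × ι')}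
    (hS : ∀ c ∈ T, ∀ i j, c.1 ≤ r i → c.2 ≤ r' j → (i, j) ∈ S) {Z : Submodule L (V ⊗[L] V')}
    (hZ : Z = tensorSub f f' T) (x : K ⊗[L] Z) :
    distribBaseChange L K V V' (Z.subtype.baseChange K x) ∈ coordSub (e.tensorProduct e') S := by
  induction x using TensorProduct.induction_on with
  | zero => rw [map_zero, map_zero]; exact Submodule.zero_mem _
  | add x y hx hy => rw [map_add, map_add]; exact Submodule.add_mem _ hx hy
  | tmul a z =>
    obtain ⟨z, hz⟩ := z
    rw [baseChange_tmul, Submodule.subtype_apply]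
    let B : Submodule L (V ⊗[L] V') :=
      { carrier := {z | distribBaseChange L K V V' (1 ⊗ₜ z) ∈ coordSub (e.tensorProduct e') S}
        add_mem' := fun ha hb => by
          rw [Set.mem_ofPred, tmul_add, map_add]
          exact Submodule.add_mem _ ha hb
        zero_mem' := by
          rw [Set.mem_ofPred, tmul_zero, map_zero]
          exact Submodule.zero_mem _
        smul_mem' := fun c x hx => by
          rw [Set.mem_ofPred, TensorProduct.tmul_smul, ← algebraMap_smul K c, map_smul]
          exact Submodule.smul_mem _ _ hx }
    have hg : Z ≤ B := by
      rw [hZ]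
      refine iSup_le fun c => Submodule.map₂_le.2 fun m hm n hn => ?_
      change distribBaseChange L K V V' (1 ⊗ₜ (m ⊗ₜ n)) ∈
        coordSub (e.tensorProduct e') S
      rw [distribBaseChange_tmul]
      have h1 := hl.one_tmul_mem (K := K) hm
      have h2 := hl'.one_tmul_mem (K := K) hn
      rw [he] at h1
      rw [he'] at h2
      rintro ⟨i, j⟩ hij
      rw [Basis.tensorProduct_repr_tmul_apply] at hij
      exact hS c c.2 i j (h1 i fun h0 => hij (by rw [h0, smul_zero]))
        (h2 j fun h0 => hij (by rw [h0, zero_smul]))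
    rw [← mul_one a, ← smul_eq_mul, ← smul_tmul', map_smul]
    exact Submodule.smul_mem _ _ (hg hz)

/-- The data needed to present `E` as the quotient of the step `A` of a filtration on `V`: the
linear map `P` is defined on all of `V`, kills `B` and identifies `A / B` with `E`, and `γ` is the
quotient norm of `α`. -/
structure IsNormedQuotient (A B : Submodule L V) (P : V →ₗ[L] E) (α : K ⊗[L] V → ℝ≥0)
    (γ : K ⊗[L] E → ℝ≥0) : Prop where
  map_eq_top : A.map P = ⊤
  inf_ker : A ⊓ ker P = B
  le : ∀ x ∈ range (A.subtype.baseChange K), γ (P.baseChange K x) ≤ α x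
  attained : ∀ z, ∃ x ∈ range (A.subtype.baseChange K), P.baseChange K x = z ∧ α x = γ z

/-- The pairs `(c, c')` of labels lying in `T` come before the pair `(c₀, c₀')`: they are greater
in one of the coordinates, and all pairs greater than `(c₀, c₀')` or than an element of `T`
belong to `T`. -/
structure Precedes (s : ι → ℝ) (s' : ι' → ℝ) (T : Set (ℝ × ℝ)) (c₀ c₀' : ℝ) : Prop where
  lt : ∀ c ∈ T, c₀ < c.1 ∨ c₀' < c.2
  mem : ∀ i j, c₀ ≤ s i → c₀' ≤ s' j → (c₀ < s i ∨ c₀' < s' j) → (s i, s' j) ∈ T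
  upper : ∀ c ∈ T, ∀ i j, c.1 ≤ s i → c.2 ≤ s' j → (s i, s' j) ∈ T

variable {c₀ c₀' : ℝ} {P : V →ₗ[L] E} {P' : V' →ₗ[L] E'} {T : Set (ℝ × ℝ)}

theorem IsNormedQuotient.apply_eq_zero (hP : IsNormedQuotient (f c₀) (⨆ u : Ioi c₀, f u) P α γ)
    {c : ℝ} (hc : c₀ < c) {x : V} (hx : x ∈ f c) : P x = 0 := by
  have h1 := le_iSup (fun u : Ioi c₀ => f u) ⟨_, hc⟩ hx
  rw [← hP.inf_ker] at h1
  exact h1.2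

theorem IsNormedQuotient.baseChange_apply_eq_zero
    (hP : IsNormedQuotient (f c₀) (⨆ u : Ioi c₀, f u) P α γ) {c : ℝ} (hc : c₀ < c) {x : K ⊗[L] V}
    (hx : x ∈ range ((f c).subtype.baseChange K)) : P.baseChange K x = 0 := by
  obtain ⟨w, rfl⟩ := hx
  rw [baseChange_tri (k := 0) fun x => hP.apply_eq_zero hc x.2, LinearMap.baseChange_zero,
    LinearMap.zero_apply]

theorem tensorSub_le_ker (hP : IsNormedQuotient (f c₀) (⨆ u : Ioi c₀, f u) P α γ)
    (hP' : IsNormedQuotient (f' c₀') (⨆ u : Ioi c₀', f' u) P' α' γ') (hT : Precedes s s' T c₀ c₀') :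
    tensorSub f f' T ≤ ker (TensorProduct.map P P') := by
  refine iSup_le fun c => Submodule.map₂_le.2 fun m hm n hn => ?_
  rw [mem_ker, TensorProduct.mk_apply, map_tmul]
  rcases hT.lt c c.2 with h | h
  · rw [hP.apply_eq_zero h hm, TensorProduct.zero_tmul]
  · rw [hP'.apply_eq_zero h hn, tmul_zero]

theorem tensorSub_insert (T : Set (ℝ × ℝ)) (c : ℝ × ℝ) : tensorSub f f' (insert c T) =
      tensorSub f f' T ⊔ Submodule.map₂ (TensorProduct.mk L V V') (f c.1) (f' c.2) := by
  apply le_antisymm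
  · refine iSup_le ?_
    rintro ⟨c', rfl | hc'⟩
    · exact le_sup_right
    · exact le_sup_of_le_left (le_iSup (fun c : T =>
        Submodule.map₂ (TensorProduct.mk L V V') (f c.1.1) (f' c.1.2)) ⟨c', hc'⟩)
  · exact sup_le (tensorSub_mono f f' (Set.subset_insert _ _)) (le_iSup (fun c : ↥(insert c T) =>
      Submodule.map₂ (TensorProduct.mk L V V') (f c.1.1) (f' c.1.2)) ⟨c, Set.mem_insert _ _⟩)

/-- The quotient of two consecutive steps of the filtration by the subspaces `tensorSub` is the
tensor product of the graded pieces. -/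
theorem tensorSub_insert_inf_ker (hl : IsLabelling f y s) (hl' : IsLabelling f' y' s')
    (hP : IsNormedQuotient (f c₀) (⨆ u : Ioi c₀, f u) P α γ)
    (hP' : IsNormedQuotient (f' c₀') (⨆ u : Ioi c₀', f' u) P' α' γ') (hT : Precedes s s' T c₀ c₀') :
    tensorSub f f' (insert (c₀, c₀') T) ⊓ ker (TensorProduct.map P P') = tensorSub f f' T := by
  have hle := tensorSub_le_ker hP hP' hT
  rw [tensorSub_insert, sup_inf_assoc_of_le _ hle, sup_eq_left]
  refine (map₂_inf_ker_map_le hP.map_eq_top hP'.map_eq_top).trans ?_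
  rw [hP.inf_ker, hP'.inf_ker, hl.mem_iSup_Ioi, hl'.mem_iSup_Ioi, hl.eq_coordSub, hl'.eq_coordSub]
  refine sup_le (map₂_coordSub_le fun i hi j hj => ?_) (map₂_coordSub_le fun i hi j hj => ?_)
  · have hj' : c₀' < s' j := hj
    exact tmul_mem_tensorSub hl hl' (hT.mem i j hi hj'.le (Or.inr hj'))
  · have hi' : c₀ < s i := hi
    exact tmul_mem_tensorSub hl hl' (hT.mem i j hi'.le hj (Or.inl hi'))

/-- The tensor product of two quotient norms is the quotient norm. -/
theorem isNormedQuotient_tensor (hα : IsSplittableNorm v α) (hα' : IsSplittableNorm v α')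
    (hγ : IsSplittableNorm v γ) (hγ' : IsSplittableNorm v γ')
    (hl : IsLabelling f y s) (hl' : IsLabelling f' y' s')
    (hP : IsNormedQuotient (f c₀) (⨆ u : Ioi c₀, f u) P α γ)
    (hP' : IsNormedQuotient (f' c₀') (⨆ u : Ioi c₀', f' u) P' α' γ') (hT : Precedes s s' T c₀ c₀') :
    IsNormedQuotient (tensorSub f f' (insert (c₀, c₀') T)) (tensorSub f f' T)
      (TensorProduct.map P P') (fun x => tensorNorm α α' (distribBaseChange L K V V' x))
      fun x => tensorNorm γ γ' (distribBaseChange L K E E' x) := by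
  have hle : ∀ x ∈ range ((tensorSub f f' (insert (c₀, c₀') T)).subtype.baseChange K),
      tensorNorm γ γ' (distribBaseChange L K E E'
        ((TensorProduct.map P P').baseChange K x)) ≤
      tensorNorm α α' (distribBaseChange L K V V' x) := by
    rintro _ ⟨x, rfl⟩
    obtain ⟨e, r, he, hr, her⟩ := exists_orthogonal_labelled y s hα
    obtain ⟨e', r', he', hr', her'⟩ := exists_orthogonal_labelled y' s' hα'
    have hmem := distribBaseChange_mem_coordSub hl hl' her her'
      (T := insert (c₀, c₀') T) (S := {k | (r k.1, r' k.2) ∈ T ∨ (c₀ ≤ r k.1 ∧ c₀' ≤ r' k.2)})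
      (by
        rintro c (rfl | hc) i j hi hj
        · exact Or.inr ⟨hi, hj⟩
        · obtain ⟨i', hi'⟩ := hr i
          obtain ⟨j', hj'⟩ := hr' j
          refine Or.inl ?_
          change (r i, r' j) ∈ T
          rw [← hi'] at hi ⊢
          rw [← hj'] at hj ⊢
          exact hT.upper c hc i' j' hi hj) rfl x
    rw [distribBaseChange_map]
    set z := distribBaseChange L K V V'
      (baseChange K (tensorSub f f' (insert (c₀, c₀') T)).subtype x) with hz
    rw [tensorNorm_eq_ofBasis hα.isUNorm hα'.isUNorm he he']
    conv_lhs => rw [← (e.tensorProduct e').sum_repr z, map_sum]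
    have hγγ := hγ.tensorNorm hγ'
    refine hγγ.isUNorm.sum_le _ _ fun k _ => ?_
    rw [map_smul, hγγ.smul, Basis.tensorProduct_apply', map_tmul]
    refine le_trans ?_ (le_sup
      (f := fun k => v ((e.tensorProduct e').repr z k) * (α (e k.1) * α' (e' k.2)))
      (mem_univ k))
    by_cases h0 : (e.tensorProduct e').repr z k = 0
    · rw [h0, map_zero, zero_mul, zero_mul]
    refine mul_le_mul_right ?_ _
    have hin : ∀ c, c ≤ r k.1 → e k.1 ∈ range ((f c).subtype.baseChange K) :=
      fun c hc => hl.mem_range_baseChange (by rw [her, basis_mem_coordSub]; exact hc)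
    have hin' : ∀ c, c ≤ r' k.2 → e' k.2 ∈ range ((f' c).subtype.baseChange K) :=
      fun c hc => hl'.mem_range_baseChange (by rw [her', basis_mem_coordSub]; exact hc)
    rcases hmem k h0 with h | h
    · rcases hT.lt _ h with h | h
      · rw [hP.baseChange_apply_eq_zero h (hin _ le_rfl), TensorProduct.zero_tmul,
          hγγ.isUNorm.map_zero]
        exact zero_le
      · rw [hP'.baseChange_apply_eq_zero h (hin' _ le_rfl), tmul_zero, hγγ.isUNorm.map_zero]
        exact zero_le
    · exact (tensorNorm_tmul_le _ _).trans
        (mul_le_mul' (hP.le _ (hin _ h.1)) (hP'.le _ (hin' _ h.2)))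
  refine ⟨?_, tensorSub_insert_inf_ker hl hl' hP hP' hT, hle, fun z => ?_⟩
  · rw [eq_top_iff, tensorSub_insert, Submodule.map_sup]
    refine le_sup_of_le_right ?_
    rintro w -
    induction w using TensorProduct.induction_on with
    | zero => exact Submodule.zero_mem _
    | add a b ha hb => exact Submodule.add_mem _ ha hb
    | tmul a b =>
      obtain ⟨a', ha', rfl⟩ : a ∈ (f c₀).map P := by rw [hP.map_eq_top]; trivial
      obtain ⟨b', hb', rfl⟩ : b ∈ (f' c₀').map P' := by rw [hP'.map_eq_top]; trivial
      exact ⟨a' ⊗ₜ b', Submodule.apply_mem_map₂ _ ha' hb', map_tmul _ _ _ _⟩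
  · obtain ⟨u, hu⟩ := hγ.exists_basis ((finBasis L E).baseChange K)
    obtain ⟨u', hu'⟩ := hγ'.exists_basis ((finBasis L E').baseChange K)
    choose w hwA hwP hw using fun i => hP.attained (u i)
    choose w' hwA' hwP' hw' using fun i => hP'.attained (u' i)
    have hαα := hα.tensorNorm hα'
    set t := distribBaseChange L K E E' z with ht
    let X : (K ⊗[L] V) ⊗[K] (K ⊗[L] V') :=
      ∑ k, (u.tensorProduct u').repr t k • (w k.1 ⊗ₜ[K] w' k.2)
    let d := distribBaseChange L K V V'
    have hX : TensorProduct.map (P.baseChange K) (P'.baseChange K) X = t := by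
      conv_rhs => rw [← (u.tensorProduct u').sum_repr t]
      rw [map_sum]
      refine sum_congr rfl fun k _ => ?_
      rw [map_smul, map_tmul, hwP, hwP', Basis.tensorProduct_apply']
    have hXP : (TensorProduct.map P P').baseChange K (d.symm X) = z := by
      apply (distribBaseChange L K E E').injective
      rw [distribBaseChange_map]
      change TensorProduct.map _ _ (d (d.symm X)) = _
      rw [LinearEquiv.apply_symm_apply, hX]
    have hXmem : d.symm X ∈
        range ((tensorSub f f' (insert (c₀, c₀') T)).subtype.baseChange K) := by
      rw [map_sum]
      refine Submodule.sum_mem _ fun k _ => ?_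
      rw [map_smul]
      refine Submodule.smul_mem _ _ ?_
      obtain ⟨x, hx⟩ := hwA k.1
      obtain ⟨x', hx'⟩ := hwA' k.2
      let j : (f c₀ ⊗[L] f' c₀') →ₗ[L] tensorSub f f' (insert (c₀, c₀') T) :=
        (TensorProduct.map (f c₀).subtype (f' c₀').subtype).codRestrict _ fun z => by
          rw [tensorSub_insert]
          refine Submodule.mem_sup_right ?_
          have := mem_range_self (TensorProduct.map (f c₀).subtype (f' c₀').subtype) z
          rwa [range_map, range_subtype, range_subtype] at this
      refine ⟨j.baseChange K ((distribBaseChange L K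
        (f c₀) (f' c₀')).symm (x ⊗ₜ x')), ?_⟩
      rw [baseChange_tri (k := TensorProduct.map (f c₀).subtype (f' c₀').subtype) fun _ => by rfl]
      apply d.injective
      rw [LinearEquiv.apply_symm_apply]
      change distribBaseChange L K V V' _ = _
      rw [distribBaseChange_map, LinearEquiv.apply_symm_apply, map_tmul, hx, hx']
    refine ⟨d.symm X, hXmem, hXP, le_antisymm ?_ ?_⟩
    · change tensorNorm α α' (d (d.symm X)) ≤ _
      rw [LinearEquiv.apply_symm_apply, tensorNorm_eq_ofBasis hγ.isUNorm hγ'.isUNorm hu hu']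
      refine hαα.isUNorm.sum_le _ _ fun k _ => ?_
      rw [hαα.smul]
      refine le_trans (mul_le_mul_right ((tensorNorm_tmul_le _ _).trans ?_) _) (le_sup
        (f := fun k => v ((u.tensorProduct u').repr t k) * (γ (u k.1) * γ' (u' k.2)))
        (mem_univ k))
      rw [hw, hw']
    · have := hle _ hXmem
      rw [hXP] at this
      exact this

end TensorQuotient

namespace Isocrystal

section TensorChain

variable {L : Type*} [NormedField L] {σ : L ≃+* L} {K : Type*} [Field K] [Algebra L K]
  {v : Valuation K ℝ≥0} {π : K} {D D' : Isocrystal σ} {α : K ⊗[L] D → ℝ≥0} {α' : K ⊗[L] D' → ℝ≥0}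
  {f : ℝ → Submodule L D} {f' : ℝ → Submodule L D'}

theorem exists_isNormedQuotient_gr (hα : IsSplittableNorm v α) (hf : D.IsFiltration f) (c : ℝ) :
    ∃ P : D →ₗ[L] gr hf c, (∀ (x : D) (hx : x ∈ f c), P x = grMk hf c ⟨x, hx⟩) ∧
      IsNormedQuotient (f c) (⨆ u : Ioi c, f u) P α (grNorm α hf c) := by
  obtain ⟨P, hP⟩ := LinearMap.exists_extend (p := f c) (V' := gr hf c) (grMk hf c)
  have hP' : ∀ (x : D) (hx : x ∈ f c), P x = grMk hf c ⟨x, hx⟩ := fun x hx =>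
    LinearMap.congr_fun hP ⟨x, hx⟩
  obtain ⟨-, h1, h2⟩ := grNorm_attained hα hf c
  have htri : ∀ x : K ⊗[L] (D.sub (f c) (hf.isSub c)),
      P.baseChange K ((D.subIncl (f c) (hf.isSub c)).baseChange K x) =
        (grMk hf c).baseChange K x := fun x => baseChange_tri (fun z => hP' z.1 z.2) x
  refine ⟨P, hP', ?_, ?_, ?_, fun z => ?_⟩
  · rw [eq_top_iff]
    rintro z -
    obtain ⟨x, rfl⟩ := grMk_surjective hf c z
    exact ⟨x.1, x.2, hP' x.1 x.2⟩
  · have hk := ker_grMk hf c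
    ext x
    constructor
    · rintro ⟨hx, hxk⟩
      have h3 : (⟨x, hx⟩ : D.sub (f c) (hf.isSub c)) ∈ ker (grMk hf c) := (hP' x hx).symm.trans hxk
      exact hk.le h3
    · intro hx
      have hx' : x ∈ f c := hf.filPlus_le c hx
      have h3 : (⟨x, hx'⟩ : D.sub (f c) (hf.isSub c)) ∈ ker (grMk hf c) := hk.ge hx
      exact ⟨hx', (hP' x hx').trans h3⟩
  · rintro _ ⟨x, rfl⟩
    exact (congrArg (grNorm α hf c) (htri x)).le.trans (h1 x)
  · obtain ⟨x, hx1, hx2⟩ := h2 z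
    exact ⟨_, ⟨x, rfl⟩, (htri x).trans hx1, hx2⟩

theorem isSub_map₂ {X : Submodule L D} {X' : Submodule L D'} (hX : D.IsSub X) (hX' : D'.IsSub X') :
    (D.tensor D').IsSub (Submodule.map₂ (TensorProduct.mk L D D') X X' :
      Submodule L (D.tensor D')) := by
  apply le_antisymm
  · rw [Submodule.map_le_iff_le_comap]
    refine Submodule.map₂_le.2 fun m hm n hn => ?_
    exact Submodule.apply_mem_map₂ (TensorProduct.mk L D D') (hX.mem hm) (hX'.mem hn)
  · refine Submodule.map₂_le.2 fun m hm n hn => ?_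
    rw [← hX] at hm
    rw [← hX'] at hn
    obtain ⟨m', hm', rfl⟩ := hm
    obtain ⟨n', hn', rfl⟩ := hn
    exact ⟨tmul D D' m' n', Submodule.apply_mem_map₂ (TensorProduct.mk L D D') hm' hn', rfl⟩

theorem isSub_tensorSub (hf : ∀ c, D.IsSub (f c)) (hf' : ∀ c, D'.IsSub (f' c))
    (T : Set (ℝ × ℝ)) : (D.tensor D').IsSub (tensorSub f f' T : Submodule L (D ⊗[L] D')) :=
  IsSub.iSup (D := D.tensor D') fun c : T => isSub_map₂ (hf c.1.1) (hf' c.1.2)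

variable {ι ι' : Type*} [Fintype ι] [Fintype ι'] {y : Basis ι L D}
  {y' : Basis ι' L D'} {s : ι → ℝ} {s' : ι' → ℝ}

/-- If the tensor product of the graded pieces of `f` and `f'` at `c` and `c'` has slope `a`,
so has the corresponding subquotient of `D ⊗ D'`. -/
theorem Setting.tensorSub_slope (S : Setting σ v π) (hα : IsSplittableNorm v α)
    (hα' : IsSplittableNorm v α') (hf : D.IsFiltration f) (hf' : D'.IsFiltration f')
    (hl : IsLabelling f y s) (hl' : IsLabelling f' y' s') {c c' a : ℝ}
    (hgr : ((gr hf c).tensor (gr hf' c')).HasSlope v π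
      ((gr hf c).tensorNorm (gr hf' c') (grNorm α hf c) (grNorm α' hf' c')) a)
    {T : Set (ℝ × ℝ)} (hT : Precedes s s' T c c') {Z Z' : Submodule L (D.tensor D')}
    (hZ : Z = tensorSub f f' T) (hZ' : Z' = tensorSub f f' (insert (c, c') T)) :
    (∀ X, (D.tensor D').IsSub X → Z ≤ X → X ≤ Z' →
      (D.tensor D').subDeg v π (D.tensorNorm D' α α') X -
        (D.tensor D').subDeg v π (D.tensorNorm D' α α') Z ≤ a * (finrank L X - finrank L Z)) ∧
      (D.tensor D').subDeg v π (D.tensorNorm D' α α') Z' -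
        (D.tensor D').subDeg v π (D.tensorNorm D' α α') Z = a * (finrank L Z' - finrank L Z) := by
  obtain ⟨P, hP, hPq⟩ := exists_isNormedQuotient_gr hα hf c
  obtain ⟨P', hP', hPq'⟩ := exists_isNormedQuotient_gr hα' hf' c'
  have hq := isNormedQuotient_tensor hα hα' (grNorm_attained hα hf c).1
    (grNorm_attained hα' hf' c').1 hl hl' hPq hPq' hT
  have hsZ : (D.tensor D').IsSub Z := hZ ▸ isSub_tensorSub hf.isSub hf'.isSub T
  have hsZ' : (D.tensor D').IsSub Z' := hZ' ▸ isSub_tensorSub hf.isSub hf'.isSub _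
  have hle : Z ≤ Z' := hZ.trans_le ((tensorSub_mono f f' (Set.subset_insert _ _)).trans hZ'.ge)
  let Q : D.tensor D' →ₗ[L] (gr hf c).tensor (gr hf' c') := TensorProduct.map P P'
  let p : (D.tensor D').sub Z' hsZ' →ₗ[L] (gr hf c).tensor (gr hf' c') :=
    Q ∘ₗ (D.tensor D').subIncl Z' hsZ'
  have hkerQ : Z' ⊓ ker Q = Z := by
    rw [hZ, hZ']
    exact hq.inf_ker
  have hQ : ∀ x ∈ Z', Q ((D.tensor D').frob x) = ((gr hf c).tensor (gr hf' c')).frob (Q x) := by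
    have key : Z' ≤ LinearMap.eqLocus (Q.comp (D.tensor D').frob)
        (((gr hf c).tensor (gr hf' c')).frob.comp Q) := by
      rw [hZ', tensorSub_insert]
      refine sup_le ?_ (Submodule.map₂_le.2 fun m hm n hn => ?_)
      · intro x hx
        have hx' : x ∈ Z := hZ.ge hx
        have h1 := hkerQ.ge hx'
        have h2 := hkerQ.ge (hsZ.mem hx')
        change Q ((D.tensor D').frob x) = ((gr hf c).tensor (gr hf' c')).frob (Q x)
        rw [mem_ker.1 h1.2, mem_ker.1 h2.2, map_zero]
      · change tmul _ _ (P (D.frob m)) (P' (D'.frob n)) =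
          tmul _ _ ((gr hf c).frob (P m)) ((gr hf' c').frob (P' n))
        rw [hP _ hm, hP' _ hn, hP _ ((hf.isSub c).mem hm), hP' _ ((hf'.isSub c').mem hn)]
        rfl
    exact fun x hx => key hx
  have hp : ∀ x, p (((D.tensor D').sub Z' hsZ').frob x) =
      ((gr hf c).tensor (gr hf' c')).frob (p x) := fun x => hQ _ x.2
  have htri : ∀ x : K ⊗[L] ((D.tensor D').sub Z' hsZ'),
      Q.baseChange K (((D.tensor D').subIncl Z' hsZ').baseChange K x) = p.baseChange K x :=
    fun x => baseChange_tri (fun _ => rfl) x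
  subst hZ'
  refine (S.hasSlope_subquotient_iff (isSplittableNorm_tensorNorm hα hα') hsZ hsZ' hle
    hp ?_ ?_ ?_ ?_ a).1 hgr
  · intro z
    have h1 : z ∈ (tensorSub f f' (insert (c, c') T)).map (TensorProduct.map P P') := by
      rw [hq.map_eq_top]; trivial
    obtain ⟨x, hx, hxz⟩ := h1
    exact ⟨⟨x, hx⟩, hxz⟩
  · ext x
    constructor
    · intro hx
      exact hkerQ.le ⟨x.2, hx⟩
    · intro hx
      exact (hkerQ.ge hx).2
  · intro x
    rw [← htri]
    exact hq.le _ ⟨x, rfl⟩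
  · intro z
    obtain ⟨_, ⟨x, rfl⟩, h1, h2⟩ := hq.attained z
    exact ⟨x, (htri x).symm.trans h1, h2⟩

/-- If the tensor products of graded pieces of slopes `c` and `c'` have slope `c + c'`, the tensor
product of the filtrations is the Harder–Narasimhan filtration of the tensor product. -/
theorem Setting.isHNFiltration_tensorFiltration (S : Setting σ v π) (hα : IsSplittableNorm v α)
    (hα' : IsSplittableNorm v α') (hf : D.IsFiltration f) (hf' : D'.IsFiltration f')
    (hgr : ∀ c c', ((gr hf c).tensor (gr hf' c')).HasSlope v π
      ((gr hf c).tensorNorm (gr hf' c') (grNorm α hf c) (grNorm α' hf' c')) (c + c')) :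
    (D.tensor D').IsHNFiltration v π (D.tensorNorm D' α α') (D.tensorFiltration D' f f') := by
  classical
  have hαα := isSplittableNorm_tensorNorm hα hα'
  rw [S.isHNFiltration_iff hαα]
  intro a
  obtain ⟨y, s, hl⟩ := (isFiltration_iff.1 hf).1.exists_labelling
  obtain ⟨y', s', hl'⟩ := (isFiltration_iff.1 hf').1.exists_labelling
  obtain ⟨M, e, he⟩ := exists_antitone_enum
    (fun k : Set.range s × Set.range s' => (k.1 : ℝ) + (k.2 : ℝ))
  let E : Fin M → ℝ × ℝ := fun k => ((e k).1, (e k).2)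
  have hEinj : Injective E := fun k k' h => e.injective
    (Prod.ext (Subtype.ext (congrArg Prod.fst h)) (Subtype.ext (congrArg Prod.snd h)))
  have hE : ∀ i j, ∃ k, E k = (s i, s' j) := fun i j =>
    ⟨e.symm (⟨s i, i, rfl⟩, ⟨s' j, j, rfl⟩), by simp [E]⟩
  have hEa : ∀ k l, k ≤ l → (E l).1 + (E l).2 ≤ (E k).1 + (E k).2 := fun k l h => he h
  let T : ℕ → Set (ℝ × ℝ) := fun k => {c | ∃ l : Fin M, (l : ℕ) < k ∧ E l = c}
  have hTsucc : ∀ k : Fin M, T (k + 1) = insert (E k) (T k) := by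
    intro k
    ext c
    constructor
    · rintro ⟨l, hl, rfl⟩
      rcases Nat.lt_succ_iff_lt_or_eq.1 hl with h | h
      · exact Or.inr ⟨l, h, rfl⟩
      · exact Or.inl (by rw [Fin.ext h])
    · rintro (rfl | ⟨l, hl, rfl⟩)
      · exact ⟨k, Nat.lt_succ_self _, rfl⟩
      · exact ⟨l, hl.trans (Nat.lt_succ_self _), rfl⟩
  have hprec : ∀ k : Fin M, Precedes s s' (T k) (E k).1 (E k).2 := by
    intro k
    refine ⟨?_, fun i j hi hj hij => ?_, ?_⟩
    · rintro _ ⟨l, hl, rfl⟩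
      by_contra! hcon
      have h1 := hEa l k (le_of_lt hl)
      have h2 : E l = E k := Prod.ext (by linarith [hcon.1, hcon.2]) (by linarith [hcon.1, hcon.2])
      have h3 : l = k := hEinj h2
      exact absurd hl (by rw [h3]; exact lt_irrefl _)
    · obtain ⟨l, hl⟩ := hE i j
      refine ⟨l, ?_, hl⟩
      by_contra hlk
      have h1 := hEa k l (not_lt.1 hlk)
      rw [hl] at h1
      dsimp only at h1
      rcases hij with h | h <;> linarith
    · rintro _ ⟨l, hl, rfl⟩ i j hi hj
      obtain ⟨l', hl'⟩ := hE i j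
      refine ⟨l', ?_, hl'⟩
      by_contra hlk
      have h1 := hEa l l' ((show (l : ℕ) ≤ l' by omega))
      rw [hl'] at h1
      dsimp only at h1
      have h2 : E l = E l' := by
        rw [hl']
        exact Prod.ext (by dsimp only; linarith) (by dsimp only; linarith)
      have h3 : l = l' := hEinj h2
      rw [h3] at hl
      exact hlk hl
  let Z : ℕ → Submodule L (D.tensor D') := fun k => tensorSub f f' (T k)
  have hlab := hl.tensor hl'
  obtain ⟨m, hmM, hm⟩ : ∃ m ≤ M, ∀ k : Fin M, (k : ℕ) < m ↔ a ≤ (E k).1 + (E k).2 :=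
    exists_cut he a
  have hZm : D.tensorFiltration D' f f' a = Z m := by
    apply le_antisymm
    · refine (hlab.eq_coordSub a).le.trans (coordSub_le fun k hk => ?_)
      have hk' : a ≤ s k.1 + s' k.2 := hk
      rw [Basis.tensorProduct_apply']
      obtain ⟨l, h⟩ := hE k.1 k.2
      exact tmul_mem_tensorSub hl hl' ⟨l, (hm l).2 (by rw [h]; exact hk'), h⟩
    · refine iSup_le ?_
      rintro ⟨_, l, hlm, rfl⟩
      refine le_trans ?_ (le_iSup (fun c : ℝ => Submodule.map₂ (TensorProduct.mk L D D') (f c)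
        (f' (a - c))) (E l).1)
      refine Submodule.map₂_le_map₂_right (hf'.antitone ?_)
      have := (hm l).1 hlm
      linarith
  rw [hZm]
  refine (S.isDegree (D.tensor D') hαα).isMaximizer_chain (M := M)
    (a := fun k => (E k).1 + (E k).2) ?_ ?_ ?_
    (fun k => isSub_tensorSub hf.isSub hf'.isSub _) (fun k => ?_) (fun k => ?_)
    hmM (fun k hk => (hm k).1 hk) fun k hk => not_le.1 fun h => absurd ((hm k).2 h) (not_lt.2 hk)
  · refine eq_bot_iff.2 (iSup_le ?_)
    rintro ⟨_, l, hlm, rfl⟩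
    exact absurd hlm (Nat.not_lt_zero _)
  · refine eq_top_iff.2 ((coordSub_univ (y.tensorProduct y')).ge.trans (coordSub_le fun k _ => ?_))
    rw [Basis.tensorProduct_apply']
    obtain ⟨l, h⟩ := hE k.1 k.2
    exact tmul_mem_tensorSub hl hl' ⟨l, l.2, h⟩
  · intro k k' hk
    refine tensorSub_mono f f' ?_
    rintro _ ⟨l, hlm, rfl⟩
    exact ⟨l, hlm.trans_le hk, rfl⟩
  · exact (S.tensorSub_slope hα hα' hf hf' hl hl' (hgr _ _) (hprec k) rfl
      (congrArg (tensorSub f f') (hTsucc k))).1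
  · exact (S.tensorSub_slope hα hα' hf hf' hl hl' (hgr _ _) (hprec k) rfl
      (congrArg (tensorSub f f') (hTsucc k))).2

end TensorChain

end Isocrystal

/-! ### The norm defined by the slope filtration of an isocrystal -/

theorem weight_add (q s t : ℝ) : weight q (s + t) = weight q s * weight q t := by
  rw [weight, weight, weight, ← toNNReal_mul (exp_pos _).le, ← exp_add]
  congr 2
  ring

theorem tensorNorm_filNorm {L : Type*} [Field L] {V V' : Type*} [AddCommGroup V] [Module L V]
    [AddCommGroup V'] [Module L V'] {ι κ : Type*} [Fintype ι] [Fintype κ] (q : ℝ)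
    (y : Basis ι L V) (y' : Basis κ L V') (s : ι → ℝ) (s' : κ → ℝ) :
    tensorNorm (K := L) (filNorm q y s) (filNorm q y' s') =
      filNorm q (y.tensorProduct y') fun k => s k.1 + s' k.2 := by
  rw [tensorNorm_eq_ofBasis (isUNorm_filNorm q y s) (isUNorm_filNorm q y' s')
    (isOrthogonalBasis_filNorm q y s) (isOrthogonalBasis_filNorm q y' s')]
  unfold filNorm
  congr 1
  funext k
  rw [ofBasis_apply_basis, ofBasis_apply_basis, weight_add]

namespace Isocrystal

section Dim

variable {L : Type*} [NormedField L] {σ : L ≃+* L}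

/-- Either `L` is discretely valued and `σ` an isometry, or the normalized valuation is
identically zero, because its value group is not discrete. -/
def IsValuedFrobenius (σ : L ≃+* L) : Prop :=
  (∃ c, CompleteSetting σ c) ∨ ∀ x : L, normalizedVal x = 0

variable {D E : Isocrystal σ}

theorem dim_eq_zero (h : ∀ x : L, normalizedVal x = 0) (D : Isocrystal σ) : D.dim = 0 := h _

theorem IsValuedFrobenius.dim_sub_eq [IsUltrametricDist L] [CompleteSpace L]
    (H : IsValuedFrobenius σ) {s : ℝ} (hdim : D.dim = s * finrank L D)
    (hsub : ∀ X (h : D.IsSub X), s * finrank L X ≤ (D.sub X h).dim)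
    {X : Submodule L D} (h : D.IsSub X) : (D.sub X h).dim = s * finrank L X := by
  obtain ⟨c, S⟩ | H := H
  · exact S.dim_sub_eq hdim hsub h
  · rw [dim_eq_zero H] at hdim ⊢
    rcases mul_eq_zero.1 hdim.symm with h0 | h0
    · rw [h0, zero_mul]
    · have h1 : finrank L X ≤ finrank L D := X.finrank_le
      have h2 : finrank L D = 0 := by exact_mod_cast h0
      rw [show finrank L X = 0 by omega, Nat.cast_zero, mul_zero]

theorem IsValuedFrobenius.le_dim_sub_tensor [IsUltrametricDist L] [CompleteSpace L]
    (H : IsValuedFrobenius σ) {s t : ℝ} (hdim : D.dim = s * finrank L D)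
    (hsub : ∀ X (h : D.IsSub X), s * finrank L X ≤ (D.sub X h).dim)
    (hdim' : E.dim = t * finrank L E)
    (hsub' : ∀ X (h : E.IsSub X), t * finrank L X ≤ (E.sub X h).dim)
    {X : Submodule L (D.tensor E)} (h : (D.tensor E).IsSub X) :
    (s + t) * finrank L X ≤ ((D.tensor E).sub X h).dim := by
  obtain ⟨c, S⟩ | H := H
  · exact S.le_dim_sub_tensor hdim hsub hdim' hsub' h
  · rw [dim_eq_zero H] at hdim hdim' ⊢
    have hrk : finrank L (D.tensor E) = finrank L D * finrank L E := finrank_tensorProduct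
    have h1 : finrank L X ≤ finrank L (D.tensor E) := X.finrank_le
    have h3 : (s + t) * finrank L X = 0 := by
      rcases mul_eq_zero.1 hdim.symm with h0 | h0
      · rcases mul_eq_zero.1 hdim'.symm with h0' | h0'
        · rw [h0, h0', add_zero, zero_mul]
        · have h2 : finrank L E = 0 := by exact_mod_cast h0'
          rw [hrk, h2, mul_zero] at h1
          rw [Nat.le_zero.1 h1, Nat.cast_zero, mul_zero]
      · have h2 : finrank L D = 0 := by exact_mod_cast h0
        rw [hrk, h2, zero_mul] at h1
        rw [Nat.le_zero.1 h1, Nat.cast_zero, mul_zero]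
    exact h3.le

theorem CompleteSetting.exists_le_dim {c : ℝ≥0} [IsUltrametricDist L] (S : CompleteSetting σ c)
    (D : Isocrystal σ) : ∃ B, ∀ X (h : D.IsSub X), B ≤ (D.sub X h).dim := by
  have hβ : IsSplittableNorm (valuation (K := L)) (ofBasis valuation (finBasis L D) fun _ => 1) :=
    isSplittableNorm_ofBasis _ fun _ => one_pos
  obtain ⟨R, hR, hR'⟩ := S.exists_frob_le hβ
  have hg : D.HasGrowth R := by
    refine ⟨_, hβ, 1, fun m x => ?_⟩
    rw [one_mul]
    induction m with
    | zero => simp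
    | succ m ih =>
      rw [iterate_succ_apply']
      refine (hR' _).trans ((mul_le_mul_right ih _).trans (le_of_eq ?_))
      ring
  obtain ⟨s, hs⟩ : ∃ s : ℝ, c ^ s = R := by
    have h1 : log c ≠ 0 := (log_neg S.c_pos (by exact_mod_cast S.c_lt_one)).ne
    refine ⟨log R / log c, ?_⟩
    have h2 : (0 : ℝ) < c := S.c_pos
    have h3 : (0 : ℝ) < R := hR
    rw [← NNReal.coe_inj, NNReal.coe_rpow, Real.rpow_def_of_pos h2, mul_div_cancel₀ _ h1,
      Real.exp_log h3]
  rw [← hs] at hg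
  refine ⟨-|s| * finrank L D, fun X h => ?_⟩
  have h1 := S.le_dim_of_hasGrowth (hg.of_injective (D.subIncl X h) (D.subIncl_injective X h)
    fun _ => rfl)
  have h2 : (finrank L X : ℝ) ≤ finrank L D := by exact_mod_cast X.finrank_le
  refine le_trans ?_ h1
  have h3 : -|s| * finrank L D ≤ -|s| * finrank L X := mul_le_mul_of_nonpos_left h2 (by simp)
  exact h3.trans (mul_le_mul_of_nonneg_right (neg_abs_le s) (Nat.cast_nonneg _))

theorem IsValuedFrobenius.exists_le_dim [IsUltrametricDist L] (H : IsValuedFrobenius σ)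
    (D : Isocrystal σ) : ∃ B, ∀ X (h : D.IsSub X), B ≤ (D.sub X h).dim := by
  obtain ⟨c, S⟩ | H := H
  · exact S.exists_le_dim D
  · exact ⟨0, fun X h => (dim_eq_zero H _).ge⟩

theorem PreservesVal.dim_modular (hσ : PreservesVal σ) {X Y : Submodule L D} (hX : D.IsSub X)
    (hY : D.IsSub Y) : (D.sub (X ⊔ Y) (hX.sup hY)).dim + (D.sub (X ⊓ Y) (hX.inf hY)).dim =
      (D.sub X hX).dim + (D.sub Y hY).dim := by
  have hp : ∀ x, D.quotMk Y hY (D.frob x) = (D.quot Y hY).frob (D.quotMk Y hY x) := fun _ => rfl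
  have hk : ker (D.quotMk Y hY) = Y := ker_mkQ Y
  have key : ∀ {Z : Submodule L D} (hZ : D.IsSub Z), (D.sub Z hZ).dim =
      (D.sub (Z ⊓ Y) (hZ.inf hY)).dim +
        ((D.quot Y hY).sub (Z.map (D.quotMk Y hY)) (hZ.map hp)).dim := fun {Z} hZ => by
    have h := isExact_restrict hp hZ
    rw [hσ.dim_add h.injective h.surjective h.exact h.left h.right]
    congr 1
    exact dim_sub_congr (by rw [hk]) _ _
  have h1 := key hX
  have h2 := key (hX.sup hY)
  have h3 : (D.sub ((X ⊔ Y) ⊓ Y) ((hX.sup hY).inf hY)).dim = (D.sub Y hY).dim :=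
    dim_sub_congr (inf_eq_right.2 le_sup_right) _ _
  have h4 : (X ⊔ Y).map (D.quotMk Y hY) = X.map (D.quotMk Y hY) := by
    rw [Submodule.map_sup, sup_eq_left]
    rintro _ ⟨x, hx, rfl⟩
    rw [← hk] at hx
    rw [mem_ker.1 hx]
    exact Submodule.zero_mem _
  rw [h3, dim_sub_congr h4 _ (hX.map hp)] at h2
  linarith

/-- The subspaces between `Z` and `Z'` come from subspaces of the subquotient `E`. -/
theorem PreservesVal.exists_sub_subquotient (hσ : PreservesVal σ) {Z Z' : Submodule L D}
    (hZ : D.IsSub Z) (hZ' : D.IsSub Z') (hle : Z ≤ Z')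
    {p : D.sub Z' hZ' →ₗ[L] E} (hp : ∀ x, p ((D.sub Z' hZ').frob x) = E.frob (p x))
    (hker : ker p = Z.comap (D.subIncl Z' hZ'))
    {X : Submodule L D} (hX : D.IsSub X) (h1 : Z ≤ X) (h2 : X ≤ Z') :
    ∃ (Y : Submodule L E) (hY : E.IsSub Y), (E.sub Y hY).dim = (D.sub X hX).dim - (D.sub Z hZ).dim ∧
      (finrank L Y : ℝ) = finrank L X - finrank L Z := by
  set i := D.subIncl Z' hZ' with hi
  have hir : range i = Z' := Z'.range_subtype
  have hinj := D.subIncl_injective Z' hZ'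
  have hcm : ∀ X, X ≤ Z' → (X.comap i).map i = X := fun X hX => by
    rw [Submodule.map_comap_eq, hir, inf_eq_right.2 hX]
  have hsub : ∀ X, D.IsSub X → (D.sub Z' hZ').IsSub (X.comap i) := fun X hX => hX.comap fun _ => rfl
  have hrank : ∀ X, X ≤ Z' → finrank L (X.comap i) = finrank L X := fun X hX => by
    conv_rhs => rw [← hcm X hX]
    exact (LinearEquiv.finrank_eq (equivMapOfInjective i hinj _))
  have hdim : ∀ X (hX : D.IsSub X), X ≤ Z' →
      ((D.sub Z' hZ').sub (X.comap i) (hsub X hX)).dim = (D.sub X hX).dim := fun X hX h => by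
    rw [← hσ.dim_sub_sub hZ' (hsub X hX) ((hcm X h).symm ▸ hX)]
    exact dim_sub_congr (hcm X h) _ _
  have hk : X.comap i ⊓ ker p = Z.comap i := by
    rw [hker, inf_eq_right]
    exact comap_mono h1
  have hex := isExact_restrict hp (hsub X hX)
  refine ⟨(X.comap i).map p, (hsub X hX).map hp, ?_, ?_⟩
  · have e1 := hσ.dim_add hex.injective hex.surjective hex.exact hex.left hex.right
    rw [dim_sub_congr hk _ (hsub Z hZ), hdim X hX h2, hdim Z hZ hle] at e1
    linarith
  · have e2 : finrank L (X.comap i) = finrank L (X.comap i ⊓ ker p :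
        Submodule L (D.sub Z' hZ')) + finrank L ((X.comap i).map p) := hex.finrank
    rw [hk, hrank X h2, hrank Z hle] at e2
    rw [e2]; push_cast; ring

end Dim

section SlopeNorm

variable {L : Type*} [NormedField L] {σ : L ≃+* L} {K : Type*} [Field K] [Algebra L K]
  {v : Valuation K ℝ≥0} {π : K}

theorem grNorm_standardNorm (hv : TrivialOn L v) {D : Isocrystal σ} {f : ℝ → Submodule L D}
    (hf : D.IsFiltration f) (s : ℝ) :
    grNorm (D.standardNorm (K := K) v) hf s = (gr hf s).standardNorm v := by
  unfold grNorm
  rw [subNorm_standardNorm hv, quotNorm_standardNorm hv]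
  rfl

theorem Setting.hasSlope_standardNorm_iff (S : Setting σ v π) (D : Isocrystal σ) (s : ℝ) :
    D.HasSlope v π (D.standardNorm v) s ↔ D.dim = -s * finrank L D ∧
      ∀ X (h : D.IsSub X), -s * finrank L X ≤ (D.sub X h).dim := by
  unfold HasSlope
  rw [S.degree_standardNorm]
  refine and_congr ⟨fun h => by linarith, fun h => by linarith⟩ (forall_congr' fun X =>
    forall_congr' fun h => ?_)
  rw [S.subDeg_standardNorm D h]
  constructor <;> intro h <;> linarith

variable [IsUltrametricDist L] [CompleteSpace L]

theorem Setting.existsUnique_isHNFiltration' (S : Setting σ v π) (H : IsValuedFrobenius σ)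
    (D : Isocrystal σ) {α : K ⊗[L] D → ℝ≥0} (hα : IsSplittableNorm v α) :
    ∃! f, D.IsHNFiltration v π α f := S.existsUnique_isHNFiltration D hα (H.exists_le_dim D)

theorem Setting.hasSlope_gr (S : Setting σ v π) {D : Isocrystal σ} {α : K ⊗[L] D → ℝ≥0}
    (hα : IsSplittableNorm v α) {f : ℝ → Submodule L D} (h : D.IsHNFiltration v π α f) (c : ℝ) :
    (gr h.isFiltration c).HasSlope v π (grNorm α h.isFiltration c) c :=
  (S.hasSlope_iff (grNorm_attained hα h.isFiltration c).1 c).2 (h.graded c)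

theorem Setting.isDegree_dim (S : Setting σ v π) (D : Isocrystal σ) :
    IsDegree D.IsSub fun X => -D.subDeg v π (D.standardNorm v) X where
  bot := D.isSub_bot
  top := D.isSub_top
  sup := IsSub.sup
  inf := IsSub.inf
  map_bot := by rw [S.subDeg_bot D (isSplittableNorm_standardNorm S.trivialOn D), neg_zero]
  supermodular := fun hX hY => by
    rw [S.subDeg_standardNorm D hX, S.subDeg_standardNorm D hY, S.subDeg_standardNorm D (hX.sup hY),
      S.subDeg_standardNorm D (hX.inf hY), neg_neg, neg_neg, neg_neg, neg_neg,
      S.preservesVal.dim_modular hX hY]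

variable {D D' : Isocrystal σ} {f : ℝ → Submodule L D} {f' : ℝ → Submodule L D'}
  {α : K ⊗[L] D → ℝ≥0} {X : Submodule L D} {ι : Type*} {y : Basis ι L D} {s : ι → ℝ} {q : ℝ}
  [Fintype ι]

theorem Setting.dim_le_lvol (S : Setting σ v π) (H : IsValuedFrobenius σ)
    (h : D.IsHNFiltration v π (D.standardNorm v) f) (hl : IsLabelling f y s) (hq : 0 < q)
    (hX : D.IsSub X) {κ : Type*} [Fintype κ] [DecidableEq κ] (b : Basis κ L X) :
    q * (D.sub X hX).dim ≤ lvol (trivVal L) b fun x : X => filNorm q y s x := by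
  have hf := h.isFiltration
  have h1 := (S.isDegree_dim D).le_lvol hl hf.isSub hq (ε := -1) (fun c Y hY hY1 hY2 => ?_) hX b
  · rwa [S.subDeg_standardNorm D hX, neg_neg, neg_neg, one_mul] at h1
  · have hgr := S.hasSlope_gr (isSplittableNorm_standardNorm S.trivialOn D) h c
    rw [grNorm_standardNorm S.trivialOn, S.hasSlope_standardNorm_iff] at hgr
    have hp : D.IsSub (⨆ u : Ioi c, f u) := hf.isSub_filPlus' c
    obtain ⟨Z, hZ, e1, e2⟩ := S.preservesVal.exists_sub_subquotient hp (hf.isSub c)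
      (hf.filPlus_le c) (grMk_frob hf c) (ker_grMk hf c) hY hY1 hY2
    have e3 := H.dim_sub_eq hgr.1 hgr.2 hZ
    rw [S.subDeg_standardNorm D hY, S.subDeg_standardNorm D hp, ← e2]
    linarith

theorem Setting.lvol_le_dim (S : Setting σ v π) (h : D.IsHNFiltration v π (D.standardNorm v) f)
    (hl : IsLabelling f y s) (hq : 0 < q)
    (hX : D.IsSub X) {κ : Type*} [Fintype κ] [DecidableEq κ] (b : Basis κ L X) :
    lvol (trivVal L) b (fun x : X => filNorm q y s x) ≤ q * (D.sub X hX).dim := by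
  have ho := isSplittableNorm_standardNorm (K := K) S.trivialOn D
  have hf := h.isFiltration
  have h1 := (S.isDegree D ho).le_lvol hl hf.isSub hq (ε := 1) (fun c Y hY hY1 hY2 => ?_) hX b
  · rw [S.subDeg_standardNorm D hX] at h1
    linarith
  · rw [one_mul]
    exact ((S.hasSlope_gr_iff ho hf c).1 (S.hasSlope_gr ho h c)).1 Y hY hY1 hY2

/-- The slope filtration of `D ⊗ D'` is the tensor product of the slope filtrations. -/
theorem Setting.isHNFiltration_tensor_standardNorm (S : Setting σ v π) (H : IsValuedFrobenius σ)
    (h : D.IsHNFiltration v π (D.standardNorm v) f)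
    (h' : D'.IsHNFiltration v π (D'.standardNorm v) f') :
    (D.tensor D').IsHNFiltration v π ((D.tensor D').standardNorm v)
      (D.tensorFiltration D' f f') := by
  have ho := isSplittableNorm_standardNorm (K := K) S.trivialOn D
  have ho' := isSplittableNorm_standardNorm (K := K) S.trivialOn D'
  rw [← tensorNorm_standardNorm S.trivialOn]
  refine S.isHNFiltration_tensorFiltration ho ho' h.isFiltration h'.isFiltration fun c c' => ?_
  have hgr := S.hasSlope_gr ho h c
  have hgr' := S.hasSlope_gr ho' h' c'
  rw [grNorm_standardNorm S.trivialOn, S.hasSlope_standardNorm_iff] at hgr hgr'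
  rw [grNorm_standardNorm S.trivialOn, grNorm_standardNorm S.trivialOn,
    tensorNorm_standardNorm S.trivialOn, S.hasSlope_standardNorm_iff]
  refine ⟨?_, fun X hX => ?_⟩
  · have hrk : finrank L ((gr h.isFiltration c).tensor (gr h'.isFiltration c')) =
      finrank L (gr h.isFiltration c) * finrank L (gr h'.isFiltration c') := finrank_tensorProduct
    rw [S.preservesVal.dim_tensor, hrk, hgr.1, hgr'.1]
    push_cast
    ring
  · rw [neg_add]
    exact H.le_dim_sub_tensor hgr.1 hgr.2 hgr'.1 hgr'.2 hX

theorem Setting.lv_subNorm_extNorm (S : Setting σ v π) (H : IsValuedFrobenius σ)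
    (h : D.IsHNFiltration v π (D.standardNorm v) f) (hl : IsLabelling f y s) (hq : 0 < q)
    (hX : D.IsSub X) :
    lv v (D.subNorm (extNorm v y (filNorm q y s)) X hX) = q * (D.sub X hX).dim := by
  have e := lv_extNorm_comp (v := v) S.trivialOn (isUNorm_filNorm q y s)
    (isOrthogonalBasis_filNorm q y s) (D.subIncl_injective X hX) (finBasis L (D.sub X hX))
  exact e.trans (le_antisymm (S.lvol_le_dim h hl hq hX (finBasis L X))
    (S.dim_le_lvol H h hl hq hX (finBasis L X)))

theorem Setting.lv_subNorm_top (S : Setting σ v π) {N : K ⊗[L] D → ℝ≥0}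
    (hN : IsSplittableNorm v N) :
    lv v (D.subNorm N ⊤ D.isSub_top) / log (v π) - (D.sub ⊤ D.isSub_top).dim =
      lv v N / log (v π) - D.dim := by
  rw [← degree_eq S.trivialOn S.discrete D hN, ← S.subDeg_top D hN, D.isSub_top.subDeg_eq,
    degree_eq S.trivialOn S.discrete _ (isSplittableNorm_subNorm hN D.isSub_top)]

theorem PreservesVal.dim_sub_top (hσ : PreservesVal σ) : (D.sub ⊤ D.isSub_top).dim = D.dim :=
  (hσ.dim_iso (D := D.sub ⊤ D.isSub_top) (E := D) topEquiv fun _ => rfl).symm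

theorem Setting.lv_extNorm_filNorm (S : Setting σ v π) (H : IsValuedFrobenius σ)
    (h : D.IsHNFiltration v π (D.standardNorm v) f) (hl : IsLabelling f y s) (hq : 0 < q) :
    lv v (extNorm v y (filNorm q y s)) = q * D.dim := by
  have h1 := S.lv_subNorm_top (isSplittableNorm_extNorm (v := v) (isUNorm_filNorm q y s) y)
  rw [S.lv_subNorm_extNorm H h hl hq D.isSub_top, S.preservesVal.dim_sub_top, sub_left_inj,
    div_left_inj' S.log_neg.ne] at h1
  exact h1.symm

/-- There are norms on `D_K` and `D'_K` whose volume on subobjects is the dimension,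
and the volume of their tensor product on subobjects of `D ⊗ D'` is the dimension, too. They
are defined by the slope filtrations, whose graded pieces are isoclinic. -/
theorem Setting.exists_slopeNorm (S : Setting σ v π) (H : IsValuedFrobenius σ)
    (D D' : Isocrystal σ) (hq : 0 < q) :
    ∃ (N : K ⊗[L] D → ℝ≥0) (N' : K ⊗[L] D' → ℝ≥0), IsSplittableNorm v N ∧ IsSplittableNorm v N' ∧
      lv v N = q * D.dim ∧ lv v N' = q * D'.dim ∧
      (∀ X (hX : D.IsSub X), lv v (D.subNorm N X hX) = q * (D.sub X hX).dim) ∧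
      (∀ X (hX : D'.IsSub X), lv v (D'.subNorm N' X hX) = q * (D'.sub X hX).dim) ∧
      ∀ X (hX : (D.tensor D').IsSub X), lv v ((D.tensor D').subNorm (D.tensorNorm D' N N') X hX) ≤
          q * ((D.tensor D').sub X hX).dim := by
  obtain ⟨f, hf, -⟩ := S.existsUnique_isHNFiltration' H D
    (isSplittableNorm_standardNorm (K := K) S.trivialOn D)
  obtain ⟨f', hf', -⟩ := S.existsUnique_isHNFiltration' H D'
    (isSplittableNorm_standardNorm (K := K) S.trivialOn D')
  obtain ⟨y, s, hl⟩ := (isFiltration_iff.1 hf.isFiltration).1.exists_labelling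
  obtain ⟨y', s', hl'⟩ := (isFiltration_iff.1 hf'.isFiltration).1.exists_labelling
  have hN := isUNorm_filNorm q y s
  have hN' := isUNorm_filNorm q y' s'
  refine ⟨extNorm v y (filNorm q y s), extNorm v y' (filNorm q y' s'),
    isSplittableNorm_extNorm hN y, isSplittableNorm_extNorm hN' y',
    S.lv_extNorm_filNorm H hf hl hq, S.lv_extNorm_filNorm H hf' hl' hq,
    fun X hX => S.lv_subNorm_extNorm H hf hl hq hX,
    fun X hX => S.lv_subNorm_extNorm H hf' hl' hq hX, fun X hX => ?_⟩
  have ht : D.tensorNorm D' (extNorm v y (filNorm q y s)) (extNorm v y' (filNorm q y' s')) =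
      extNorm v (y.tensorProduct y') (filNorm q (y.tensorProduct y') fun k => s k.1 + s' k.2) := by
    funext x
    refine (tensorNorm_extNorm hN hN' (isOrthogonalBasis_filNorm q y s)
      (isOrthogonalBasis_filNorm q y' s') x).trans ?_
    rw [tensorNorm_filNorm]
  rw [ht]
  exact (S.lv_subNorm_extNorm H (S.isHNFiltration_tensor_standardNorm H hf hf')
    (hl.tensor hl') hq hX).le

end SlopeNorm

end Isocrystal

/-! ### Automorphisms of algebraically closed fields -/

section FixedField

open MvPolynomial

/-- An automorphism of a polynomial ring on a transcendence basis extends to the algebraically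
closed field. -/
theorem exists_ringEquiv_aeval {A Ω : Type*} [Field A] [Field Ω] [IsAlgClosed Ω] [Algebra A Ω]
    {ι : Type*} {x : ι → Ω} (hx : IsTranscendenceBasis A x)
    (e : MvPolynomial ι A ≃+* MvPolynomial ι A) :
    ∃ f : Ω ≃+* Ω, ∀ p, f (aeval x p) = aeval x (e p) := by
  have := IsAlgClosed.isAlgClosure_of_transcendence_basis x hx
  let e' : Algebra.adjoin A (Set.range x) ≃+* Algebra.adjoin A (Set.range x) :=
    (hx.1.aevalEquiv.symm.toRingEquiv.trans e).trans hx.1.aevalEquiv.toRingEquiv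
  refine ⟨IsAlgClosure.equivOfEquiv Ω Ω e', fun p => ?_⟩
  have h := IsAlgClosure.equivOfEquiv_algebraMap (L := Ω) (M := Ω) e' (hx.1.aevalEquiv p)
  have h1 : e' (hx.1.aevalEquiv p) = hx.1.aevalEquiv (e p) := by simp [e']
  rw [h1] at h
  exact h

/-- The field fixed by the automorphisms of an algebraically closed extension. An algebraic
element outside the base field is moved by an automorphism of the algebraic closure, a
transcendental element `a` by an automorphism with `a ↦ a + 1`. -/
theorem mem_range_algebraMap_of_fixed {L Ω : Type*} [Field L] [CharZero L] [Field Ω]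
    [IsAlgClosed Ω] [Algebra L Ω] {a : Ω} (ha : ∀ f : Ω ≃ₐ[L] Ω, f a = a) :
    a ∈ Set.range (algebraMap L Ω) := by
  by_cases halg : IsAlgebraic L a
  · let A := algebraicClosure L Ω
    obtain ⟨ι, x, hx⟩ := exists_isTranscendenceBasis' A Ω
    let a' : A := ⟨a, mem_algebraicClosure_iff.2 halg⟩
    have h : ∀ τ : A ≃ₐ[L] A, τ a' = a' := by
      intro τ
      obtain ⟨f, hf⟩ := exists_ringEquiv_aeval hx (MvPolynomial.mapEquiv ι τ.toRingEquiv)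
      have hf' : ∀ z : A, f z = τ z := fun z => by
        have := hf (C z)
        simpa using this
      let f' : Ω ≃ₐ[L] Ω := AlgEquiv.ofRingEquiv (f := f) fun c => by
        have := hf' (algebraMap L A c)
        rwa [τ.commutes] at this
      have h1 := ha f'
      exact Subtype.ext ((hf' a').symm.trans h1)
    obtain ⟨c, hc⟩ := (InfiniteGalois.mem_range_algebraMap_iff_fixed a').2 h
    exact ⟨c, congrArg Subtype.val hc⟩
  · have h0 : AlgebraicIndependent L ((↑) : ({a} : Set Ω) → Ω) := by
      rw [algebraicIndependent_singleton_iff (⟨a, rfl⟩ : ({a} : Set Ω))]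
      exact halg
    obtain ⟨t, hat, ht⟩ := exists_isTranscendenceBasis_superset h0
    let e : MvPolynomial t L ≃ₐ[L] MvPolynomial t L :=
      AlgEquiv.ofAlgHom (aeval fun i => X i + 1) (aeval fun i => X i - 1)
        (by ext; simp) (by ext; simp)
    obtain ⟨f, hf⟩ := exists_ringEquiv_aeval ht e.toRingEquiv
    let f' : Ω ≃ₐ[L] Ω := AlgEquiv.ofRingEquiv (f := f) fun c => by
      have := hf (C c)
      simpa [e] using this
    have h1 := ha f'
    have h2 := hf (X ⟨a, hat rfl⟩)
    have h3 : f a = a + 1 := by simpa [e] using h2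
    have h4 : f a = a := h1
    rw [h3] at h4
    simp at h4

end FixedField

/-! ### Sums over the labels of a filtration -/

section LabelSum

theorem card_filter_le_eq {τ β : Type*} [Fintype τ] [LinearOrder β] (g : τ → β) (c : β) :
    (univ.filter fun i => g i ≤ c).card =
      (univ.filter fun i => g i < c).card + Multiset.count c (univ.val.map g) := by
  rw [Multiset.count_map]
  change _ = _ + (univ.filter fun i => c = g i).card
  classical
  rw [← Finset.card_union_of_disjoint, ← Finset.filter_or]
  · congr 1
    grind
  · rw [Finset.disjoint_filter]
    grind

theorem map_univ_eq_of_card_le_eq {ι ι' β : Type*} [Fintype ι] [Fintype ι'] [LinearOrder β]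
    {a : ι → β} {b : ι' → β} (h : ∀ c, (univ.filter fun i => a i ≤ c).card =
      (univ.filter fun i => b i ≤ c).card) : univ.val.map a = univ.val.map b := by
  classical
  have hlt : ∀ c, (univ.filter fun i => a i < c).card = (univ.filter fun i => b i < c).card := by
    intro c
    -- the largest value below `c`
    let s : Finset β := (univ.image a ∪ univ.image b).filter (· < c)
    have hsa : ∀ i, a i < c → a i ∈ s := fun i hi => by simp [s, hi]
    have hsb : ∀ i, b i < c → b i ∈ s := fun i hi => by simp [s, hi]
    rcases s.eq_empty_or_nonempty with hs | hs
    · rw [Finset.filter_false_of_mem fun i _ hi => by simpa [hs] using hsa i hi,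
        Finset.filter_false_of_mem fun i _ hi => by simpa [hs] using hsb i hi]
      rfl
    · have hm := s.max'_mem hs
      have hmc : s.max' hs < c := (mem_filter.1 hm).2
      rw [filter_congr fun i _ => (⟨fun hi => s.le_max' _ (hsa i hi), fun hi =>
          hi.trans_lt hmc⟩ : a i < c ↔ a i ≤ s.max' hs),
        filter_congr fun i _ => (⟨fun hi => s.le_max' _ (hsb i hi), fun hi =>
          hi.trans_lt hmc⟩ : b i < c ↔ b i ≤ s.max' hs)]
      exact h _
  ext c
  have h1 := card_filter_le_eq a c
  have h2 := card_filter_le_eq b c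
  rw [h c, hlt c] at h1
  omega

variable {κ : Type*} [Field κ] {V : Type*} [AddCommGroup V] [Module κ V] {ι : Type*} [Fintype ι]
  {h : V → ℝ≥0} {e : Basis ι κ V}

variable (κ) in
/-- The span of the ball of radius `c`. -/
def ballSpan (h : V → ℝ≥0) (c : ℝ≥0) : Submodule κ V := span κ {x | h x ≤ c}

theorem IsOrthogonalBasis.ballSpan_eq (he : IsOrthogonalBasis (trivVal κ) h e) (c : ℝ≥0) :
    ballSpan κ h c = coordSub e {i | h (e i) ≤ c} := by
  have : (coordSub e {i | h (e i) ≤ c} : Set V) = {x | h x ≤ c} := by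
    ext x
    refine Iff.trans ?_ (he.le_iff (x := x)).symm
    refine forall_congr' fun i => ?_
    by_cases h0 : e.repr x i = 0
    · simp [h0]
    · rw [trivVal_apply h0, one_mul]
      simp [h0]
  rw [ballSpan, ← this, Submodule.span_eq]

theorem IsOrthogonalBasis.finrank_ballSpan (he : IsOrthogonalBasis (trivVal κ) h e) (c : ℝ≥0) :
    finrank κ (ballSpan κ h c) = (univ.filter fun i => h (e i) ≤ c).card := by
  classical
  have := Finite.of_basis e
  rw [he.ballSpan_eq, finrank_coordSub]
  rfl

/-- The values of a norm for the trivial absolute value on an orthogonal basis, with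
multiplicities, are determined by the dimensions of the balls. -/
theorem IsOrthogonalBasis.sum_eq_sum {κ' : Type*} [Field κ'] {V' : Type*} [AddCommGroup V']
    [Module κ' V'] {ι' : Type*} [Fintype ι'] {h' : V' → ℝ≥0} {e' : Basis ι' κ' V'}
    (he : IsOrthogonalBasis (trivVal κ) h e) (he' : IsOrthogonalBasis (trivVal κ') h' e')
    (hb : ∀ c, finrank κ (ballSpan κ h c) = finrank κ' (ballSpan κ' h' c))
    (φ : ℝ≥0 → ℝ) : ∑ i, φ (h (e i)) = ∑ i, φ (h' (e' i)) := by
  have h1 := map_univ_eq_of_card_le_eq (a := fun i => h (e i)) (b := fun i => h' (e' i)) fun c => by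
    rw [← he.finrank_ballSpan, ← he'.finrank_ballSpan, hb]
  have h2 := congrArg (fun m => (Multiset.map φ m).sum) h1
  rw [Multiset.map_map, Multiset.map_map] at h2
  exact h2

open Classical in
variable (κ) in
/-- The sum of `φ (log h(e_i))` over an orthogonal basis `e` of a norm `h` for the trivial
absolute value. -/
def labelSum (φ : ℝ → ℝ) (h : V → ℝ≥0) : ℝ := if hex : ∃ e : Basis (Fin (finrank κ V)) κ V,
      IsOrthogonalBasis (trivVal κ) h e then ∑ i, φ (log (h (hex.choose i))) else 0

theorem IsOrthogonalBasis.labelSum_eq (φ : ℝ → ℝ)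
    (he : IsOrthogonalBasis (trivVal κ) h e) : labelSum κ φ h = ∑ i, φ (log (h (e i))) := by
  have hc : card ι = finrank κ V := (finrank_eq_card_basis e).symm
  have hex : ∃ e : Basis (Fin (finrank κ V)) κ V,
      IsOrthogonalBasis (trivVal κ) h e := ⟨_, he.reindex (Fintype.equivFinOfCardEq hc)⟩
  rw [labelSum, dif_pos hex]
  exact hex.choose_spec.sum_eq_sum he (fun c => rfl) fun r => φ (log r)

theorem labelSum_id [FiniteDimensional κ V] [DecidableEq ι]
    (hh : IsSplittableNorm (trivVal κ) h) (b : Basis ι κ V) :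
    labelSum κ (fun t => t) h = lvol (trivVal κ) b h := by
  obtain ⟨e, he⟩ := hh.exists_basis b
  rw [he.labelSum_eq, he.lvol_trivVal hh.isUNorm b]

theorem labelSum_congr_ball {κ' : Type*} [Field κ'] {V' : Type*} [AddCommGroup V']
    [Module κ' V'] [FiniteDimensional κ V] [FiniteDimensional κ' V'] {h' : V' → ℝ≥0}
    (hh : IsSplittableNorm (trivVal κ) h) (hh' : IsSplittableNorm (trivVal κ') h')
    (hb : ∀ c, finrank κ (ballSpan κ h c) = finrank κ' (ballSpan κ' h' c))
    (φ : ℝ → ℝ) : labelSum κ φ h = labelSum κ' φ h' := by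
  obtain ⟨e, he⟩ := hh.exists_basis (finBasis κ V)
  obtain ⟨e', he'⟩ := hh'.exists_basis (finBasis κ' V')
  rw [he.labelSum_eq, he'.labelSum_eq]
  exact he.sum_eq_sum he' hb fun r => φ (log r)

end LabelSum

/-! ### Kempf's optimal pair of filtrations -/

section Kempf

variable {κ : Type*} [Field κ] {V V' W : Type*} [AddCommGroup V] [Module κ V] [AddCommGroup V']
  [Module κ V'] [AddCommGroup W] [Module κ W]
variable {j : W →ₗ[κ] V ⊗[κ] V'}

/-- Kempf's functional on pairs of norms for the trivial absolute value (that is, of filtrations)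
on `V` and `V'`, for a subspace `j : W → V ⊗ V'`. The linear part is normalized so as to be
invariant under scaling; the quadratic part makes the functional strictly convex. -/
def kempf (j : W →ₗ[κ] V ⊗[κ] V') (h : V → ℝ≥0) (h' : V' → ℝ≥0) : ℝ :=
  labelSum κ (fun t => t) (fun w => tensorNorm (K := κ) h h' (j w)) -
    finrank κ W * (labelSum κ (fun t => t) h / finrank κ V +
      labelSum κ (fun t => t) h' / finrank κ V') +
    (labelSum κ (fun t => t ^ 2) h + labelSum κ (fun t => t ^ 2) h') / 2

variable [FiniteDimensional κ V] [FiniteDimensional κ V'] [FiniteDimensional κ W]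

theorem labelSum_id_le_of_sq_le {N N₁ N₂ : W → ℝ≥0} (hN : IsSplittableNorm (trivVal κ) N)
    (hN₁ : IsSplittableNorm (trivVal κ) N₁) (hN₂ : IsSplittableNorm (trivVal κ) N₂)
    (h : ∀ x, N x ^ 2 ≤ N₁ x * N₂ x) : labelSum κ (fun t => t) N ≤
      (labelSum κ (fun t => t) N₁ + labelSum κ (fun t => t) N₂) / 2 := by
  obtain ⟨u, hu₁, hu₂⟩ := exists_common_basis_trivVal hN₁ hN₂.isUNorm hN₂.finite_range
    (finBasis κ W)
  rw [hu₁.labelSum_eq, hu₂.labelSum_eq, labelSum_id hN u]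
  refine (hN.lvol_le u (det_basis_ne_zero u u)).trans ?_
  rw [Basis.det_self, map_one, coe_one, log_one, sub_zero, ← sum_add_distrib, sum_div]
  refine sum_le_sum fun i _ => ?_
  have h0 : (0 : ℝ) < N (u i) := hN.isUNorm.pos (u.ne_zero i)
  have h1 : (0 : ℝ) < N₁ (u i) := hN₁.isUNorm.pos (u.ne_zero i)
  have h2 : (0 : ℝ) < N₂ (u i) := hN₂.isUNorm.pos (u.ne_zero i)
  have h3 : (N (u i) : ℝ) ^ 2 ≤ N₁ (u i) * N₂ (u i) := by exact_mod_cast h (u i)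
  have h4 := log_le_log (pow_pos h0 2) h3
  rw [log_pow, log_mul h1.ne' h2.ne'] at h4
  push_cast at h4
  linarith

theorem ofBasis_sq_le {ι : Type*} [Fintype ι] {v : Valuation κ ℝ≥0} (b : Basis ι κ V)
    {c c₁ c₂ : ι → ℝ≥0} (h : ∀ i, c i ^ 2 = c₁ i * c₂ i) (x : V) :
    ofBasis v b c x ^ 2 ≤ ofBasis v b c₁ x * ofBasis v b c₂ x := by
  rw [← NNReal.le_sqrt_iff_sq_le]
  refine Finset.sup_le fun i _ => ?_
  rw [NNReal.le_sqrt_iff_sq_le, mul_pow, h]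
  calc v (b.repr x i) ^ 2 * (c₁ i * c₂ i) =
      (v (b.repr x i) * c₁ i) * (v (b.repr x i) * c₂ i) := by ring
    _ ≤ _ := mul_le_mul' (le_sup (f := fun i => v (b.repr x i) * c₁ i) (mem_univ i))
      (le_sup (f := fun i => v (b.repr x i) * c₂ i) (mem_univ i))

/-- Convexity: the functional at the midpoint of two pairs of norms. -/
theorem kempf_midpoint (hj : Injective j)
    {ι ι' : Type*} [Fintype ι] [Fintype ι'] {e : Basis ι κ V} {e' : Basis ι' κ V'}
    {h k : V → ℝ≥0} {h' k' : V' → ℝ≥0} (hh : IsUNorm (trivVal κ) h) (hk : IsUNorm (trivVal κ) k)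
    (hh' : IsUNorm (trivVal κ) h') (hk' : IsUNorm (trivVal κ) k')
    (heh : IsOrthogonalBasis (trivVal κ) h e) (hek : IsOrthogonalBasis (trivVal κ) k e)
    (heh' : IsOrthogonalBasis (trivVal κ) h' e') (hek' : IsOrthogonalBasis (trivVal κ) k' e') :
    kempf j (ofBasis (trivVal κ) e fun i => sqrt (h (e i) * k (e i)))
        (ofBasis (trivVal κ) e' fun i => sqrt (h' (e' i) * k' (e' i))) +
      (∑ i, (log (h (e i)) - log (k (e i))) ^ 2 +
        ∑ i, (log (h' (e' i)) - log (k' (e' i))) ^ 2) / 8 ≤ (kempf j h h' + kempf j k k') / 2 := by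
  set m := ofBasis (trivVal κ) e fun i => sqrt (h (e i) * k (e i)) with hm
  set m' := ofBasis (trivVal κ) e' fun i => sqrt (h' (e' i) * k' (e' i)) with hm'
  have hpos : ∀ i, 0 < sqrt (h (e i) * k (e i)) := fun i =>
    sqrt_pos.2 (mul_pos (hh.pos (e.ne_zero i)) (hk.pos (e.ne_zero i)))
  have hpos' : ∀ i, 0 < sqrt (h' (e' i) * k' (e' i)) := fun i =>
    sqrt_pos.2 (mul_pos (hh'.pos (e'.ne_zero i)) (hk'.pos (e'.ne_zero i)))
  have hmu : IsUNorm (trivVal κ) m := isUNorm_ofBasis e hpos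
  have hmu' : IsUNorm (trivVal κ) m' := isUNorm_ofBasis e' hpos'
  have hmo : IsOrthogonalBasis (trivVal κ) m e := isOrthogonalBasis_ofBasis _ _
  have hmo' : IsOrthogonalBasis (trivVal κ) m' e' := isOrthogonalBasis_ofBasis _ _
  have hlog : ∀ i, log (m (e i)) = (log (h (e i)) + log (k (e i))) / 2 := by
    intro i
    have h1 : (0 : ℝ) < h (e i) := hh.pos (e.ne_zero i)
    have h2 : (0 : ℝ) < k (e i) := hk.pos (e.ne_zero i)
    rw [hm, ofBasis_apply_basis, Real.coe_sqrt, coe_mul, Real.log_sqrt (by positivity),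
      log_mul h1.ne' h2.ne']
  have hlog' : ∀ i, log (m' (e' i)) = (log (h' (e' i)) + log (k' (e' i))) / 2 := by
    intro i
    have h1 : (0 : ℝ) < h' (e' i) := hh'.pos (e'.ne_zero i)
    have h2 : (0 : ℝ) < k' (e' i) := hk'.pos (e'.ne_zero i)
    rw [hm', ofBasis_apply_basis, Real.coe_sqrt, coe_mul, Real.log_sqrt (by positivity),
      log_mul h1.ne' h2.ne']
  have hW : labelSum κ (fun t => t) (fun w => tensorNorm (K := κ) m m' (j w)) ≤
      (labelSum κ (fun t => t) (fun w => tensorNorm (K := κ) h h' (j w)) +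
        labelSum κ (fun t => t) (fun w => tensorNorm (K := κ) k k' (j w))) / 2 := by
    refine labelSum_id_le_of_sq_le
      (((hmu.isSplittableNorm hmo).tensorNorm (hmu'.isSplittableNorm hmo')).comp j hj)
      (((hh.isSplittableNorm heh).tensorNorm (hh'.isSplittableNorm heh')).comp j hj)
      (((hk.isSplittableNorm hek).tensorNorm (hk'.isSplittableNorm hek')).comp j hj) fun w => ?_
    rw [tensorNorm_eq_ofBasis hmu hmu' hmo hmo', tensorNorm_eq_ofBasis hh hh' heh heh',
      tensorNorm_eq_ofBasis hk hk' hek hek']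
    refine ofBasis_sq_le _ (fun i => ?_) _
    rw [hm, hm', ofBasis_apply_basis, ofBasis_apply_basis, mul_pow, NNReal.sq_sqrt, NNReal.sq_sqrt]
    ring
  have hq : ∑ i, log (m (e i)) ^ 2 + (∑ i, (log (h (e i)) - log (k (e i))) ^ 2) / 4 =
      (∑ i, log (h (e i)) ^ 2 + ∑ i, log (k (e i)) ^ 2) / 2 := by
    rw [sum_div, ← sum_add_distrib, ← sum_add_distrib, sum_div]
    refine sum_congr rfl fun i _ => ?_
    rw [hlog]
    ring
  have hq' : ∑ i, log (m' (e' i)) ^ 2 + (∑ i, (log (h' (e' i)) - log (k' (e' i))) ^ 2) / 4 =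
      (∑ i, log (h' (e' i)) ^ 2 + ∑ i, log (k' (e' i)) ^ 2) / 2 := by
    rw [sum_div, ← sum_add_distrib, ← sum_add_distrib, sum_div]
    refine sum_congr rfl fun i _ => ?_
    rw [hlog']
    ring
  have hl : ∑ i, log (m (e i)) = (∑ i, log (h (e i)) + ∑ i, log (k (e i))) / 2 := by
    rw [← sum_add_distrib, sum_div]
    exact sum_congr rfl fun i _ => hlog i
  have hl' : ∑ i, log (m' (e' i)) = (∑ i, log (h' (e' i)) + ∑ i, log (k' (e' i))) / 2 := by
    rw [← sum_add_distrib, sum_div]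
    exact sum_congr rfl fun i _ => hlog' i
  unfold kempf
  rw [hmo.labelSum_eq, hmo'.labelSum_eq, hmo.labelSum_eq, hmo'.labelSum_eq, heh.labelSum_eq,
    heh'.labelSum_eq, heh.labelSum_eq, heh'.labelSum_eq, hek.labelSum_eq, hek'.labelSum_eq,
    hek.labelSum_eq, hek'.labelSum_eq, hl, hl']
  simp only [add_div, mul_add, div_right_comm _ (2 : ℝ), mul_div_assoc'] at hW ⊢
  linarith

/-- The pair `(h, h')` minimizes Kempf's functional. -/
structure IsKempf (j : W →ₗ[κ] V ⊗[κ] V') (h : V → ℝ≥0) (h' : V' → ℝ≥0) : Prop where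
  left : IsSplittableNorm (trivVal κ) h
  right : IsSplittableNorm (trivVal κ) h'
  le : ∀ k k', IsSplittableNorm (trivVal κ) k → IsSplittableNorm (trivVal κ) k' →
    kempf j h h' ≤ kempf j k k'

theorem IsKempf.unique (hj : Injective j) {h k : V → ℝ≥0}
    {h' k' : V' → ℝ≥0} (H : IsKempf j h h') (H' : IsKempf j k k') : h = k ∧ h' = k' := by
  obtain ⟨e, heh, hek⟩ := exists_common_basis_trivVal H.left H'.left.isUNorm H'.left.finite_range
    (finBasis κ V)
  obtain ⟨e', heh', hek'⟩ := exists_common_basis_trivVal H.right H'.right.isUNorm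
    H'.right.finite_range (finBasis κ V')
  have hh := H.left.isUNorm
  have hk := H'.left.isUNorm
  have hh' := H.right.isUNorm
  have hk' := H'.right.isUNorm
  have h1 := kempf_midpoint hj hh hk hh' hk' heh hek heh' hek'
  have h2 := H.le _ _
    (isSplittableNorm_ofBasis e fun i => sqrt_pos.2 (mul_pos (hh.pos (e.ne_zero i))
      (hk.pos (e.ne_zero i))))
    (isSplittableNorm_ofBasis e' fun i => sqrt_pos.2 (mul_pos (hh'.pos (e'.ne_zero i))
      (hk'.pos (e'.ne_zero i))))
  have h3 := H'.le h h' H.left H.right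
  have hA : 0 ≤ ∑ i, (log (h (e i)) - log (k (e i))) ^ 2 := sum_nonneg fun i _ => sq_nonneg _
  have hB : 0 ≤ ∑ i, (log (h' (e' i)) - log (k' (e' i))) ^ 2 := sum_nonneg fun i _ => sq_nonneg _
  have hA0 := (Finset.sum_eq_zero_iff_of_nonneg fun i _ => sq_nonneg _).1
    (show ∑ i, (log (h (e i)) - log (k (e i))) ^ 2 = 0 by linarith)
  have hB0 := (Finset.sum_eq_zero_iff_of_nonneg fun i _ => sq_nonneg _).1
    (show ∑ i, (log (h' (e' i)) - log (k' (e' i))) ^ 2 = 0 by linarith)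
  constructor
  · rw [heh.eq_ofBasis, hek.eq_ofBasis]
    congr 1
    funext i
    have h4 := pow_eq_zero_iff (two_ne_zero) |>.1 (hA0 i (mem_univ i))
    exact NNReal.coe_injective (Real.log_injOn_pos (hh.pos (e.ne_zero i)) (hk.pos (e.ne_zero i))
      (sub_eq_zero.1 h4))
  · rw [heh'.eq_ofBasis, hek'.eq_ofBasis]
    congr 1
    funext i
    have h4 := pow_eq_zero_iff (two_ne_zero) |>.1 (hB0 i (mem_univ i))
    exact NNReal.coe_injective (Real.log_injOn_pos (hh'.pos (e'.ne_zero i))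
      (hk'.pos (e'.ne_zero i)) (sub_eq_zero.1 h4))

/-- By invariance under scaling of the linear part, the labels of the minimizer have sum zero. -/
theorem IsKempf.labelSum_eq_zero [Nontrivial V]
    (hj : Injective j) {h : V → ℝ≥0} {h' : V' → ℝ≥0} (H : IsKempf j h h') :
    labelSum κ (fun t => t) h = 0 := by
  obtain ⟨e, he⟩ := H.left.exists_basis (finBasis κ V)
  set n : ℝ := (finrank κ V : ℝ) with hn
  have hn0 : 0 < n := by
    have : 0 < finrank κ V := finrank_pos
    rw [hn]
    exact_mod_cast this
  set Γ := ∑ i, log (h (e i)) with hΓ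
  set s : ℝ := -Γ / n with hs
  let C : ℝ≥0 := toNNReal (exp s)
  have hC : 0 < C := toNNReal_pos.2 (exp_pos _)
  have hlC : log C = s := by rw [coe_toNNReal _ (exp_pos _).le, log_exp]
  have hCh : IsUNorm (trivVal κ) fun x => C * h x :=
    (lvol_const_mul H.left (finBasis κ V) hC).1.isUNorm
  have heC : IsOrthogonalBasis (trivVal κ) (fun x => C * h x) e := by
    intro x
    dsimp only
    rw [he x, mul_finset_sup]
    exact sup_congr rfl fun i _ => by ring
  have hle := H.le _ h' (hCh.isSplittableNorm heC) H.right
  have hh' := H.right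
  obtain ⟨e', he'⟩ := H.right.exists_basis (finBasis κ V')
  have hlog : ∀ i, log ((C * h (e i) : ℝ≥0) : ℝ) = s + log (h (e i)) := fun i => by
    have h1 : (0 : ℝ) < h (e i) := H.left.isUNorm.pos (e.ne_zero i)
    have h2 : (0 : ℝ) < C := hC
    rw [coe_mul, log_mul h2.ne' h1.ne', hlC]
  have ht : ∀ x, tensorNorm (K := κ) (fun x => C * h x) h' x = C * tensorNorm (K := κ) h h' x := by
    intro x
    rw [tensorNorm_eq_ofBasis hCh hh'.isUNorm heC he',
      tensorNorm_eq_ofBasis H.left.isUNorm hh'.isUNorm he he']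
    unfold ofBasis
    rw [mul_finset_sup]
    exact sup_congr rfl fun i _ => by ring
  have hWs := (H.left.tensorNorm hh').comp j hj
  have hWC := lvol_const_mul hWs (finBasis κ W) hC
  have hW : labelSum κ (fun t => t) (fun w => tensorNorm (K := κ) (fun x => C * h x) h' (j w)) =
      finrank κ W * s + labelSum κ (fun t => t) (fun w => tensorNorm (K := κ) h h' (j w)) := by
    simp only [ht]
    rw [labelSum_id hWC.1 (finBasis κ W), hWC.2, labelSum_id hWs (finBasis κ W), hlC, card_fin]
  have hcard : (∑ _i : Fin (finrank κ V), (1 : ℝ)) = n := by simp [hn]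
  have e1 : ∑ i, (s + log (h (e i))) = n * s + Γ := by
    rw [sum_add_distrib, ← hcard, sum_mul]
    simp [hΓ]
  have e2 : ∑ i, (s + log (h (e i))) ^ 2 = n * s ^ 2 + 2 * s * Γ + ∑ i, log (h (e i)) ^ 2 := by
    rw [hΓ, mul_sum, ← hcard, sum_mul, ← sum_add_distrib, ← sum_add_distrib]
    exact sum_congr rfl fun i _ => by ring
  unfold kempf at hle
  rw [hW, heC.labelSum_eq, heC.labelSum_eq, he.labelSum_eq, he.labelSum_eq] at hle
  simp only [hlog] at hle
  rw [e1, e2, ← hΓ, ← hn, add_div (n * s), mul_div_cancel_left₀ _ hn0.ne'] at hle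
  rw [he.labelSum_eq, ← hΓ]
  have h3 : 0 ≤ n * s ^ 2 + 2 * s * Γ := by nlinarith
  have h4 : n * s = -Γ := by rw [hs]; field_simp
  have h5 : n * (n * s ^ 2 + 2 * s * Γ) = -Γ ^ 2 := by
    have : n * (n * s ^ 2 + 2 * s * Γ) = (n * s) ^ 2 + 2 * (n * s) * Γ := by ring
    rw [this, h4]; ring
  have h6 : 0 ≤ n * (n * s ^ 2 + 2 * s * Γ) := mul_nonneg hn0.le h3
  rw [h5] at h6
  nlinarith [sq_nonneg Γ]

end Kempf

section KempfExistence

variable {κ : Type*} [Field κ] {V V' W : Type*} [AddCommGroup V] [Module κ V] [AddCommGroup V']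
  [Module κ V'] [AddCommGroup W] [Module κ W]

/-- The norm for the trivial absolute value with `log ‖b i‖ = t i` in the orthogonal
basis `b`. -/
def expNorm {ι : Type*} [Fintype ι] (b : Basis ι κ V) (t : ι → ℝ) : V → ℝ≥0 :=
  ofBasis (trivVal κ) b fun i => toNNReal (exp (t i))

section

variable {ι : Type*} [Fintype ι]

theorem isUNorm_expNorm (b : Basis ι κ V) (t : ι → ℝ) : IsUNorm (trivVal κ) (expNorm b t) :=
  isUNorm_ofBasis b fun _ => toNNReal_pos.2 (exp_pos _)

theorem isOrthogonalBasis_expNorm (b : Basis ι κ V) (t : ι → ℝ) :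
    IsOrthogonalBasis (trivVal κ) (expNorm b t) b := isOrthogonalBasis_ofBasis _ _

theorem isSplittableNorm_expNorm (b : Basis ι κ V) (t : ι → ℝ) :
    IsSplittableNorm (trivVal κ) (expNorm b t) :=
  (isUNorm_expNorm b t).isSplittableNorm (isOrthogonalBasis_expNorm b t)

theorem log_expNorm (b : Basis ι κ V) (t : ι → ℝ) (i : ι) : log (expNorm b t (b i)) = t i := by
  rw [expNorm, ofBasis_apply_basis, coe_toNNReal _ (exp_pos _).le, log_exp]

theorem labelSum_expNorm (b : Basis ι κ V) (t : ι → ℝ) (φ : ℝ → ℝ) :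
    labelSum κ φ (expNorm b t) = ∑ i, φ (t i) := by
  rw [(isOrthogonalBasis_expNorm b t).labelSum_eq]
  simp only [log_expNorm]

theorem IsOrthogonalBasis.eq_expNorm {h : V → ℝ≥0} {b : Basis ι κ V}
    (hh : IsUNorm (trivVal κ) h) (hb : IsOrthogonalBasis (trivVal κ) h b) :
    h = expNorm b fun i => log (h (b i)) := by
  conv_lhs => rw [hb.eq_ofBasis]
  unfold expNorm
  congr 1
  funext i
  have h1 : (0 : ℝ) < h (b i) := hh.pos (b.ne_zero i)
  rw [Real.exp_log h1, Real.toNNReal_coe]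

theorem tensorNorm_expNorm {ι' : Type*} [Fintype ι'] (b : Basis ι κ V) (t : ι → ℝ)
    (b' : Basis ι' κ V') (t' : ι' → ℝ) : tensorNorm (K := κ) (expNorm b t) (expNorm b' t') =
      expNorm (b.tensorProduct b') fun k => t k.1 + t' k.2 := by
  rw [tensorNorm_eq_ofBasis (isUNorm_expNorm b t) (isUNorm_expNorm b' t')
    (isOrthogonalBasis_expNorm b t) (isOrthogonalBasis_expNorm b' t')]
  unfold expNorm
  congr 1
  funext k
  rw [ofBasis_apply_basis, ofBasis_apply_basis, ← toNNReal_mul (exp_pos _).le, exp_add]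

theorem expNorm_le (b : Basis ι κ V) {t u : ι → ℝ} {δ : ℝ} (h : ∀ i, t i ≤ δ + u i) (x : V) :
    expNorm b t x ≤ toNNReal (exp δ) * expNorm b u x := by
  unfold expNorm ofBasis
  rw [mul_finset_sup]
  refine Finset.sup_mono_fun fun i _ => ?_
  rw [mul_left_comm, ← toNNReal_mul (exp_pos _).le, ← exp_add]
  exact mul_le_mul_right (Real.toNNReal_le_toNNReal (Real.exp_le_exp.2 (h i))) _

end

theorem sq_norm_le_sum_sq {ι : Type*} [Fintype ι] (t : ι → ℝ) : ‖t‖ ^ 2 ≤ ∑ i, t i ^ 2 := by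
  have h0 : 0 ≤ ∑ i, t i ^ 2 := sum_nonneg fun i _ => sq_nonneg _
  have h : ‖t‖ ≤ Real.sqrt (∑ i, t i ^ 2) := by
    rw [pi_norm_le_iff_of_nonneg (Real.sqrt_nonneg _)]
    intro i
    refine Real.abs_le_sqrt ?_
    exact single_le_sum (f := fun i => t i ^ 2) (fun i _ => sq_nonneg _) (mem_univ i)
  calc ‖t‖ ^ 2 ≤ Real.sqrt (∑ i, t i ^ 2) ^ 2 := pow_le_pow_left₀ (norm_nonneg _) h 2
    _ = _ := Real.sq_sqrt h0

theorem sum_div_card_le_norm {n : ℕ} (t : Fin n → ℝ) : (∑ i, t i) / n ≤ ‖t‖ := by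
  rcases Nat.eq_zero_or_pos n with rfl | hn
  · simp
  · have hn' : (0 : ℝ) < n := by exact_mod_cast hn
    rw [div_le_iff₀ hn']
    calc ∑ i, t i ≤ ∑ _i : Fin n, ‖t‖ :=
          sum_le_sum fun i _ => (le_abs_self _).trans (norm_le_pi_norm t i)
      _ = ‖t‖ * n := by simp [mul_comm]

variable [FiniteDimensional κ V] [FiniteDimensional κ V'] [FiniteDimensional κ W]
  {n n' : ℕ} {j : W →ₗ[κ] V ⊗[κ] V'}

/-- The ranks of the intersections of `W` with the coordinate subspaces of `V ⊗ V'`. -/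
def coordRank (j : W →ₗ[κ] V ⊗[κ] V') (e : Basis (Fin n) κ V)
    (e' : Basis (Fin n') κ V') (S : Set (Fin n × Fin n')) : ℕ :=
  finrank κ ((coordSub (e.tensorProduct e') S).comap j)

theorem kempf_eq_of_coordRank_eq (hj : Injective j) {e u : Basis (Fin n) κ V}
    {e' u' : Basis (Fin n') κ V'} (h : coordRank j e e' = coordRank j u u')
    (t : Fin n → ℝ) (t' : Fin n' → ℝ) :
    kempf j (expNorm e t) (expNorm e' t') = kempf j (expNorm u t) (expNorm u' t') := by
  have key : ∀ (e : Basis (Fin n) κ V) (e' : Basis (Fin n') κ V') (c : ℝ≥0), finrank κ (ballSpan κ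
        (fun w => tensorNorm (K := κ) (expNorm e t) (expNorm e' t') (j w)) c) =
      coordRank j e e' {k | toNNReal (exp (t k.1 + t' k.2)) ≤ c} := by
    intro e e' c
    have h2 : {w | tensorNorm (K := κ) (expNorm e t) (expNorm e' t') (j w) ≤ c} =
        (((coordSub (e.tensorProduct e')
          {k | toNNReal (exp (t k.1 + t' k.2)) ≤ c}).comap j : Submodule κ W) : Set W) := by
      ext w
      rw [tensorNorm_expNorm]
      refine ((isOrthogonalBasis_expNorm (e.tensorProduct e')
        fun k => t k.1 + t' k.2).le_iff (x := j w)).trans ?_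
      refine forall_congr' fun k => ?_
      rw [expNorm, ofBasis_apply_basis]
      by_cases h0 : (e.tensorProduct e').repr (j w) k = 0
      · simp [h0]
      · rw [trivVal_apply h0, one_mul]
        simp [h0]
    have h3 : ballSpan κ (fun w => tensorNorm (K := κ) (expNorm e t) (expNorm e' t') (j w)) c =
        (coordSub (e.tensorProduct e') {k | toNNReal (exp (t k.1 + t' k.2)) ≤ c}).comap j := by
      rw [ballSpan, h2, Submodule.span_eq]
    unfold coordRank
    rw [h3]
  unfold kempf
  simp only [labelSum_expNorm]
  rw [labelSum_congr_ball
    (((isSplittableNorm_expNorm e t).tensorNorm (isSplittableNorm_expNorm e' t')).comp j hj)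
    (((isSplittableNorm_expNorm u t).tensorNorm (isSplittableNorm_expNorm u' t')).comp j hj)
    (fun c => by rw [key, key, h])]

theorem exists_forall_kempf_expNorm_le (hj : Injective j) (e : Basis (Fin n) κ V)
    (e' : Basis (Fin n') κ V') : ∃ p : (Fin n → ℝ) × (Fin n' → ℝ), ∀ q : (Fin n → ℝ) × (Fin n' → ℝ),
      kempf j (expNorm e p.1) (expNorm e' p.2) ≤ kempf j (expNorm e q.1) (expNorm e' q.2) := by
  have hn : finrank κ V = n := by rw [finrank_eq_card_basis e, card_fin]
  have hn' : finrank κ V' = n' := by rw [finrank_eq_card_basis e', card_fin]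
  let r : ℝ := finrank κ W
  let w : (Fin n → ℝ) × (Fin n' → ℝ) → ℝ := fun p => labelSum κ (fun t => t)
    (fun x => tensorNorm (K := κ) (expNorm e p.1) (expNorm e' p.2) (j x))
  have hs : ∀ p : (Fin n → ℝ) × (Fin n' → ℝ), IsSplittableNorm (trivVal κ)
      (fun x => tensorNorm (K := κ) (expNorm e p.1) (expNorm e' p.2) (j x)) := fun p =>
    ((isSplittableNorm_expNorm e p.1).tensorNorm (isSplittableNorm_expNorm e' p.2)).comp j hj
  have hr : 0 ≤ r := Nat.cast_nonneg _
  have hw : ∀ p q, w p ≤ w q + (2 * r) * dist p q := by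
    intro p q
    have h1 := lvol_le_of_le_mul (hs p) (hs q) (finBasis κ W)
      (C := toNNReal (exp (2 * dist p q))) (toNNReal_pos.2 (exp_pos _)) fun x => by
        rw [tensorNorm_expNorm, tensorNorm_expNorm]
        refine expNorm_le _ (fun k => ?_) _
        have h2 : dist (p.1 k.1) (q.1 k.1) ≤ dist p q :=
          (dist_le_pi_dist p.1 q.1 k.1).trans (le_max_left _ _)
        have h3 : dist (p.2 k.2) (q.2 k.2) ≤ dist p q :=
          (dist_le_pi_dist p.2 q.2 k.2).trans (le_max_right _ _)
        rw [Real.dist_eq] at h2 h3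
        have h4 := (le_abs_self _).trans h2
        have h5 := (le_abs_self _).trans h3
        linarith
    rw [← labelSum_id (hs p), ← labelSum_id (hs q), coe_toNNReal _ (exp_pos _).le,
      log_exp, card_fin] at h1
    change w p ≤ r * (2 * dist p q) + w q at h1
    linarith
  have hwc : Continuous w := (LipschitzWith.of_le_add_mul (toNNReal (2 * r)) fun p q => by
      rw [coe_toNNReal _ (by positivity)]; exact hw p q).continuous
  have hF : ∀ p : (Fin n → ℝ) × (Fin n' → ℝ), kempf j (expNorm e p.1) (expNorm e' p.2) =
      w p - r * ((∑ i, p.1 i) / n + (∑ i, p.2 i) / n') + (∑ i, p.1 i ^ 2 + ∑ i, p.2 i ^ 2) / 2 := by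
    intro p
    unfold kempf
    simp only [labelSum_expNorm, hn, hn']
    rfl
  simp only [hF]
  have hcont : Continuous fun p : (Fin n → ℝ) × (Fin n' → ℝ) =>
      w p - r * ((∑ i, p.1 i) / n + (∑ i, p.2 i) / n') +
        (∑ i, p.1 i ^ 2 + ∑ i, p.2 i ^ 2) / 2 := by fun_prop
  refine hcont.exists_forall_le ?_
  have hlow : ∀ p : (Fin n → ℝ) × (Fin n' → ℝ), w 0 + ‖p‖ * (‖p‖ / 2 - 4 * r) ≤
      w p - r * ((∑ i, p.1 i) / n + (∑ i, p.2 i) / n') + (∑ i, p.1 i ^ 2 + ∑ i, p.2 i ^ 2) / 2 := by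
    intro p
    have h1 := hw 0 p
    rw [dist_zero_left] at h1
    have h2 : (∑ i, p.1 i) / n ≤ ‖p‖ := (sum_div_card_le_norm p.1).trans (le_max_left _ _)
    have h3 : (∑ i, p.2 i) / n' ≤ ‖p‖ := (sum_div_card_le_norm p.2).trans (le_max_right _ _)
    have h4 : ‖p‖ ^ 2 ≤ ∑ i, p.1 i ^ 2 + ∑ i, p.2 i ^ 2 := by
      have h5 := sq_norm_le_sum_sq p.1
      have h6 := sq_norm_le_sum_sq p.2
      rcases max_choice ‖p.1‖ ‖p.2‖ with hm | hm
      · rw [Prod.norm_def, hm]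
        linarith [sq_nonneg ‖p.2‖]
      · rw [Prod.norm_def, hm]
        linarith [sq_nonneg ‖p.1‖]
    have h7 := mul_le_mul_of_nonneg_left (add_le_add h2 h3) hr
    nlinarith
  refine Filter.tendsto_atTop_mono hlow ?_
  refine Filter.tendsto_atTop_add_const_left _ _ ?_
  have hN := tendsto_norm_cocompact_atTop (E := (Fin n → ℝ) × (Fin n' → ℝ))
  refine Filter.Tendsto.atTop_mul_atTop₀ hN ?_
  refine Filter.tendsto_atTop_add_const_right _ _ ?_
  exact hN.atTop_div_const two_pos

/-- A pair minimizing Kempf's functional exists: on the pairs split by a given pair of bases, the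
functional is continuous and coercive in the labels, and as a function of the labels it only
depends on the ranks of the intersections of `W` with the coordinate subspaces, for which there are
finitely many possibilities. -/
theorem exists_isKempf (hj : Injective j) : ∃ h h', IsKempf j h h' := by
  let n := finrank κ V
  let n' := finrank κ V'
  let r := finrank κ W
  let B := Basis (Fin n) κ V × Basis (Fin n') κ V'
  let τ : B → Set (Fin n × Fin n') → Fin (r + 1) := fun b S =>
    ⟨coordRank j b.1 b.2 S, Nat.lt_succ_of_le (finrank_le _)⟩
  choose p hp using fun b : B => exists_forall_kempf_expNorm_le hj b.1 b.2
  let R := Set.range τ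
  have : Nonempty R := ⟨⟨_, (finBasis κ V, finBasis κ V'), rfl⟩⟩
  choose b hb using fun s : R => s.2
  obtain ⟨s, hs⟩ := Finite.exists_min fun s : R =>
    kempf j (expNorm (b s).1 (p (b s)).1) (expNorm (b s).2 (p (b s)).2)
  refine ⟨_, _, isSplittableNorm_expNorm (b s).1 (p (b s)).1,
    isSplittableNorm_expNorm (b s).2 (p (b s)).2, fun k k' hk hk' => ?_⟩
  obtain ⟨e, he⟩ := hk.exists_basis (finBasis κ V)
  obtain ⟨e', he'⟩ := hk'.exists_basis (finBasis κ V')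
  rw [he.eq_expNorm hk.isUNorm, he'.eq_expNorm hk'.isUNorm]
  let s' : R := ⟨τ (e, e'), _, rfl⟩
  refine (hs s').trans ((hp (b s') (fun i => log (k (e i)),
    fun i => log (k' (e' i)))).trans (le_of_eq ?_))
  refine kempf_eq_of_coordRank_eq hj ?_ _ _
  funext S
  exact congrArg Fin.val (congrFun (hb s') S)

end KempfExistence

/-! ### Rationality of the optimal pair -/

section Semilinear

variable {κ : Type*} [Field κ] {τ : κ ≃+* κ} {V V' W : Type*} [AddCommGroup V] [Module κ V]
  [AddCommGroup V'] [Module κ V'] [AddCommGroup W] [Module κ W]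
variable {h : V → ℝ≥0} {h' : V' → ℝ≥0}

theorem IsSplittableNorm.mem_ballSpan [FiniteDimensional κ V]
    (hh : IsSplittableNorm (trivVal κ) h) {c : ℝ≥0} {x : V} : x ∈ ballSpan κ h c ↔ h x ≤ c := by
  obtain ⟨e, he⟩ := hh.splittable
  rw [he.ballSpan_eq]
  refine Iff.trans ?_ (he.le_iff (x := x)).symm
  refine forall_congr' fun i => ?_
  by_cases h0 : e.repr x i = 0
  · simp [h0]
  · rw [trivVal_apply h0, one_mul]
    simp [h0]

variable [FiniteDimensional κ V] [FiniteDimensional κ V'] [FiniteDimensional κ W]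
  {φ : V →ₛₗ[(τ : κ →+* κ)] V} {φ' : V' →ₛₗ[(τ : κ →+* κ)] V'} {ψ : W →ₛₗ[(τ : κ →+* κ)] W}

theorem IsSplittableNorm.comp_semilinear (hφ : Injective φ)
    (hh : IsSplittableNorm (trivVal κ) h) : IsSplittableNorm (trivVal κ) fun x => h (φ x) := by
  have hu : IsUNorm (trivVal κ) fun x => h (φ x) :=
    ⟨fun x => (hh.eq_zero_iff _).trans (map_eq_zero_iff φ hφ), fun c x => by
      rw [LinearMap.map_smulₛₗ, hh.smul]
      congr 1
      by_cases hc : c = 0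
      · simp [hc]
      · rw [trivVal_apply hc]
        exact trivVal_apply ((map_ne_zero (τ : κ →+* κ)).2 hc), fun x y => by
      rw [map_add]
      exact hh.add_le_max _ _⟩
  exact hu.isSplittableNorm_of_trivVal (hh.finite_range.subset (Set.range_comp_subset_range φ h))

theorem labelSum_comp_semilinear (hφ : Bijective φ)
    (hh : IsSplittableNorm (trivVal κ) h) (f : ℝ → ℝ) :
    labelSum κ f (fun x => h (φ x)) = labelSum κ f h := by
  have hh' := hh.comp_semilinear hφ.1
  refine labelSum_congr_ball hh' hh (fun c => ?_) f
  let e : V ≃+ V := AddEquiv.ofBijective φ hφ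
  let E : ballSpan κ (fun x => h (φ x)) c ≃+ ballSpan κ h c :=
    { toFun := fun x => ⟨φ x, hh.mem_ballSpan.2 (hh'.mem_ballSpan.1 x.2)⟩
      invFun := fun y => ⟨e.symm y, hh'.mem_ballSpan.2 (by
        have h1 : φ (e.symm y) = y := e.apply_symm_apply _
        rw [h1]
        exact hh.mem_ballSpan.1 y.2)⟩
      left_inv := fun x => Subtype.ext (e.symm_apply_apply _)
      right_inv := fun x => Subtype.ext (e.apply_symm_apply _)
      map_add' := fun x y => Subtype.ext (map_add φ _ _) }
  have := rank_eq_of_equiv_equiv (R := κ) (R' := κ) τ E τ.bijective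
    fun r m => Subtype.ext (LinearMap.map_smulₛₗ φ r (m : V))
  rw [finrank, finrank, this]

theorem bijective_map_semilinear (hφ : Bijective φ) (hφ' : Bijective φ') :
    Bijective (TensorProduct.map φ φ') := by
  have := RingHomInvPair.of_ringEquiv τ
  have := RingHomInvPair.of_ringEquiv_symm τ
  exact (TensorProduct.congr (LinearEquiv.ofBijective φ hφ)
    (LinearEquiv.ofBijective φ' hφ')).bijective

theorem tensorNorm_comp_semilinear (hφ : Bijective φ) (hφ' : Bijective φ')
    (h : V → ℝ≥0) (h' : V' → ℝ≥0) (t : V ⊗[κ] V') :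
    tensorNorm (K := κ) (fun x => h (φ x)) (fun x => h' (φ' x)) t =
      tensorNorm (K := κ) h h' (TensorProduct.map φ φ' t) := by
  unfold tensorNorm
  congr 1
  ext r
  constructor
  · rintro ⟨m, x, y, rfl, rfl⟩
    exact ⟨m, fun i => φ (x i), fun i => φ' (y i), by simp [map_sum], rfl⟩
  · rintro ⟨m, x, y, ht, rfl⟩
    choose x' hx' using fun i => hφ.2 (x i)
    choose y' hy' using fun i => hφ'.2 (y i)
    refine ⟨m, x', y', (bijective_map_semilinear hφ hφ').1 ?_, by simp only [hx', hy']⟩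
    rw [ht, map_sum]
    simp [hx', hy']

variable {j : W →ₗ[κ] V ⊗[κ] V'}

/-- The optimal pair is invariant under the semilinear automorphisms preserving `W`. -/
theorem IsKempf.invariant (hj : Injective j)
    (H : IsKempf j h h') (hφ : Bijective φ) (hφ' : Bijective φ')
    (hψ : Bijective ψ) (hjψ : ∀ w, j (ψ w) = TensorProduct.map φ φ' (j w)) :
    (∀ x, h (φ x) = h x) ∧ ∀ x, h' (φ' x) = h' x := by
  have e1 : kempf j (fun x => h (φ x)) (fun x => h' (φ' x)) = kempf j h h' := by
    unfold kempf
    simp only [tensorNorm_comp_semilinear hφ hφ', ← hjψ]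
    rw [labelSum_comp_semilinear hφ H.left, labelSum_comp_semilinear hφ H.left,
      labelSum_comp_semilinear hφ' H.right, labelSum_comp_semilinear hφ' H.right,
      labelSum_comp_semilinear (h := fun w => tensorNorm (K := κ) h h' (j w)) hψ
        ((H.left.tensorNorm H.right).comp j hj)]
  have H' : IsKempf j (fun x => h (φ x)) (fun x => h' (φ' x)) :=
    ⟨H.left.comp_semilinear hφ.1, H.right.comp_semilinear hφ'.1, fun k k' hk hk' => by
      rw [e1]; exact H.le k k' hk hk'⟩
  obtain ⟨h1, h2⟩ := H'.unique hj H
  exact ⟨congrFun h1, congrFun h2⟩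

theorem tensorNorm_comm (h : V → ℝ≥0) (h' : V' → ℝ≥0) (t : V ⊗[κ] V') :
    tensorNorm (K := κ) h' h (TensorProduct.comm κ V V' t) = tensorNorm (K := κ) h h' t := by
  unfold tensorNorm
  congr 1
  ext r
  constructor
  · rintro ⟨m, x, y, ht, rfl⟩
    refine ⟨m, y, x, (TensorProduct.comm κ V V').injective ?_, by simp only [mul_comm]⟩
    rw [ht, map_sum]
    simp
  · rintro ⟨m, x, y, rfl, rfl⟩
    exact ⟨m, y, x, by simp [map_sum], by simp only [mul_comm]⟩

theorem kempf_comm (j : W →ₗ[κ] V ⊗[κ] V') (h : V → ℝ≥0) (h' : V' → ℝ≥0) :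
    kempf ((TensorProduct.comm κ V V').toLinearMap ∘ₗ j) h' h = kempf j h h' := by
  have h1 : ∀ w, tensorNorm (K := κ) h' h (((TensorProduct.comm κ V V').toLinearMap ∘ₗ j) w) =
      tensorNorm (K := κ) h h' (j w) := fun w => tensorNorm_comm h h' (j w)
  unfold kempf
  simp only [h1]
  ring

theorem IsKempf.symm (H : IsKempf j h h') :
    IsKempf ((TensorProduct.comm κ V V').toLinearMap ∘ₗ j) h' h :=
  ⟨H.right, H.left, fun k k' hk hk' => by rw [kempf_comm, kempf_comm]; exact H.le k' k hk' hk⟩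

theorem IsKempf.labelSum_eq_zero_right [Nontrivial V'] (hj : Injective j)
    (H : IsKempf j h h') : labelSum κ (fun t => t) h' = 0 :=
  H.symm.labelSum_eq_zero (j := (TensorProduct.comm κ V V').toLinearMap ∘ₗ j)
    (fun _ _ hxy => hj ((TensorProduct.comm κ V V').injective hxy))

end Semilinear

section Descent

variable {L : Type*} [Field L] {Ω : Type*} [Field Ω] [Algebra L Ω]
  {V V' W : Type*} [AddCommGroup V] [Module L V] [AddCommGroup V'] [Module L V']
  [AddCommGroup W] [Module L W]
variable {j : W →ₗ[L] V ⊗[L] V'} {N : V → ℝ≥0} {y : Basis ι L V}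

variable (V) in
/-- The semilinear action of an automorphism of `Ω` over `L` on `Ω ⊗ V`. -/
def galAct (τ : Ω ≃ₐ[L] Ω) : Ω ⊗[L] V →ₛₗ[((τ : Ω ≃+* Ω) : Ω →+* Ω)] Ω ⊗[L] V :=
  { LinearMap.rTensor V τ.toLinearMap with
    map_smul' := fun c x => by
      change LinearMap.rTensor V τ.toLinearMap (c • x) = (τ c) • LinearMap.rTensor V τ.toLinearMap x
      induction x using TensorProduct.induction_on with
      | zero => simp
      | tmul a x => simp [smul_tmul']
      | add x y hx hy => rw [smul_add, map_add, map_add, smul_add, hx, hy] }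

theorem galAct_tmul (τ : Ω ≃ₐ[L] Ω) (a : Ω) (x : V) : galAct V τ (a ⊗ₜ[L] x) = τ a ⊗ₜ[L] x := rfl

theorem galAct_bijective (τ : Ω ≃ₐ[L] Ω) : Bijective (galAct V τ) := by
  have h : ∀ (τ : Ω ≃ₐ[L] Ω) (x : Ω ⊗[L] V), galAct V τ.symm (galAct V τ x) = x := by
    intro τ x
    induction x using TensorProduct.induction_on with
    | zero => rw [map_zero, map_zero]
    | tmul a x => rw [galAct_tmul, galAct_tmul, AlgEquiv.symm_apply_apply]
    | add x y hx hy => rw [map_add, map_add, hx, hy]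
  exact ⟨Function.LeftInverse.injective (h τ), Function.RightInverse.surjective
    (g := galAct V τ.symm) (f := galAct V τ) (h τ.symm)⟩

variable (Ω) in
/-- The extension of scalars of a map to a tensor product. -/
def extMap (j : W →ₗ[L] V ⊗[L] V') : Ω ⊗[L] W →ₗ[Ω] (Ω ⊗[L] V) ⊗[Ω] (Ω ⊗[L] V') :=
  (distribBaseChange L Ω V V').toLinearMap ∘ₗ j.baseChange Ω

theorem extMap_injective [FiniteDimensional L V] [FiniteDimensional L V']
    [FiniteDimensional L W] (hj : Injective j) : Injective (extMap Ω j) :=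
  (distribBaseChange L Ω V V').injective.comp (baseChange_injective hj)

theorem extMap_galAct (j : W →ₗ[L] V ⊗[L] V') (τ : Ω ≃ₐ[L] Ω) (w : Ω ⊗[L] W) :
    extMap Ω j (galAct W τ w) = TensorProduct.map (galAct V τ) (galAct V' τ) (extMap Ω j w) := by
  induction w using TensorProduct.induction_on with
  | zero => rw [map_zero, map_zero, map_zero]
  | add x y hx hy => rw [map_add, map_add, map_add, map_add, hx, hy]
  | tmul a w =>
    rw [galAct_tmul]
    have h1 : ∀ b : Ω, extMap Ω j (b ⊗ₜ[L] w) =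
        distribBaseChange L Ω V V' (b ⊗ₜ[L] j w) := fun b => rfl
    rw [h1, h1]
    induction j w using TensorProduct.induction_on with
    | zero => rw [tmul_zero, tmul_zero, map_zero, map_zero]
    | add x y hx hy => rw [tmul_add, tmul_add, map_add, map_add, map_add, hx, hy]
    | tmul x y =>
      rw [distribBaseChange_tmul, distribBaseChange_tmul, map_tmul,
        galAct_tmul, galAct_tmul, map_one]

/-- Descent of filtrations: a filtration of `Ω ⊗ V` which is invariant under the automorphisms
of `Ω` over `L` is defined over the fixed field `L`. A vector of minimal length in a given step
with a coordinate `1` is fixed by all automorphisms. -/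
theorem exists_orthogonal_baseChange [CharZero L] [IsAlgClosed Ω] [FiniteDimensional L V]
    {h : Ω ⊗[L] V → ℝ≥0} (hh : IsSplittableNorm (trivVal Ω) h)
    (hinv : ∀ (τ : Ω ≃ₐ[L] Ω) x, h (galAct V τ x) = h x) :
    ∃ (N : V → ℝ≥0) (y : Basis (Fin (finrank L V)) L V),
      IsSplittableNorm (trivVal L) N ∧ IsOrthogonalBasis (trivVal L) N y ∧
        h = extNorm (trivVal Ω) y N := by
  let N : V → ℝ≥0 := fun x => h (1 ⊗ₜ[L] x)
  have hNu : IsUNorm (trivVal L) N := ⟨fun x => by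
      refine (hh.eq_zero_iff _).trans ⟨fun h0 => ?_, fun h0 => by rw [h0, tmul_zero]⟩
      by_contra hx
      have hinj := Flat.rTensor_preserves_injective_linearMap (M := V)
        (Algebra.linearMap L Ω) (algebraMap L Ω).injective
      have h1 : LinearMap.rTensor V (Algebra.linearMap L Ω) ((TensorProduct.lid L V).symm x) =
          1 ⊗ₜ[L] x := by simp
      rw [← h1] at h0
      exact hx ((TensorProduct.lid L V).symm.map_eq_zero_iff.1
        (hinj (h0.trans (map_zero _).symm))), fun c x => by
      have h1 : (1 : Ω) ⊗ₜ[L] (c • x) = algebraMap L Ω c • ((1 : Ω) ⊗ₜ[L] x) := by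
        rw [TensorProduct.tmul_smul, algebraMap_smul]
      change h _ = _
      rw [h1, hh.smul]
      congr 1
      by_cases hc : c = 0
      · simp [hc]
      · rw [trivVal_apply hc, trivialOn_trivVal c hc], fun x y => by
      change h _ ≤ _
      rw [tmul_add]
      exact hh.add_le_max _ _⟩
  have hN : IsSplittableNorm (trivVal L) N := hNu.isSplittableNorm_of_trivVal
    (hh.finite_range.subset (Set.range_comp_subset_range _ h))
  obtain ⟨y, hy⟩ := hN.splittable
  refine ⟨N, y, hN, hy, ?_⟩
  let B := y.baseChange Ω
  have hB : ∀ i, B i = (1 : Ω) ⊗ₜ[L] y i := fun i => Basis.baseChange_apply _ _ i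
  have hBN : ∀ i, h (B i) = N (y i) := fun i => by rw [hB]
  have hcard : ∀ {x x' : Ω ⊗[L] V} {k}, (∀ l, B.repr x' l ≠ 0 → B.repr x l ≠ 0) →
      B.repr x' k = 0 → B.repr x k ≠ 0 → (B.repr x').support.card < (B.repr x).support.card :=
    fun h hk hk' => Finset.card_lt_card ((Finset.ssubset_iff_of_subset fun l hl =>
      Finsupp.mem_support_iff.2 (h l (Finsupp.mem_support_iff.1 hl))).2
        ⟨_, Finsupp.mem_support_iff.2 hk', fun h' => Finsupp.mem_support_iff.1 h' hk⟩)
  -- the coordinates of an element of a ball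
  have key : ∀ (m : ℕ) (c : ℝ≥0) (x : Ω ⊗[L] V), (B.repr x).support.card ≤ m → h x ≤ c →
      ∀ i, B.repr x i ≠ 0 → N (y i) ≤ c := by
    intro m
    induction m with
    | zero =>
      intro c x hm _ i hi
      exact absurd (Finsupp.mem_support_iff.2 hi) (by
        simp [Finset.card_eq_zero.1 (Nat.le_zero.1 hm)])
    | succ m ih =>
      intro c x hm hx i hi
      by_cases hex : ∃ k, B.repr x k ≠ 0 ∧ N (y k) ≤ c
      · obtain ⟨k, hk, hkc⟩ := hex
        by_cases hik : i = k
        · rwa [hik]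
        let x' := x - B.repr x k • B k
        have hr : ∀ l, B.repr x' l = if l = k then 0 else B.repr x l := fun l => by
          simp only [x', map_sub, map_smul, Finsupp.sub_apply, Finsupp.smul_apply,
            Basis.repr_self, single_apply, smul_eq_mul]
          by_cases hlk : l = k
          · simp [hlk]
          · simp [hlk, Ne.symm hlk]
        have hsub := hcard (x := x) (x' := x') (fun l hl h0 => hl (by rw [hr, h0, ite_self]))
          (by rw [hr, if_pos rfl]) hk
        refine ih c x' (Nat.lt_succ_iff.1 (hsub.trans_le hm)) ?_ i ?_
        · refine (hh.isUNorm.sub_le_max _ _).trans (max_le hx ?_)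
          rw [hh.smul, trivVal_apply hk, one_mul, hBN]
          exact hkc
        · rwa [hr, if_neg hik]
      · push Not at hex
        exfalso
        -- normalize the coordinate at `i` to `1`
        let z := (B.repr x i)⁻¹ • x
        have hz : h z ≤ c := by rw [hh.smul, trivVal_apply (inv_ne_zero hi), one_mul]; exact hx
        have hzr : ∀ l, B.repr z l = (B.repr x i)⁻¹ * B.repr x l := fun l => by simp [z]
        have hzi : B.repr z i = 1 := by rw [hzr, inv_mul_cancel₀ hi]
        have hsupp : ∀ l, B.repr z l ≠ 0 → B.repr x l ≠ 0 := fun l hl h0 => hl (by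
          rw [hzr, h0, mul_zero])
        have hgal : ∀ (τ : Ω ≃ₐ[L] Ω) (l), B.repr (galAct V τ z) l = τ (B.repr z l) := by
          intro τ l
          conv_lhs => rw [← B.sum_repr z]
          simp only [map_sum, LinearMap.map_smulₛₗ, hB, galAct_tmul, map_one, map_smul]
          simp only [← hB, Finsupp.coe_finsetSum, Finset.sum_apply, Finsupp.smul_apply,
            Basis.repr_self, single_apply, smul_eq_mul]
          simp
        have hfix : ∀ (τ : Ω ≃ₐ[L] Ω) (l), τ (B.repr z l) = B.repr z l := by
          intro τ l
          by_contra hne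
          let d := galAct V τ z - z
          have hd : ∀ l, B.repr d l = τ (B.repr z l) - B.repr z l := fun l => by
            simp only [d, map_sub, Finsupp.sub_apply, hgal]
          have hds : ∀ l, B.repr d l ≠ 0 → B.repr x l ≠ 0 := fun l hl => hsupp l fun h0 => hl (by
            rw [hd, h0, map_zero, sub_zero])
          have hsub := hcard hds (by rw [hd, hzi, map_one, sub_self]) hi
          have hdl : B.repr d l ≠ 0 := by rw [hd]; exact sub_ne_zero.2 hne
          refine (hex l (hds l hdl)).not_ge (ih c d (Nat.lt_succ_iff.1 (hsub.trans_le hm)) ?_ l hdl)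
          exact (hh.isUNorm.sub_le_max _ _).trans (max_le (by rw [hinv]; exact hz) hz)
        choose a ha using fun l => mem_range_algebraMap_of_fixed (L := L) fun τ => hfix τ l
        let x0 : V := ∑ l, a l • y l
        have hx0 : (1 : Ω) ⊗ₜ[L] x0 = z := by
          rw [← B.sum_repr z, TensorProduct.tmul_sum]
          refine sum_congr rfl fun l _ => ?_
          rw [hB, ← ha, TensorProduct.tmul_smul, algebraMap_smul]
        have h2 := (hy.le_iff (x := x0)).1 (show h _ ≤ c by rwa [hx0]) i
        have h3 : y.repr x0 i = a i := by simp [x0, single_apply]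
        have h4 : a i ≠ 0 := fun h0 => zero_ne_one (by rw [← hzi, ← ha, h0, map_zero])
        rw [h3, trivVal_apply h4, one_mul] at h2
        exact (hex i hi).not_ge h2
  funext x
  apply le_antisymm
  · conv_lhs => rw [← B.sum_repr x]
    refine hh.isUNorm.sum_le _ _ fun i _ => ?_
    rw [hh.smul, hBN]
    exact le_sup (f := fun i => trivVal Ω (B.repr x i) * N (y i)) (mem_univ i)
  · unfold extNorm ofBasis
    refine Finset.sup_le fun i _ => ?_
    by_cases h0 : (y.baseChange Ω).repr x i = 0
    · rw [h0, map_zero, zero_mul]; exact zero_le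
    · rw [trivVal_apply h0, one_mul]
      exact key _ (h x) x le_rfl le_rfl i h0

theorem labelSum_extNorm {ι : Type*} [Fintype ι] {y : Basis ι L V}
    (hy : IsOrthogonalBasis (trivVal L) N y) (f : ℝ → ℝ) :
    labelSum Ω f (extNorm (trivVal Ω) y N) = labelSum L f N := by
  have h1 : IsOrthogonalBasis (trivVal Ω) (extNorm (trivVal Ω) y N) (y.baseChange Ω) :=
    isOrthogonalBasis_ofBasis _ _
  rw [h1.labelSum_eq, hy.labelSum_eq]
  simp only [extNorm_basis]

theorem labelSum_extMap [FiniteDimensional L V] [FiniteDimensional L V'] [FiniteDimensional L W]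
    {ι ι' : Type*} [Fintype ι] [Fintype ι'] (hj : Injective j)
    {N' : V' → ℝ≥0} {y : Basis ι L V} {y' : Basis ι' L V'}
    (hN : IsSplittableNorm (trivVal L) N) (hN' : IsSplittableNorm (trivVal L) N')
    (hy : IsOrthogonalBasis (trivVal L) N y) (hy' : IsOrthogonalBasis (trivVal L) N' y') :
    labelSum Ω (fun t => t) (fun w => tensorNorm (K := Ω) (extNorm (trivVal Ω) y N)
      (extNorm (trivVal Ω) y' N') (extMap Ω j w)) =
      labelSum L (fun t => t) (fun w => tensorNorm (K := L) N N' (j w)) := by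
  have hT := isOrthogonalBasis_tensorNorm hN.isUNorm hN'.isUNorm hy hy'
  have hTN := hN.tensorNorm hN'
  have h1 : ∀ w, tensorNorm (K := Ω) (extNorm (trivVal Ω) y N) (extNorm (trivVal Ω) y' N')
      (extMap Ω j w) = extNorm (trivVal Ω) (y.tensorProduct y') (tensorNorm (K := L) N N')
        (j.baseChange Ω w) := fun w =>
    tensorNorm_extNorm hN.isUNorm hN'.isUNorm hy hy' (j.baseChange Ω w)
  simp only [h1]
  rw [labelSum_id ((isSplittableNorm_extNorm (v := trivVal Ω) hTN.isUNorm
    (y.tensorProduct y')).comp _ (baseChange_injective hj))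
    ((finBasis L W).baseChange Ω), labelSum_id (hTN.comp j hj) (finBasis L W)]
  exact lv_extNorm_comp trivialOn_trivVal hTN.isUNorm hT hj (finBasis L W)

theorem kempf_extNorm [FiniteDimensional L V] [FiniteDimensional L V'] [FiniteDimensional L W]
    {ι ι' : Type*} [Fintype ι] [Fintype ι'] (hj : Injective j)
    {N' : V' → ℝ≥0} {y : Basis ι L V} {y' : Basis ι' L V'}
    (hN : IsSplittableNorm (trivVal L) N) (hN' : IsSplittableNorm (trivVal L) N')
    (hy : IsOrthogonalBasis (trivVal L) N y) (hy' : IsOrthogonalBasis (trivVal L) N' y') :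
    kempf (extMap Ω j) (extNorm (trivVal Ω) y N) (extNorm (trivVal Ω) y' N') = kempf j N N' := by
  unfold kempf
  rw [labelSum_extMap hj hN hN' hy hy', labelSum_extNorm hy, labelSum_extNorm hy,
    labelSum_extNorm hy', labelSum_extNorm hy', finrank_baseChange,
    finrank_baseChange, finrank_baseChange]

/-- The optimal pair is defined over the base field and remains optimal over an algebraically
closed extension. -/
theorem exists_isKempf_extMap [CharZero L] [IsAlgClosed Ω] [FiniteDimensional L V]
    [FiniteDimensional L V'] [FiniteDimensional L W] (hj : Injective j) :
    ∃ (N : V → ℝ≥0) (N' : V' → ℝ≥0), IsKempf j N N' ∧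
      ∀ H H', IsSplittableNorm (trivVal Ω) H → IsSplittableNorm (trivVal Ω) H' →
        kempf j N N' ≤ kempf (extMap Ω j) H H' := by
  have hjΩ := extMap_injective (Ω := Ω) hj
  obtain ⟨H, H', hH⟩ := exists_isKempf hjΩ
  have hinv := fun τ : Ω ≃ₐ[L] Ω => hH.invariant hjΩ (galAct_bijective τ) (galAct_bijective τ)
    (galAct_bijective τ) (extMap_galAct j τ)
  obtain ⟨N, y, hN, hy, rfl⟩ := exists_orthogonal_baseChange hH.left fun τ => (hinv τ).1
  obtain ⟨N', y', hN', hy', rfl⟩ := exists_orthogonal_baseChange hH.right fun τ => (hinv τ).2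
  have e := kempf_extNorm (Ω := Ω) hj hN hN' hy hy'
  refine ⟨N, N', ⟨hN, hN', fun k k' hk hk' => ?_⟩, fun k k' hk hk' => ?_⟩
  · obtain ⟨u, hu⟩ := hk.splittable
    obtain ⟨u', hu'⟩ := hk'.splittable
    rw [← e, ← kempf_extNorm (Ω := Ω) hj hk hk' hu hu']
    exact hH.le _ _ (isSplittableNorm_extNorm hk.isUNorm u)
      (isSplittableNorm_extNorm hk'.isUNorm u')
  · rw [← e]
    exact hH.le k k' hk hk'

end Descent

/-! ### Bases adapted to a norm, a filtration and a lattice -/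

section Perturb

variable {K : Type*} [Field K] {v : Valuation K ℝ≥0} {V : Type*} [AddCommGroup V] [Module K V]
  {β : V → ℝ≥0} {ι ι' : Type*} [Fintype ι] [Fintype ι']

theorem IsUNorm.add_eq_of_lt (h : IsUNorm v β) {x y : V} (hxy : β y < β x) : β (x + y) = β x := by
  refine le_antisymm ((h.add_le_max x y).trans (max_le le_rfl hxy.le)) ?_
  have h1 := h.sub_le_max (x + y) y
  rw [add_sub_cancel_right] at h1
  rcases le_max_iff.1 h1 with h2 | h2
  · exact h2
  · exact absurd h2 hxy.not_ge

theorem IsUNorm.sum_lt (h : IsUNorm v β) {f : ι → V} {C : ℝ≥0} (hC : 0 < C)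
    (hf : ∀ i, β (f i) < C) : β (∑ i, f i) < C :=
  (h.sum_le _ _ fun _ hi => le_sup (f := fun i => β (f i)) hi).trans_lt
    ((Finset.sup_lt_iff hC).2 fun i _ => hf i)

/-- A small perturbation of an orthogonal basis is an orthogonal basis. -/
theorem IsOrthogonalBasis.perturb (hβ : IsUNorm v β) {e : Basis ι K V}
    (he : IsOrthogonalBasis v β e) {z : ι → V} (hz : ∀ i, β (z i - e i) < β (e i)) :
    ∃ u : Basis ι K V, (∀ i, u i = z i) ∧ IsOrthogonalBasis v β u ∧ ∀ i, β (z i) = β (e i) := by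
  have := Finite.of_basis e
  have hval : ∀ i, β (z i) = β (e i) := fun i => by
    have := hβ.add_eq_of_lt (hz i)
    rwa [add_sub_cancel] at this
  have key : ∀ (d : ι → K) (i), v (d i) * β (z i) ≤ β (∑ j, d j • z j) := by
    intro d i
    set y := ∑ j, d j • e j with hy
    have hyr : ∀ j, e.repr y j = d j := fun j => by rw [hy, e.repr_sum_self]
    have hle : ∀ j, v (d j) * β (e j) ≤ β y := fun j => by rw [← hyr j]; exact he.le y j
    by_cases hy0 : y = 0
    · have : d i = 0 := by rw [← hyr i, hy0]; simp
      rw [this, map_zero, zero_mul]; exact zero_le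
    have hpos := hβ.pos hy0
    have hd : β (∑ j, d j • (z j - e j)) < β y := by
      refine hβ.sum_lt hpos fun j => ?_
      rw [hβ.smul]
      by_cases hj : d j = 0
      · rw [hj, map_zero, zero_mul]; exact hpos
      · exact (mul_lt_mul_of_pos_left (hz j) (zero_lt_iff.2 (v.ne_zero_iff.2 hj))).trans_le (hle j)
    have hsum : ∑ j, d j • z j = y + ∑ j, d j • (z j - e j) := by
      rw [hy, ← sum_add_distrib]
      refine sum_congr rfl fun j _ => ?_
      rw [← smul_add, add_sub_cancel]
    rw [hsum, hβ.add_eq_of_lt hd, hval]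
    exact hle i
  have hinj : Injective (e.constr K z) := by
    rw [injective_iff_map_eq_zero]
    intro x hx
    rw [e.constr_apply_fintype K] at hx
    apply e.repr.map_eq_zero_iff.1
    ext i
    have h1 := key (fun j => e.equivFun x j) i
    rw [hx, hβ.map_zero, hval] at h1
    have h2 := hβ.pos (e.ne_zero i)
    exact (Valuation.zero_iff v).1 (by_contra fun h0 => h1.not_gt (mul_pos (zero_lt_iff.2 h0) h2))
  let u := e.map (LinearEquiv.ofInjectiveEndo _ hinj)
  have hu : ∀ i, u i = z i := fun i => by
    rw [Basis.map_apply]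
    exact e.constr_basis K z i
  refine ⟨u, hu, hβ.isOrthogonalBasis u fun d i => ?_, hval⟩
  simp only [hu]
  exact key d i

end Perturb

section Equiv

theorem exists_equiv_of_map_univ_eq {ι ι' β : Type*} [Fintype ι] [Fintype ι'] {a : ι → β}
    {b : ι' → β} (h : univ.val.map a = univ.val.map b) : ∃ f : ι ≃ ι', ∀ i, b (f i) = a i := by
  classical
  have hc : ∀ c, card {i // a i = c} = card {i // b i = c} := by
    intro c
    have h1 := congrArg (Multiset.count c) h
    rw [Multiset.count_map, Multiset.count_map] at h1
    rw [card_subtype, card_subtype]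
    simp only [eq_comm (b := c)]
    exact h1
  let f := (Equiv.sigmaFiberEquiv a).symm.trans
    ((Equiv.sigmaCongrRight fun c => equivOfCardEq (hc c)).trans (Equiv.sigmaFiberEquiv b))
  exact ⟨f, fun i => (equivOfCardEq (hc (a i)) ⟨i, rfl⟩).2⟩

end Equiv

section Adapted

variable {K : Type*} [Field K] {v : Valuation K ℝ≥0} {V : Type*} [AddCommGroup V] [Module K V]
  {α β : V → ℝ≥0} {ι : Type*} [Fintype ι]
variable {g : ι → ℝ≥0} {b : Basis ι K V}

/-- The projection onto the span of the basis vectors of weight `c`. -/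
def levelProj (b : Basis ι K V) (g : ι → ℝ≥0) (c : ℝ≥0) : V →ₗ[K] V := by
  classical
  exact b.constr K fun i => if g i = c then b i else 0

theorem levelProj_basis (b : Basis ι K V) (g : ι → ℝ≥0) (c : ℝ≥0) (i : ι)
    [Decidable (g i = c)] : levelProj b g c (b i) = if g i = c then b i else 0 := by
  rw [levelProj, b.constr_basis]
  congr

theorem levelProj_eq {c : ℝ≥0} {i : ι} (h : g i = c) : levelProj b g c (b i) = b i := by
  classical
  rw [levelProj_basis, if_pos h]

theorem levelProj_eq_zero {c : ℝ≥0} {i : ι} (h : g i ≠ c) : levelProj b g c (b i) = 0 := by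
  classical
  rw [levelProj_basis, if_neg h]

/-- The coordinates of a projection with respect to any homogeneous basis. -/
theorem repr_levelProj {ι' : Type*} [Fintype ι']
    {u : Basis ι' K V} {g' : ι' → ℝ≥0} (hu : ∀ c i, g' i = c → levelProj b g c (u i) = u i)
    (hu' : ∀ c i, g' i ≠ c → levelProj b g c (u i) = 0) (c : ℝ≥0) (x : V) (i : ι')
    [Decidable (g' i = c)] : u.repr (levelProj b g c x) i = if g' i = c then u.repr x i else 0 := by
  classical
  conv_lhs => rw [← u.sum_repr x]
  rw [map_sum, map_sum, finsetSum_apply, sum_eq_single i (fun j _ hj => ?_) (by simp),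
    _root_.map_smul]
  · by_cases h : g' i = c
    · simp [hu c i h, h]
    · simp [hu' c i h, h]
  · rw [_root_.map_smul]
    by_cases h : g' j = c
    · simp [hu c j h, hj]
    · simp [hu' c j h]

theorem levelProj_levelProj (b : Basis ι K V) (g : ι → ℝ≥0) (c : ℝ≥0) (x : V) :
    levelProj b g c (levelProj b g c x) = levelProj b g c x := by
  have : levelProj b g c ∘ₗ levelProj b g c = levelProj b g c := b.ext fun i => by
    by_cases h : g i = c
    · simp [levelProj_eq h]
    · simp [levelProj_eq_zero h]
  exact LinearMap.congr_fun this x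

theorem levelProj_levelProj_of_ne (b : Basis ι K V) (g : ι → ℝ≥0) {c d : ℝ≥0} (hcd : c ≠ d)
    (x : V) : levelProj b g c (levelProj b g d x) = 0 := by
  have : levelProj b g c ∘ₗ levelProj b g d = 0 := b.ext fun i => by
    by_cases h : g i = d
    · simp [levelProj_eq h, levelProj_eq_zero (c := c) (fun h' => hcd (h'.symm.trans h))]
    · simp [levelProj_eq_zero h]
  exact LinearMap.congr_fun this x

/-- A norm with a homogeneous orthogonal basis does not increase under projections. -/
theorem ofBasis_levelProj_le {ι' : Type*} [Fintype ι']
    {u : Basis ι' K V} {g' : ι' → ℝ≥0} (hu : ∀ c i, g' i = c → levelProj b g c (u i) = u i)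
    (hu' : ∀ c i, g' i ≠ c → levelProj b g c (u i) = 0) (w : ι' → ℝ≥0) (c : ℝ≥0) (x : V) :
    ofBasis v u w (levelProj b g c x) ≤ ofBasis v u w x := by
  classical
  refine Finset.sup_mono_fun fun i _ => ?_
  rw [repr_levelProj hu hu']
  split_ifs
  · exact le_rfl
  · rw [map_zero, zero_mul]; exact zero_le

/-- Two graded norms have a homogeneous common orthogonal basis. -/
theorem HasDiscreteValues.exists_homogeneous_common_basis (hd : HasDiscreteValues v)
    (b : Basis ι K V) (g : ι → ℝ≥0) (hα : IsSplittableNorm v α) (hβ : IsSplittableNorm v β)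
    (hαg : ∀ c x, α (levelProj b g c x) ≤ α x) (hβg : ∀ c x, β (levelProj b g c x) ≤ β x) :
    ∃ e : Basis ι K V, (∀ i, ∃ c, levelProj b g c (e i) = e i) ∧
      IsOrthogonalBasis v α e ∧ IsOrthogonalBasis v β e := by
  have := Finite.of_basis b
  obtain ⟨n, e, hQ, h1, h2⟩ := _root_.exists_common_basis hα.isUNorm hβ.isUNorm
    (fun U => ∀ c, ∀ x ∈ U, levelProj b g c x ∈ U) (fun x => ∃ c, levelProj b g c x = x)
    (fun U hP hU => by
      have hne : ∃ x ∈ {x | x ∈ U ∧ ∃ c, levelProj b g c x = x}, x ≠ 0 := by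
        obtain ⟨x, hxU, hx⟩ := exists_mem_ne_zero_of_ne_bot hU
        obtain ⟨i, hi⟩ : ∃ i, b.repr x i ≠ 0 := by
          by_contra h
          push Not at h
          exact hx (b.repr.map_eq_zero_iff.1 (Finsupp.ext h))
        refine ⟨levelProj b g (g i) x, ⟨hP _ x hxU, g i, levelProj_levelProj _ _ _ _⟩, fun h0 => ?_⟩
        have h3 := repr_levelProj (b := b) (g := g) (fun c i => levelProj_eq)
          (fun c i => levelProj_eq_zero) (g i) x i
        rw [h0, if_pos rfl] at h3
        exact hi (h3.symm.trans (by simp))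
      obtain ⟨x, ⟨hxU, c, hc⟩, hx, hmax⟩ := hd.exists_max_ratio hα hβ hne
      obtain ⟨l, hl, hl'⟩ := hβ.exists_functional hx
      have hlβ : ∀ y, v (l (levelProj b g c y)) * β x ≤ β y := fun y => (hl' _).trans (hβg c y)
      refine ⟨x, hxU, ⟨c, hc⟩, l ∘ₗ levelProj b g c, by rw [LinearMap.comp_apply, hc, hl],
        fun d y hy => ⟨hP d y hy.1, ?_⟩, fun y hy => ⟨?_, hlβ y⟩⟩
      · change l (levelProj b g c (levelProj b g d y)) = 0
        by_cases hdc : c = d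
        · subst hdc
          rw [levelProj_levelProj]; exact hy.2
        · rw [levelProj_levelProj_of_ne _ _ hdc, map_zero]
      · refine le_trans ?_ (hαg c y)
        have hβx := hβ.isUNorm.pos hx
        have h3 := hmax (levelProj b g c y) ⟨hP c y hy, c, levelProj_levelProj _ _ _ _⟩
        have h4 := hl' (levelProj b g c y)
        have h5 : v (l (levelProj b g c y)) * β x * α x ≤ β (levelProj b g c y) * α x := by gcongr
        refine le_of_mul_le_mul_left ?_ hβx
        calc β x * (v (l (levelProj b g c y)) * α x) = v (l (levelProj b g c y)) * β x * α x := by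
              ring
          _ ≤ _ := h5.trans h3) ⊤ (fun _ _ _ => trivial)
  have hc : card (Fin n) = card ι := by
    rw [← finrank_eq_card_basis b, ← finrank_eq_card_basis (e.map topEquiv)]
  refine ⟨(e.map topEquiv).reindex (equivOfCardEq hc), fun i => ?_, ?_, ?_⟩
  · rw [Basis.reindex_apply, Basis.map_apply]
    exact hQ _
  · exact IsOrthogonalBasis.reindex (h1.map_equiv topEquiv) _
  · exact IsOrthogonalBasis.reindex (h2.map_equiv topEquiv) _

/-- A common basis adapted to a norm `α`, to the filtration with weights `g` on the basis `b`, and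
to the lattice spanned by `b`: the basis `e` spans the same lattice, `z` is orthogonal for `α`, and
the vector `z i` has leading term `e i` with respect to the filtration.

Replacing the vectors of a basis orthogonal for `α` and the filtration by their leading terms
identifies `α` with a graded norm. -/
theorem HasDiscreteValues.exists_adapted_basis (hd : HasDiscreteValues v)
    (b : Basis ι K V) (hg : ∀ i, 0 < g i) (hα : IsSplittableNorm v α) :
    ∃ e z : Basis ι K V, IsOrthogonalBasis v (ofBasis v b fun _ => 1) e ∧
      (∀ i, ofBasis v b (fun _ => 1) (e i) = 1) ∧
      IsOrthogonalBasis (trivVal K) (ofBasis (trivVal K) b g) e ∧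
      (∀ i, ofBasis (trivVal K) b g (e i) = g i) ∧ IsOrthogonalBasis v α z ∧
      ∀ i, ofBasis (trivVal K) b g (z i - e i) < g i := by
  classical
  have := Finite.of_basis b
  set G := ofBasis (trivVal K) b g with hGdef
  have hG : IsUNorm (trivVal K) G := isUNorm_ofBasis b hg
  have hGb : IsOrthogonalBasis (trivVal K) G b := isOrthogonalBasis_ofBasis b g
  have hGs := hG.isSplittableNorm hGb
  have hGval : ∀ x, x ≠ 0 → ∃ i, b.repr x i ≠ 0 ∧ G x = g i := fun x hx => by
    obtain ⟨i, hi, h⟩ := hGb.exists_eq hG hx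
    refine ⟨i, hi, ?_⟩
    rw [h, trivVal_apply hi, one_mul, hGdef, ofBasis_apply_basis]
  have hGle : ∀ x i, b.repr x i ≠ 0 → g i ≤ G x := fun x i hi => by
    have := hGb.le x i
    rwa [trivVal_apply hi, one_mul, hGdef, ofBasis_apply_basis] at this
  have hGlt : ∀ x (c : ℝ≥0), 0 < c → (∀ i, b.repr x i ≠ 0 → g i < c) → G x < c := by
    intro x c hc h
    by_cases hx : x = 0
    · rw [hx, hG.map_zero]; exact hc
    · obtain ⟨i, hi, h1⟩ := hGval x hx
      rw [h1]; exact h i hi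
  have hproj : ∀ c x i, b.repr (levelProj b g c x) i = if g i = c then b.repr x i else 0 :=
    fun c x i => repr_levelProj (fun c i => levelProj_eq) (fun c i => levelProj_eq_zero) c x i
  obtain ⟨x, hxα, hxG⟩ := exists_common_basis_trivVal hα hG hGs.finite_range b
  -- the leading terms of the basis `x`
  have hlead : ∀ i, G (levelProj b g (G (x i)) (x i) - x i) < G (x i) := fun i => by
    refine hGlt _ _ (hG.pos (x.ne_zero i)) fun k hk => ?_
    rw [map_sub, Finsupp.sub_apply, hproj] at hk
    split_ifs at hk with h
    · exact absurd (sub_self _) hk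
    · rw [zero_sub, neg_ne_zero] at hk
      exact lt_of_le_of_ne (hGle _ _ hk) h
  obtain ⟨u, hu, huG, huval⟩ := hxG.perturb hG hlead
  have huval' : ∀ i, G (u i) = G (x i) := fun i => by rw [hu, huval]
  have hu1 : ∀ c i, G (x i) = c → levelProj b g c (u i) = u i := by
    rintro _ i rfl
    rw [hu, levelProj_levelProj]
  have hu2 : ∀ c i, G (x i) ≠ c → levelProj b g c (u i) = 0 := by
    intro c i h
    rw [hu, levelProj_levelProj_of_ne _ _ (Ne.symm h)]
  obtain ⟨e, hhom, heo, heα⟩ := hd.exists_homogeneous_common_basis b g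
    (α := ofBasis v b fun _ => 1) (β := ofBasis v u fun i => α (x i))
    (isSplittableNorm_ofBasis _ fun _ => one_pos)
    (isSplittableNorm_ofBasis _ fun i => hα.isUNorm.pos (x.ne_zero i))
    (ofBasis_levelProj_le (fun c i => levelProj_eq) (fun c i => levelProj_eq_zero) _)
    (ofBasis_levelProj_le hu1 hu2 _)
  choose c hc using hhom
  have ho : IsUNorm v (ofBasis v b fun _ => 1) := isUNorm_ofBasis b fun _ => one_pos
  -- normalize the vectors of the lattice basis
  have hscale : ∀ i, ∃ a : Kˣ, ofBasis v b (fun _ => 1) (a • e i) = 1 := fun i => by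
    obtain ⟨k, hk, h⟩ := (isOrthogonalBasis_ofBasis (v := v) b fun _ => 1).exists_eq ho
      (e.ne_zero i)
    refine ⟨(Units.mk0 _ hk)⁻¹, ?_⟩
    rw [Units.smul_def, ho.smul, h, ofBasis_apply_basis, mul_one, ← map_mul]
    simp [hk]
  choose a ha using hscale
  let e₁ := e.unitsSMul a
  have he₁ : ∀ i, e₁ i = a i • e i := fun i => Basis.unitsSMul_apply i
  have horth : ∀ {w : Valuation K ℝ≥0} {γ : V → ℝ≥0}, IsUNorm w γ → IsOrthogonalBasis w γ e →
      IsOrthogonalBasis w γ e₁ := by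
    intro w γ hγ he
    refine hγ.isOrthogonalBasis _ fun d i => ?_
    have h1 := he.le (∑ j, d j • e₁ j) i
    have h2 : ∑ j, d j • e₁ j = ∑ j, (d j * a j) • e j :=
      sum_congr rfl fun j _ => by rw [he₁, Units.smul_def, smul_smul]
    rw [h2, e.repr_sum_self, map_mul, mul_assoc] at h1
    rw [h2, he₁, Units.smul_def, hγ.smul]
    exact h1
  have hhom₁ : ∀ i, levelProj b g (c i) (e₁ i) = e₁ i := fun i => by
    rw [he₁, Units.smul_def, _root_.map_smul, hc]
  have hGe : ∀ i, G (e₁ i) = c i := fun i => by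
    obtain ⟨k, hk, h⟩ := hGval _ (e₁.ne_zero i)
    rw [← hhom₁, hproj] at hk
    rw [h]
    exact (ite_ne_right_iff.1 hk).1
  have heG : IsOrthogonalBasis (trivVal K) G e₁ := by
    refine hG.isOrthogonalBasis _ fun d i => ?_
    by_cases hdi : d i = 0
    · rw [hdi, map_zero, zero_mul]; exact zero_le
    rw [trivVal_apply hdi, one_mul, hGe]
    have h1 : ∀ j, levelProj b g (c i) (e₁ j) = if c j = c i then e₁ j else 0 := fun j => by
      split_ifs with h
      · rw [← h]; exact hhom₁ j
      · rw [← hhom₁ j]; exact levelProj_levelProj_of_ne _ _ (Ne.symm h) _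
    have h2 : e₁.repr (levelProj b g (c i) (∑ j, d j • e₁ j)) i = d i := by
      have : levelProj b g (c i) (∑ j, d j • e₁ j) =
          ∑ j, (if c j = c i then d j else 0) • e₁ j := by
        rw [map_sum]
        refine sum_congr rfl fun j _ => ?_
        rw [_root_.map_smul, h1]
        split_ifs <;> simp
      rw [this, e₁.repr_sum_self, if_pos rfl]
    have h3 : levelProj b g (c i) (∑ j, d j • e₁ j) ≠ 0 := fun h0 => by
      rw [h0] at h2
      exact hdi (h2.symm.trans (by simp))
    obtain ⟨k, hk, -⟩ := hGval _ h3
    rw [hproj] at hk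
    obtain ⟨h4, hk⟩ := ite_ne_right_iff.1 hk
    exact h4 ▸ hGle _ _ hk
  -- index the basis by the weights
  obtain ⟨f, hf⟩ := exists_equiv_of_map_univ_eq
    (map_univ_eq_of_card_le_eq (a := fun i => G (e₁ i)) (b := fun i => G (b i)) fun r => by
      rw [← heG.finrank_ballSpan, ← hGb.finrank_ballSpan])
  have hf' : ∀ i, G (e₁ (f.symm i)) = g i := fun i => by
    rw [← hf, Equiv.apply_symm_apply, hGdef, ofBasis_apply_basis]
  -- transport `e` by the isomorphism from the leading terms to the basis `x`
  let T : V ≃ₗ[K] V := u.equiv x (Equiv.refl ι)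
  have hT : ∀ i, T (u i) = x i := fun i => by simp [T]
  have hTα : ∀ y, α y = ofBasis v u (fun i => α (x i)) (T.symm y) := fun y => by
    rw [hxα y]
    refine sup_congr rfl fun i _ => ?_
    congr 2
    conv_lhs => rw [← T.apply_symm_apply y, ← u.sum_repr (T.symm y), map_sum]
    simp only [_root_.map_smul, hT, x.repr_sum_self]
  have hTG : ∀ y, y ≠ 0 → G (T y - y) < G y := fun y hy => by
    have h1 : T y - y = ∑ i, u.repr y i • (x i - u i) := by
      conv_lhs => rw [← u.sum_repr y]
      simp only [map_sum, _root_.map_smul, hT, smul_sub, sum_sub_distrib]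
    have hpos := hG.pos hy
    rw [h1]
    refine hG.sum_lt hpos fun i => ?_
    rw [hG.smul]
    by_cases h0 : u.repr y i = 0
    · rw [h0, map_zero, zero_mul]; exact hpos
    rw [trivVal_apply h0, one_mul, ← hG.map_neg, neg_sub, hu]
    refine (hlead i).trans_le ?_
    have h2 := huG.le y i
    rwa [trivVal_apply h0, one_mul, huval'] at h2
  have hαu : IsUNorm v (ofBasis v u fun i => α (x i)) :=
    isUNorm_ofBasis _ fun i => hα.isUNorm.pos (x.ne_zero i)
  refine ⟨e₁.reindex f, (e₁.reindex f).map T, (horth ho heo).reindex f, fun i => ?_,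
    heG.reindex f, fun i => ?_, ?_, fun i => ?_⟩
  · rw [Basis.reindex_apply, he₁, ha]
  · rw [Basis.reindex_apply, hf']
  · have h1 := ((horth hαu heα).reindex f).map_equiv T
    have h2 : (fun y => ofBasis v u (fun i => α (x i)) (T.symm y)) = α :=
      funext fun y => (hTα y).symm
    rwa [h2] at h1
  · rw [Basis.map_apply]
    have h1 := hTG _ ((e₁.reindex f).ne_zero i)
    rw [Basis.reindex_apply, hf'] at h1
    rw [Basis.reindex_apply]
    exact h1

end Adapted

/-! ### Volumes of the steps of a filtration -/

section StepVolume

variable {K : Type*} [Field K] {v : Valuation K ℝ≥0} {V X : Type*} [AddCommGroup V] [Module K V]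
  [AddCommGroup X] [Module K X] {α : V → ℝ≥0} {ι κ : Type*} [Fintype ι] [Fintype κ]
variable {i : X →ₗ[K] V} {e : Basis ι K V} {S : Set ι} {eX : Basis S K X} [Fintype S]

/-- An adapted pair of bases has volume `1`. -/
theorem log_det_adapted [DecidableEq κ] {b e z : Basis κ K X} {o : X → ℝ≥0}
    (ho : IsUNorm v o) (hb : IsOrthogonalBasis v o b) (he : IsOrthogonalBasis v o e)
    (hb1 : ∀ k, o (b k) = 1) (he1 : ∀ k, o (e k) = 1) {g : κ → ℝ≥0}
    (hz : ∀ k l, e.repr (z l) k ≠ 0 → k = l ∨ g k < g l) (hz1 : ∀ k, e.repr (z k) k = 1) :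
    log (v (b.det z)) = 0 := by
  have h1 : b.det z = b.det e * e.det z := by
    rw [Basis.det_apply, Basis.det_apply, Basis.det_apply, ← Matrix.det_mul,
      Basis.toMatrix_mul_toMatrix]
  have h2 : e.det z = 1 := by
    rw [Basis.det_apply, Matrix.BlockTriangular.det (b := g)]
    · refine Finset.prod_eq_one fun c _ => ?_
      have : (e.toMatrix z).toSquareBlock g c = 1 := by
        ext k l
        rw [Matrix.one_apply]
        change e.repr (z l) k = _
        split_ifs with h
        · rw [h, hz1]
        · by_contra h0
          rcases hz k l h0 with h3 | h3
          · exact h (Subtype.ext h3)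
          · rw [k.2, l.2] at h3
            exact lt_irrefl _ h3
      rw [this, Matrix.det_one]
    · intro k l hkl
      by_contra h0
      rcases hz k l h0 with h3 | h3
      · rw [h3] at hkl; exact lt_irrefl _ hkl
      · exact lt_asymm h3 hkl
  have h3 := hb.lvol_eq ho b
  rw [he.lvol_eq ho b] at h3
  simp only [hb1, he1, Basis.det_self, map_one, coe_one, log_one] at h3
  rw [h1, h2, mul_one]
  linarith

theorem adapted_repr {b e z : Basis ι K V} {g : ι → ℝ≥0}
    (heG : IsOrthogonalBasis (trivVal K) (ofBasis (trivVal K) b g) e)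
    (heg : ∀ i, ofBasis (trivVal K) b g (e i) = g i)
    (hze : ∀ i, ofBasis (trivVal K) b g (z i - e i) < g i) :
    (∀ k l, e.repr (z l) k ≠ 0 → k = l ∨ g k < g l) ∧ ∀ k, e.repr (z k) k = 1 := by
  classical
  have hδ : ∀ k l, e.repr (z l) k = (if l = k then 1 else 0) + e.repr (z l - e l) k := by
    intro k l
    rw [map_sub, Finsupp.sub_apply, e.repr_self, single_apply]
    ring
  have hlt : ∀ k l, e.repr (z l - e l) k ≠ 0 → g k < g l := fun k l h => by
    have := heG.le (z l - e l) k
    rw [trivVal_apply h, one_mul, heg] at this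
    exact this.trans_lt (hze l)
  refine ⟨fun k l h => ?_, fun k => ?_⟩
  · by_cases hkl : k = l
    · exact Or.inl hkl
    · rw [hδ, if_neg (Ne.symm hkl), zero_add] at h
      exact Or.inr (hlt _ _ h)
  · rw [hδ, if_pos rfl, add_eq_left]
    by_contra h0
    exact lt_irrefl _ (hlt _ _ h0)

theorem exists_basis_of_range_eq (hi : Injective i) {S : Set ι} (h : range i = coordSub e S) :
    ∃ eX : Basis S K X, ∀ k, i (eX k) = e k := by
  have hx : ∀ k : S, ∃ x, i x = e k := fun k => by
    have : e k ∈ range i := by rw [h]; exact basis_mem_coordSub.2 k.2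
    exact this
  choose x hx using hx
  have hc : i ∘ x = e ∘ Subtype.val := funext hx
  refine ⟨Basis.mk (v := x) (LinearIndependent.of_comp i (hc ▸
    e.linearIndependent.comp _ Subtype.val_injective)) fun y _ => ?_, fun k => by
      rw [Basis.mk_apply, hx]⟩
  have h1 : i y ∈ (span K (Set.range x)).map i := by
    rw [Submodule.map_span, ← Set.range_comp, hc]
    have h2 : coordSub e S ≤ span K (Set.range (e ∘ (Subtype.val : S → ι))) :=
      coordSub_le fun k hk => subset_span ⟨⟨k, hk⟩, rfl⟩
    exact h2 (h ▸ mem_range_self i y)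
  obtain ⟨y', hy', h2⟩ := h1
  exact hi h2 ▸ hy'

theorem range_eq_coordSub (h : ∀ k, i (eX k) = e k) : range i = coordSub e S := by
  apply le_antisymm
  · rintro _ ⟨x, rfl⟩
    rw [← eX.sum_repr x, map_sum]
    refine Submodule.sum_mem _ fun k _ => ?_
    rw [map_smul, h]
    exact Submodule.smul_mem _ _ (basis_mem_coordSub.2 k.2)
  · exact coordSub_le fun k hk => ⟨eX ⟨k, hk⟩, h _⟩

theorem repr_restrict (h : ∀ k, i (eX k) = e k) (x : X) (k : S) : eX.repr x k = e.repr (i x) k := by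
  classical
  have : eX.coord k = e.coord (k : ι) ∘ₗ i := eX.ext fun l => by
    simp [h, single_apply, Subtype.ext_iff]
  exact LinearMap.congr_fun this x

theorem IsOrthogonalBasis.restrict (hi : Injective i)

    (h : ∀ k, i (eX k) = e k) (hα : IsUNorm v α) (he : IsOrthogonalBasis v α e) :
    IsOrthogonalBasis v (fun x => α (i x)) eX := by
  refine (hα.comp i hi).isOrthogonalBasis eX fun a k => ?_
  have h1 := he.le (i (∑ j, a j • eX j)) k
  rwa [← repr_restrict h, eX.repr_sum_self, ← h] at h1

/-- The volume of `α` on a step of the filtration, in terms of an adapted basis. -/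
theorem lvol_step {b e z : Basis ι K V} {g : ι → ℝ≥0} (hg : ∀ i, 0 < g i)
    (hα : IsUNorm v α) (heo : IsOrthogonalBasis v (ofBasis v b fun _ => 1) e)
    (he1 : ∀ i, ofBasis v b (fun _ => 1) (e i) = 1)
    (heG : IsOrthogonalBasis (trivVal K) (ofBasis (trivVal K) b g) e)
    (heg : ∀ i, ofBasis (trivVal K) b g (e i) = g i) (hz : IsOrthogonalBasis v α z)
    (hze : ∀ i, ofBasis (trivVal K) b g (z i - e i) < g i)
    (hi : Injective i) {c : ℝ≥0} [DecidableEq ι]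
    {bX : Basis {k | g k ≤ c} K X} (hbX : ∀ k, i (bX k) = b k) :
    lvol v bX (fun x => α (i x)) = ∑ k ∈ univ.filter (fun k => g k ≤ c), log (α (z k)) := by
  have hG : IsUNorm (trivVal K) (ofBasis (trivVal K) b g) := isUNorm_ofBasis b hg
  have ho : IsUNorm v (ofBasis v b fun _ => 1) := isUNorm_ofBasis b fun _ => one_pos
  obtain ⟨z', hz', hzG, hzg⟩ := heG.perturb hG (z := z) fun k => by rw [heg]; exact hze k
  obtain rfl : z' = z := Basis.eq_of_apply_eq hz'
  have hball : ∀ {u : Basis ι K V}, IsOrthogonalBasis (trivVal K) (ofBasis (trivVal K) b g) u →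
      (∀ k, ofBasis (trivVal K) b g (u k) = g k) →
      ballSpan K (ofBasis (trivVal K) b g) c = coordSub u {k | g k ≤ c} := fun hu hug => by
    rw [hu.ballSpan_eq]
    simp only [hug]
  have hr := range_eq_coordSub hbX
  rw [← hball (isOrthogonalBasis_ofBasis b g) (ofBasis_apply_basis b g)] at hr
  obtain ⟨eX, heX⟩ := exists_basis_of_range_eq hi (hr.trans (hball heG heg))
  obtain ⟨zX, hzX⟩ := exists_basis_of_range_eq hi (hr.trans (hball hzG fun k => by rw [hzg, heg]))
  obtain ⟨hδ, hδ1⟩ := adapted_repr heG heg hze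
  have hdet : log (v (bX.det zX)) = 0 := by
    refine log_det_adapted (g := fun k => g k) (ho.comp i hi)
      ((isOrthogonalBasis_ofBasis b _).restrict hi hbX ho) (heo.restrict hi heX ho)
      (fun k => by rw [hbX, ofBasis_apply_basis]) (fun k => by rw [heX, he1])
      (fun k l h => ?_) fun k => by rw [repr_restrict heX, hzX, hδ1]
    rw [repr_restrict heX, hzX] at h
    exact (hδ _ _ h).imp_left Subtype.ext
  rw [(hz.restrict hi hzX hα).lvol_eq (hα.comp i hi), hdet, sub_zero]
  simp only [hzX]
  exact (Finset.sum_subtype (univ.filter fun k => g k ≤ c) (fun k => by simp)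
    fun k => log (α (z' k))).symm

end StepVolume

/-! ### Tilting a norm by a filtration -/

section Tilt

variable {K : Type*} [Field K] {v : Valuation K ℝ≥0} {V V' W : Type*} [AddCommGroup V] [Module K V]
  [AddCommGroup V'] [Module K V'] [AddCommGroup W] [Module K W] {α : V → ℝ≥0} {α' : V' → ℝ≥0}
  {ι ι' μ : Type*} [Fintype ι] [Fintype ι'] [Fintype μ]

/-- For large `τ`, the tilted norm is determined by leading terms. -/
theorem eventually_tilt_le {e z : Basis ι K V} {a g : ι → ℝ≥0} (ha : ∀ i, 0 < a i)
    (hg : ∀ i, 0 < g i) (hz : ∀ k l, e.repr (z l) k ≠ 0 → k = l ∨ g k < g l)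
    (hz1 : ∀ k, e.repr (z k) k = 1) :
    ∀ᶠ τ : ℝ in Filter.atTop, ∀ k, ofBasis v e (fun k => a k * g k ^ τ) (z k) ≤ a k * g k ^ τ := by
  rw [Filter.eventually_all]
  intro l
  simp only [ofBasis, Finset.sup_le_iff, mem_univ, true_implies]
  rw [Filter.eventually_all]
  intro k
  by_cases h0 : e.repr (z l) k = 0
  · simp [h0]
  rcases hz k l h0 with rfl | hlt
  · simp [hz1]
  have h1 : (1 : ℝ) < g l / g k := by
    rw [one_lt_div (by exact_mod_cast hg k)]
    exact_mod_cast hlt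
  filter_upwards [(tendsto_rpow_atTop_of_base_gt_one _ h1).eventually_ge_atTop
    ((v (e.repr (z l) k) * a k / a l : ℝ≥0) : ℝ)] with τ hτ
  have h2 : v (e.repr (z l) k) * a k / a l ≤ (g l / g k) ^ τ := by exact_mod_cast hτ
  rw [NNReal.div_rpow, div_le_div_iff₀ (ha l) (rpow_pos (hg k))] at h2
  rw [← mul_assoc, mul_comm (a l)]
  exact h2

/-- The volume of a subspace of the tensor product for tilted norms. -/
theorem lvol_tilt_le [DecidableEq μ] {b e z : Basis ι K V} {b' e' z' : Basis ι' K V'}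
    {g : ι → ℝ≥0} {g' : ι' → ℝ≥0} (hg : ∀ i, 0 < g i) (hg' : ∀ i, 0 < g' i)
    (hα : IsUNorm v α) (hα' : IsUNorm v α') (hz : IsOrthogonalBasis v α z)
    (hz' : IsOrthogonalBasis v α' z')
    (hzG : IsOrthogonalBasis (trivVal K) (ofBasis (trivVal K) b g) z)
    (hzG' : IsOrthogonalBasis (trivVal K) (ofBasis (trivVal K) b' g') z')
    (hzg : ∀ i, ofBasis (trivVal K) b g (z i) = g i)
    (hzg' : ∀ i, ofBasis (trivVal K) b' g' (z' i) = g' i) {τ : ℝ} (hτ : 0 ≤ τ)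
    (ht : ∀ k, ofBasis v e (fun k => α (z k) * g k ^ τ) (z k) ≤ α (z k) * g k ^ τ)
    (ht' : ∀ k, ofBasis v e' (fun k => α' (z' k) * g' k ^ τ) (z' k) ≤ α' (z' k) * g' k ^ τ)
    {J : W →ₗ[K] V ⊗[K] V'} (hJ : Injective J) (bW : Basis μ K W) :
    lvol v bW (fun w => tensorNorm (K := K) (ofBasis v e fun k => α (z k) * g k ^ τ)
        (ofBasis v e' fun k => α' (z' k) * g' k ^ τ) (J w)) ≤
      lvol v bW (fun w => tensorNorm (K := K) α α' (J w)) +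
        τ * labelSum K (fun t => t) (fun w => tensorNorm (K := K) (ofBasis (trivVal K) b g)
          (ofBasis (trivVal K) b' g') (J w)) := by
  have := Finite.of_basis bW
  have := Finite.of_basis b
  have := Finite.of_basis b'
  have hG : IsUNorm (trivVal K) (ofBasis (trivVal K) b g) := isUNorm_ofBasis b hg
  have hG' : IsUNorm (trivVal K) (ofBasis (trivVal K) b' g') := isUNorm_ofBasis b' hg'
  have hpos : ∀ k, 0 < α (z k) * g k ^ τ := fun k =>
    mul_pos (hα.pos (z.ne_zero k)) (rpow_pos (hg k))
  have hpos' : ∀ k, 0 < α' (z' k) * g' k ^ τ := fun k =>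
    mul_pos (hα'.pos (z'.ne_zero k)) (rpow_pos (hg' k))
  set N₀ := tensorNorm (K := K) (ofBasis v e fun k => α (z k) * g k ^ τ)
    (ofBasis v e' fun k => α' (z' k) * g' k ^ τ) with hN₀
  set N₁ := tensorNorm (K := K) α α' with hN₁
  set N₂ := tensorNorm (K := K) (ofBasis (trivVal K) b g) (ofBasis (trivVal K) b' g') with hN₂
  have h₀ : IsSplittableNorm v N₀ :=
    (isSplittableNorm_ofBasis e hpos).tensorNorm (isSplittableNorm_ofBasis e' hpos')
  have h₁ : IsSplittableNorm v N₁ := (hα.isSplittableNorm hz).tensorNorm (hα'.isSplittableNorm hz')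
  have h₂ : IsSplittableNorm (trivVal K) N₂ :=
    (hG.isSplittableNorm hzG).tensorNorm (hG'.isSplittableNorm hzG')
  have hz₁ := isOrthogonalBasis_tensorNorm hα hα' hz hz'
  have hz₂ := isOrthogonalBasis_tensorNorm hG hG' hzG hzG'
  have hle : ∀ x, N₀ x ≤ N₁ x * N₂ x ^ τ := fun x => by
    conv_lhs => rw [← (z.tensorProduct z').sum_repr x]
    refine h₀.isUNorm.sum_le _ _ fun k _ => ?_
    rw [h₀.smul]
    by_cases h0 : (z.tensorProduct z').repr x k = 0
    · rw [h0, map_zero, zero_mul]; exact zero_le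
    have e1 := hz₁.le x k
    have e2 := hz₂.le x k
    rw [tensorNorm_basis hα hα' hz hz'] at e1
    rw [trivVal_apply h0, one_mul, tensorNorm_basis hG hG' hzG hzG', hzg, hzg'] at e2
    have e3 : N₀ (z.tensorProduct z' k) ≤ α (z k.1) * g k.1 ^ τ * (α' (z' k.2) * g' k.2 ^ τ) := by
      rw [Basis.tensorProduct_apply']
      exact (tensorNorm_tmul_le _ _).trans (mul_le_mul' (ht k.1) (ht' k.2))
    calc _ ≤ v ((z.tensorProduct z').repr x k) *
          (α (z k.1) * g k.1 ^ τ * (α' (z' k.2) * g' k.2 ^ τ)) := mul_le_mul_right e3 _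
      _ = v ((z.tensorProduct z').repr x k) * (α (z k.1) * α' (z' k.2)) *
          (g k.1 * g' k.2) ^ τ := by rw [NNReal.mul_rpow]; ring
      _ ≤ _ := mul_le_mul' e1 (NNReal.rpow_le_rpow e2 hτ)
  have s₁ := h₁.comp J hJ
  have s₂ := h₂.comp J hJ
  obtain ⟨u, hu₁, hu₂⟩ := exists_common_basis_trivVal s₁ s₂.isUNorm s₂.finite_range bW
  rw [hu₁.lvol_eq s₁.isUNorm, hu₂.labelSum_eq]
  refine ((h₀.comp J hJ).lvol_le bW (det_basis_ne_zero bW u)).trans ?_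
  rw [mul_sum, sub_add_eq_add_sub, ← sum_add_distrib]
  refine sub_le_sub_right (sum_le_sum fun k _ => ?_) _
  have p₀ : (0 : ℝ) < N₀ (J (u k)) := (h₀.comp J hJ).isUNorm.pos (u.ne_zero k)
  have p₁ : (0 : ℝ) < N₁ (J (u k)) := s₁.isUNorm.pos (u.ne_zero k)
  have p₂ : (0 : ℝ) < N₂ (J (u k)) := s₂.isUNorm.pos (u.ne_zero k)
  have h3 : (N₀ (J (u k)) : ℝ) ≤ N₁ (J (u k)) * (N₂ (J (u k)) : ℝ) ^ τ := by
    exact_mod_cast hle (J (u k))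
  have h4 := log_le_log p₀ h3
  rwa [log_mul p₁.ne' (rpow_pos_of_pos p₂ _).ne', log_rpow p₂] at h4

end Tilt

/-! ### Reduction to the residue field -/

section Reduction

variable {K : Type*} [Field K] {v : Valuation K ℝ≥0} {Ω : Type*} [Field Ω]
  {red : v.valuationSubring →+* Ω} {V V' U : Type*} [AddCommGroup V] [Module K V]
  [AddCommGroup V'] [Module K V'] [AddCommGroup U] [Module K U]
  {Vr Vr' Ur : Type*} [AddCommGroup Vr] [Module Ω Vr] [AddCommGroup Vr'] [Module Ω Vr']
  [AddCommGroup Ur] [Module Ω Ur] {ι ι' μ : Type*} [Fintype ι] [Fintype ι'] [Fintype μ]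

variable (red) in
/-- The coordinates of `x` in the basis `b` are integral, and their reductions are the
coordinates of `y` in the basis `c`. -/
def Reduces (b : Basis ι K V) (c : Basis ι Ω Vr) (x : V) (y : Vr) : Prop :=
  ∀ k, ∃ r : v.valuationSubring, b.repr x k = r ∧ c.repr y k = red r

theorem red_ne_zero {r : v.valuationSubring} (hr : v r = 1) : red r ≠ 0 := by
  have h0 : (r : K) ≠ 0 := fun h => by rw [h, map_zero] at hr; exact zero_ne_one hr
  have hm : (r : K)⁻¹ ∈ v.valuationSubring := by
    rw [mem_valuationSubring_iff, map_inv₀, hr, inv_one]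
  have h1 : r * ⟨_, hm⟩ = 1 := Subtype.ext (mul_inv_cancel₀ h0)
  intro h
  have := congrArg red h1
  rw [map_mul, h, zero_mul, map_one] at this
  exact zero_ne_one this

namespace Reduces

variable {b : Basis ι K V} {c : Basis ι Ω Vr} {b' : Basis ι' K V'} {c' : Basis ι' Ω Vr'}

theorem smul (r : v.valuationSubring) {x : V} {y : Vr} (h : Reduces red b c x y) :
    Reduces red b c ((r : K) • x) (red r • y) := fun k => by
  obtain ⟨s, h1, h2⟩ := h k
  exact ⟨r * s, by simp [h1], by simp [h2]⟩

theorem sum {κ : Type*} (s : Finset κ) {x : κ → V} {y : κ → Vr}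
    (h : ∀ i, Reduces red b c (x i) (y i)) : Reduces red b c (∑ i ∈ s, x i) (∑ i ∈ s, y i) :=
  fun k => by
    choose r h1 h2 using fun i => h i k
    exact ⟨∑ i ∈ s, r i, by simp [h1, finsetSum_apply], by simp [h2, finsetSum_apply]⟩

theorem tmul {x : V} {y : Vr} {x' : V'} {y' : Vr'} (h : Reduces red b c x y)
    (h' : Reduces red b' c' x' y') :
    Reduces red (b.tensorProduct b') (c.tensorProduct c') (x ⊗ₜ x') (y ⊗ₜ y') := fun k => by
  obtain ⟨r, h1, h2⟩ := h k.1
  obtain ⟨s, h3, h4⟩ := h' k.2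
  exact ⟨r * s, by simp [repr_tensorProduct_tmul, h1, h3], by
    simp [repr_tensorProduct_tmul, h2, h4]⟩

theorem unique {x : V} {y y' : Vr} (h : Reduces red b c x y) (h' : Reduces red b c x y') :
    y = y' := by
  refine c.repr.injective (Finsupp.ext fun k => ?_)
  obtain ⟨r, h1, h2⟩ := h k
  obtain ⟨s, h3, h4⟩ := h' k
  rw [h2, h4, Subtype.ext (h1.symm.trans h3)]

/-- Maps compatible with reduction on the basis are compatible with reduction. -/
theorem map {J : U →ₗ[K] V} {Jr : Ur →ₗ[Ω] Vr} {bU : Basis μ K U} {cU : Basis μ Ω Ur}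
    (hJ : ∀ l, Reduces red b c (J (bU l)) (Jr (cU l))) {x : U} {y : Ur}
    (h : Reduces red bU cU x y) : Reduces red b c (J x) (Jr y) := by
  choose r h1 h2 using h
  rw [← bU.sum_repr x, ← cU.sum_repr y, map_sum, map_sum]
  refine sum _ fun l => ?_
  rw [map_smul, map_smul, h1, h2]
  exact (hJ l).smul _

end Reduces

theorem ofBasis_one_le_one_iff {b : Basis ι K V} {x : V} :
    ofBasis v b (fun _ => 1) x ≤ 1 ↔ ∀ k, b.repr x k ∈ v.valuationSubring := by
  simp [ofBasis, Finset.sup_le_iff, mem_valuationSubring_iff]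

/-- A basis of the lattice reduces to a basis. -/
theorem exists_reduced_basis (b : Basis ι K V) (c : Basis ι Ω Vr)
    {e : Basis ι K V} (he : IsOrthogonalBasis v (ofBasis v b fun _ => 1) e)
    (he1 : ∀ k, ofBasis v b (fun _ => 1) (e k) = 1) :
    ∃ f : Basis ι Ω Vr, ∀ k, Reduces red b c (e k) (f k) := by
  classical
  have ho : IsUNorm v (ofBasis v b fun _ => 1) := isUNorm_ofBasis b fun _ => one_pos
  have hm : ∀ k l, b.repr (e k) l ∈ v.valuationSubring := fun k =>
    ofBasis_one_le_one_iff.1 (he1 k).le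
  let y : ι → Vr := fun k => ∑ l, red ⟨_, hm k l⟩ • c l
  have hy : ∀ k, Reduces red b c (e k) (y k) := fun k l =>
    ⟨⟨_, hm k l⟩, rfl, by simp only [y, c.repr_sum_self]⟩
  let M : Matrix ι ι v.valuationSubring := Matrix.of fun l k => ⟨_, hm k l⟩
  have h1 : b.det e = (M.det : v.valuationSubring) := by
    rw [Basis.det_apply]
    exact (RingHom.map_det v.valuationSubring.subtype M).symm
  have h2 : c.det y = red M.det := by
    rw [Basis.det_apply, RingHom.map_det]
    congr 1
    ext l k
    rw [Basis.toMatrix_apply]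
    simp only [y, c.repr_sum_self]
    rfl
  have h3 : v (b.det e) = 1 := by
    have h4 := log_det_adapted (g := fun _ : ι => (1 : ℝ≥0)) (z := e) ho
      (isOrthogonalBasis_ofBasis b _) he (ofBasis_apply_basis b _) he1 (fun k l h => Or.inl (by
        by_contra hkl
        exact h (by rw [e.repr_self, single_apply, if_neg (Ne.symm hkl)])))
      fun k => by rw [e.repr_self, single_apply, if_pos rfl]
    have h5 : (0 : ℝ) < v (b.det e) := by
      have := zero_lt_iff.2 (v.ne_zero_iff.2 (det_basis_ne_zero b e))
      exact_mod_cast this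
    exact NNReal.coe_injective (Real.eq_one_of_pos_of_log_eq_zero h5 h4)
  have h6 : IsUnit (c.det y) := by
    rw [h2]
    exact IsUnit.mk0 _ (red_ne_zero (by rw [← h1, h3]))
  obtain ⟨hli, hsp⟩ := c.is_basis_iff_det.2 h6
  exact ⟨Basis.mk hli hsp.ge, fun k => by rw [Basis.mk_apply]; exact hy k⟩

/-- The volume does not increase under reduction to the residue field. -/
theorem exists_reduction_lvol_le [DecidableEq μ] (hd : HasDiscreteValues v)
    (hred : ∀ r : v.valuationSubring, v r < 1 → red r = 0) {b e : Basis ι K V}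
    {b' e' : Basis ι' K V'} (c : Basis ι Ω Vr) (c' : Basis ι' Ω Vr')
    (he : IsOrthogonalBasis v (ofBasis v b fun _ => 1) e)
    (he1 : ∀ k, ofBasis v b (fun _ => 1) (e k) = 1)
    (he' : IsOrthogonalBasis v (ofBasis v b' fun _ => 1) e')
    (he1' : ∀ k, ofBasis v b' (fun _ => 1) (e' k) = 1) {J : U →ₗ[K] V ⊗[K] V'}
    (hJ : Injective J) {Jr : Ur →ₗ[Ω] Vr ⊗[Ω] Vr'} (hJr : Injective Jr)
    {bU : Basis μ K U} {cU : Basis μ Ω Ur}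
    (hJJ : ∀ l, Reduces red (b.tensorProduct b') (c.tensorProduct c') (J (bU l)) (Jr (cU l))) :
    ∃ (f : Basis ι Ω Vr) (f' : Basis ι' Ω Vr'), ∀ (a : ι → ℝ≥0) (a' : ι' → ℝ≥0)
      (τ : ℝ), (∀ k, 0 < a k) → (∀ k, 0 < a' k) → 0 < τ →
      labelSum Ω (fun t => t) (fun w => tensorNorm (K := Ω) (expNorm f fun k => log (a k) / τ)
        (expNorm f' fun k => log (a' k) / τ) (Jr w)) ≤
      lvol v bU (fun w => tensorNorm (K := K) (ofBasis v e a) (ofBasis v e' a') (J w)) / τ := by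
  classical
  have := Finite.of_basis bU
  have := Finite.of_basis cU
  have := Finite.of_basis b
  have := Finite.of_basis b'
  have := Finite.of_basis c
  have := Finite.of_basis c'
  obtain ⟨f, hf⟩ := exists_reduced_basis (red := red) b c he he1
  obtain ⟨f', hf'⟩ := exists_reduced_basis (red := red) b' c' he' he1'
  refine ⟨f, f', fun a a' τ ha ha' hτ => ?_⟩
  set N := tensorNorm (K := K) (ofBasis v e a) (ofBasis v e' a') with hN
  have hNs : IsSplittableNorm v N :=
    (isSplittableNorm_ofBasis e ha).tensorNorm (isSplittableNorm_ofBasis e' ha')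
  have hNJ := hNs.comp J hJ
  -- a basis of the lattice of `U` which is orthogonal for the norm
  obtain ⟨w, hwN, hwo, hw1⟩ : ∃ w : Basis μ K U, IsOrthogonalBasis v (fun x => N (J x)) w ∧
      IsOrthogonalBasis v (ofBasis v bU fun _ => 1) w ∧
      ∀ k, ofBasis v bU (fun _ => 1) (w k) = 1 := by
    obtain ⟨w, z, h1, h2, -, -, h3, h4⟩ := hd.exists_adapted_basis bU (g := fun _ => 1)
      (fun _ => one_pos) hNJ
    have hzw : z = w := by
      refine Basis.eq_of_apply_eq fun k => sub_eq_zero.1 ?_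
      by_contra h0
      obtain ⟨l, hl⟩ : ∃ l, bU.repr (z k - w k) l ≠ 0 := by
        by_contra h
        push Not at h
        exact h0 (bU.repr.map_eq_zero_iff.1 (Finsupp.ext h))
      have h5 := (isOrthogonalBasis_ofBasis (v := trivVal K) bU fun _ => 1).le (z k - w k) l
      rw [trivVal_apply hl, one_mul, ofBasis_apply_basis] at h5
      exact (h4 k).not_ge h5
    exact ⟨w, hzw ▸ h3, h1, h2⟩
  obtain ⟨y, hy⟩ := exists_reduced_basis (red := red) bU cU hwo hw1
  set F := tensorNorm (K := Ω) (expNorm f fun k => log (a k) / τ)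
    (expNorm f' fun k => log (a' k) / τ) with hF
  have hFe : F = expNorm (f.tensorProduct f') fun k => log (a k.1) / τ +
      log (a' k.2) / τ := tensorNorm_expNorm _ _ _ _
  have hFs : IsSplittableNorm (trivVal Ω) F := by rw [hFe]; exact isSplittableNorm_expNorm _ _
  have hdet : log (v (bU.det w)) = 0 := by
    have h := hwo.lvol_eq (isUNorm_ofBasis bU fun _ => one_pos) bU
    rw [(isOrthogonalBasis_ofBasis bU _).lvol_eq (isUNorm_ofBasis bU fun _ => one_pos) bU] at h
    simp only [hw1, ofBasis_apply_basis, Basis.det_self, map_one, coe_one, log_one] at h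
    linarith
  rw [labelSum_id (hFs.comp Jr hJr) cU, hwN.lvol_eq hNJ.isUNorm bU, hdet, sub_zero, sum_div]
  refine ((hFs.comp Jr hJr).lvol_le cU (det_basis_ne_zero cU y)).trans ?_
  rw [trivVal_apply (det_basis_ne_zero cU y), coe_one, log_one, sub_zero]
  refine sum_le_sum fun i _ => ?_
  -- the coordinates of `J (w i)` in the basis `e ⊗ e'`
  have hRed := Reduces.map hJJ (hy i)
  have hlat := ofBasis_one_le_one_iff.2 fun k => by
    obtain ⟨r, h1, -⟩ := hRed k
    rw [h1]; exact r.2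
  have ho : IsUNorm v (ofBasis v b fun _ => 1) := isUNorm_ofBasis b fun _ => one_pos
  have ho' : IsUNorm v (ofBasis v b' fun _ => 1) := isUNorm_ofBasis b' fun _ => one_pos
  have hoo : tensorNorm (K := K) (ofBasis v b fun _ => 1) (ofBasis v b' fun _ => 1) =
      ofBasis v (b.tensorProduct b') fun _ => 1 := by
    rw [tensorNorm_eq_ofBasis ho ho' (isOrthogonalBasis_ofBasis _ _)
      (isOrthogonalBasis_ofBasis _ _)]
    simp only [ofBasis_apply_basis, one_mul]
  have hmem : ∀ k, (e.tensorProduct e').repr (J (w i)) k ∈ v.valuationSubring := fun k => by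
    have h1 := (isOrthogonalBasis_tensorNorm ho ho' he he').le (J (w i)) k
    rw [tensorNorm_basis ho ho' he he', he1, he1', one_mul, mul_one, hoo] at h1
    exact (mem_valuationSubring_iff _ _).2 (h1.trans hlat)
  have hRed' : Reduces red (b.tensorProduct b') (c.tensorProduct c') (J (w i))
      (∑ k, red ⟨_, hmem k⟩ • (f.tensorProduct f') k) := by
    conv_lhs => rw [← (e.tensorProduct e').sum_repr (J (w i))]
    refine Reduces.sum _ fun k => Reduces.smul ⟨_, hmem k⟩ ?_
    rw [Basis.tensorProduct_apply', Basis.tensorProduct_apply']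
    exact (hf k.1).tmul (hf' k.2)
  have hrepr : ∀ k, (f.tensorProduct f').repr (Jr (y i)) k = red ⟨_, hmem k⟩ := fun k => by
    rw [hRed.unique hRed', Basis.repr_sum_self]
  have hne : Jr (y i) ≠ 0 := fun h0 => y.ne_zero i (hJr (h0.trans (map_zero _).symm))
  obtain ⟨k, hk, hk'⟩ := (isOrthogonalBasis_expNorm (f.tensorProduct f') fun k =>
    log (a k.1) / τ + log (a' k.2) / τ).exists_eq (isUNorm_expNorm _ _) hne
  have hv1 : v ((e.tensorProduct e').repr (J (w i)) k) = 1 := by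
    refine le_antisymm ((mem_valuationSubring_iff _ _).1 (hmem k)) (not_lt.1 fun h => ?_)
    rw [hrepr k] at hk
    exact hk (hred ⟨_, hmem k⟩ h)
  have hue := isUNorm_ofBasis (v := v) e ha
  have hue' := isUNorm_ofBasis (v := v) e' ha'
  have h2 := (isOrthogonalBasis_tensorNorm hue hue' (isOrthogonalBasis_ofBasis _ _)
    (isOrthogonalBasis_ofBasis _ _)).le (J (w i)) k
  rw [hv1, one_mul, tensorNorm_basis hue hue' (isOrthogonalBasis_ofBasis _ _)
    (isOrthogonalBasis_ofBasis _ _), ofBasis_apply_basis, ofBasis_apply_basis] at h2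
  have h3 : (0 : ℝ) < a k.1 := ha k.1
  have h4 : (0 : ℝ) < a' k.2 := ha' k.2
  have h5 : (a k.1 * a' k.2 : ℝ) ≤ N (J (w i)) := by exact_mod_cast h2
  have h6 := log_le_log (mul_pos h3 h4) h5
  rw [log_mul h3.ne' h4.ne'] at h6
  rw [hFe, hk', trivVal_apply hk, one_mul, log_expNorm, ← add_div]
  exact div_le_div_of_nonneg_right h6 hτ.le

end Reduction

/-! ### Volumes of subspaces of a tensor product -/

section Core

variable {L : Type*} [Field L] {K : Type*} [Field K] [Algebra L K] {v : Valuation K ℝ≥0}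
  {Ω : Type*} [Field Ω] [Algebra L Ω] {V V' W : Type*} [AddCommGroup V] [Module L V]
  [AddCommGroup V'] [Module L V'] [AddCommGroup W] [Module L W] [FiniteDimensional L V]
  [FiniteDimensional L V'] [FiniteDimensional L W] {ι ι' : Type*} [Fintype ι] [Fintype ι']

theorem repr_extMap (y : Basis ι L V) (y' : Basis ι' L V') (j : W →ₗ[L] V ⊗[L] V')
    (w : W) (k : ι × ι') :
    ((y.baseChange Ω).tensorProduct (y'.baseChange Ω)).repr (extMap Ω j (1 ⊗ₜ[L] w)) k =
      algebraMap L Ω ((y.tensorProduct y').repr (j w) k) := by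
  rw [← baseChange_tensorProduct_map, Basis.map_repr, LinearEquiv.trans_apply]
  have : (distribBaseChange L Ω V V').symm
      (extMap Ω j (1 ⊗ₜ[L] w)) = 1 ⊗ₜ[L] j w := LinearEquiv.symm_apply_apply _ _
  rw [this, Basis.baseChange_repr_tmul, Algebra.smul_def, mul_one]

theorem lv_steps (hv : TrivialOn L v) {y : Basis ι L V} {g : ι → ℝ≥0} (hg : ∀ i, 0 < g i)
    {α : K ⊗[L] V → ℝ≥0} (hα : IsUNorm v α) {e z : Basis ι K (K ⊗[L] V)}
    (heo : IsOrthogonalBasis v (ofBasis v (y.baseChange K) fun _ => 1) e)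
    (he1 : ∀ i, ofBasis v (y.baseChange K) (fun _ => 1) (e i) = 1)
    (heG : IsOrthogonalBasis (trivVal K) (ofBasis (trivVal K) (y.baseChange K) g) e)
    (heg : ∀ i, ofBasis (trivVal K) (y.baseChange K) g (e i) = g i) (hz : IsOrthogonalBasis v α z)
    (hze : ∀ i, ofBasis (trivVal K) (y.baseChange K) g (z i - e i) < g i) :
    (∀ c, lv v (fun x => α ((coordSub y {k | g k ≤ c}).subtype.baseChange K x)) =
      ∑ k ∈ univ.filter (fun k => g k ≤ c), log (α (z k))) ∧ lv v α = ∑ k, log (α (z k)) := by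
  classical
  obtain ⟨hδ, hδ1⟩ := adapted_repr heG heg hze
  refine ⟨fun c => ?_, ?_⟩
  · obtain ⟨yX, hyX⟩ := exists_basis_of_range_eq (e := y) (S := {k | g k ≤ c})
      (i := (coordSub y {k | g k ≤ c}).subtype) (injective_subtype _) (range_subtype _)
    rw [← hv.lv_eq yX]
    refine lvol_step hg hα heo he1 heG heg hz hze
      (i := (coordSub y {k | g k ≤ c}).subtype.baseChange K)
      (baseChange_injective (injective_subtype _)) fun k => ?_
    rw [Basis.baseChange_apply, baseChange_tmul, hyX, Basis.baseChange_apply]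
  · rw [← hv.lv_eq y, hz.lvol_eq hα, log_det_adapted (isUNorm_ofBasis _ fun _ => one_pos)
      (isOrthogonalBasis_ofBasis _ _) heo (ofBasis_apply_basis _ _) he1 hδ hδ1, sub_zero]

/-- A reduction map from the valuation ring of `K` to a field `Ω`, compatible with the embeddings
of `L`. -/
structure IsReduction (L : Type*) [Field L] [Algebra L K] [Algebra L Ω]
    (red : v.valuationSubring →+* Ω) : Prop where
  eq_zero : ∀ r : v.valuationSubring, v r < 1 → red r = 0
  compat : ∀ a : L, ∃ r : v.valuationSubring, (r : K) = algebraMap L K a ∧ red r = algebraMap L Ω a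

/-- The volume of the subspace `j : W → V ⊗ V'` for a tensor product of norms is bounded below in
terms of the volumes of the steps of the optimal filtrations.

Reduce the norms tilted by `τ` times the optimal filtrations to the residue field, apply the
minimality over `Ω` to the resulting filtrations with labels `γ + A / τ`, and let `τ → ∞`. -/
theorem exists_core (hd : HasDiscreteValues v) (hv : TrivialOn L v)
    {red : v.valuationSubring →+* Ω} (hred : IsReduction L red) {j : W →ₗ[L] V ⊗[L] V'}
    (hj : Injective j) {N : V → ℝ≥0} {N' : V' → ℝ≥0}
    (hN : IsSplittableNorm (trivVal L) N) (hN' : IsSplittableNorm (trivVal L) N')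
    (hmin : ∀ H H', IsSplittableNorm (trivVal Ω) H → IsSplittableNorm (trivVal Ω) H' →
      kempf j N N' ≤ kempf (extMap Ω j) H H') {y : Basis ι L V} {y' : Basis ι' L V'}
    (hy : IsOrthogonalBasis (trivVal L) N y) (hy' : IsOrthogonalBasis (trivVal L) N' y')
    {α : K ⊗[L] V → ℝ≥0} {α' : K ⊗[L] V' → ℝ≥0} (hα : IsSplittableNorm v α)
    (hα' : IsSplittableNorm v α') : ∃ (A : ι → ℝ) (A' : ι' → ℝ),
      (∀ c, lv v (fun x => α ((coordSub y {k | N (y k) ≤ c}).subtype.baseChange K x)) =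
        ∑ k ∈ univ.filter (fun k => N (y k) ≤ c), A k) ∧
      (∀ c, lv v (fun x => α' ((coordSub y' {k | N' (y' k) ≤ c}).subtype.baseChange K x)) =
        ∑ k ∈ univ.filter (fun k => N' (y' k) ≤ c), A' k) ∧
      lv v α = ∑ k, A k ∧ lv v α' = ∑ k, A' k ∧
      finrank L W * (lv v α / finrank L V + lv v α' / finrank L V') ≤
        lv v (fun w => tensorNorm (K := K) α α' (extMap K j w)) +
          ∑ k, log (N (y k)) * A k + ∑ k, log (N' (y' k)) * A' k := by
  classical
  have hg : ∀ i, 0 < N (y i) := fun i => hN.isUNorm.pos (y.ne_zero i)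
  have hg' : ∀ i, 0 < N' (y' i) := fun i => hN'.isUNorm.pos (y'.ne_zero i)
  obtain ⟨e, z, heo, he1, heG, heg, hz, hze⟩ := hd.exists_adapted_basis (y.baseChange K) hg hα
  obtain ⟨e', z', heo', he1', heG', heg', hz', hze'⟩ :=
    hd.exists_adapted_basis (y'.baseChange K) hg' hα'
  have hα0 := hα.isUNorm
  have hα0' := hα'.isUNorm
  obtain ⟨hstep, htot⟩ := lv_steps hv hg hα0 heo he1 heG heg hz hze
  obtain ⟨hstep', htot'⟩ := lv_steps hv hg' hα0' heo' he1' heG' heg' hz' hze'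
  refine ⟨_, _, hstep, hstep', htot, htot', ?_⟩
  obtain ⟨hδ, hδ1⟩ := adapted_repr heG heg hze
  obtain ⟨hδ', hδ1'⟩ := adapted_repr heG' heg' hze'
  obtain ⟨u, hu, hzG, hzg⟩ := heG.perturb (isUNorm_ofBasis _ hg) (z := z) fun k => by
    rw [heg]; exact hze k
  obtain rfl : u = z := Basis.eq_of_apply_eq hu
  obtain ⟨u', hu', hzG', hzg'⟩ := heG'.perturb (isUNorm_ofBasis _ hg') (z := z') fun k => by
    rw [heg']; exact hze' k
  obtain rfl : u' = z' := Basis.eq_of_apply_eq hu'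
  let bW := finBasis L W
  obtain ⟨f, f', hf⟩ := exists_reduction_lvol_le hd hred.eq_zero (y.baseChange Ω) (y'.baseChange Ω)
    heo he1 heo' he1' (extMap_injective (Ω := K) hj) (extMap_injective (Ω := Ω) hj)
    (bU := bW.baseChange K) (cU := bW.baseChange Ω) fun l k => by
      obtain ⟨r, h1, h2⟩ := hred.compat ((y.tensorProduct y').repr (j (bW l)) k)
      refine ⟨r, ?_, ?_⟩
      · rw [Basis.baseChange_apply, repr_extMap, h1]
      · rw [Basis.baseChange_apply, repr_extMap, h2]
  set A : ι → ℝ := fun k => log (α (u k))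
  set A' : ι' → ℝ := fun k => log (α' (u' k))
  set γ : ι → ℝ := fun k => log (N (y k))
  set γ' : ι' → ℝ := fun k => log (N' (y' k))
  set r : ℝ := ((finrank L W : ℕ) : ℝ)
  set n : ℝ := ((finrank L V : ℕ) : ℝ)
  set n' : ℝ := ((finrank L V' : ℕ) : ℝ)
  set w := lv v (fun w => tensorNorm (K := K) α α' (extMap K j w)) with hw
  set X : ℝ := w + ∑ k, γ k * A k + ∑ k, γ' k * A' k - r * (lv v α / n + lv v α' / n') with hX
  set Y : ℝ := (∑ k, A k ^ 2 + ∑ k, A' k ^ 2) / 2 with hY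
  have hα1 : ∀ i, 0 < α (u i) := fun i => hα0.pos (u.ne_zero i)
  have hα1' : ∀ i, 0 < α' (u' i) := fun i => hα0'.pos (u'.ne_zero i)
  have hev : ∀ᶠ τ : ℝ in Filter.atTop, 0 ≤ X + Y * τ⁻¹ := by
    filter_upwards [eventually_tilt_le hα1 hg hδ hδ1, eventually_tilt_le hα1' hg' hδ' hδ1',
      Filter.eventually_gt_atTop 0] with τ ht ht' hτ
    have h1 := hf (fun k => α (u k) * N (y k) ^ τ) (fun k => α' (u' k) * N' (y' k) ^ τ) τ
      (fun k => mul_pos (hα1 k) (rpow_pos (hg k))) (fun k => mul_pos (hα1' k) (rpow_pos (hg' k))) hτ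
    have h2 := lvol_tilt_le hg hg' hα0 hα0' hz hz' hzG hzG'
      (fun k => by rw [hzg, heg]) (fun k => by rw [hzg', heg']) hτ.le ht ht'
      (extMap_injective (Ω := K) hj) (bW.baseChange K)
    have h3 := labelSum_extMap (Ω := K) hj hN hN' hy hy'
    unfold extNorm at h3
    rw [h3, hv.lv_eq, hv.lv_eq, ← hw] at h2
    rw [hv.lv_eq] at h1
    have h4 := hmin _ _ (isSplittableNorm_expNorm f fun k => log (α (u k) * N (y k) ^ τ : ℝ≥0) / τ)
      (isSplittableNorm_expNorm f' fun k => log (α' (u' k) * N' (y' k) ^ τ : ℝ≥0) / τ)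
    have hl : ∀ k, log (α (u k) * N (y k) ^ τ : ℝ≥0) / τ = γ k + A k * τ⁻¹ := fun k => by
      have p1 : (0 : ℝ) < α (u k) := hα1 k
      have p2 : (0 : ℝ) < N (y k) := hg k
      rw [coe_mul, NNReal.coe_rpow, log_mul p1.ne' (rpow_pos_of_pos p2 _).ne', log_rpow p2]
      field_simp
      ring
    have hl' : ∀ k, log (α' (u' k) * N' (y' k) ^ τ : ℝ≥0) / τ = γ' k + A' k * τ⁻¹ := fun k => by
      have p1 : (0 : ℝ) < α' (u' k) := hα1' k
      have p2 : (0 : ℝ) < N' (y' k) := hg' k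
      rw [coe_mul, NNReal.coe_rpow, log_mul p1.ne' (rpow_pos_of_pos p2 _).ne', log_rpow p2]
      field_simp
      ring
    simp only [hl, hl'] at h1 h4
    unfold kempf at h4
    simp only [labelSum_expNorm, hy.labelSum_eq, hy'.labelSum_eq, finrank_baseChange] at h4
    have e1 : ∑ k, (γ k + A k * τ⁻¹) = ∑ k, γ k + lv v α * τ⁻¹ := by
      rw [sum_add_distrib, ← sum_mul, htot]
    have e1' : ∑ k, (γ' k + A' k * τ⁻¹) = ∑ k, γ' k + lv v α' * τ⁻¹ := by
      rw [sum_add_distrib, ← sum_mul, htot']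
    have e2 : ∑ k, (γ k + A k * τ⁻¹) ^ 2 =
        ∑ k, γ k ^ 2 + 2 * τ⁻¹ * ∑ k, γ k * A k + τ⁻¹ ^ 2 * ∑ k, A k ^ 2 := by
      rw [mul_sum, mul_sum, ← sum_add_distrib, ← sum_add_distrib]
      exact sum_congr rfl fun k _ => by ring
    have e2' : ∑ k, (γ' k + A' k * τ⁻¹) ^ 2 =
        ∑ k, γ' k ^ 2 + 2 * τ⁻¹ * ∑ k, γ' k * A' k + τ⁻¹ ^ 2 * ∑ k, A' k ^ 2 := by
      rw [mul_sum, mul_sum, ← sum_add_distrib, ← sum_add_distrib]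
      exact sum_congr rfl fun k _ => by ring
    rw [e1, e1', e2, e2'] at h4
    have h5 := h1.trans (div_le_div_of_nonneg_right h2 hτ.le)
    rw [add_div, mul_div_cancel_left₀ _ hτ.ne', div_eq_mul_inv w] at h5
    have h6 : 0 ≤ (X + Y * τ⁻¹) * τ⁻¹ := by
      rw [hX, hY]
      simp only [add_mul, mul_add, sub_mul, div_eq_mul_inv] at h4 h5 ⊢
      linarith
    exact nonneg_of_mul_nonneg_left h6 (inv_pos.2 hτ)
  have hlim : Filter.Tendsto (fun τ : ℝ => X + Y * τ⁻¹) Filter.atTop (nhds (X + Y * 0)) :=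
    tendsto_const_nhds.add (tendsto_inv_atTop_zero.const_mul Y)
  have hX0 := ge_of_tendsto hlim hev
  rw [mul_zero, add_zero] at hX0
  linarith

end Core

/-! ### Tensor products of semistable normed isocrystals -/

section Abel

theorem sum_sub_mul_nonneg {ι : Type*} {γ a : ι → ℝ} (s : Finset ι)
    (h : ∀ c, 0 ≤ ∑ k ∈ s.filter (fun k => γ k ≤ c), a k) (M : ℝ) (hM : ∀ k ∈ s, γ k ≤ M) :
    0 ≤ ∑ k ∈ s, (M - γ k) * a k := by
  classical
  induction s using Finset.strongInduction generalizing M with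
  | H s ih =>
  rcases s.eq_empty_or_nonempty with rfl | hs
  · simp
  obtain ⟨k₀, hk₀, hmax⟩ := s.exists_max_image γ hs
  set t := s.filter fun k => γ k < γ k₀ with ht
  have hts : t ⊂ s := Finset.filter_ssubset.2 ⟨k₀, hk₀, lt_irrefl _⟩
  have ht0 : ∀ c, 0 ≤ ∑ k ∈ t.filter (fun k => γ k ≤ c), a k := by
    intro c
    rcases (t.filter fun k => γ k ≤ c).eq_empty_or_nonempty with h0 | h0
    · rw [h0, Finset.sum_empty]
    obtain ⟨k₁, hk₁, hmax₁⟩ := (t.filter fun k => γ k ≤ c).exists_max_image γ h0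
    have h1 := mem_filter.1 hk₁
    have h2 := mem_filter.1 h1.1
    have : t.filter (fun k => γ k ≤ c) = s.filter fun k => γ k ≤ γ k₁ := by
      ext k
      refine ⟨fun hk => mem_filter.2 ⟨hts.1 (mem_filter.1 hk).1, hmax₁ k hk⟩, fun hk => ?_⟩
      obtain ⟨h3, h4⟩ := mem_filter.1 hk
      exact mem_filter.2 ⟨mem_filter.2 ⟨h3, h4.trans_lt h2.2⟩, h4.trans h1.2⟩
    rw [this]
    exact h _
  have h1 := ih t hts ht0 (γ k₀) fun k hk => (mem_filter.1 hk).2.le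
  have h2 : ∑ k ∈ t, (γ k₀ - γ k) * a k = ∑ k ∈ s, (γ k₀ - γ k) * a k :=
    sum_subset hts.1 fun k hk hk' => by
      have h3 : γ k = γ k₀ := le_antisymm (hmax k hk)
        (not_lt.1 fun h4 => hk' (mem_filter.2 ⟨hk, h4⟩))
      rw [h3, sub_self, zero_mul]
  have h3 := h (γ k₀)
  rw [Finset.filter_true_of_mem hmax] at h3
  have h4 : ∑ k ∈ s, (M - γ k) * a k = (M - γ k₀) * ∑ k ∈ s, a k + ∑ k ∈ s, (γ k₀ - γ k) * a k := by
    rw [mul_sum, ← sum_add_distrib]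
    exact sum_congr rfl fun k _ => by ring
  rw [h4, ← h2]
  exact add_nonneg (mul_nonneg (sub_nonneg.2 (hM k₀ hk₀)) h3) h1

/-- Summation by parts. -/
theorem sum_mul_nonpos {ι : Type*} [Fintype ι] {γ a : ι → ℝ}
    (h : ∀ c, 0 ≤ ∑ k ∈ univ.filter (fun k => γ k ≤ c), a k) (h0 : ∑ k, a k = 0) :
    ∑ k, γ k * a k ≤ 0 := by
  obtain ⟨M, hM⟩ := (Set.finite_range γ).bddAbove
  have h1 := sum_sub_mul_nonneg univ h M fun k _ => hM ⟨k, rfl⟩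
  simp only [sub_mul, sum_sub_distrib, ← mul_sum, h0, mul_zero, zero_sub] at h1
  linarith

end Abel

namespace Isocrystal

variable {L : Type*} [NormedField L] {σ : L ≃+* L} {K : Type*} [Field K] [Algebra L K]
  {v : Valuation K ℝ≥0} {π : K} {D D' : Isocrystal σ}

/-- The balls of a norm invariant under the Frobenius are subisocrystals. -/
theorem isSub_coordSub {N : D → ℝ≥0} (hN : IsSplittableNorm (trivVal L) N)
    (hinv : ∀ x, N (D.frob x) = N x) {ι : Type*} [Fintype ι] {y : Basis ι L D}
    (hy : IsOrthogonalBasis (trivVal L) N y) (c : ℝ≥0) :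
    D.IsSub (coordSub y {k | N (y k) ≤ c}) := by
  rw [← hy.ballSpan_eq]
  ext x
  rw [Submodule.mem_map, hN.mem_ballSpan]
  refine ⟨?_, fun hx => ?_⟩
  · rintro ⟨z, hz, rfl⟩
    rw [hinv]
    exact hN.mem_ballSpan.1 hz
  · obtain ⟨z, rfl⟩ := D.bijective.2 x
    rw [hinv] at hx
    exact ⟨z, hN.mem_ballSpan.2 hx, rfl⟩

theorem Setting.hasSlope_volume (S : Setting σ v π) {α : K ⊗[L] D → ℝ≥0}
    (hα : IsSplittableNorm v α) {μ : ℝ} :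
    D.HasSlope v π α μ ↔ lv v α + -log (v π) * (D.dim + μ * finrank L D) = 0 ∧
      ∀ X (hX : D.IsSub X), 0 ≤ lv v (D.subNorm α X hX) +
        -log (v π) * ((D.sub X hX).dim + μ * finrank L X) := by
  have hq := S.log_neg
  refine and_congr ?_ (forall_congr' fun X => forall_congr' fun hX => ?_)
  · rw [degree_eq S.trivialOn S.discrete D hα, sub_eq_iff_eq_add, div_eq_iff hq.ne]
    constructor <;> intro h <;> linarith
  · rw [hX.subDeg_eq, degree_eq S.trivialOn S.discrete _ (isSplittableNorm_subNorm hα hX),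
      sub_le_iff_le_add, div_le_iff_of_neg hq]
    constructor <;> intro h <;> linarith

/-- The inequality for one factor: the volumes of the steps of the filtration by the balls of `N`
are bounded below by semistability. -/
theorem Setting.sum_log_mul_nonpos (S : Setting σ v π) {α M : K ⊗[L] D → ℝ≥0}
    (hα : IsSplittableNorm v α) {μ : ℝ} (h : D.HasSlope v π α μ) (hM : lv v M = -log (v π) * D.dim)
    (hM' : ∀ X (hX : D.IsSub X), lv v (D.subNorm M X hX) = -log (v π) * (D.sub X hX).dim)
    {N : D → ℝ≥0} (hN : IsSplittableNorm (trivVal L) N) (hinv : ∀ x, N (D.frob x) = N x)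
    {ι : Type*} [Fintype ι] {y : Basis ι L D} (hy : IsOrthogonalBasis (trivVal L) N y)
    {A B : ι → ℝ} (hA : ∀ c, lv v (fun x => α ((coordSub y {k | N (y k) ≤ c}).subtype.baseChange K x))
      = ∑ k ∈ univ.filter (fun k => N (y k) ≤ c), A k)
    (hB : ∀ c, lv v (fun x => M ((coordSub y {k | N (y k) ≤ c}).subtype.baseChange K x))
      = ∑ k ∈ univ.filter (fun k => N (y k) ≤ c), B k)
    (hA0 : lv v α = ∑ k, A k) (hB0 : lv v M = ∑ k, B k) :
    ∑ k, log (N (y k)) * (A k + B k + -log (v π) * μ) ≤ 0 := by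
  classical
  rw [S.hasSlope_volume hα] at h
  have hpos : ∀ k, 0 < N (y k) := fun k => hN.isUNorm.pos (y.ne_zero k)
  refine sum_mul_nonpos (fun c => ?_) ?_
  · have hfilter : (univ.filter fun k => log (N (y k)) ≤ c) =
        univ.filter fun k => N (y k) ≤ toNNReal (exp c) := by
      refine filter_congr fun k _ => ?_
      have hp : (0 : ℝ) < N (y k) := hpos k
      rw [Real.log_le_iff_le_exp hp, ← NNReal.coe_le_coe, coe_toNNReal _ (exp_pos c).le]
    rw [hfilter]
    set C := toNNReal (exp c)
    have hX := isSub_coordSub hN hinv hy C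
    have h1 := h.2 _ hX
    have h2 : lv v (D.subNorm α _ hX) = _ := hA C
    have h3 : lv v (D.subNorm M _ hX) = _ := hB C
    rw [hM'] at h3
    rw [sum_add_distrib, sum_add_distrib, ← h2, ← h3, sum_const]
    have h4 : (univ.filter fun k => N (y k) ≤ C).card =
        finrank L (coordSub y {k | N (y k) ≤ C}) := by
      rw [finrank_coordSub]
      exact congrArg Finset.card (filter_congr fun k _ => Iff.rfl)
    rw [h4, nsmul_eq_mul]
    linarith
  · rw [sum_add_distrib, sum_add_distrib, ← hA0, ← hB0, hM, sum_const,
      card_univ, ← finrank_eq_card_basis y, nsmul_eq_mul]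
    linarith [h.1]

variable [IsUltrametricDist L] [CompleteSpace L] [CharZero L]

/-- The tensor product of semistable normed isocrystals is semistable. For a subisocrystal `W` of
the tensor product, take the optimal filtrations for `W`; they are stable under the Frobenius.
Apply the lower bound for the volume of `W` to the given norms and to the norms defined by the
slope filtrations. -/
theorem Setting.hasSlope_tensor (S : Setting σ v π) (H : IsValuedFrobenius σ) {Ω : Type*} [Field Ω]
    [IsAlgClosed Ω] [Algebra L Ω] {red : v.valuationSubring →+* Ω} (hred : IsReduction L red)
    {α : K ⊗[L] D → ℝ≥0} {α' : K ⊗[L] D' → ℝ≥0} (hα : IsSplittableNorm v α)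
    (hα' : IsSplittableNorm v α') {μ μ' : ℝ} (h : D.HasSlope v π α μ) (h' : D'.HasSlope v π α' μ') :
    (D.tensor D').HasSlope v π (D.tensorNorm D' α α') (μ + μ') := by
  have hαα := isSplittableNorm_tensorNorm hα hα'
  have hv := S.trivialOn
  have hfr : finrank L (D.tensor D') = finrank L D * finrank L D' := finrank_tensorProduct
  rcases Nat.eq_zero_or_pos (finrank L (D.tensor D')) with h0 | h0
  · have := finrank_zero_iff.1 h0
    exact (S.hasSlope_iff hαα _).2 (Or.inl this)
  have hn : 0 < finrank L D := Nat.pos_of_ne_zero fun h1 => by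
    rw [hfr, h1, zero_mul] at h0; exact lt_irrefl _ h0
  have hn' : 0 < finrank L D' := Nat.pos_of_ne_zero fun h1 => by
    rw [hfr, h1, mul_zero] at h0; exact lt_irrefl _ h0
  have : Nontrivial D := nontrivial_of_finrank_pos hn
  have : Nontrivial D' := nontrivial_of_finrank_pos hn'
  have hq : 0 < -log (v π) := neg_pos.2 S.log_neg
  refine ⟨?_, fun X hX => ?_⟩
  · rw [degree_tensorNorm S.preservesVal hv S.discrete hα hα', h.1, h'.1, hfr]
    push_cast
    ring
  obtain ⟨M, M', hM, hM', hMD, hMD', hMX, hMX', hMt⟩ := S.exists_slopeNorm H D D' hq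
  let j : (D.tensor D').sub X hX →ₗ[L] D ⊗[L] D' := (D.tensor D').subIncl X hX
  have hj : Injective j := (D.tensor D').subIncl_injective X hX
  obtain ⟨N, N', hK, hmin⟩ := exists_isKempf_extMap (Ω := Ω) hj
  obtain ⟨hinv, hinv'⟩ := hK.invariant hj D.bijective D'.bijective
    ((D.tensor D').sub X hX).bijective fun w => rfl
  obtain ⟨y, hy⟩ := hK.left.splittable
  obtain ⟨y', hy'⟩ := hK.right.splittable
  obtain ⟨A, A', hA, hA', hA0, hA0', hAc⟩ :=
    exists_core S.discrete hv hred hj hK.left hK.right hmin hy hy' hα hα'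
  obtain ⟨B, B', hB, hB', hB0, hB0', hBc⟩ :=
    exists_core S.discrete hv hred hj hK.left hK.right hmin hy hy' hM hM'
  have e1 := S.sum_log_mul_nonpos hα h hMD hMX hK.left hinv hy hA hB hA0 hB0
  have e2 := S.sum_log_mul_nonpos hα' h' hMD' hMX' hK.right hinv' hy' hA' hB' hA0' hB0'
  have z1 := hK.labelSum_eq_zero hj
  have z2 := hK.labelSum_eq_zero_right hj
  rw [hy.labelSum_eq] at z1
  rw [hy'.labelSum_eq] at z2
  simp only [mul_add, sum_add_distrib, ← sum_mul, z1, zero_mul, add_zero] at e1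
  simp only [mul_add, sum_add_distrib, ← sum_mul, z2, zero_mul, add_zero] at e2
  have h1 := ((S.hasSlope_volume hα).1 h).1
  have h2 := ((S.hasSlope_volume hα').1 h').1
  have hW := hMt X hX
  have eα : lv v ((D.tensor D').subNorm (D.tensorNorm D' α α') X hX) =
      lv v (fun w => _root_.tensorNorm (K := K) α α' (extMap K j w)) := rfl
  have eM : lv v ((D.tensor D').subNorm (D.tensorNorm D' M M') X hX) =
      lv v (fun w => _root_.tensorNorm (K := K) M M' (extMap K j w)) := rfl
  rw [eM] at hW
  rw [hX.subDeg_eq, degree_eq hv S.discrete _ (isSplittableNorm_subNorm hαα hX), eα,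
    sub_le_iff_le_add, div_le_iff_of_neg S.log_neg]
  have hr : finrank L ((D.tensor D').sub X hX) = finrank L X := rfl
  rw [hr] at hAc hBc
  have p1 : (0 : ℝ) < finrank L D := by exact_mod_cast hn
  have p2 : (0 : ℝ) < finrank L D' := by exact_mod_cast hn'
  have s1 : lv v α / finrank L D + lv v M / finrank L D = log (v π) * μ := by
    rw [← add_div, div_eq_iff p1.ne', hMD]
    linarith
  have s2 : lv v α' / finrank L D' + lv v M' / finrank L D' = log (v π) * μ' := by
    rw [← add_div, div_eq_iff p2.ne', hMD']
    linarith
  have s3 : (finrank L X : ℝ) * (log (v π) * μ + log (v π) * μ') =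
      finrank L X * (lv v α / finrank L D + lv v α' / finrank L D') +
      finrank L X * (lv v M / finrank L D + lv v M' / finrank L D') := by rw [← s1, ← s2]; ring
  linarith

end Isocrystal

/-! ### The field `breve F` and the discretely valued field `K` -/

section DiscreteValues

variable {L K : Type*} [Field L] [Field K] [Algebra L K] {v : Valuation K ℝ≥0}

theorem exists_val_eq_zpow [IsDiscreteValuationRing v.valuationSubring] {π : v.valuationSubring}
    (hπ : Irreducible π) {x : K} (hx : x ≠ 0) : ∃ k : ℤ, v x = v π ^ k := by
  have key : ∀ z : v.valuationSubring, z ≠ 0 → ∃ k : ℤ, v z = v π ^ k := fun z hz => by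
    obtain ⟨n, u, rfl⟩ := IsDiscreteValuationRing.eq_unit_mul_pow_irreducible hz hπ
    refine ⟨n, ?_⟩
    have hu : v ((u : v.valuationSubring) : K) = 1 :=
      (Valuation.integer.integers v).isUnit_iff_valuation_eq_one.1 u.isUnit
    rw [MulMemClass.coe_mul, SubmonoidClass.coe_pow, map_mul, map_pow, hu, one_mul, zpow_natCast]
  rcases le_total (v x) 1 with h | h
  · exact key ⟨x, h⟩ fun h0 => hx (congrArg Subtype.val h0)
  · have h' : v x⁻¹ ≤ 1 := by rw [map_inv₀]; exact inv_le_one_of_one_le₀ h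
    obtain ⟨k, hk⟩ := key ⟨x⁻¹, h'⟩ fun h0 => inv_ne_zero hx (congrArg Subtype.val h0)
    exact ⟨-k, by rw [zpow_neg, ← hk, map_inv₀, inv_inv]⟩

theorem HasDiscreteValues.of_zpow {q : ℝ≥0} (hq0 : 0 < q) (hq1 : q < 1)
    (h : ∀ x : K, x ≠ 0 → ∃ k : ℤ, v x = q ^ k) : HasDiscreteValues v := by
  intro a b ha
  have hq : (0 : ℝ) < q := hq0
  have hlog : log q < 0 := log_neg hq hq1
  refine ((Set.finite_Icc ⌊log b / log q⌋ ⌈log a / log q⌉).image fun k : ℤ => q ^ k).subset ?_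
  rintro _ ⟨⟨x, rfl⟩, h1, h2⟩
  have hx : x ≠ 0 := by rintro rfl; rw [map_zero] at h1; exact ha.not_ge h1
  obtain ⟨k, hk⟩ := h x hx
  have hkp : (0 : ℝ) < (q : ℝ) ^ k := zpow_pos hq k
  rw [hk, ← NNReal.coe_le_coe, NNReal.coe_zpow] at h1 h2
  have e1 := log_le_log (show (0 : ℝ) < a from ha) h1
  have e2 := log_le_log hkp h2
  rw [Real.log_zpow] at e1 e2
  refine ⟨k, ⟨?_, ?_⟩, hk.symm⟩
  · exact_mod_cast (Int.floor_le _).trans ((div_le_iff_of_neg hlog).2 e2)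
  · exact_mod_cast ((le_div_iff_of_neg hlog).2 e1).trans (Int.le_ceil _)

theorem Isocrystal.PreservesVal.setting {L : Type*} [NormedField L] [Algebra L K] {σ : L ≃+* L}
    (hσ : Isocrystal.PreservesVal σ) [IsDiscreteValuationRing v.valuationSubring]
    (hv : ∀ x : L, v (algebraMap L K x) ≤ 1) {π : v.valuationSubring} (hπ : Irreducible π) :
    Isocrystal.Setting σ v (π : K) := by
  have hπ0 : (π : K) ≠ 0 := fun h => hπ.ne_zero (Subtype.ext h)
  have hq0 : 0 < v (π : K) := pos_iff_ne_zero.2 (v.ne_zero_iff.2 hπ0)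
  have hq1 : v (π : K) < 1 := lt_of_le_of_ne π.2 fun h =>
    hπ.not_isUnit ((Valuation.integer.integers v).isUnit_iff_valuation_eq_one.2 h)
  refine ⟨hσ, fun x hx => le_antisymm (hv x) ?_, .of_zpow hq0 hq1 fun x => exists_val_eq_zpow hπ,
    log_neg hq0 hq1, fun x hx => ?_⟩
  · have h1 := hv x⁻¹
    rw [map_inv₀, map_inv₀] at h1
    exact (inv_le_one₀ (pos_iff_ne_zero.2 (v.ne_zero_iff.2 ((map_ne_zero _).2 hx)))).1 h1
  · obtain ⟨k, hk⟩ := exists_val_eq_zpow hπ hx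
    exact ⟨k, by rw [hk, NNReal.coe_zpow, Real.log_zpow]⟩

/-- The residue map of `K`, followed by the inclusion of the residue field into its algebraic
closure. -/
def residueMap (v : Valuation K ℝ≥0) : v.valuationSubring →+*
    AlgebraicClosure (IsLocalRing.ResidueField v.valuationSubring) :=
  (algebraMap _ _).comp (IsLocalRing.residue _)

/-- The embedding of `L` into the valuation ring of `K`. -/
def toValuationSubring (hv : ∀ x : L, v (algebraMap L K x) ≤ 1) : L →+* v.valuationSubring :=
  (algebraMap L K).codRestrict v.valuationSubring hv

theorem isReduction_residueMap (hv : ∀ x : L, v (algebraMap L K x) ≤ 1) :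
    letI := ((residueMap v).comp (toValuationSubring hv)).toAlgebra
    IsReduction L (residueMap v) := by
  refine @IsReduction.mk _ _ _ _ _ _ _ _ (_) _ (fun r hr => ?_) fun a =>
    ⟨toValuationSubring hv a, rfl, rfl⟩
  have h0 : IsLocalRing.residue v.valuationSubring r = 0 := by
    rw [IsLocalRing.residue_eq_zero_iff, IsLocalRing.mem_maximalIdeal, mem_nonunits_iff]
    exact fun h => hr.ne ((Valuation.integer.integers v).isUnit_iff_valuation_eq_one.1 h)
  rw [residueMap, RingHom.comp_apply, h0, map_zero]

end DiscreteValues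

namespace Isocrystal

/-- If the absolute values `< 1` of a normed field are bounded by some `c < 1`, then the supremum
of these absolute values is attained and generates the value group. -/
theorem exists_norm_eq_zpow {L : Type*} [NormedField L] {p : L} (hp0 : p ≠ 0) (hp : ‖p‖ < 1) {c : ℝ}
    (hc : IsLUB {r : ℝ | ∃ y : L, r = ‖y‖ ∧ ‖y‖ < 1} c) (hc1 : c < 1) :
    0 < c ∧ (∃ z : L, ‖z‖ = c) ∧ ∀ x : L, x ≠ 0 → ∃ k : ℤ, ‖x‖ = c ^ k := by
  have hle : ∀ y : L, ‖y‖ < 1 → ‖y‖ ≤ c := fun y hy => hc.1 ⟨y, rfl, hy⟩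
  have hc0 : 0 < c := (norm_pos_iff.2 hp0).trans_le (hle p hp)
  have hat : ∃ z : L, ‖z‖ = c := by
    by_contra hne
    push Not at hne
    obtain ⟨_, ⟨y, rfl, hy1⟩, hy, -⟩ := hc.exists_between (show c * c < c by nlinarith)
    have hyc := lt_of_le_of_ne (hle y hy1) (hne y)
    obtain ⟨_, ⟨z, rfl, hz1⟩, hz, -⟩ := hc.exists_between hyc
    have hz0 : 0 < ‖z‖ := (norm_nonneg y).trans_lt hz
    -- `c * c < ‖y‖ < ‖z‖ ≤ c`, hence `c < ‖y / z‖ < 1`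
    have h1 : ‖y / z‖ ≤ c := hle _ (by rw [norm_div]; exact (div_lt_one hz0).2 hz)
    rw [norm_div, div_le_iff₀ hz0] at h1
    nlinarith [hle z hz1]
  refine ⟨hc0, hat, fun x hx => ?_⟩
  obtain ⟨z, hz⟩ := hat
  obtain ⟨k, hk1, hk2⟩ := exists_mem_Ioc_zpow (norm_pos_iff.2 hx)
    (show (1 : ℝ) < c⁻¹ from (one_lt_inv₀ hc0).2 hc1)
  rw [inv_zpow'] at hk1 hk2
  have hcp : 0 < c ^ (-(k + 1)) := zpow_pos hc0 _
  have h1 : ‖x / z ^ (-(k + 1))‖ = ‖x‖ / c ^ (-(k + 1)) := by rw [norm_div, norm_zpow, hz]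
  rcases lt_or_eq_of_le hk2 with h | h
  · have h2 := hle (x / z ^ (-(k + 1))) (by rw [h1]; exact (div_lt_one hcp).2 h)
    rw [h1, div_le_iff₀ hcp, ← zpow_one_add₀ hc0.ne'] at h2
    rw [show 1 + -(k + 1) = -k by ring] at h2
    exact absurd h2 hk1.not_ge
  · exact ⟨_, h⟩

section Frobenius

variable {p : ℕ} [Fact p.Prime] {F : IntermediateField ℚ_[p] (PadicAlgCl p)}

instance : IsUltrametricDist (breve F) :=
  ⟨fun x y z => IsUltrametricDist.dist_triangle_max (x : ℂ_[p]) y z⟩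

instance : CompleteSpace (breve F) := (Subfield.isClosed_topologicalClosure _).completeSpace_coe

theorem norm_natCast_prime : ‖(p : breve F)‖ < 1 ∧ (p : breve F) ≠ 0 := by
  have h1 : ‖(p : breve F)‖ = ‖(p : ℚ_[p])‖ := by
    rw [← PadicComplex.norm_extends' p (p : ℚ_[p])]
    change ‖((p : breve F) : ℂ_[p])‖ = _
    congr 1
    change ((p : breve F) : ℂ_[p]) = algebraMap (PadicAlgCl p) ℂ_[p] (algebraMap ℚ_[p] _ (p : ℚ_[p]))
    simp
  refine ⟨h1 ▸ Padic.norm_p_lt_one, ?_⟩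
  exact_mod_cast (Fact.out : p.Prime).ne_zero

variable {σ : breve F ≃+* breve F}

theorem norm_frobenius_of_norm_eq_one (hσ : IsFrobenius F σ) {z : breve F} (hz : ‖z‖ = 1) :
    ‖σ z‖ = 1 := by
  have h1 := hσ.residue z hz.le
  have h2 : ‖z ^ residueCard F‖ = 1 := by rw [norm_pow, hz, one_pow]
  have h3 := IsUltrametricDist.norm_add_eq_max_of_norm_ne_norm (x := σ z - z ^ residueCard F)
    (y := z ^ residueCard F) (by rw [h2]; exact h1.ne)
  rwa [sub_add_cancel, h2, max_eq_right h1.le] at h3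

/-- `σ` is an isometry if the value group is discrete, because it fixes `p`. -/
theorem norm_frobenius (hσ : IsFrobenius F σ) {c : ℝ} (hc0 : 0 < c) {z : breve F}
    (hz : ‖z‖ = c) (h : ∀ x : breve F, x ≠ 0 → ∃ k : ℤ, ‖x‖ = c ^ k) (x : breve F) :
    ‖σ x‖ = ‖x‖ := by
  have hunit : ∀ (x : breve F) (k : ℤ), ‖x‖ = c ^ k → ‖σ x‖ = ‖σ z‖ ^ k := fun x k hk => by
    have h1 : ‖x / z ^ k‖ = 1 := by rw [norm_div, norm_zpow, hz, hk, div_self (zpow_pos hc0 k).ne']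
    have h2 := norm_frobenius_of_norm_eq_one hσ h1
    rw [map_div₀, map_zpow₀, norm_div, norm_zpow] at h2
    exact eq_of_div_eq_one h2
  obtain ⟨hp1, hp0⟩ := norm_natCast_prime (F := F)
  obtain ⟨e, he⟩ := h _ hp0
  have h1 := hunit _ e he
  rw [hσ.fixes (p : F) (p : breve F) (by simp), he] at h1
  have he0 : e ≠ 0 := by rintro rfl; rw [he, zpow_zero] at hp1; exact lt_irrefl _ hp1
  have hσz : ‖σ z‖ = c := ((zpow_left_inj₀ hc0.le (norm_nonneg _) he0).1 h1).symm
  rcases eq_or_ne x 0 with rfl | hx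
  · rw [map_zero]
  · obtain ⟨k, hk⟩ := h x hx
    rw [hunit x k hk, hσz, hk]

/-- The Frobenius of `breve F` satisfies the hypotheses of the theory of isocrystals. If the value
group were dense, `normalizedVal` would be zero. -/
theorem _root_.IsFrobenius.isValuedFrobenius (hσ : IsFrobenius F σ) :
    IsValuedFrobenius σ ∧ PreservesVal σ := by
  obtain ⟨hp1, hp0⟩ := norm_natCast_prime (F := F)
  set s := {r : ℝ | ∃ y : breve F, r = ‖y‖ ∧ ‖y‖ < 1} with hs
  have hlub : IsLUB s (sSup s) :=
    isLUB_csSup ⟨_, _, rfl, hp1⟩ ⟨1, by rintro _ ⟨y, rfl, hy⟩; exact hy.le⟩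
  have hval : ∀ x : breve F, normalizedVal x = logb (sSup s) ‖x‖ := fun _ => rfl
  rcases eq_or_lt_of_le (hlub.2 (show 1 ∈ upperBounds s by rintro _ ⟨y, rfl, hy⟩; exact hy.le))
    with hc | hc
  · have h0 : ∀ x : breve F, normalizedVal x = 0 := fun x => by
      rw [hval, hc, logb, log_one, div_zero]
    exact ⟨Or.inr h0, fun x => by rw [h0, h0], fun x _ => ⟨0, by rw [h0, Int.cast_zero]⟩⟩
  obtain ⟨hc0, ⟨z, hz⟩, h⟩ := exists_norm_eq_zpow hp0 hp1 hlub hc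
  have hiso := norm_frobenius hσ hc0 hz h
  have hpv : PreservesVal σ := ⟨fun x => by rw [hval, hval, hiso], fun x hx => by
    obtain ⟨k, hk⟩ := h x hx
    exact ⟨k, by rw [hval, hk, ← Real.rpow_intCast, Real.logb_rpow hc0 hc.ne]⟩⟩
  exact ⟨Or.inl ⟨⟨_, hc0.le⟩, hc0, hc, fun x hx =>
    (Real.rpow_logb hc0 hc.ne (norm_pos_iff.2 hx)).symm, hiso, ⟨_, hp0, hp1⟩, hpv⟩, hpv⟩

end Frobenius

variable {L K : Type*} [NormedField L] [IsUltrametricDist L] [CompleteSpace L] {σ : L ≃+* L}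
  [Field K] [Algebra L K] {v : Valuation K ℝ≥0} {π : K}

theorem IsHNFiltration.hnFiltration_eq (S : Setting σ v π) (H : IsValuedFrobenius σ)
    {D : Isocrystal σ} {α : K ⊗[L] D → ℝ≥0} (hα : IsSplittableNorm v α)
    {f : ℝ → Submodule L D} (h : D.IsHNFiltration v π α f) : D.hnFiltration v π α = f :=
  (S.existsUnique_isHNFiltration' H D hα).unique (Classical.epsilon_spec ⟨f, h⟩) h

end Isocrystal

end

theorem theorem2 {p : ℕ} [Fact p.Prime]
    (F : IntermediateField ℚ_[p] (PadicAlgCl p)) [FiniteDimensional ℚ_[p] F]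
    (σ : breve F ≃+* breve F) (hσ : IsFrobenius F σ)
    {K : Type*} [Field K] [Algebra (breve F) K] (v : Valuation K ℝ≥0)
    [IsDiscreteValuationRing v.valuationSubring] [HenselianLocalRing v.valuationSubring]
    (hv : ∀ x : breve F, v (algebraMap (breve F) K x) ≤ 1)
    (π : v.valuationSubring) (hπ : Irreducible π)
    (D D' : Isocrystal σ) (α : K ⊗[breve F] D → ℝ≥0) (α' : K ⊗[breve F] D' → ℝ≥0)
    (hα : IsSplittableNorm v α) (hα' : IsSplittableNorm v α') :
    IsSplittableNorm v (D.tensorNorm D' α α') ∧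
    (∃! f, D.IsHNFiltration v π α f) ∧
    (∃! f', D'.IsHNFiltration v π α' f') ∧
    (∃! g, (D.tensor D').IsHNFiltration v π (D.tensorNorm D' α α') g) ∧
    (D.tensor D').hnFiltration v π (D.tensorNorm D' α α') =
      D.tensorFiltration D' (D.hnFiltration v π α) (D'.hnFiltration v π α') ∧
    (D.IsSemistable v π α → D'.IsSemistable v π α' →
      (D.tensor D').IsSemistable v π (D.tensorNorm D' α α')) := by
  classical
  obtain ⟨H, hpv⟩ := hσ.isValuedFrobenius
  have S := hpv.setting hv hπ
  let := ((residueMap v).comp (toValuationSubring hv)).toAlgebra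
  have hred := isReduction_residueMap hv
  have hαα := Isocrystal.isSplittableNorm_tensorNorm hα hα'
  obtain ⟨f, hf, hfu⟩ := S.existsUnique_isHNFiltration' H D hα
  obtain ⟨f', hf', hfu'⟩ := S.existsUnique_isHNFiltration' H D' hα'
  refine ⟨hαα, ⟨f, hf, hfu⟩, ⟨f', hf', hfu'⟩, S.existsUnique_isHNFiltration' H _ hαα, ?_,
    fun h h' => ?_⟩
  · rw [hf.hnFiltration_eq S H hα, hf'.hnFiltration_eq S H hα']
    refine (S.isHNFiltration_tensorFiltration hα hα' hf.isFiltration hf'.isFiltration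
      fun c c' => ?_).hnFiltration_eq S H hαα
    exact S.hasSlope_tensor H hred (Isocrystal.grNorm_attained hα hf.isFiltration c).1
      (Isocrystal.grNorm_attained hα' hf'.isFiltration c').1 (S.hasSlope_gr hα hf c)
      (S.hasSlope_gr hα' hf' c')
  · have ht := S.hasSlope_tensor H hred hα hα' ((S.hasSlope_iff hα _).2 (Or.inr ⟨h, rfl⟩))
      ((S.hasSlope_iff hα' _).2 (Or.inr ⟨h', rfl⟩))
    refine (((S.hasSlope_iff hαα _).1 ht).resolve_left fun h0 => ?_).1
    have := h.1
    have := h'.1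
    have hpos : 0 < Module.finrank (breve F) (D ⊗[breve F] D') := by
      rw [Module.finrank_tensorProduct]
      exact Nat.mul_pos Module.finrank_pos Module.finrank_pos
    exact not_subsingleton_iff_nontrivial.2 (Module.nontrivial_of_finrank_pos hpos) h0
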